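/- Write $\langle y\rangle=1+|y|$, and let $\hat f$ denote the Fourier transform with kernel $e^{-ix\xi}$ (in space) or $e^{-i(x\xi+t\tau)}$ (in space-time). For $k,s,b\in\mathbb R$ let $H^k(\mathbb R)$, $X^{k,b}$ and $H^b(\mathbb R,H^s_x)$ be the spaces of tempered distributions $f$ on $\mathbb R$, respectively on $\mathbb R^2$, whose Fourier transform is a function such that, respectively, $$\|f\|_{H^k}=\|\langle\xi\rangle^k\hat f\|_{L^2_\xi},\qquad \|f\|_{X^{k,b}}=\|\langle\xi\rangle^k\langle\tau+\tfrac12\xi^2\rangle^b\hat f\|_{L^2_{\xi,\tau}},\qquad \|f\|_{H^b_tH^s_x}=\|\langle\xi\rangle^s\langle\tau\rangle^b\hat f\|_{L^2_{\xi,\tau}}$$ is finite. Let $\sigma>0$, $\epsilon\in\{1,-1\}$, let $\psi\in C_0^\infty(\mathbb R)$ satisfy $0\le\psi\le1$, $\psi(t)=1$ for $|t|\le1$, $\psi(t)=0$ for $|t|\ge2$, and put $\psi_T(t)=\psi(t/T)$. Consider the Schrödinger–Debye system $$i\partial_tu+\tfrac12\partial_x^2u=uv,\qquad \sigma\partial_tv+v=\epsilon|u|^2,\qquad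 u(\cdot,0)=u_0,\quad v(\cdot,0)=v_0,\qquad x\in\mathbb R,$$ with $u$ complex valued and $v$ real valued. For $b>1/2$ and $T>0$, a solution of class $b$ on $[0,T]$ with data $(u_0,v_0)$ is a pair $(u,v)$, $v$ real valued, such that (i) $u$ and $v$ have extensions to all times (again denoted $u,v$) with $(\psi_Tu,\psi_Tv)\in X^{k,b}\times H^{b}(\mathbb R,H^s_x)$; (ii) $(u,v)\in C([0,T];H^k(\mathbb R)\times H^s(\mathbb R))$; $(u(0),v(0))=(u_0,v_0)$, and both equations hold in the sense of distributions on $\mathbb R\times(0,T)$. Here the products $uv$ and $|u|^2=u\bar u$ on $\mathbb R\times(0,T)$ are those of the localized extensions $\psi_Tu$, $\psi_Tv$, $\overline{\psi_Tu}$, defined through almost everywhere absolutely convergent convolution of the space-time Fourier transforms. **Theorem.** Let $$|k|-\tfrac12\le s<\min\{k+\tfrac12,\,2k+\tfrac12\}\quad\text{and}\quad k>-\tfrac14 .$$ There are $b_0>1/2$ and a positive function $T(\cdot,\cdot)$, depending only on $k,s,\sigma,\epsilon,\psi$, such that for every $b\in(1/2,b_0)$ and all $(u_0,v_0)\in H^k(\mathbb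 R)\times H^s(\mathbb R)$ with $v_0$ real valued, with $T=T(\|u_0\|_{H^k},\|v_0\|_{H^s})$: * there is a solution $(u,v)$ of class $b$ on $[0,T]$ with data $(u_0,v_0)$, and it is unique: any other solution of class $b$ on $[0,T]$ with the same data equals $(u(t),v(t))$ for all $t\in[0,T]$; * the map from data to solution is locally Lipschitz into $C([0,T];H^k\times H^s)$: there is a neighborhood of $(u_0,v_0)$ in $H^k(\mathbb R)\times H^s(\mathbb R)$ (with real-valued second component) such that all data in it have a solution of class $b$ on the same interval $[0,T]$, and a constant $L$ such that for any two data $(u_1,v_1),(u_2,v_2)$ in it the solutions $(u,v),(u',v')$ on $[0,T]$ satisfy $$\sup_{t\in[0,T]}\big(\|u(t)-u'(t)\|_{H^k}+\|v(t)-v'(t)\|_{H^s}\big)\le L\big(\|u_1-u_2\|_{H^k}+\|v_1-v_2\|_{H^s}\big).$$ -/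

import Mathlib

open MeasureTheory Filter Topology Set
open scoped SchwartzMap FourierTransform LineDeriv ENNReal NNReal Convolution ContDiff

noncomputable section

namespace SchrodingerDebye

/-- The space-time plane; coordinate `0` is the space variable `x` (dual variable `ξ`),
coordinate `1` is the time variable `t` (dual variable `τ`). -/
abbrev Plane : Type := EuclideanSpace ℝ (Fin 2)

/-- The unit vector in the `x` direction. -/
def ex : Plane := EuclideanSpace.single 0 1

/-- The unit vector in the `t` direction. -/
def et : Plane := EuclideanSpace.single 1 1

/-- The bracket `⟨y⟩ = 1 + |y|`. -/
def bracket (y : ℝ) : ℝ := 1 + |y|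

section Fourier

variable {E : Type*} [NormedAddCommGroup E] [InnerProductSpace ℝ E] [FiniteDimensional ℝ E]
  [MeasurableSpace E] [BorelSpace E]

/-- The Fourier transform of the tempered distribution `f` is (given by) the function `g`. -/
def HasFourierFun (f : 𝓢'(E, ℂ)) (g : E → ℂ) : Prop :=
  ∀ φ : 𝓢(E, ℂ), Integrable (fun ζ => φ ζ * g ζ) ∧ (𝓕 f) φ = ∫ ζ, φ ζ * g ζ

/-- The norm `‖w f̂‖_{L²}`, with value `∞` if `f̂` is not a function. (If `f̂` is a function,
it is unique up to null sets, so the infimum is over a single number.) -/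
def fourierNorm (w : E → ℝ) (f : 𝓢'(E, ℂ)) : ℝ≥0∞ :=
  ⨅ (g : E → ℂ) (_ : HasFourierFun f g), eLpNorm (fun ζ => (w ζ : ℂ) * g ζ) 2 volume

/-- `P` is the product `f g`, in the sense that its Fourier transform is the (almost everywhere
absolutely convergent) convolution of the Fourier transforms of `f` and `g`. -/
def IsFourierProduct (f g P : 𝓢'(E, ℂ)) : Prop :=
  ∃ F G : E → ℂ, HasFourierFun f F ∧ HasFourierFun g G ∧
    (∀ᵐ ζ, ConvolutionExistsAt F G ζ (ContinuousLinearMap.mul ℂ ℂ) volume) ∧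
    HasFourierFun P (F ⋆[ContinuousLinearMap.mul ℂ ℂ, volume] G)

end Fourier

section Conj

variable {E : Type*} [NormedAddCommGroup E] [NormedSpace ℝ E]

/-- Complex conjugation of a Schwartz function. -/
def conjSchwartz : 𝓢(E, ℂ) →L[ℝ] 𝓢(E, ℂ) :=
  SchwartzMap.postcompCLM (𝕜 := ℝ) (Complex.conjCLE : ℂ →L[ℝ] ℂ)

/-- The complex conjugate of a tempered distribution, `⟨f̄, φ⟩ = conj ⟨f, φ̄⟩`. -/
def conjDist (f : 𝓢'(E, ℂ)) : 𝓢'(E, ℂ) where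
  toFun φ := (starRingEnd ℂ) (f (conjSchwartz φ))
  map_add' φ χ := by simp
  map_smul' c φ := by
    have h : conjSchwartz (c • φ) = (starRingEnd ℂ) c • conjSchwartz φ := by
      ext x; simp [conjSchwartz]
    simp [h]
  cont := Complex.continuous_conj.comp (f.cont.comp conjSchwartz.continuous)

theorem conjDist_apply (f : 𝓢'(E, ℂ)) (φ : 𝓢(E, ℂ)) :
    conjDist f φ = (starRingEnd ℂ) (f (conjSchwartz φ)) := rfl

/-- A tempered distribution is real valued if it is its own conjugate. -/
def IsRealDist (f : 𝓢'(E, ℂ)) : Prop := conjDist f = f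

end Conj

/- Mathlib's Fourier transform is `∫ exp (-2πi x ξ) f x dx`, so a frequency `ξ` there corresponds
to the angular frequency `2πξ` used in the weights below. -/

/-- The norm of `H^k(ℝ)`. -/
def sobolevNorm (k : ℝ) (f : 𝓢'(ℝ, ℂ)) : ℝ≥0∞ :=
  fourierNorm (fun ξ => bracket (2 * Real.pi * ξ) ^ k) f

/-- `f ∈ H^k(ℝ)`. -/
def MemH (k : ℝ) (f : 𝓢'(ℝ, ℂ)) : Prop := sobolevNorm k f < ⊤

/-- The norm of the Bourgain space `X^{k,b}` of the group `exp (i t ∂ₓ² / 2)`: the weight is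
`⟨ξ⟩^k ⟨τ + ξ² / 2⟩^b`. -/
def bourgainNorm (k b : ℝ) (U : 𝓢'(Plane, ℂ)) : ℝ≥0∞ :=
  fourierNorm (fun ζ => bracket (2 * Real.pi * ζ 0) ^ k *
    bracket (2 * Real.pi * ζ 1 + (2 * Real.pi * ζ 0) ^ 2 / 2) ^ b) U

/-- The norm of `H^b_t(ℝ; H^s_x)`: the weight is `⟨ξ⟩^s ⟨τ⟩^b`. -/
def mixedNorm (s b : ℝ) (V : 𝓢'(Plane, ℂ)) : ℝ≥0∞ :=
  fourierNorm (fun ζ => bracket (2 * Real.pi * ζ 0) ^ s * bracket (2 * Real.pi * ζ 1) ^ b) V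

/-- `u ∈ C([0,T]; H^k(ℝ))`. -/
def ContinuousInH (k T : ℝ) (u : ℝ → 𝓢'(ℝ, ℂ)) : Prop :=
  ∀ t ∈ Icc 0 T, MemH k (u t) ∧
    Tendsto (fun t' => sobolevNorm k (u t' - u t)) (𝓝[Icc 0 T] t) (𝓝 0)

/-- The line `{(x, t) : x ∈ ℝ}` of the plane. -/
def lineAt (t x : ℝ) : Plane := x • ex + t • et

theorem lineAt_hasTemperateGrowth (t : ℝ) : (lineAt t).HasTemperateGrowth := by
  unfold lineAt
  fun_prop

theorem lineAt_antilipschitz (t : ℝ) : AntilipschitzWith 1 (lineAt t) := by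
  refine AntilipschitzWith.of_le_mul_dist fun x y => ?_
  simp [lineAt, ex, et, dist_eq_norm, ← sub_smul, norm_smul]

/-- The slice `φ(·, t)` of a Schwartz function on the plane. -/
def slice (t : ℝ) : 𝓢(Plane, ℂ) →L[ℂ] 𝓢(ℝ, ℂ) :=
  SchwartzMap.compCLMOfAntilipschitz ℂ (lineAt_hasTemperateGrowth t) (lineAt_antilipschitz t)

theorem slice_apply (t x : ℝ) (φ : 𝓢(Plane, ℂ)) : slice t φ x = φ (lineAt t x) := rfl

/-- The open strip `ℝ × (0, T)`. -/
def strip (T : ℝ) : Set Plane := {z | z 1 ∈ Ioo 0 T}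

/-- The distribution `U` on the plane extends the curve `u`, i.e. it coincides with `u` on the
strip `ℝ × (0, T)`. -/
def Extends (T : ℝ) (u : ℝ → 𝓢'(ℝ, ℂ)) (U : 𝓢'(Plane, ℂ)) : Prop :=
  ∀ φ : 𝓢(Plane, ℂ), tsupport φ ⊆ strip T → U φ = ∫ t in Ioo 0 T, u t (slice t φ)

/-- The class of admissible cutoff functions `ψ`. -/
structure IsCutoff (ψ : ℝ → ℝ) : Prop where
  smooth : ContDiff ℝ ∞ ψ
  nonneg : ∀ t, 0 ≤ ψ t
  le_one : ∀ t, ψ t ≤ 1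
  eq_one : ∀ t, |t| ≤ 1 → ψ t = 1
  eq_zero : ∀ t, 2 ≤ |t| → ψ t = 0

/-- The multiplier `ψ_T` acts on tempered distributions. -/
theorem IsCutoff.hasTemperateGrowth {ψ : ℝ → ℝ} (h : IsCutoff ψ) (T : ℝ) :
    (fun z : Plane => ((ψ (z 1 / T) : ℝ) : ℂ)).HasTemperateGrowth := by
  have hc : HasCompactSupport ψ := by
    refine HasCompactSupport.of_support_subset_isCompact (isCompact_Icc (a := -2) (b := 2)) ?_
    intro t ht
    by_contra h'
    apply ht
    apply h.eq_zero
    rw [mem_Icc, ← abs_le] at h'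
    linarith
  have h1 : ψ.HasTemperateGrowth :=
    (hc.toSchwartzMap h.smooth : 𝓢(ℝ, ℝ)).hasTemperateGrowth
  have h2 : (fun z : Plane => z 1 / T).HasTemperateGrowth := by
    have h3 := ContinuousLinearMap.hasTemperateGrowth
      ((T⁻¹ : ℝ) • (EuclideanSpace.proj 1 : Plane →L[ℝ] ℝ))
    convert h3 using 2 with z
    simp [div_eq_inv_mul]
  have h4 : (fun x : ℝ => (x : ℂ)).HasTemperateGrowth := Complex.ofRealCLM.hasTemperateGrowth
  exact h4.comp (h1.comp h2)

/-- Multiplication by `ψ_T(t) = ψ(t / T)`. -/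
def localize (ψ : ℝ → ℝ) (T : ℝ) (U : 𝓢'(Plane, ℂ)) : 𝓢'(Plane, ℂ) :=
  TemperedDistribution.smulLeftCLM ℂ (fun z : Plane => ((ψ (z 1 / T) : ℝ) : ℂ)) U

/-- `(u, v)` is a solution on `[0, T]`, with `v` real valued, of
`i ∂ₜ u + ½ ∂ₓ² u = u v`, `σ ∂ₜ v + v = ε |u|²`, `u(0) = u₀`, `v(0) = v₀`,
in `C([0,T]; H^k × H^s)`, which has an extension `(U, V)` in time with `ψ_T U ∈ X^{k,b}` and
`ψ_T V ∈ H^b_t H^s_x`. The equations hold in the sense of distributions on `ℝ × (0, T)`, and the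
products `u v` and `|u|² = u ū` there are those of the localized extensions. -/
structure IsSolution (σ ε : ℝ) (ψ : ℝ → ℝ) (k s b T : ℝ) (u₀ v₀ : 𝓢'(ℝ, ℂ))
    (u v : ℝ → 𝓢'(ℝ, ℂ)) : Prop where
  initial_u : u 0 = u₀
  initial_v : v 0 = v₀
  real_v : ∀ t ∈ Icc 0 T, IsRealDist (v t)
  continuous_u : ContinuousInH k T u
  continuous_v : ContinuousInH s T v
  equations : ∃ U V uv uu : 𝓢'(Plane, ℂ),
    Extends T u U ∧ Extends T v V ∧
    bourgainNorm k b (localize ψ T U) < ⊤ ∧ mixedNorm s b (localize ψ T V) < ⊤ ∧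
    IsFourierProduct (localize ψ T U) (localize ψ T V) uv ∧
    IsFourierProduct (localize ψ T U) (conjDist (localize ψ T U)) uu ∧
    Distribution.IsVanishingOn
      (Complex.I • ∂_{et} U + (1 / 2 : ℂ) • ∂_{ex} (∂_{ex} U) - uv : 𝓢'(Plane, ℂ)) (strip T) ∧
    Distribution.IsVanishingOn
      ((σ : ℂ) • ∂_{et} V + V - (ε : ℂ) • uu : 𝓢'(Plane, ℂ)) (strip T)

/-- The distance in `H^k(ℝ) × H^s(ℝ)`. -/
def pairDist (k s : ℝ) (u v u' v' : 𝓢'(ℝ, ℂ)) : ℝ≥0∞ :=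
  sobolevNorm k (u - u') + sobolevNorm s (v - v')

end SchrodingerDebye

end

open SchrodingerDebye

noncomputable section

namespace SchrodingerDebye

/-! ### Brackets -/

/-! The proof is Bourgain's method, carried out on the Fourier side. At a fixed space frequency `ξ`
both equations are scalar ODEs `∂ₜ y + 2πi·disp κ ξ·y = q`, with `κ = 1` for `u` and `κ = 0` for
`v`. Solutions are fixed points of the Duhamel formula multiplied by the cutoff at scale `T`, in the
`L²` spaces with weights `wt 1 k b` and `wt 0 s b`.

Linear part (`exists_cnorm_duhF_le`): the data cost `T^(1/2-b)`, and the source, measured with time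
weight `-a`, is returned with weight `b` and a factor `T^(1-a-b)`. A ball adapted to the data thus
has radius of order `T^(1/2-b)`, and the map contracts on it once `T^(3/2-a-2b)` is small. Since the
bilinear estimates hold with some `a < 1/2`, every `b` slightly above `1/2` is admissible
(`PicardBounds.exists_admissible`, `PicardBounds.exists_fixedPoint`).

Bilinear part (`exists_product_le`, `exists_modulus_le`): by duality and Cauchy–Schwarz it is enough
to freeze one of the three space-time frequencies of a trilinear form and to bound the integral of
the squared weight quotient over the remaining one (`TriBounded.of_left`, `TriBounded.of_right`,
`TriBounded.of_difference`). The derivatives are paid for by resonance: the modulations `s₁`, `s₂`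
of the two Schrödinger factors and the time frequency `l` of the Debye factor satisfy `s₁ - s₂ - l =
(x₁² - x₂²)/2`, so the largest of the three controls the right side (`pointwise_schrodinger`,
`pointwise_debye`). The condition `|k| - 1/2 ≤ s` is used for `u v`. The upper bound on `s` and `k >
-1/4` produce the exponent `γ` of the estimate of `u ū`.

Uniqueness is claimed in the whole class, where an extension of a solution need not be a fixed point
nor be small. What is known is that its traces on `[0,T]` satisfy the Duhamel equations
(`TraceSol`). The Duhamel integral of a convolution at time `t` sees the traces of the factors only
between `0` and `t` (`integral_cv_duk_eq`). Iterating the contraction from two such extensions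
therefore preserves both traces while the distance of the iterates tends to zero, so the traces
agree on a short interval (`PicardBounds.traceSol_unique_short`). Restarting with the same step
length covers `[0,T]`.

The remaining work relates tempered distributions to these traces. A distribution with Duhamel
traces solves the equation weakly (`HasFF.weakEq`). Conversely, product test functions isolate the
frequencies, and mollifiers turn the weak equation into the Duhamel formula (`ae_tr_eq_duh`) and
identify a continuous curve with the traces of its extension (`hasFourierFun_tr`). Reality of `v`
follows from Gronwall's inequality (`ae_tr_eq_conj`). -/

theorem one_le_bracket (y : ℝ) : 1 ≤ bracket y := by
  unfold bracket; linarith [abs_nonneg y]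

theorem bracket_pos (y : ℝ) : 0 < bracket y := zero_lt_one.trans_le (one_le_bracket y)

theorem bracket_add_le_mul (x y : ℝ) : bracket (x + y) ≤ bracket x * bracket y := by
  unfold bracket
  nlinarith [abs_add_le x y, abs_nonneg x, abs_nonneg y, mul_nonneg (abs_nonneg x) (abs_nonneg y)]

theorem bracket_add_le_add (x y : ℝ) : bracket (x + y) ≤ bracket x + bracket y := by
  unfold bracket
  linarith [abs_add_le x y]

@[fun_prop]
theorem continuous_bracket : Continuous bracket := by
  unfold bracket; fun_prop

@[fun_prop]
theorem measurable_bracket : Measurable bracket := continuous_bracket.measurable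

theorem bracket_rpow_le_one {y r : ℝ} (hr : r ≤ 0) : bracket y ^ r ≤ 1 :=
  Real.rpow_le_one_of_one_le_of_nonpos (one_le_bracket y) hr

theorem bracket_rpow_pos (y r : ℝ) : 0 < bracket y ^ r := Real.rpow_pos_of_pos (bracket_pos y) r

theorem rpow_neg_le_of_le_mul {x y c r : ℝ} (hx : 0 < x) (hc : 0 < c) (hy : 0 < y)
    (h : x ≤ c * y) (hr : 0 ≤ r) : y ^ (-r) ≤ c ^ r * x ^ (-r) := by
  have h1 : (c * y) ^ (-r) ≤ x ^ (-r) := Real.rpow_le_rpow_of_nonpos hx h (by linarith)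
  rw [Real.mul_rpow hc.le hy.le] at h1
  calc y ^ (-r) = c ^ r * (c ^ (-r) * y ^ (-r)) := by
        rw [← mul_assoc, ← Real.rpow_add hc]; simp
    _ ≤ _ := by gcongr

/-- `A^{-p} B^{-r} ≤ A^{-p-r} + B^{-p-r}`. -/
theorem rpow_neg_mul_rpow_neg_le {A B p r : ℝ} (hA : 0 < A) (hB : 0 < B) (hp : 0 ≤ p)
    (hr : 0 ≤ r) : A ^ (-p) * B ^ (-r) ≤ A ^ (-(p + r)) + B ^ (-(p + r)) := by
  have eA : A ^ (-(p + r)) = A ^ (-p) * A ^ (-r) := by rw [← Real.rpow_add hA]; ring_nf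
  have eB : B ^ (-(p + r)) = B ^ (-p) * B ^ (-r) := by rw [← Real.rpow_add hB]; ring_nf
  have pA : 0 < A ^ (-(p + r)) := Real.rpow_pos_of_pos hA _
  have pB : 0 < B ^ (-(p + r)) := Real.rpow_pos_of_pos hB _
  rcases le_total A B with h | h
  · have : B ^ (-r) ≤ A ^ (-r) := Real.rpow_le_rpow_of_nonpos hA h (by linarith)
    have h2 : A ^ (-p) * B ^ (-r) ≤ A ^ (-p) * A ^ (-r) := by gcongr
    linarith
  · have : A ^ (-p) ≤ B ^ (-p) := Real.rpow_le_rpow_of_nonpos hB h (by linarith)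
    have h2 : A ^ (-p) * B ^ (-r) ≤ B ^ (-p) * B ^ (-r) := by gcongr
    linarith

/-! ### `L²` norms of nonnegative functions -/

/-- The `L²` norm of an `ℝ≥0∞`-valued function. -/
def l2 {α : Type*} [MeasureSpace α] (f : α → ℝ≥0∞) : ℝ≥0∞ := (∫⁻ x, f x ^ 2) ^ (1 / 2 : ℝ)

section L2

variable {α β : Type*} [MeasureSpace α] [MeasureSpace β]

theorem l2_sq (f : α → ℝ≥0∞) : l2 f ^ 2 = ∫⁻ x, f x ^ 2 := by
  unfold l2
  rw [← ENNReal.rpow_natCast, ← ENNReal.rpow_mul]; norm_num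

theorem l2_le_iff {f : α → ℝ≥0∞} {c : ℝ≥0∞} : l2 f ≤ c ↔ ∫⁻ x, f x ^ 2 ≤ c ^ 2 := by
  rw [← l2_sq, ENNReal.pow_le_pow_left_iff two_ne_zero]

theorem l2_mono_ae {f g : α → ℝ≥0∞} (h : ∀ᵐ x, f x ≤ g x) : l2 f ≤ l2 g := by
  unfold l2
  refine ENNReal.rpow_le_rpow (lintegral_mono_ae ?_) (by norm_num)
  filter_upwards [h] with x hx
  gcongr

theorem l2_mono {f g : α → ℝ≥0∞} (h : ∀ x, f x ≤ g x) : l2 f ≤ l2 g :=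
  l2_mono_ae (Eventually.of_forall h)

theorem l2_congr_ae {f g : α → ℝ≥0∞} (h : ∀ᵐ x, f x = g x) : l2 f = l2 g :=
  le_antisymm (l2_mono_ae (h.mono fun _ hx => hx.le)) (l2_mono_ae (h.mono fun _ hx => hx.ge))

theorem l2_const_mul {c : ℝ≥0∞} (hc : c ≠ ⊤) (f : α → ℝ≥0∞) :
    l2 (fun x => c * f x) = c * l2 f := by
  unfold l2
  simp_rw [mul_pow]
  rw [lintegral_const_mul' _ _ (by simp [hc]), ENNReal.mul_rpow_of_nonneg _ _ (by norm_num),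
    ← ENNReal.rpow_natCast, ← ENNReal.rpow_mul]
  norm_num

theorem l2_add_le {f g : α → ℝ≥0∞} (hf : Measurable f) (hg : Measurable g) :
    l2 (fun x => f x + g x) ≤ l2 f + l2 g := by
  have := ENNReal.lintegral_Lp_add_le (μ := (volume : Measure α)) (p := 2) hf.aemeasurable
    hg.aemeasurable (by norm_num)
  simpa [l2] using this

theorem lintegral_mul_le_l2 {f g : α → ℝ≥0∞} (hf : Measurable f) (hg : Measurable g) :
    ∫⁻ x, f x * g x ≤ l2 f * l2 g := by
  have := ENNReal.lintegral_mul_le_Lp_mul_Lq (volume : Measure α) Real.HolderConjugate.two_two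
    hf.aemeasurable hg.aemeasurable
  simpa [l2] using this

theorem l2_eq_zero_iff {f : α → ℝ≥0∞} (hf : Measurable f) : l2 f = 0 ↔ ∀ᵐ x, f x = 0 := by
  unfold l2
  rw [ENNReal.rpow_eq_zero_iff_of_pos (by norm_num), lintegral_eq_zero_iff (hf.pow_const 2)]
  simp [Filter.EventuallyEq]

theorem l2_prod [SFinite (volume : Measure β)] {f : α × β → ℝ≥0∞}
    (hf : Measurable f) : l2 f = l2 (fun x => l2 fun y => f (x, y)) := by
  have : ∫⁻ z, f z ^ 2 = ∫⁻ x, (l2 fun y => f (x, y)) ^ 2 := by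
    simp_rw [l2_sq]
    exact lintegral_prod _ (hf.pow_const 2).aemeasurable
  unfold l2 at *
  rw [this]

theorem measurable_l2_right [SFinite (volume : Measure β)] {f : α → β → ℝ≥0∞}
    (hf : Measurable (Function.uncurry f)) : Measurable fun x => l2 (f x) := by
  unfold l2
  have h : Measurable fun z : α × β => (Function.uncurry f z) ^ 2 := hf.pow_const 2
  exact (Measurable.lintegral_prod_right' h).pow_const _

/-- Duality: a bound on all pairings is a bound on the `L²` norm. -/
theorem l2_le_of_pairing [SigmaFinite (volume : Measure α)] {A : α → ℝ≥0∞} (hA : Measurable A)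
    {C : ℝ≥0∞} (h : ∀ φ : α → ℝ≥0∞, Measurable φ → ∫⁻ x, φ x * A x ≤ C * l2 φ) : l2 A ≤ C := by
  let S : ℕ → Set α := spanningSets volume
  -- The norm of `A` may be infinite. The truncations of `A` in height and in space have finite
  -- norm, which can be cancelled, and they increase to `A`.
  let φ : ℕ → α → ℝ≥0∞ := fun n => (S n).indicator fun x => min (A x) n
  have hφm : ∀ n, Measurable (φ n) := fun n =>
    (hA.min measurable_const).indicator (measurableSet_spanningSets _ n)
  have hφA : ∀ n x, φ n x ≤ A x := fun n x => by
    by_cases hx : x ∈ S n <;> simp [φ, hx]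
  have hfin : ∀ n, ∫⁻ x, φ n x ^ 2 ≠ ⊤ := fun n => by
    have : ∫⁻ x, φ n x ^ 2 ≤ ∫⁻ x, (S n).indicator (fun _ => (n : ℝ≥0∞) ^ 2) x := by
      refine lintegral_mono fun x => ?_
      by_cases hx : x ∈ S n
      · simp only [φ, hx, indicator_of_mem]; gcongr; exact min_le_right _ _
      · simp [φ, hx]
    rw [lintegral_indicator (measurableSet_spanningSets _ n), setLIntegral_const] at this
    exact (this.trans_lt (ENNReal.mul_lt_top (by simp) (measure_spanningSets_lt_top _ n))).ne
  have hle : ∀ n, ∫⁻ x, φ n x ^ 2 ≤ C ^ 2 := fun n => by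
    have h1 : l2 (φ n) * l2 (φ n) ≤ C * l2 (φ n) := by
      rw [← sq, l2_sq]
      refine le_trans (lintegral_mono fun x => ?_) (h _ (hφm n))
      rw [sq]; gcongr; exact hφA n x
    have h2 : l2 (φ n) ≠ ⊤ := ENNReal.rpow_ne_top_of_nonneg (by norm_num) (hfin n)
    by_cases h0 : l2 (φ n) = 0
    · rw [← l2_sq, h0]; simp
    · rw [← l2_sq]; gcongr
      exact (ENNReal.mul_le_mul_iff_left h0 h2).1 h1
  have hmono : Monotone fun n x => φ n x ^ 2 := by
    intro n m hnm x
    dsimp only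
    gcongr
    by_cases hx : x ∈ S n
    · have hx' : x ∈ S m := monotone_spanningSets _ hnm hx
      simp only [φ, hx, hx', indicator_of_mem]
      exact min_le_min le_rfl (by exact_mod_cast hnm)
    · simp [φ, hx]
  have hsup : ∀ x, ⨆ n, φ n x ^ 2 = A x ^ 2 := by
    intro x
    refine le_antisymm (iSup_le fun n => by gcongr; exact hφA n x) ?_
    obtain ⟨n₀, hn₀⟩ : ∃ n, x ∈ S n := by
      have := iUnion_spanningSets (volume : Measure α)
      exact mem_iUnion.1 (this ▸ mem_univ x)
    have ht : Tendsto (fun n : ℕ => (min (A x) (n : ℝ≥0∞)) ^ 2) atTop (𝓝 (A x ^ 2)) := by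
      have : Tendsto (fun n : ℕ => min (A x) (n : ℝ≥0∞)) atTop (𝓝 (min (A x) ⊤)) :=
        tendsto_const_nhds.min ENNReal.tendsto_nat_nhds_top
      rw [min_top_right] at this
      exact (ENNReal.continuous_pow 2).continuousAt.tendsto.comp this
    refine le_of_tendsto ht ?_
    filter_upwards [eventually_ge_atTop n₀] with n hn
    refine le_iSup_of_le n ?_
    have hx' : x ∈ S n := monotone_spanningSets _ hn hn₀
    simp [φ, hx']
  rw [l2_le_iff]
  calc ∫⁻ x, A x ^ 2 = ∫⁻ x, ⨆ n, φ n x ^ 2 := by simp_rw [hsup]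
    _ = ⨆ n, ∫⁻ x, φ n x ^ 2 := lintegral_iSup (fun n => (hφm n).pow_const 2) hmono
    _ ≤ C ^ 2 := iSup_le hle

end L2

/-- Young's inequality `‖h ⋆ g‖₂ ≤ ‖h‖₁ ‖g‖₂` on the line. -/
theorem l2_conv_le {h g : ℝ → ℝ≥0∞} (hh : Measurable h) (hg : Measurable g) :
    l2 (fun x => ∫⁻ y, h (x - y) * g y) ≤ (∫⁻ x, h x) * l2 g := by
  have hm2 : Measurable fun p : ℝ × ℝ => h (p.1 - p.2) * g p.2 := by fun_prop
  refine l2_le_of_pairing (Measurable.lintegral_prod_right' hm2) fun φ hφ => ?_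
  have e1 : ∫⁻ x, φ x * ∫⁻ y, h (x - y) * g y = ∫⁻ x, ∫⁻ z, h z * (φ x * g (x - z)) := by
    refine lintegral_congr fun x => ?_
    rw [← lintegral_const_mul _ (by fun_prop),
      ← lintegral_sub_left_eq_self (fun y => φ x * (h (x - y) * g y)) x]
    refine lintegral_congr fun z => ?_
    rw [sub_sub_cancel]; ring
  rw [e1, lintegral_lintegral_swap (by fun_prop)]
  calc ∫⁻ z, ∫⁻ x, h z * (φ x * g (x - z))
      ≤ ∫⁻ z, h z * (l2 φ * l2 g) := by
        refine lintegral_mono fun z => ?_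
        dsimp only
        rw [lintegral_const_mul _ (by fun_prop)]
        gcongr
        refine (lintegral_mul_le_l2 hφ (by fun_prop)).trans ?_
        gcongr
        unfold l2
        rw [lintegral_sub_right_eq_self (fun x => g x ^ 2) z]
    _ = (∫⁻ x, h x) * l2 g * l2 φ := by
        rw [lintegral_mul_const _ hh]; ring

/-! ### Kernel integrals -/

theorem lintegral_comp_mul_left {T : ℝ} (hT : 0 < T) (f : ℝ → ℝ≥0∞) :
    ∫⁻ x, f (T * x) = ENNReal.ofReal T⁻¹ * ∫⁻ x, f x := by
  have e : ∫⁻ x, f x ∂(Measure.map (T * ·) volume) = ∫⁻ x, f (T * x) :=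
    (Homeomorph.mulLeft₀ T hT.ne').toMeasurableEquiv.measurableEmbedding.lintegral_map f
  have hm := Real.map_volume_mul_left hT.ne'
  simp only [hm, lintegral_smul_measure, abs_of_pos (inv_pos.2 hT), smul_eq_mul] at e
  exact e.symm

theorem lintegral_bracket_lt_top {r : ℝ} (hr : 1 < r) :
    ∫⁻ x, ENNReal.ofReal (bracket x ^ (-r)) < ⊤ := by
  have := finite_integral_one_add_norm (E := ℝ) (μ := volume) (r := r) (by simpa using hr)
  simpa [bracket] using this

theorem lintegral_comp_mul_left_le {T : ℝ} (hT : 1 ≤ T) (f : ℝ → ℝ≥0∞) :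
    ∫⁻ x, f (T * x) ≤ ∫⁻ x, f x := by
  rw [lintegral_comp_mul_left (by linarith) f]
  refine mul_le_of_le_one_left' ?_
  rw [ENNReal.ofReal_le_one]
  exact inv_le_one_of_one_le₀ hT

/-- The larger of the two brackets is at least half of `bracket (x + y)` and can pay the decay `r₁`.
If the larger one carries the exponent `r₂`, the excess `r₂ - r₁` is handed over to the smaller one.
-/
theorem bracket_conv_pointwise {r₁ r₂ : ℝ} (h0 : 0 ≤ r₁) (h12 : r₁ ≤ r₂) (x y : ℝ) :
    bracket x ^ (-r₁) * bracket y ^ (-r₂) ≤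
      2 ^ r₁ * bracket (x + y) ^ (-r₁) * (bracket x ^ (-r₂) + bracket y ^ (-r₂)) := by
  have hx := bracket_pos x
  have hy := bracket_pos y
  have hc := bracket_pos (x + y)
  have hadd := bracket_add_le_add x y
  have px := bracket_rpow_pos x (-r₂)
  have py := bracket_rpow_pos y (-r₂)
  have pc := bracket_rpow_pos (x + y) (-r₁)
  rcases le_total (bracket y) (bracket x) with h | h
  · have h1 := rpow_neg_le_of_le_mul hc two_pos hx (by linarith) h0
    calc _ ≤ 2 ^ r₁ * bracket (x + y) ^ (-r₁) * bracket y ^ (-r₂) := by gcongr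
      _ ≤ _ := by gcongr; linarith
  · have h1 := rpow_neg_le_of_le_mul hc two_pos hy (by linarith) h0
    have e : bracket y ^ (-r₂) = bracket y ^ (-r₁) * bracket y ^ (-(r₂ - r₁)) := by
      rw [← Real.rpow_add hy]; ring_nf
    have e' : bracket x ^ (-r₂) = bracket x ^ (-r₁) * bracket x ^ (-(r₂ - r₁)) := by
      rw [← Real.rpow_add hx]; ring_nf
    have h2 : bracket y ^ (-(r₂ - r₁)) ≤ bracket x ^ (-(r₂ - r₁)) :=
      Real.rpow_le_rpow_of_nonpos hx h (by linarith)
    calc bracket x ^ (-r₁) * bracket y ^ (-r₂)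
        = bracket y ^ (-r₁) * (bracket x ^ (-r₁) * bracket y ^ (-(r₂ - r₁))) := by rw [e]; ring
      _ ≤ (2 ^ r₁ * bracket (x + y) ^ (-r₁)) * bracket x ^ (-r₂) := by
          rw [e']
          have := bracket_rpow_pos x (-r₁)
          gcongr
      _ ≤ _ := by gcongr; linarith

/-- Only the larger exponent has to exceed `1`; the convolution keeps the decay of the smaller one.
This matters because exponents `2a < 1` occur in the bilinear estimates. -/
theorem exists_bracket_conv_le {r₁ r₂ : ℝ} (h0 : 0 ≤ r₁) (h12 : r₁ ≤ r₂) (h2 : 1 < r₂) :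
    ∃ C : ℝ≥0∞, C ≠ ⊤ ∧ ∀ c : ℝ,
      ∫⁻ x, ENNReal.ofReal (bracket x ^ (-r₁) * bracket (c - x) ^ (-r₂)) ≤
        C * ENNReal.ofReal (bracket c ^ (-r₁)) := by
  set I := ∫⁻ x, ENNReal.ofReal (bracket x ^ (-r₂)) with hI
  have hIt : I ≠ ⊤ := (lintegral_bracket_lt_top h2).ne
  refine ⟨ENNReal.ofReal (2 ^ r₁) * (I + I), by finiteness, fun c => ?_⟩
  calc ∫⁻ x, ENNReal.ofReal (bracket x ^ (-r₁) * bracket (c - x) ^ (-r₂))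
      ≤ ∫⁻ x, ENNReal.ofReal (2 ^ r₁ * bracket c ^ (-r₁)) *
          (ENNReal.ofReal (bracket x ^ (-r₂)) + ENNReal.ofReal (bracket (c - x) ^ (-r₂))) := by
        refine lintegral_mono fun x => ?_
        dsimp only
        rw [← ENNReal.ofReal_add (bracket_rpow_pos _ _).le (bracket_rpow_pos _ _).le,
          ← ENNReal.ofReal_mul (by have := bracket_rpow_pos c (-r₁); positivity)]
        refine ENNReal.ofReal_le_ofReal ?_
        simpa using bracket_conv_pointwise h0 h12 x (c - x)
    _ = ENNReal.ofReal (2 ^ r₁ * bracket c ^ (-r₁)) * (I + I) := by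
        rw [lintegral_const_mul _ (by fun_prop), lintegral_add_left (by fun_prop),
          lintegral_sub_left_eq_self (fun x => ENNReal.ofReal (bracket x ^ (-r₂))) c]
    _ = _ := by rw [ENNReal.ofReal_mul (by positivity)]; ring

/-- This prepares the substitution `y = x²/2`. The factor `|x|` on the right is its Jacobian, and
the remaining power `|x|^(θ-1)` is comparable to a negative power of `bracket (x²/2)`. -/
theorem bracket_quadratic_pointwise {θ r : ℝ} (h0 : 0 ≤ θ) (h1 : θ ≤ 1) (hr : 0 ≤ r) (c x : ℝ)
    (hx : 1 ≤ |x|) : bracket x ^ θ * bracket (c + x ^ 2 / 2) ^ (-r) ≤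
      |x| * (4 * (bracket (x ^ 2 / 2) ^ (-((1 - θ) / 2 + r)) +
        bracket (c + x ^ 2 / 2) ^ (-((1 - θ) / 2 + r)))) := by
  have hx0 : 0 < |x| := by linarith
  have hb : bracket x ≤ 2 * |x| := by unfold bracket; linarith
  have h2 : bracket x ^ θ ≤ 2 * |x| ^ θ := by
    calc bracket x ^ θ ≤ (2 * |x|) ^ θ := Real.rpow_le_rpow (bracket_pos x).le hb h0
      _ = 2 ^ θ * |x| ^ θ := Real.mul_rpow (by norm_num) hx0.le
      _ ≤ 2 ^ (1 : ℝ) * |x| ^ θ := by gcongr; norm_num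
      _ = _ := by norm_num
  have hsq : 1 ≤ x ^ 2 := by rw [← sq_abs]; nlinarith
  have hy : bracket (x ^ 2 / 2) ≤ 2 * x ^ 2 := by
    unfold bracket; rw [abs_of_nonneg (by positivity)]; linarith
  have h3 : |x| ^ θ ≤ |x| * (2 * bracket (x ^ 2 / 2) ^ (-((1 - θ) / 2))) := by
    have e : |x| ^ θ = |x| * (x ^ 2) ^ (-((1 - θ) / 2)) := by
      rw [← sq_abs x, ← Real.rpow_natCast, ← Real.rpow_mul hx0.le]
      nth_rw 2 [← Real.rpow_one |x|]
      rw [← Real.rpow_add hx0]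
      congr 1; push_cast; ring
    have h4 := rpow_neg_le_of_le_mul (bracket_pos (x ^ 2 / 2)) two_pos (by linarith) hy
      (show 0 ≤ (1 - θ) / 2 by linarith)
    have h5 : (2 : ℝ) ^ ((1 - θ) / 2) ≤ 2 ^ (1 : ℝ) :=
      Real.rpow_le_rpow_of_exponent_le (by norm_num) (by linarith)
    rw [Real.rpow_one] at h5
    rw [e]
    have := bracket_rpow_pos (x ^ 2 / 2) (-((1 - θ) / 2))
    gcongr
    exact h4.trans (by gcongr)
  have h6 := rpow_neg_mul_rpow_neg_le (bracket_pos (x ^ 2 / 2)) (bracket_pos (c + x ^ 2 / 2))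
    (show 0 ≤ (1 - θ) / 2 by linarith) hr
  have p := bracket_rpow_pos (c + x ^ 2 / 2) (-r)
  calc bracket x ^ θ * bracket (c + x ^ 2 / 2) ^ (-r)
      ≤ (2 * (|x| * (2 * bracket (x ^ 2 / 2) ^ (-((1 - θ) / 2))))) *
          bracket (c + x ^ 2 / 2) ^ (-r) := by
        gcongr; linarith
    _ = |x| * (4 * (bracket (x ^ 2 / 2) ^ (-((1 - θ) / 2)) * bracket (c + x ^ 2 / 2) ^ (-r))) := by
        ring
    _ ≤ _ := by gcongr

/-- Outside `[-1,1]` substitute `y = x²/2`, which is injective on each half-line. The hypothesis `(1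
+ θ)/2 < r` says that the resulting exponent `q` exceeds `1`. On `[-1,1]` the integrand is at most
`2`. -/
theorem exists_bracket_quadratic_le {θ r : ℝ} (h0 : 0 ≤ θ) (h1 : θ ≤ 1) (hr : (1 + θ) / 2 < r) :
    ∃ C : ℝ≥0∞, C ≠ ⊤ ∧ ∀ c : ℝ,
      ∫⁻ x, ENNReal.ofReal (bracket x ^ θ * bracket (c + x ^ 2 / 2) ^ (-r)) ≤ C := by
  set q := (1 - θ) / 2 + r with hq
  have hq1 : 1 < q := by linarith
  set I := ∫⁻ x, ENNReal.ofReal (bracket x ^ (-q)) with hI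
  have hIt : I ≠ ⊤ := (lintegral_bracket_lt_top hq1).ne
  refine ⟨ENNReal.ofReal 4 * (I + I) + ENNReal.ofReal 4 * (I + I) + 4, by finiteness,
    fun c => ?_⟩
  set f : ℝ → ℝ≥0∞ := fun x => ENNReal.ofReal (bracket x ^ θ * bracket (c + x ^ 2 / 2) ^ (-r))
  set G : ℝ → ℝ≥0∞ := fun y => ENNReal.ofReal 4 * (ENNReal.ofReal (bracket y ^ (-q)) +
    ENNReal.ofReal (bracket (c + y) ^ (-q))) with hG
  have hGI : ∫⁻ y, G y = ENNReal.ofReal 4 * (I + I) := by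
    rw [lintegral_const_mul _ (by fun_prop), lintegral_add_left (by fun_prop),
      lintegral_add_left_eq_self (fun x => ENNReal.ofReal (bracket x ^ (-q))) c]
  have hout : ∀ s : Set ℝ, MeasurableSet s → (∀ x ∈ s, 1 ≤ |x|) →
      InjOn (fun x : ℝ => x ^ 2 / 2) s → ∫⁻ x in s, f x ≤ ENNReal.ofReal 4 * (I + I) := by
    intro s hs hs1 hinj
    have hcv := lintegral_image_eq_lintegral_abs_deriv_mul (f := fun x : ℝ => x ^ 2 / 2)
      (f' := fun x => x) hs (fun x _ => by
        have := ((hasDerivAt_pow 2 x).div_const 2).hasDerivWithinAt (s := s)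
        simpa using this) hinj G
    calc ∫⁻ x in s, f x ≤ ∫⁻ x in s, ENNReal.ofReal |x| * G (x ^ 2 / 2) := by
          refine setLIntegral_mono' hs fun x hx => ?_
          simp only [f, hG]
          rw [← ENNReal.ofReal_add (bracket_rpow_pos _ _).le (bracket_rpow_pos _ _).le,
            ← ENNReal.ofReal_mul (by norm_num), ← ENNReal.ofReal_mul (abs_nonneg x)]
          exact ENNReal.ofReal_le_ofReal
            (bracket_quadratic_pointwise h0 h1 (by linarith) c x (hs1 x hx))
      _ = ∫⁻ y in (fun x : ℝ => x ^ 2 / 2) '' s, G y := hcv.symm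
      _ ≤ ∫⁻ y, G y := setLIntegral_le_lintegral _ _
      _ = _ := hGI
  have hin : ∫⁻ x in Icc (-1 : ℝ) 1, f x ≤ 4 := by
    calc ∫⁻ x in Icc (-1 : ℝ) 1, f x ≤ ∫⁻ x in Icc (-1 : ℝ) 1, 2 := by
          refine setLIntegral_mono' measurableSet_Icc fun x hx => ?_
          rw [show (2 : ℝ≥0∞) = ENNReal.ofReal 2 by simp]
          refine ENNReal.ofReal_le_ofReal ?_
          have hb1 : bracket x ≤ 2 := by
            unfold bracket; linarith [abs_le.2 ⟨hx.1, hx.2⟩]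
          have h3 : bracket x ^ θ ≤ 2 := by
            calc bracket x ^ θ ≤ bracket x ^ (1 : ℝ) :=
                  Real.rpow_le_rpow_of_exponent_le (one_le_bracket x) h1
              _ = bracket x := Real.rpow_one _
              _ ≤ 2 := hb1
          have h4 : bracket (c + x ^ 2 / 2) ^ (-r) ≤ 1 := bracket_rpow_le_one (by linarith)
          have := bracket_rpow_pos x θ
          calc _ ≤ bracket x ^ θ * 1 := by gcongr
            _ ≤ 2 := by linarith
      _ = 4 := by
          rw [setLIntegral_const, Real.volume_Icc]; norm_num
  have hcover : (univ : Set ℝ) ⊆ (Ioi 1 ∪ Iio (-1)) ∪ Icc (-1) 1 := by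
    intro x _
    simp only [mem_union, mem_Ioi, mem_Iio, mem_Icc]
    by_contra! h
    linarith [h.2 (by linarith [h.1.2]), h.1.1]
  calc ∫⁻ x, f x = ∫⁻ x in univ, f x := by simp
    _ ≤ ∫⁻ x in (Ioi 1 ∪ Iio (-1)) ∪ Icc (-1) 1, f x := lintegral_mono_set hcover
    _ ≤ (∫⁻ x in Ioi 1, f x) + (∫⁻ x in Iio (-1), f x) + ∫⁻ x in Icc (-1) 1, f x :=
        (lintegral_union_le _ _ _).trans (by gcongr; exact lintegral_union_le _ _ _)
    _ ≤ _ := by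
        gcongr
        · refine hout _ measurableSet_Ioi (fun x hx => le_trans hx.le (le_abs_self x)) ?_
          intro x hx y hy hxy
          simp only [mem_Ioi] at hx hy
          have : (x - y) * (x + y) = 0 := by simp only at hxy; nlinarith
          rcases mul_eq_zero.1 this with h | h <;> linarith
        · refine hout _ measurableSet_Iio (fun x hx => ?_) ?_
          · simp only [mem_Iio] at hx
            rw [abs_of_neg (by linarith)]; linarith
          intro x hx y hy hxy
          simp only [mem_Iio] at hx hy
          have : (x - y) * (x + y) = 0 := by simp only at hxy; nlinarith
          rcases mul_eq_zero.1 this with h | h <;> linarith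

/-- The angular bracket `⟨2πy⟩`. -/
def jb (y : ℝ) : ℝ := bracket (2 * Real.pi * y)

theorem jb_pos (y : ℝ) : 0 < jb y := bracket_pos _
theorem one_le_jb (y : ℝ) : 1 ≤ jb y := one_le_bracket _
theorem jb_neg (y : ℝ) : jb (-y) = jb y := by simp [jb, bracket]
theorem jb_rpow_pos (y r : ℝ) : 0 < jb y ^ r := bracket_rpow_pos _ _

theorem jb_add_le_mul (x y : ℝ) : jb (x + y) ≤ jb x * jb y := by
  unfold jb; rw [mul_add]; exact bracket_add_le_mul _ _

@[fun_prop]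
theorem continuous_jb : Continuous jb := by unfold jb; fun_prop

@[fun_prop]
theorem measurable_jb : Measurable jb := continuous_jb.measurable

theorem one_le_two_pi : 1 ≤ 2 * Real.pi := by linarith [Real.pi_gt_three]

theorem lintegral_jb_lt_top {r : ℝ} (hr : 1 < r) :
    ∫⁻ x, ENNReal.ofReal (jb x ^ (-r)) < ⊤ :=
  (lintegral_comp_mul_left_le one_le_two_pi
    fun x => ENNReal.ofReal (bracket x ^ (-r))).trans_lt (lintegral_bracket_lt_top hr)

theorem exists_jb_conv_le {r₁ r₂ : ℝ} (h1 : 0 ≤ r₁) (h2 : 0 ≤ r₂) (h : 1 < r₁ ∨ 1 < r₂) :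
    ∃ C : ℝ≥0∞, C ≠ ⊤ ∧ ∀ c d : ℝ,
      ∫⁻ x, ENNReal.ofReal (jb (x + c) ^ (-r₁) * jb (d - x) ^ (-r₂)) ≤
        C * ENNReal.ofReal (jb (c + d) ^ (-(min r₁ r₂))) := by
  have key : ∀ s₁ s₂ : ℝ, 0 ≤ s₁ → s₁ ≤ s₂ → 1 < s₂ → ∃ C : ℝ≥0∞, C ≠ ⊤ ∧ ∀ c d : ℝ,
      ∫⁻ x, ENNReal.ofReal (jb (x + c) ^ (-s₁) * jb (d - x) ^ (-s₂)) ≤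
        C * ENNReal.ofReal (jb (c + d) ^ (-s₁)) := by
    intro s₁ s₂ hs1 hs12 hs2
    obtain ⟨C, hC, hb⟩ := exists_bracket_conv_le hs1 hs12 hs2
    refine ⟨C, hC, fun c d => ?_⟩
    have e := lintegral_add_right_eq_self (μ := (volume : Measure ℝ))
      (fun x => ENNReal.ofReal (jb x ^ (-s₁) * jb ((c + d) - x) ^ (-s₂))) c
    have e2 : ∀ x, (c + d) - (x + c) = d - x := fun x => by ring
    simp_rw [e2] at e
    rw [e]
    refine le_trans ?_ (hb (2 * Real.pi * (c + d)))
    refine le_trans (le_of_eq ?_) (lintegral_comp_mul_left_le one_le_two_pi _)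
    refine lintegral_congr fun x => ?_
    simp only [jb, mul_sub]
  rcases le_total r₁ r₂ with h12 | h12
  · rw [min_eq_left h12]
    exact key r₁ r₂ h1 h12 (by rcases h with h | h <;> linarith)
  · rw [min_eq_right h12]
    obtain ⟨C, hC, hb⟩ := key r₂ r₁ h2 h12 (by rcases h with h | h <;> linarith)
    refine ⟨C, hC, fun c d => ?_⟩
    refine le_trans (le_of_eq ?_) ((hb (-d) (-c)).trans (le_of_eq ?_))
    · refine lintegral_congr fun x => ?_
      rw [mul_comm, ← jb_neg (d - x), ← jb_neg (x + c)]
      ring_nf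
    · rw [← jb_neg]; ring_nf

theorem exists_jb_quadratic_le {θ r : ℝ} (h0 : 0 ≤ θ) (h1 : θ ≤ 1) (hr : (1 + θ) / 2 < r) :
    ∃ C : ℝ≥0∞, C ≠ ⊤ ∧ ∀ c : ℝ,
      ∫⁻ x, ENNReal.ofReal (jb x ^ θ * jb (c + Real.pi * x ^ 2) ^ (-r)) ≤ C := by
  obtain ⟨C, hC, hb⟩ := exists_bracket_quadratic_le h0 h1 hr
  refine ⟨C, hC, fun c => le_trans ?_ (hb (2 * Real.pi * c))⟩
  refine le_trans (le_of_eq ?_) (lintegral_comp_mul_left_le one_le_two_pi _)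
  refine lintegral_congr fun x => ?_
  simp only [jb]
  ring_nf

/-- The kernel bound with a Schrödinger frequency fixed. -/
theorem exists_kernel_schrodinger_le {θ r₁ r₂ : ℝ} (h0 : 0 ≤ θ) (h1 : θ ≤ 1)
    (hr1 : (1 + θ) / 2 < r₁) (hr2 : (1 + θ) / 2 < r₂) (h : 1 < r₁ ∨ 1 < r₂) :
    ∃ C : ℝ≥0∞, C ≠ ⊤ ∧ ∀ t : ℝ,
      ∫⁻ z : ℝ × ℝ, ENNReal.ofReal (jb z.1 ^ θ * (jb (z.2 + Real.pi * z.1 ^ 2) ^ (-r₁) *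
        jb (t - z.2) ^ (-r₂))) ≤ C := by
  obtain ⟨C₁, hC₁, hb₁⟩ := exists_jb_conv_le (by linarith) (by linarith) h
  obtain ⟨C₂, hC₂, hb₂⟩ := exists_jb_quadratic_le h0 h1 (lt_min hr1 hr2)
  refine ⟨C₁ * C₂, by finiteness, fun t => ?_⟩
  rw [Measure.volume_eq_prod, lintegral_prod _ (by fun_prop)]
  calc _ ≤ ∫⁻ x : ℝ, C₁ * ENNReal.ofReal
        (jb x ^ θ * jb (t + Real.pi * x ^ 2) ^ (-(min r₁ r₂))) := by
        refine lintegral_mono fun x => ?_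
        dsimp only
        simp_rw [ENNReal.ofReal_mul (jb_rpow_pos x θ).le]
        rw [lintegral_const_mul _ (by fun_prop)]
        have := hb₁ (Real.pi * x ^ 2) t
        rw [add_comm _ t] at this
        calc _ ≤ ENNReal.ofReal (jb x ^ θ) * (C₁ * _) := by gcongr
          _ = _ := by ring
    _ ≤ _ := by
        rw [lintegral_const_mul _ (by fun_prop)]
        gcongr
        exact hb₂ t

/-- The kernel bound with the difference frequency fixed. -/
theorem exists_kernel_difference_le {r : ℝ} (hr : 1 < r) :
    ∃ C : ℝ≥0∞, C ≠ ⊤ ∧ ∀ w : ℝ × ℝ,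
      ∫⁻ z : ℝ × ℝ, ENNReal.ofReal (|w.1| *
        (jb (z.2 + w.2 + Real.pi * (z.1 + w.1) ^ 2) ^ (-r) *
          jb (z.2 + Real.pi * z.1 ^ 2) ^ (-r))) ≤ C := by
  obtain ⟨C₁, hC₁, hb₁⟩ := exists_jb_conv_le (r₁ := r) (r₂ := r) (by linarith) (by linarith)
    (Or.inl hr)
  rw [min_self] at hb₁
  set I := ∫⁻ x, ENNReal.ofReal (jb x ^ (-r)) with hI
  refine ⟨C₁ * I, ENNReal.mul_ne_top hC₁ (lintegral_jb_lt_top hr).ne, fun w => ?_⟩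
  rcases eq_or_ne w.1 0 with hw | hw
  · simp [hw]
  rw [Measure.volume_eq_prod, lintegral_prod _ (by fun_prop)]
  -- After integration in the time frequency the squares of the space frequency cancel, and the
  -- kernel depends on it through an affine function of slope `2πw.1`. The factor `|w.1|` absorbs
  -- the Jacobian.
  have hlin : ENNReal.ofReal |w.1| * ∫⁻ x : ℝ, ENNReal.ofReal
      (jb (2 * Real.pi * |w.1| * x + (w.2 + Real.pi * w.1 ^ 2)) ^ (-r)) ≤ I := by
    have hpos : 0 < 2 * Real.pi * |w.1| := by have := abs_pos.2 hw; positivity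
    rw [lintegral_comp_mul_left hpos
      (fun x => ENNReal.ofReal (jb (x + (w.2 + Real.pi * w.1 ^ 2)) ^ (-r))),
      lintegral_add_right_eq_self (fun x => ENNReal.ofReal (jb x ^ (-r))), ← mul_assoc,
      ← ENNReal.ofReal_mul (abs_nonneg _)]
    refine mul_le_of_le_one_left' ?_
    rw [ENNReal.ofReal_le_one, mul_inv_le_iff₀ hpos, one_mul]
    nlinarith [one_le_two_pi, abs_pos.2 hw]
  have hsym : ∫⁻ x : ℝ, ENNReal.ofReal
      (jb (2 * Real.pi * w.1 * x + (w.2 + Real.pi * w.1 ^ 2)) ^ (-r)) =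
      ∫⁻ x : ℝ, ENNReal.ofReal
      (jb (2 * Real.pi * |w.1| * x + (w.2 + Real.pi * w.1 ^ 2)) ^ (-r)) := by
    rcases abs_choice w.1 with h | h
    · rw [h]
    · rw [h, ← lintegral_neg_eq_self (μ := (volume : Measure ℝ))]
      refine lintegral_congr fun x => ?_
      ring_nf
  calc _ ≤ ∫⁻ x : ℝ, C₁ * (ENNReal.ofReal |w.1| * ENNReal.ofReal
        (jb (2 * Real.pi * w.1 * x + (w.2 + Real.pi * w.1 ^ 2)) ^ (-r))) := by
        refine lintegral_mono fun x => ?_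
        dsimp only
        simp_rw [ENNReal.ofReal_mul (abs_nonneg w.1)]
        rw [lintegral_const_mul _ (by fun_prop)]
        have h1 := hb₁ (w.2 + Real.pi * (x + w.1) ^ 2) (-(Real.pi * x ^ 2))
        have e : ∀ y, jb (-(Real.pi * x ^ 2) - y) = jb (y + Real.pi * x ^ 2) := fun y => by
          rw [← jb_neg]; ring_nf
        simp_rw [e, ← add_assoc] at h1
        calc _ ≤ ENNReal.ofReal |w.1| * (C₁ * _) := by gcongr
          _ = _ := by
            rw [show w.2 + Real.pi * (x + w.1) ^ 2 + -(Real.pi * x ^ 2) =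
              2 * Real.pi * w.1 * x + (w.2 + Real.pi * w.1 ^ 2) by ring]
            ring
    _ ≤ _ := by
        rw [lintegral_const_mul _ (by fun_prop), lintegral_const_mul _ (by fun_prop)]
        gcongr
        rw [hsym]
        exact hlin

/-! ### Pointwise bounds on the interaction weights -/

/-- The quadratic expression is a signed sum of the three modulations, so three times the largest
bracket dominates it. Where a Schrödinger modulation is largest, the comparison with `bracket l` is
recorded as well, because `pointwise_debye` transfers decay from that modulation to `l`. -/
theorem resonance_dominant {x₁ x₂ s₁ s₂ l : ℝ} (hres : s₁ - s₂ - l = (x₁ ^ 2 - x₂ ^ 2) / 2) :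
    (bracket s₂ ≤ bracket s₁ ∧ bracket l ≤ bracket s₁ ∧
      |(x₁ ^ 2 - x₂ ^ 2) / 2| ≤ 3 * bracket s₁) ∨
    (bracket s₁ ≤ bracket s₂ ∧ bracket l ≤ bracket s₂ ∧
      |(x₁ ^ 2 - x₂ ^ 2) / 2| ≤ 3 * bracket s₂) ∨
    |(x₁ ^ 2 - x₂ ^ 2) / 2| ≤ 3 * bracket l := by
  have h1 : |s₁ - s₂ - l| ≤ |s₁| + |s₂| + |l| :=
    (abs_sub _ _).trans (by linarith [abs_sub s₁ s₂])
  rw [← hres]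
  unfold bracket
  rcases le_total |s₁| |s₂| with h12 | h12 <;> rcases le_total |s₁| |l| with h13 | h13 <;>
    rcases le_total |s₂| |l| with h23 | h23
  all_goals first
    | (right; right; linarith)
    | (right; left; refine ⟨?_, ?_, ?_⟩ <;> linarith)
    | (left; refine ⟨?_, ?_, ?_⟩ <;> linarith)

theorem bracket_rpow_neg_sub {s p q : ℝ} :
    bracket s ^ (-(p - q)) = bracket s ^ q * bracket s ^ (-p) := by
  rw [← Real.rpow_add (bracket_pos s)]; ring_nf

/-- If `x₁ - x₂` is not much larger than `x₂`, the first term suffices. Otherwise the resonance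
function is of the order of `bracket (x₁ - x₂) ^ 2`, so the dominant modulation absorbs `bracket (x₁
- x₂)` at the price of half a power. For `s₁` this is affordable because `2a ≥ 1/2`. -/
theorem pointwise_schrodinger {a b x₁ x₂ s₁ s₂ l : ℝ} (ha : 1 / 4 ≤ a)
    (hres : s₁ - s₂ - l = (x₁ ^ 2 - x₂ ^ 2) / 2) :
    bracket (x₁ - x₂) * (bracket s₁ ^ (-(2 * a)) *
        (bracket s₂ ^ (-(2 * b)) * bracket l ^ (-(2 * b)))) ≤
      7 * (bracket x₂ ^ (1 : ℝ) * (bracket s₂ ^ (-(2 * b)) * bracket l ^ (-(2 * b))) +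
        bracket s₂ ^ (-(2 * b - 1 / 2)) * bracket l ^ (-(2 * b)) +
        bracket s₂ ^ (-(2 * b)) * bracket l ^ (-(2 * b - 1 / 2))) := by
  have p1 := bracket_rpow_pos s₁ (-(2 * a))
  have p2 := bracket_rpow_pos s₂ (-(2 * b))
  have p3 := bracket_rpow_pos l (-(2 * b))
  have p4 := bracket_rpow_pos s₂ (-(2 * b - 1 / 2))
  have p5 := bracket_rpow_pos l (-(2 * b - 1 / 2))
  have px := one_le_bracket x₂
  have py := bracket_pos (x₁ - x₂)
  have le1 : bracket s₁ ^ (-(2 * a)) ≤ 1 := bracket_rpow_le_one (by linarith)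
  rw [Real.rpow_one]
  have pA : 0 < bracket s₂ ^ (-(2 * b)) * bracket l ^ (-(2 * b)) := mul_pos p2 p3
  have pB := mul_pos p4 p3
  have pC := mul_pos p2 p5
  by_cases hc : bracket (x₁ - x₂) ≤ 4 * bracket x₂
  · calc _ ≤ (4 * bracket x₂) * (1 * (bracket s₂ ^ (-(2 * b)) * bracket l ^ (-(2 * b)))) := by
          gcongr
      _ ≤ _ := by nlinarith [mul_pos (zero_lt_one.trans_le px) pA]
  push Not at hc
  set y := x₁ - x₂ with hy
  have hH : bracket y ^ 2 ≤ 16 * |(x₁ ^ 2 - x₂ ^ 2) / 2| := by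
    have e : (x₁ ^ 2 - x₂ ^ 2) / 2 = y * (y + 2 * x₂) / 2 := by rw [hy]; ring
    rw [e, abs_div, abs_mul, abs_of_pos (two_pos : (0 : ℝ) < 2)]
    unfold bracket at hc ⊢
    have h1 : |y| - 2 * |x₂| ≤ |y + 2 * x₂| := by
      have := abs_sub_abs_le_abs_sub y (-(2 * x₂))
      rw [abs_neg, abs_mul, abs_of_pos (two_pos : (0 : ℝ) < 2), sub_neg_eq_add] at this
      exact this
    have h2 : |y| / 2 ≤ |y + 2 * x₂| := by linarith
    have h3 : 3 ≤ |y| := by linarith [abs_nonneg x₂]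
    nlinarith [mul_le_mul_of_nonneg_left h2 (abs_nonneg y)]
  -- The constant comes from `16 * 3 = 48 ≤ 7 ^ 2`.
  have key : ∀ s : ℝ, |(x₁ ^ 2 - x₂ ^ 2) / 2| ≤ 3 * bracket s →
      bracket y ≤ 7 * bracket s ^ (1 / 2 : ℝ) := by
    intro s hs
    have ps := bracket_rpow_pos s (1 / 2)
    have e : (bracket s ^ (1 / 2 : ℝ)) ^ 2 = bracket s := by
      rw [← Real.rpow_natCast, ← Real.rpow_mul (bracket_pos s).le]; norm_num
    refine (pow_le_pow_iff_left₀ (bracket_pos y).le (by positivity) two_ne_zero).1 ?_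
    rw [mul_pow, e]; nlinarith [bracket_pos s]
  rcases resonance_dominant hres with ⟨_, _, h⟩ | ⟨_, _, h⟩ | h
  · have h1 := key _ h
    have h2 : bracket s₁ ^ (1 / 2 : ℝ) * bracket s₁ ^ (-(2 * a)) ≤ 1 := by
      rw [← Real.rpow_add (bracket_pos _)]
      exact bracket_rpow_le_one (by linarith)
    calc _ ≤ (7 * bracket s₁ ^ (1 / 2 : ℝ)) * (bracket s₁ ^ (-(2 * a)) *
          (bracket s₂ ^ (-(2 * b)) * bracket l ^ (-(2 * b)))) := by gcongr
      _ = 7 * (bracket s₁ ^ (1 / 2 : ℝ) * bracket s₁ ^ (-(2 * a))) *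
          (bracket s₂ ^ (-(2 * b)) * bracket l ^ (-(2 * b))) := by ring
      _ ≤ 7 * 1 * (bracket s₂ ^ (-(2 * b)) * bracket l ^ (-(2 * b))) := by gcongr
      _ ≤ _ := by nlinarith
  · have h1 := key _ h
    have h0 := bracket_rpow_pos s₂ (1 / 2)
    calc _ ≤ (7 * bracket s₂ ^ (1 / 2 : ℝ)) * (1 *
          (bracket s₂ ^ (-(2 * b)) * bracket l ^ (-(2 * b)))) := by gcongr
      _ = 7 * (bracket s₂ ^ (-(2 * b - 1 / 2)) * bracket l ^ (-(2 * b))) := by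
          rw [bracket_rpow_neg_sub]; ring
      _ ≤ _ := by nlinarith
  · have h1 := key _ h
    have h0 := bracket_rpow_pos l (1 / 2)
    calc _ ≤ (7 * bracket l ^ (1 / 2 : ℝ)) * (1 *
          (bracket s₂ ^ (-(2 * b)) * bracket l ^ (-(2 * b)))) := by gcongr
      _ = 7 * (bracket s₂ ^ (-(2 * b)) * bracket l ^ (-(2 * b - 1 / 2))) := by
          rw [bracket_rpow_neg_sub]; ring
      _ ≤ _ := by nlinarith

/-- There are three regimes. If `|x₁ - x₂| < 1`, the two frequencies are comparable. If both are
bounded by a multiple of `bracket (x₁ - x₂)`, all weights collapse to the first power of `|x₁ -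
x₂|`. Otherwise both are of a common size `m`, the resonance function is at least of the order of
`bracket (x₁ - x₂) * m`, and the dominant modulation pays. Each of the four terms on the right has
an integrable kernel once a suitable frequency is frozen. -/
theorem pointwise_debye {a b γ x₁ x₂ s₁ s₂ l : ℝ} (hγ0 : 0 < γ) (hγ1 : γ < 1) (hb : 1 / 2 < b)
    (ha1 : 1 - γ ≤ 2 * a) (ha2 : 2 * a ≤ 1)
    (hres : s₁ - s₂ - l = (x₁ ^ 2 - x₂ ^ 2) / 2) :
    bracket (x₁ - x₂) ^ γ * (bracket x₁ * bracket x₂) ^ ((1 - γ) / 2) * (bracket s₁ ^ (-(2 * b)) *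
        (bracket s₂ ^ (-(2 * b)) * bracket l ^ (-(2 * a)))) ≤
      24 * (|x₁ - x₂| * (bracket s₁ ^ (-(2 * b)) * bracket s₂ ^ (-(2 * b))) +
        bracket x₂ ^ (1 - γ) * (bracket s₂ ^ (-(2 * b)) * bracket l ^ (-(2 * a))) +
        bracket x₂ ^ (1 : ℝ) * (bracket s₂ ^ (-(2 * b)) * bracket l ^ (-(2 * a + 2 * b - γ))) +
        bracket x₁ ^ (1 : ℝ) *
          (bracket s₁ ^ (-(2 * b)) * bracket l ^ (-(2 * a + 2 * b - γ)))) := by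
  have p1 := bracket_rpow_pos s₁ (-(2 * b))
  have p2 := bracket_rpow_pos s₂ (-(2 * b))
  have p3 := bracket_rpow_pos l (-(2 * a))
  have p4 := bracket_rpow_pos l (-(2 * a + 2 * b - γ))
  have X1 := bracket_pos x₁
  have X2 := bracket_pos x₂
  have Y := bracket_pos (x₁ - x₂)
  have Y1 := one_le_bracket (x₁ - x₂)
  have le1 : bracket s₁ ^ (-(2 * b)) ≤ 1 := bracket_rpow_le_one (by linarith)
  have le2 : bracket s₂ ^ (-(2 * b)) ≤ 1 := bracket_rpow_le_one (by linarith)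
  have le3 : bracket l ^ (-(2 * a)) ≤ 1 := bracket_rpow_le_one (by linarith)
  simp only [Real.rpow_one]
  set y := x₁ - x₂ with hy
  have q1 : 0 ≤ |y| * (bracket s₁ ^ (-(2 * b)) * bracket s₂ ^ (-(2 * b))) := by positivity
  have q2 : 0 ≤ bracket x₂ ^ (1 - γ) * (bracket s₂ ^ (-(2 * b)) * bracket l ^ (-(2 * a))) := by
    positivity
  have q3 : 0 ≤ bracket x₂ * (bracket s₂ ^ (-(2 * b)) * bracket l ^ (-(2 * a + 2 * b - γ))) := by
    positivity
  have q4 : 0 ≤ bracket x₁ * (bracket s₁ ^ (-(2 * b)) * bracket l ^ (-(2 * a + 2 * b - γ))) := by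
    positivity
  have hx12 : bracket x₁ ≤ bracket x₂ + |y| := by
    unfold bracket; linarith [abs_sub_abs_le_abs_sub x₁ x₂]
  have hx21 : bracket x₂ ≤ bracket x₁ + |y| := by
    unfold bracket
    have := abs_sub_abs_le_abs_sub x₂ x₁
    rw [abs_sub_comm] at this; linarith
  have hYγ : bracket y ^ γ ≤ bracket y := by
    simpa using Real.rpow_le_rpow_of_exponent_le Y1 hγ1.le
  have hYp : bracket y ^ γ * bracket y ^ (1 - γ) = bracket y := by
    rw [← Real.rpow_add Y]; simp
  by_cases hy1 : |y| < 1
  · have hY2 : bracket y ≤ 2 := by unfold bracket; linarith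
    have h1 : bracket x₁ * bracket x₂ ≤ (2 * bracket x₂) ^ 2 := by
      nlinarith [one_le_bracket x₂]
    have h2 : (bracket x₁ * bracket x₂) ^ ((1 - γ) / 2) ≤ 2 * bracket x₂ ^ (1 - γ) := by
      calc _ ≤ ((2 * bracket x₂) ^ 2) ^ ((1 - γ) / 2) := by gcongr
        _ = (2 * bracket x₂) ^ (1 - γ) := by
            rw [← Real.rpow_natCast, ← Real.rpow_mul (by positivity)]; congr 1; push_cast; ring
        _ = 2 ^ (1 - γ) * bracket x₂ ^ (1 - γ) := Real.mul_rpow (by norm_num) X2.le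
        _ ≤ 2 ^ (1 : ℝ) * bracket x₂ ^ (1 - γ) := by gcongr <;> linarith
        _ = _ := by norm_num
    calc _ ≤ 2 * (2 * bracket x₂ ^ (1 - γ)) * (1 *
          (bracket s₂ ^ (-(2 * b)) * bracket l ^ (-(2 * a)))) := by
          gcongr; linarith
      _ ≤ _ := by linarith
  push Not at hy1
  have hY2y : bracket y ≤ 2 * |y| := by unfold bracket; linarith
  by_cases hm : bracket x₁ ≤ 4 * bracket y ∧ bracket x₂ ≤ 4 * bracket y
  · have h2 : (bracket x₁ * bracket x₂) ^ ((1 - γ) / 2) ≤ 4 * bracket y ^ (1 - γ) := by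
      calc _ ≤ ((4 * bracket y) ^ 2) ^ ((1 - γ) / 2) := by
            gcongr; rw [sq]; exact mul_le_mul hm.1 hm.2 X2.le (by positivity)
        _ = (4 * bracket y) ^ (1 - γ) := by
            rw [← Real.rpow_natCast, ← Real.rpow_mul (by positivity)]; congr 1; push_cast; ring
        _ = 4 ^ (1 - γ) * bracket y ^ (1 - γ) := Real.mul_rpow (by norm_num) Y.le
        _ ≤ 4 ^ (1 : ℝ) * bracket y ^ (1 - γ) := by gcongr <;> linarith
        _ = _ := by norm_num
    calc _ ≤ bracket y ^ γ * (4 * bracket y ^ (1 - γ)) * (bracket s₁ ^ (-(2 * b)) *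
          (bracket s₂ ^ (-(2 * b)) * 1)) := by gcongr
      _ = 4 * (bracket y ^ γ * bracket y ^ (1 - γ)) * (bracket s₁ ^ (-(2 * b)) *
          bracket s₂ ^ (-(2 * b))) := by ring
      _ ≤ 4 * (2 * |y|) * (bracket s₁ ^ (-(2 * b)) * bracket s₂ ^ (-(2 * b))) := by
          rw [hYp]; gcongr
      _ ≤ _ := by linarith
  -- The frequencies differ by `|y|`, so when one of them exceeds `4 * bracket y` they are
  -- comparable. Here `m` is the larger bracket, and the sum `x₁ + x₂` is twice the corresponding
  -- frequency up to `y`.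
  obtain ⟨m, hm1, hm2, hm1', hm2', hmH⟩ : ∃ m : ℝ, bracket x₁ ≤ m ∧ bracket x₂ ≤ m ∧
      m ≤ 2 * bracket x₁ ∧ m ≤ 2 * bracket x₂ ∧ m ≤ |x₁ + x₂| := by
    rw [not_and_or, not_le, not_le] at hm
    have hb0 : bracket y = 1 + |y| := rfl
    rcases le_total (bracket x₁) (bracket x₂) with h | h
    · have h4 : 4 * bracket y < bracket x₂ := by rcases hm with h' | h' <;> linarith
      refine ⟨bracket x₂, h, le_rfl, by linarith, by linarith, ?_⟩
      have e : x₁ + x₂ = 2 * x₂ - (-y) := by rw [hy]; ring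
      have := abs_sub_abs_le_abs_sub (2 * x₂) (-y)
      rw [← e, abs_neg, abs_mul, abs_of_pos (two_pos : (0 : ℝ) < 2)] at this
      have hb2 : bracket x₂ = 1 + |x₂| := rfl
      linarith
    · have h4 : 4 * bracket y < bracket x₁ := by rcases hm with h' | h' <;> linarith
      refine ⟨bracket x₁, le_rfl, h, by linarith, by linarith, ?_⟩
      have e : x₁ + x₂ = 2 * x₁ - y := by rw [hy]; ring
      have := abs_sub_abs_le_abs_sub (2 * x₁) y
      rw [← e, abs_mul, abs_of_pos (two_pos : (0 : ℝ) < 2)] at this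
      have hb2 : bracket x₁ = 1 + |x₁| := rfl
      linarith
  have hm0 : 1 ≤ m := (one_le_bracket x₁).trans hm1
  have mpos : 0 < m := by linarith
  have hH : bracket y * m ≤ 4 * |(x₁ ^ 2 - x₂ ^ 2) / 2| := by
    have e : (x₁ ^ 2 - x₂ ^ 2) / 2 = y * (x₁ + x₂) / 2 := by rw [hy]; ring
    rw [e, abs_div, abs_mul, abs_of_pos (two_pos : (0 : ℝ) < 2)]
    have : bracket y * m ≤ (2 * |y|) * |x₁ + x₂| := by gcongr
    linarith
  have hX : (bracket x₁ * bracket x₂) ^ ((1 - γ) / 2) ≤ m ^ (1 - γ) := by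
    calc _ ≤ (m ^ 2) ^ ((1 - γ) / 2) := by
          gcongr; rw [sq]; exact mul_le_mul hm1 hm2 X2.le (by positivity)
      _ = m ^ (1 - γ) := by
          rw [← Real.rpow_natCast, ← Real.rpow_mul (by positivity)]; congr 1; push_cast; ring
  have hYm : 0 < bracket y * m := by positivity
  -- The product `bracket y * m` is raised to the power `γ` and charged to the dominant modulation.
  -- What is left, `m ^ (1 - 2γ)`, is at most `m`. The constant `12` is `4 * 3`.
  have hpow : ∀ s : ℝ, |(x₁ ^ 2 - x₂ ^ 2) / 2| ≤ 3 * bracket s →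
      bracket y ^ γ * m ^ (1 - γ) ≤ 12 * bracket s ^ γ * m := by
    intro s hs
    have h1 : (bracket y * m) ^ γ ≤ 12 * bracket s ^ γ := by
      calc (bracket y * m) ^ γ ≤ (12 * bracket s) ^ γ :=
            Real.rpow_le_rpow hYm.le (by linarith) hγ0.le
        _ = 12 ^ γ * bracket s ^ γ := Real.mul_rpow (by norm_num) (bracket_pos s).le
        _ ≤ 12 ^ (1 : ℝ) * bracket s ^ γ := by
            have := bracket_rpow_pos s γ
            gcongr; norm_num
        _ = _ := by norm_num
    have h2 : m ^ (1 - 2 * γ) ≤ m := by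
      simpa using Real.rpow_le_rpow_of_exponent_le hm0 (show 1 - 2 * γ ≤ 1 by linarith)
    calc bracket y ^ γ * m ^ (1 - γ) = (bracket y * m) ^ γ * m ^ (1 - 2 * γ) := by
          rw [Real.mul_rpow Y.le mpos.le, mul_assoc, ← Real.rpow_add mpos]; ring_nf
      _ ≤ _ := by
          have := bracket_rpow_pos s γ
          gcongr
  -- Since `γ < 2b`, the dominant modulation keeps a negative power after paying, and this power may
  -- be moved to `l`.
  have hmod : ∀ s : ℝ, bracket l ≤ bracket s →
      bracket s ^ γ * bracket s ^ (-(2 * b)) * bracket l ^ (-(2 * a)) ≤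
        bracket l ^ (-(2 * a + 2 * b - γ)) := by
    intro s hs
    rw [← Real.rpow_add (bracket_pos s)]
    have h1 : bracket s ^ (γ + -(2 * b)) ≤ bracket l ^ (γ + -(2 * b)) :=
      Real.rpow_le_rpow_of_nonpos (bracket_pos l) hs (by linarith)
    calc _ ≤ bracket l ^ (γ + -(2 * b)) * bracket l ^ (-(2 * a)) := by gcongr
      _ = _ := by rw [← Real.rpow_add (bracket_pos l)]; ring_nf
  have hstart : bracket y ^ γ * (bracket x₁ * bracket x₂) ^ ((1 - γ) / 2) ≤
      bracket y ^ γ * m ^ (1 - γ) := by gcongr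
  have r1 := bracket_rpow_pos s₁ γ
  have r2 := bracket_rpow_pos s₂ γ
  rcases resonance_dominant hres with ⟨_, hl, h⟩ | ⟨_, hl, h⟩ | h
  · calc _ ≤ (12 * bracket s₁ ^ γ * m) * (bracket s₁ ^ (-(2 * b)) *
          (bracket s₂ ^ (-(2 * b)) * bracket l ^ (-(2 * a)))) := by
          exact mul_le_mul_of_nonneg_right (hstart.trans (hpow _ h)) (by positivity)
      _ = 12 * m * bracket s₂ ^ (-(2 * b)) *
          (bracket s₁ ^ γ * bracket s₁ ^ (-(2 * b)) * bracket l ^ (-(2 * a))) := by ring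
      _ ≤ 12 * (2 * bracket x₂) * bracket s₂ ^ (-(2 * b)) *
          bracket l ^ (-(2 * a + 2 * b - γ)) := by
          gcongr; exact hmod _ hl
      _ ≤ _ := by linarith
  · calc _ ≤ (12 * bracket s₂ ^ γ * m) * (bracket s₁ ^ (-(2 * b)) *
          (bracket s₂ ^ (-(2 * b)) * bracket l ^ (-(2 * a)))) := by
          exact mul_le_mul_of_nonneg_right (hstart.trans (hpow _ h)) (by positivity)
      _ = 12 * m * bracket s₁ ^ (-(2 * b)) *
          (bracket s₂ ^ γ * bracket s₂ ^ (-(2 * b)) * bracket l ^ (-(2 * a))) := by ring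
      _ ≤ 12 * (2 * bracket x₁) * bracket s₁ ^ (-(2 * b)) *
          bracket l ^ (-(2 * a + 2 * b - γ)) := by
          gcongr; exact hmod _ hl
      _ ≤ _ := by linarith
  · have h1 : bracket l ^ (-(2 * a)) ≤ 12 * (bracket y * m) ^ (-(2 * a)) := by
      refine (rpow_neg_le_of_le_mul hYm (c := 12) (by norm_num) (bracket_pos l) (by linarith)
        (by linarith)).trans ?_
      gcongr
      calc (12 : ℝ) ^ (2 * a) ≤ 12 ^ (1 : ℝ) :=
            Real.rpow_le_rpow_of_exponent_le (by norm_num) ha2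
        _ = 12 := by norm_num
    -- The condition `1 - γ ≤ 2a` makes the total exponent of `m` nonpositive. A dominant time
    -- frequency then leaves one factor `|y|`, which the kernel with frozen difference tolerates.
    have h2 : bracket y ^ γ * m ^ (1 - γ) * (bracket y * m) ^ (-(2 * a)) ≤ 2 * |y| := by
      have e : bracket y ^ γ * m ^ (1 - γ) * (bracket y * m) ^ (-(2 * a)) =
          bracket y ^ γ * bracket y ^ (-(2 * a)) * m ^ (1 - γ - 2 * a) := by
        rw [Real.mul_rpow Y.le mpos.le, sub_eq_add_neg (1 - γ), Real.rpow_add mpos]; ring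
      have h3 : bracket y ^ (-(2 * a)) ≤ 1 := bracket_rpow_le_one (by linarith)
      have h4 : m ^ (1 - γ - 2 * a) ≤ 1 :=
        Real.rpow_le_one_of_one_le_of_nonpos hm0 (by linarith)
      rw [e]
      calc _ ≤ bracket y * 1 * 1 := by gcongr
        _ ≤ _ := by linarith
    calc _ ≤ (bracket y ^ γ * m ^ (1 - γ)) * (bracket s₁ ^ (-(2 * b)) *
          (bracket s₂ ^ (-(2 * b)) * (12 * (bracket y * m) ^ (-(2 * a))))) := by
          gcongr
      _ = 12 * (bracket y ^ γ * m ^ (1 - γ) * (bracket y * m) ^ (-(2 * a))) *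
          (bracket s₁ ^ (-(2 * b)) * bracket s₂ ^ (-(2 * b))) := by ring
      _ ≤ 12 * (2 * |y|) * (bracket s₁ ^ (-(2 * b)) * bracket s₂ ^ (-(2 * b))) := by gcongr
      _ ≤ _ := by linarith

/-! ### Trilinear forms -/

/-- The trilinear form with kernel `√m` is bounded on `L² × L² × L²`. -/
def TriBounded (m : ℝ × ℝ → ℝ × ℝ → ℝ≥0∞) : Prop :=
  ∃ C : ℝ≥0∞, C ≠ ⊤ ∧ ∀ φ f g : ℝ × ℝ → ℝ≥0∞, Measurable φ → Measurable f → Measurable g →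
    ∫⁻ z, ∫⁻ w, m z w ^ (1 / 2 : ℝ) * (φ z * (f w * g (z - w))) ≤ C * (l2 φ * l2 f * l2 g)

theorem ennreal_sqrt_sq (x : ℝ≥0∞) : (x ^ (1 / 2 : ℝ)) ^ 2 = x := by
  rw [← ENNReal.rpow_natCast, ← ENNReal.rpow_mul]; norm_num

theorem l2_comp_neg (f : ℝ × ℝ → ℝ≥0∞) : l2 (fun z => f (-z)) = l2 f := by
  unfold l2
  rw [lintegral_neg_eq_self (fun z => f z ^ 2)]

theorem l2_mul_shift {f g : ℝ × ℝ → ℝ≥0∞} (hf : Measurable f) (hg : Measurable g) :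
    l2 (fun z => l2 fun w => f w * g (z - w)) = l2 f * l2 g := by
  have h : ∫⁻ z, ∫⁻ w, (f w * g (z - w)) ^ 2 = (∫⁻ w, f w ^ 2) * ∫⁻ z, g z ^ 2 := by
    rw [lintegral_lintegral_swap (by fun_prop)]
    simp_rw [mul_pow]
    calc ∫⁻ w, ∫⁻ z, f w ^ 2 * g (z - w) ^ 2 = ∫⁻ w, f w ^ 2 * ∫⁻ z, g z ^ 2 := by
          refine lintegral_congr fun w => ?_
          rw [lintegral_const_mul _ (by fun_prop), lintegral_sub_right_eq_self (fun z => g z ^ 2)]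
      _ = _ := lintegral_mul_const _ (by fun_prop)
  have h2 : ∫⁻ z, (l2 fun w => f w * g (z - w)) ^ 2 = (∫⁻ w, f w ^ 2) * ∫⁻ z, g z ^ 2 := by
    rw [← h]; simp_rw [l2_sq]
  unfold l2 at h2 ⊢
  rw [h2, ENNReal.mul_rpow_of_nonneg _ _ (by norm_num)]

/-- Cauchy–Schwarz in `w` separates `√m` from `f w * g (z - w)`, and a second one in `z` separates
`φ`. The remaining double `L²` norm factors by translation invariance. -/
theorem TriBounded.of_left {m : ℝ × ℝ → ℝ × ℝ → ℝ≥0∞} (hm : Measurable (Function.uncurry m))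
    {C : ℝ≥0∞} (hC : C ≠ ⊤) (h : ∀ z, ∫⁻ w, m z w ≤ C) : TriBounded m := by
  refine ⟨C ^ (1 / 2 : ℝ), ENNReal.rpow_ne_top_of_nonneg (by norm_num) hC, ?_⟩
  intro φ f g hφ hf hg
  have hmz : ∀ z, Measurable (m z) := fun z => hm.comp (measurable_const.prodMk measurable_id)
  calc ∫⁻ z, ∫⁻ w, m z w ^ (1 / 2 : ℝ) * (φ z * (f w * g (z - w)))
      ≤ ∫⁻ z, φ z * (C ^ (1 / 2 : ℝ) * l2 fun w => f w * g (z - w)) := by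
        refine lintegral_mono fun z => ?_
        calc ∫⁻ w, m z w ^ (1 / 2 : ℝ) * (φ z * (f w * g (z - w)))
            = φ z * ∫⁻ w, m z w ^ (1 / 2 : ℝ) * (f w * g (z - w)) := by
              rw [← lintegral_const_mul (μ := volume) (φ z)
                (f := fun w => m z w ^ (1 / 2 : ℝ) * (f w * g (z - w)))
                (((hmz z).pow_const _).mul (by fun_prop))]
              refine lintegral_congr fun w => by ring
          _ ≤ _ := by
              gcongr
              refine (lintegral_mul_le_l2 ((hmz z).pow_const _) (by fun_prop)).trans ?_
              gcongr
              rw [l2_le_iff]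
              simp_rw [ennreal_sqrt_sq]
              exact h z
    _ ≤ l2 φ * l2 (fun z => C ^ (1 / 2 : ℝ) * l2 fun w => f w * g (z - w)) :=
        lintegral_mul_le_l2 hφ ((measurable_l2_right (by fun_prop)).const_mul _)
    _ = _ := by
        rw [l2_const_mul (ENNReal.rpow_ne_top_of_nonneg (by norm_num) hC), l2_mul_shift hf hg]
        ring

/-- The form is symmetric under exchanging `φ` and `f` when `g` is reflected, so freezing `w`
reduces to freezing `z`. -/
theorem TriBounded.of_right {m : ℝ × ℝ → ℝ × ℝ → ℝ≥0∞} (hm : Measurable (Function.uncurry m))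
    {C : ℝ≥0∞} (hC : C ≠ ⊤) (h : ∀ w, ∫⁻ z, m z w ≤ C) : TriBounded m := by
  obtain ⟨D, hD, hb⟩ := TriBounded.of_left (m := fun w z => m z w) (hm.comp measurable_swap) hC h
  refine ⟨D, hD, fun φ f g hφ hf hg => ?_⟩
  have hm' : Measurable fun p : (ℝ × ℝ) × (ℝ × ℝ) => m p.1 p.2 := hm
  rw [lintegral_lintegral_swap
    (((hm'.pow_const _).mul (by fun_prop : Measurable fun p : (ℝ × ℝ) × (ℝ × ℝ) =>
      φ p.1 * (f p.2 * g (p.1 - p.2)))).aemeasurable)]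
  refine le_trans (le_of_eq ?_)
    ((hb f φ (fun z => g (-z)) hf hφ (by fun_prop)).trans (le_of_eq ?_))
  · refine lintegral_congr fun w => lintegral_congr fun z => ?_
    rw [neg_sub]; ring
  · rw [l2_comp_neg]; ring

/-- With `u = z - w` as outer variable, `g` takes the place of `φ`. The reflections bring the form
into the convolution shape required by `TriBounded.of_left`. -/
theorem TriBounded.of_difference {m : ℝ × ℝ → ℝ × ℝ → ℝ≥0∞}
    (hm : Measurable (Function.uncurry m))
    {C : ℝ≥0∞} (hC : C ≠ ⊤) (h : ∀ u, ∫⁻ w, m (w + u) w ≤ C) : TriBounded m := by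
  have hm' : Measurable fun p : (ℝ × ℝ) × (ℝ × ℝ) => m p.1 p.2 := hm
  have hm2 : Measurable fun p : (ℝ × ℝ) × (ℝ × ℝ) => m (-p.2 + p.1) (-p.2) :=
    hm'.comp (by fun_prop : Measurable fun p : (ℝ × ℝ) × (ℝ × ℝ) => (-p.2 + p.1, -p.2))
  have hm3 : Measurable fun p : (ℝ × ℝ) × (ℝ × ℝ) => m (p.1 + p.2) p.1 :=
    hm'.comp (by fun_prop : Measurable fun p : (ℝ × ℝ) × (ℝ × ℝ) => (p.1 + p.2, p.1))
  obtain ⟨D, hD, hb⟩ := TriBounded.of_left (m := fun u w => m (-w + u) (-w)) hm2 hC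
    (fun u => by rw [lintegral_neg_eq_self (fun w => m (w + u) w)]; exact h u)
  refine ⟨D, hD, fun φ f g hφ hf hg => ?_⟩
  rw [lintegral_lintegral_swap
    (((hm'.pow_const _).mul (by fun_prop : Measurable fun p : (ℝ × ℝ) × (ℝ × ℝ) =>
      φ p.1 * (f p.2 * g (p.1 - p.2)))).aemeasurable)]
  calc ∫⁻ w, ∫⁻ z, m z w ^ (1 / 2 : ℝ) * (φ z * (f w * g (z - w)))
      = ∫⁻ w, ∫⁻ u, m (w + u) w ^ (1 / 2 : ℝ) * (φ (w + u) * (f w * g u)) := by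
        refine lintegral_congr fun w => ?_
        rw [← lintegral_add_left_eq_self _ w]
        simp
    _ = ∫⁻ u, ∫⁻ w, m (w + u) w ^ (1 / 2 : ℝ) * (φ (w + u) * (f w * g u)) :=
        lintegral_lintegral_swap (((hm3.pow_const _).mul
          (by fun_prop : Measurable fun p : (ℝ × ℝ) × (ℝ × ℝ) =>
            φ (p.1 + p.2) * (f p.1 * g p.2))).aemeasurable)
    _ = ∫⁻ u, ∫⁻ w, m (-w + u) (-w) ^ (1 / 2 : ℝ) * (g u * (f (-w) * φ (u - w))) := by
        refine lintegral_congr fun u => ?_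
        rw [← lintegral_neg_eq_self (fun w => m (w + u) w ^ (1 / 2 : ℝ) *
          (φ (w + u) * (f w * g u)))]
        refine lintegral_congr fun w => ?_
        rw [show -w + u = u - w by abel]; ring
    _ ≤ D * (l2 g * l2 (fun w => f (-w)) * l2 φ) := hb g _ φ hg (by fun_prop) hφ
    _ = _ := by rw [l2_comp_neg]; ring

/-- Subadditivity of the square root. It allows each term of a pointwise bound to be treated with
its own frozen frequency. -/
theorem TriBounded.add {m n : ℝ × ℝ → ℝ × ℝ → ℝ≥0∞} (hmm : Measurable (Function.uncurry m))
    (hm : TriBounded m) (hn : TriBounded n) : TriBounded fun z w => m z w + n z w := by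
  obtain ⟨C, hC, hb⟩ := hm
  obtain ⟨D, hD, hb'⟩ := hn
  have hm' : Measurable fun p : (ℝ × ℝ) × (ℝ × ℝ) => m p.1 p.2 := hmm
  refine ⟨C + D, by finiteness, fun φ f g hφ hf hg => ?_⟩
  have hM : Measurable fun p : (ℝ × ℝ) × (ℝ × ℝ) =>
      m p.1 p.2 ^ (1 / 2 : ℝ) * (φ p.1 * (f p.2 * g (p.1 - p.2))) :=
    (hm'.pow_const _).mul (by fun_prop)
  calc _ ≤ ∫⁻ z, ∫⁻ w, (m z w ^ (1 / 2 : ℝ) * (φ z * (f w * g (z - w))) +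
        n z w ^ (1 / 2 : ℝ) * (φ z * (f w * g (z - w)))) := by
        refine lintegral_mono fun z => lintegral_mono fun w => ?_
        dsimp only
        rw [← add_mul]
        gcongr
        exact ENNReal.rpow_add_le_add_rpow _ _ (by norm_num) (by norm_num)
    _ = (∫⁻ z, ∫⁻ w, m z w ^ (1 / 2 : ℝ) * (φ z * (f w * g (z - w)))) +
        ∫⁻ z, ∫⁻ w, n z w ^ (1 / 2 : ℝ) * (φ z * (f w * g (z - w))) := by
        rw [← lintegral_add_left (Measurable.lintegral_prod_right' hM)]
        refine lintegral_congr fun z => ?_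
        exact lintegral_add_left (f := fun w => m z w ^ (1 / 2 : ℝ) * (φ z * (f w * g (z - w))))
          (hM.comp measurable_prodMk_left) _
    _ ≤ _ := by
        rw [add_mul]
        exact add_le_add (hb φ f g hφ hf hg) (hb' φ f g hφ hf hg)

theorem TriBounded.mono {m n : ℝ × ℝ → ℝ × ℝ → ℝ≥0∞} {c : ℝ≥0∞} (hc : c ≠ ⊤)
    (hm : TriBounded m) (h : ∀ z w, n z w ≤ c * m z w) : TriBounded n := by
  obtain ⟨C, hC, hb⟩ := hm
  have hc' : c ^ (1 / 2 : ℝ) ≠ ⊤ := ENNReal.rpow_ne_top_of_nonneg (by norm_num) hc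
  refine ⟨c ^ (1 / 2 : ℝ) * C, by finiteness, fun φ f g hφ hf hg => ?_⟩
  calc _ ≤ ∫⁻ z, ∫⁻ w, c ^ (1 / 2 : ℝ) * (m z w ^ (1 / 2 : ℝ) * (φ z * (f w * g (z - w)))) := by
        refine lintegral_mono fun z => lintegral_mono fun w => ?_
        dsimp only
        rw [← mul_assoc (c ^ (1 / 2 : ℝ)), ← ENNReal.mul_rpow_of_nonneg _ _ (by norm_num)]
        gcongr
        exact h z w
    _ = c ^ (1 / 2 : ℝ) * ∫⁻ z, ∫⁻ w, m z w ^ (1 / 2 : ℝ) * (φ z * (f w * g (z - w))) := by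
        rw [← lintegral_const_mul' _ _ hc']
        refine lintegral_congr fun z => ?_
        rw [lintegral_const_mul' _ _ hc']
    _ ≤ _ := by
        rw [mul_assoc]
        gcongr
        exact hb φ f g hφ hf hg

/-! ### Weighted norms and the bilinear estimates -/

/-- The weight `⟨2πξ⟩^k ⟨2π(τ + κπξ²)⟩^b`. -/
def wt (κ k b : ℝ) (z : ℝ × ℝ) : ℝ := jb z.1 ^ k * jb (z.2 + κ * Real.pi * z.1 ^ 2) ^ b

theorem wt_pos (κ k b : ℝ) (z : ℝ × ℝ) : 0 < wt κ k b z :=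
  mul_pos (jb_rpow_pos _ _) (jb_rpow_pos _ _)

@[fun_prop]
theorem measurable_wt (κ k b : ℝ) : Measurable (wt κ k b) := by
  unfold wt; fun_prop

/-- The weighted `L²` norm. -/
def wnorm (κ k b : ℝ) (F : ℝ × ℝ → ℝ≥0∞) : ℝ≥0∞ :=
  l2 fun z => ENNReal.ofReal (wt κ k b z) * F z

/-- The convolution of nonnegative functions. -/
def lconv (F G : ℝ × ℝ → ℝ≥0∞) (z : ℝ × ℝ) : ℝ≥0∞ := ∫⁻ w, F w * G (z - w)

theorem measurable_lconv {F G : ℝ × ℝ → ℝ≥0∞} (hF : Measurable F) (hG : Measurable G) :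
    Measurable (lconv F G) := by
  have h : Measurable fun p : (ℝ × ℝ) × (ℝ × ℝ) => F p.2 * G (p.1 - p.2) := by fun_prop
  exact Measurable.lintegral_prod_right' h

theorem ofReal_inv_mul_cancel {x : ℝ} (hx : 0 < x) (y : ℝ≥0∞) :
    ENNReal.ofReal x⁻¹ * (ENNReal.ofReal x * y) = y := by
  rw [← mul_assoc, ← ENNReal.ofReal_mul (inv_pos.2 hx).le, inv_mul_cancel₀ hx.ne']
  simp

theorem ofReal_sq_sqrt {x : ℝ} (hx : 0 ≤ x) :
    ENNReal.ofReal (x ^ 2) ^ (1 / 2 : ℝ) = ENNReal.ofReal x := by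
  rw [ENNReal.ofReal_pow hx, ← ENNReal.rpow_natCast, ← ENNReal.rpow_mul]; norm_num

/-- The weighted estimate for `F ⋆ G`, from the boundedness of the trilinear form. -/
theorem exists_wnorm_lconv_le {A B D : ℝ × ℝ → ℝ} (hA : ∀ z, 0 < A z) (hB : ∀ z, 0 < B z)
    (hD : ∀ z, 0 < D z) (mA : Measurable A) (mB : Measurable B) (mD : Measurable D)
    (h : TriBounded fun z w => ENNReal.ofReal ((A z * (B w)⁻¹ * (D (z - w))⁻¹) ^ 2)) :
    ∃ C : ℝ≥0∞, C ≠ ⊤ ∧ ∀ F G : ℝ × ℝ → ℝ≥0∞, Measurable F → Measurable G →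
      l2 (fun z => ENNReal.ofReal (A z) * lconv F G z) ≤
        C * (l2 (fun z => ENNReal.ofReal (B z) * F z) *
          l2 (fun z => ENNReal.ofReal (D z) * G z)) := by
  obtain ⟨C, hC, hb⟩ := h
  refine ⟨C, hC, fun F G hF hG => ?_⟩
  refine l2_le_of_pairing ((by fun_prop : Measurable fun z => ENNReal.ofReal (A z)).mul
    (measurable_lconv hF hG)) fun φ hφ => ?_
  refine le_trans (le_of_eq ?_) ((hb φ _ _ hφ
    (by fun_prop : Measurable fun z => ENNReal.ofReal (B z) * F z)
    (by fun_prop : Measurable fun z => ENNReal.ofReal (D z) * G z)).trans (le_of_eq (by ring)))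
  refine lintegral_congr fun z => ?_
  change φ z * (ENNReal.ofReal (A z) * ∫⁻ w, F w * G (z - w)) = _
  rw [← mul_assoc, ← lintegral_const_mul _ (by fun_prop)]
  refine lintegral_congr fun w => ?_
  have pA := hA z
  have pB := hB w
  have pD := hD (z - w)
  rw [ofReal_sq_sqrt (by positivity), ENNReal.ofReal_mul (by positivity),
    ENNReal.ofReal_mul pA.le]
  conv_lhs => rw [← ofReal_inv_mul_cancel pB (F w), ← ofReal_inv_mul_cancel pD (G (z - w))]
  ring

theorem jb_sub_le_mul (x y : ℝ) : jb (x - y) ≤ jb x * jb y := by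
  rw [sub_eq_add_neg, ← jb_neg y]; exact jb_add_le_mul _ _

theorem sq_rpow_bracket (y r : ℝ) : (jb y ^ r) ^ 2 = jb y ^ (2 * r) := by
  rw [← Real.rpow_natCast, ← Real.rpow_mul (jb_pos y).le]; congr 1; push_cast; ring

theorem sq_inv_rpow_bracket (y r : ℝ) : ((jb y ^ r)⁻¹) ^ 2 = jb y ^ (-(2 * r)) := by
  rw [inv_pow, sq_rpow_bracket, ← Real.rpow_neg (jb_pos y).le]

theorem jb_resonance (z w : ℝ × ℝ) :
    2 * Real.pi * (z.2 + 1 * Real.pi * z.1 ^ 2) - 2 * Real.pi * (w.2 + 1 * Real.pi * w.1 ^ 2) -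
      2 * Real.pi * (z.2 - w.2) =
      ((2 * Real.pi * z.1) ^ 2 - (2 * Real.pi * w.1) ^ 2) / 2 := by ring

/-- The estimate of the product `u v`. -/
theorem exists_product_le {k s a b : ℝ} (hks : |k| - 1 / 2 ≤ s) (ha : 1 / 4 ≤ a)
    (hb : 1 / 2 < b) :
    ∃ C : ℝ≥0∞, C ≠ ⊤ ∧ ∀ F G : ℝ × ℝ → ℝ≥0∞, Measurable F → Measurable G →
      wnorm 1 k (-a) (lconv F G) ≤ C * (wnorm 1 k b F * wnorm 0 s b G) := by
  refine exists_wnorm_lconv_le (wt_pos _ _ _) (wt_pos _ _ _) (wt_pos _ _ _)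
    (measurable_wt _ _ _) (measurable_wt _ _ _) (measurable_wt _ _ _) ?_
  have t1 : ∀ θ r₁ r₂ : ℝ, 0 ≤ θ → θ ≤ 1 → (1 + θ) / 2 < r₁ → (1 + θ) / 2 < r₂ →
      (1 < r₁ ∨ 1 < r₂) → TriBounded fun z w => ENNReal.ofReal (jb w.1 ^ θ *
        (jb (w.2 + Real.pi * w.1 ^ 2) ^ (-r₁) * jb (z.2 - w.2) ^ (-r₂))) := by
    intro θ r₁ r₂ h0 h1 hr1 hr2 hr
    obtain ⟨C, hC, h⟩ := exists_kernel_schrodinger_le h0 h1 hr1 hr2 hr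
    exact TriBounded.of_left (by unfold Function.uncurry; fun_prop) hC fun z => h z.2
  -- The three terms of `pointwise_schrodinger`, all integrated in `w` with `z` frozen. The kernel
  -- bound asks for `1 < 2b` when `θ = 1` and for `1/2 < 2b - 1/2` when `θ = 0`; both follow from `b
  -- > 1/2`.
  have hsum := ((t1 1 (2 * b) (2 * b) zero_le_one le_rfl (by linarith) (by linarith)
    (Or.inl (by linarith))).add (by unfold Function.uncurry; fun_prop)
      (t1 0 (2 * b - 1 / 2) (2 * b) le_rfl zero_le_one (by linarith) (by linarith)
        (Or.inr (by linarith)))).add (by unfold Function.uncurry; fun_prop)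
      (t1 0 (2 * b) (2 * b - 1 / 2) le_rfl zero_le_one (by linarith) (by linarith)
        (Or.inl (by linarith)))
  refine hsum.mono (c := ENNReal.ofReal 7) (by simp) fun z w => ?_
  rw [← ENNReal.ofReal_add (by unfold jb bracket; positivity) (by unfold jb bracket; positivity),
    ← ENNReal.ofReal_add (by unfold jb bracket; positivity) (by unfold jb bracket; positivity),
    ← ENNReal.ofReal_mul (by norm_num)]
  refine ENNReal.ofReal_le_ofReal ?_
  have hp := pointwise_schrodinger (b := b) ha (jb_resonance z w)
  simp only [wt, mul_pow, mul_inv, sq_inv_rpow_bracket, sq_rpow_bracket, Prod.fst_sub,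
    Prod.snd_sub, zero_mul, add_zero, one_mul, Real.rpow_zero] at hp ⊢
  rw [← mul_sub] at hp
  refine le_trans ?_ hp
  -- Peetre's inequality, for both signs of `k`. Together with `|k| - 1/2 ≤ s` it leaves one power
  -- of `jb (z.1 - w.1)`.
  have hk : jb z.1 ^ (2 * k) * jb w.1 ^ (-(2 * k)) ≤ jb (z.1 - w.1) ^ (2 * |k|) := by
    have pz := jb_pos z.1
    have pw := jb_pos w.1
    have pd := jb_pos (z.1 - w.1)
    rcases le_total 0 k with h | h
    · have h1 : jb z.1 ≤ jb (z.1 - w.1) * jb w.1 := by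
        simpa using jb_add_le_mul (z.1 - w.1) w.1
      rw [abs_of_nonneg h]
      calc _ ≤ (jb (z.1 - w.1) * jb w.1) ^ (2 * k) * jb w.1 ^ (-(2 * k)) := by gcongr
        _ = _ := by
          rw [Real.mul_rpow pd.le pw.le, mul_assoc, ← Real.rpow_add pw]; simp
    · have h1 : jb w.1 ≤ jb (z.1 - w.1) * jb z.1 := by
        have := jb_sub_le_mul z.1 (z.1 - w.1)
        rwa [sub_sub_cancel, mul_comm] at this
      rw [abs_of_nonpos h]
      calc _ ≤ jb z.1 ^ (2 * k) * (jb (z.1 - w.1) * jb z.1) ^ (-(2 * k)) := by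
            gcongr; linarith
        _ = _ := by
          rw [Real.mul_rpow pd.le pz.le, mul_comm, mul_assoc, ← Real.rpow_add pz]; simp
  have hy : jb z.1 ^ (2 * k) * jb w.1 ^ (-(2 * k)) * jb (z.1 - w.1) ^ (-(2 * s)) ≤
      jb (z.1 - w.1) := by
    calc _ ≤ jb (z.1 - w.1) ^ (2 * |k|) * jb (z.1 - w.1) ^ (-(2 * s)) := by
          have := jb_rpow_pos (z.1 - w.1) (-(2 * s))
          gcongr
      _ = jb (z.1 - w.1) ^ (2 * |k| - 2 * s) := by
          rw [← Real.rpow_add (jb_pos _)]; ring_nf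
      _ ≤ jb (z.1 - w.1) ^ (1 : ℝ) :=
          Real.rpow_le_rpow_of_exponent_le (one_le_jb _) (by linarith)
      _ = _ := Real.rpow_one _
  have e1 := jb_rpow_pos (z.2 + Real.pi * z.1 ^ 2) (-(2 * a))
  have e2 := jb_rpow_pos (w.2 + Real.pi * w.1 ^ 2) (-(2 * b))
  have e3 := jb_rpow_pos (z.2 - w.2) (-(2 * b))
  calc _ = (jb z.1 ^ (2 * k) * jb w.1 ^ (-(2 * k)) * jb (z.1 - w.1) ^ (-(2 * s))) *
        (jb (z.2 + Real.pi * z.1 ^ 2) ^ (-(2 * a)) *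
          (jb (w.2 + Real.pi * w.1 ^ 2) ^ (-(2 * b)) * jb (z.2 - w.2) ^ (-(2 * b)))) := by
        rw [mul_neg 2 a]; ring
    _ ≤ jb (z.1 - w.1) * (jb (z.2 + Real.pi * z.1 ^ 2) ^ (-(2 * a)) *
          (jb (w.2 + Real.pi * w.1 ^ 2) ^ (-(2 * b)) * jb (z.2 - w.2) ^ (-(2 * b)))) := by
        gcongr
    _ = _ := by simp only [jb, mul_sub]

/-- The weighted estimate for the correlation of `F` and `G`, from the boundedness of the
trilinear form. -/
theorem exists_wnorm_lcorr_le {A B D : ℝ × ℝ → ℝ} (hA : ∀ z, 0 < A z) (hB : ∀ z, 0 < B z)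
    (hD : ∀ z, 0 < D z) (mA : Measurable A) (mB : Measurable B) (mD : Measurable D)
    (h : TriBounded fun z w => ENNReal.ofReal ((A (z - w) * (B z)⁻¹ * (D w)⁻¹) ^ 2)) :
    ∃ C : ℝ≥0∞, C ≠ ⊤ ∧ ∀ F G : ℝ × ℝ → ℝ≥0∞, Measurable F → Measurable G →
      l2 (fun z => ENNReal.ofReal (A z) * lconv F (fun w => G (-w)) z) ≤
        C * (l2 (fun z => ENNReal.ofReal (B z) * F z) *
          l2 (fun z => ENNReal.ofReal (D z) * G z)) := by
  obtain ⟨C, hC, hb⟩ := h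
  refine ⟨C, hC, fun F G hF hG => ?_⟩
  refine l2_le_of_pairing ((by fun_prop : Measurable fun z => ENNReal.ofReal (A z)).mul
    (measurable_lconv hF (by fun_prop))) fun φ hφ => ?_
  refine le_trans (le_of_eq ?_) ((hb _ _ φ
    (by fun_prop : Measurable fun z => ENNReal.ofReal (B z) * F z)
    (by fun_prop : Measurable fun z => ENNReal.ofReal (D z) * G z) hφ).trans (le_of_eq (by ring)))
  calc ∫⁻ z, φ z * (ENNReal.ofReal (A z) * lconv F (fun w => G (-w)) z)
      = ∫⁻ z, ∫⁻ w, φ z * ENNReal.ofReal (A z) * (F w * G (w - z)) := by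
        refine lintegral_congr fun z => ?_
        rw [lintegral_const_mul _ (by fun_prop), ← mul_assoc]
        simp [lconv]
    _ = ∫⁻ w, ∫⁻ z, φ z * ENNReal.ofReal (A z) * (F w * G (w - z)) :=
        lintegral_lintegral_swap (by fun_prop)
    _ = _ := by
        refine lintegral_congr fun z => ?_
        rw [← lintegral_sub_left_eq_self _ z]
        refine lintegral_congr fun w => ?_
        have pA := hA (z - w)
        have pB := hB z
        have pD := hD w
        rw [sub_sub_cancel, ofReal_sq_sqrt (by positivity), ENNReal.ofReal_mul (by positivity),
          ENNReal.ofReal_mul pA.le]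
        conv_lhs => rw [← ofReal_inv_mul_cancel pB (F z), ← ofReal_inv_mul_cancel pD (G w)]
        ring

/-- The estimate of the product `u ū`, for an admissible interpolation exponent `γ`. -/
theorem exists_modulus_le {k s a b γ : ℝ} (hγ0 : 0 < γ) (hγ1 : γ < 1)
    (hw : ∀ x y : ℝ, jb (x - y) ^ (2 * s) * (jb x ^ (-(2 * k)) * jb y ^ (-(2 * k))) ≤
      jb (x - y) ^ γ * (jb x * jb y) ^ ((1 - γ) / 2))
    (ha1 : 1 - γ / 2 < 2 * a) (ha2 : γ < 2 * a) (ha3 : 2 * a ≤ 1) (hb : 1 / 2 < b) :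
    ∃ C : ℝ≥0∞, C ≠ ⊤ ∧ ∀ F G : ℝ × ℝ → ℝ≥0∞, Measurable F → Measurable G →
      wnorm 0 s (-a) (lconv F fun w => G (-w)) ≤ C * (wnorm 1 k b F * wnorm 1 k b G) := by
  refine exists_wnorm_lcorr_le (wt_pos _ _ _) (wt_pos _ _ _) (wt_pos _ _ _)
    (measurable_wt _ _ _) (measurable_wt _ _ _) (measurable_wt _ _ _) ?_
  have t1 : ∀ θ r₁ r₂ : ℝ, 0 ≤ θ → θ ≤ 1 → (1 + θ) / 2 < r₁ → (1 + θ) / 2 < r₂ →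
      (1 < r₁ ∨ 1 < r₂) → TriBounded fun z w => ENNReal.ofReal (jb w.1 ^ θ *
        (jb (w.2 + Real.pi * w.1 ^ 2) ^ (-r₁) * jb (z.2 - w.2) ^ (-r₂))) := by
    intro θ r₁ r₂ h0 h1 hr1 hr2 hr
    obtain ⟨C, hC, h⟩ := exists_kernel_schrodinger_le h0 h1 hr1 hr2 hr
    exact TriBounded.of_left (by unfold Function.uncurry; fun_prop) hC fun z => h z.2
  have t2 : ∀ θ r₁ r₂ : ℝ, 0 ≤ θ → θ ≤ 1 → (1 + θ) / 2 < r₁ → (1 + θ) / 2 < r₂ →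
      (1 < r₁ ∨ 1 < r₂) → TriBounded fun z w => ENNReal.ofReal (jb z.1 ^ θ *
        (jb (z.2 + Real.pi * z.1 ^ 2) ^ (-r₁) * jb (z.2 - w.2) ^ (-r₂))) := by
    intro θ r₁ r₂ h0 h1 hr1 hr2 hr
    obtain ⟨C, hC, h⟩ := exists_kernel_schrodinger_le h0 h1 hr1 hr2 hr
    refine TriBounded.of_right (by unfold Function.uncurry; fun_prop) hC fun w => ?_
    refine le_trans (le_of_eq (lintegral_congr fun z => ?_)) (h w.2)
    rw [← jb_neg (z.2 - w.2), neg_sub]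
  have t3 : TriBounded fun z w => ENNReal.ofReal (|z.1 - w.1| *
        (jb (z.2 + Real.pi * z.1 ^ 2) ^ (-(2 * b)) *
          jb (w.2 + Real.pi * w.1 ^ 2) ^ (-(2 * b)))) := by
    obtain ⟨C, hC, h⟩ := exists_kernel_difference_le (r := 2 * b) (by linarith)
    refine TriBounded.of_difference (by unfold Function.uncurry; fun_prop) hC fun u => ?_
    refine le_trans (le_of_eq (lintegral_congr fun z => ?_)) (h u)
    simp
  -- The four terms of `pointwise_debye`: the difference is frozen in the first, `z` in the next two
  -- and `w` in the last. The second term needs `1 - γ/2 < 2a`, the last two need `1 < 2a + 2b - γ`.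
  have hsum := ((t3.add (by unfold Function.uncurry; fun_prop)
    (t1 (1 - γ) (2 * b) (2 * a) (by linarith) (by linarith) (by linarith) (by linarith)
    (Or.inl (by linarith)))).add (by unfold Function.uncurry; fun_prop)
      (t1 1 (2 * b) (2 * a + 2 * b - γ) zero_le_one le_rfl (by linarith) (by linarith)
        (Or.inl (by linarith)))).add (by unfold Function.uncurry; fun_prop)
      (t2 1 (2 * b) (2 * a + 2 * b - γ) zero_le_one le_rfl (by linarith) (by linarith)
        (Or.inl (by linarith)))
  refine hsum.mono (c := ENNReal.ofReal (24 * (2 * Real.pi))) ENNReal.ofReal_ne_top fun z w => ?_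
  rw [← ENNReal.ofReal_add (by unfold jb bracket; positivity) (by unfold jb bracket; positivity),
    ← ENNReal.ofReal_add (by unfold jb bracket; positivity) (by unfold jb bracket; positivity),
    ← ENNReal.ofReal_add (by unfold jb bracket; positivity) (by unfold jb bracket; positivity),
    ← ENNReal.ofReal_mul (by positivity)]
  refine ENNReal.ofReal_le_ofReal ?_
  have hp := pointwise_debye (a := a) hγ0 hγ1 hb (by linarith) ha3 (jb_resonance z w)
  simp only [wt, mul_pow, mul_inv, sq_inv_rpow_bracket, sq_rpow_bracket, Prod.fst_sub,
    Prod.snd_sub, zero_mul, add_zero, one_mul] at hp ⊢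
  rw [← mul_sub, abs_mul, abs_of_pos Real.two_pi_pos] at hp
  simp only [← jb.eq_1] at hp
  have e1 := jb_rpow_pos (z.2 + Real.pi * z.1 ^ 2) (-(2 * b))
  have e2 := jb_rpow_pos (w.2 + Real.pi * w.1 ^ 2) (-(2 * b))
  have e3 := jb_rpow_pos (z.2 - w.2) (-(2 * a))
  have e4 := jb_rpow_pos (z.2 - w.2) (-(2 * a + 2 * b - γ))
  have e5 := jb_rpow_pos w.1 (1 - γ)
  have e6 := jb_rpow_pos w.1 1
  have e7 := jb_rpow_pos z.1 1
  have hpi := one_le_two_pi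
  calc _ = (jb (z.1 - w.1) ^ (2 * s) * (jb z.1 ^ (-(2 * k)) * jb w.1 ^ (-(2 * k)))) *
        (jb (z.2 + Real.pi * z.1 ^ 2) ^ (-(2 * b)) *
          (jb (w.2 + Real.pi * w.1 ^ 2) ^ (-(2 * b)) * jb (z.2 - w.2) ^ (-(2 * a)))) := by
        rw [mul_neg 2 a]; ring
    _ ≤ (jb (z.1 - w.1) ^ γ * (jb z.1 * jb w.1) ^ ((1 - γ) / 2)) *
        (jb (z.2 + Real.pi * z.1 ^ 2) ^ (-(2 * b)) *
          (jb (w.2 + Real.pi * w.1 ^ 2) ^ (-(2 * b)) * jb (z.2 - w.2) ^ (-(2 * a)))) := by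
        exact mul_le_mul_of_nonneg_right (hw _ _) (by positivity)
    _ ≤ _ := hp
    _ ≤ _ := by
        rw [mul_assoc 24]
        gcongr 24 * ?_
        rw [mul_add (2 * Real.pi), mul_add (2 * Real.pi), mul_add (2 * Real.pi), mul_assoc]
        gcongr ?_ + ?_ + ?_ + ?_
        · exact le_rfl
        all_goals exact le_mul_of_one_le_left (by positivity) hpi

/-- The interpolation exponent in the estimate of `u ū`. -/
theorem exists_interpolation_exponent {k s : ℝ} (hs : s < min (k + 1 / 2) (2 * k + 1 / 2))
    (hk : -(1 / 4) < k) : ∃ γ : ℝ, 0 < γ ∧ γ < 1 ∧ ∀ x y : ℝ,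
      jb (x - y) ^ (2 * s) * (jb x ^ (-(2 * k)) * jb y ^ (-(2 * k))) ≤
        jb (x - y) ^ γ * (jb x * jb y) ^ ((1 - γ) / 2) := by
  obtain ⟨h1, h2⟩ := lt_min_iff.1 hs
  rcases le_or_gt 0 k with h0 | h0
  -- For `k ≥ 0` the negative powers absorb `jb (x - y) ^ (2k)`, and `2(s - k) < 1` remains. The
  -- value `1/2` only keeps `γ` positive.
  · refine ⟨max (2 * (s - k)) (1 / 2), lt_max_of_lt_right (by norm_num),
      max_lt (by linarith) (by norm_num), fun x y => ?_⟩
    set γ := max (2 * (s - k)) (1 / 2) with hγ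
    have hγ1 : γ < 1 := max_lt (by linarith) (by norm_num)
    have px := jb_pos x
    have py := jb_pos y
    have pd := jb_pos (x - y)
    have hd : 1 ≤ (jb x * jb y) ^ ((1 - γ) / 2) :=
      Real.one_le_rpow (one_le_mul_of_one_le_of_one_le (one_le_jb _) (one_le_jb _)) (by linarith)
    have hk' : jb (x - y) ^ (2 * k) * (jb x ^ (-(2 * k)) * jb y ^ (-(2 * k))) ≤ 1 := by
      rw [← Real.mul_rpow px.le py.le]
      calc _ ≤ (jb x * jb y) ^ (2 * k) * (jb x * jb y) ^ (-(2 * k)) := by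
            gcongr; exact jb_sub_le_mul x y
        _ = 1 := by rw [← Real.rpow_add (by positivity)]; simp
    calc jb (x - y) ^ (2 * s) * (jb x ^ (-(2 * k)) * jb y ^ (-(2 * k)))
        = jb (x - y) ^ (2 * (s - k)) *
          (jb (x - y) ^ (2 * k) * (jb x ^ (-(2 * k)) * jb y ^ (-(2 * k)))) := by
          rw [← mul_assoc (jb (x - y) ^ (2 * (s - k))), ← Real.rpow_add pd]; ring_nf
      _ ≤ jb (x - y) ^ γ * 1 := by
          gcongr
          · exact one_le_jb _
          · exact le_max_left _ _
      _ ≤ _ := by gcongr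
  -- For `k < 0` this makes `(1 - γ)/2` equal to `-2k`. Positivity of `γ` is `k > -1/4`, and `2s ≤
  -- γ` follows from `s < 2k + 1/2`.
  · refine ⟨1 + 4 * k, by linarith, by linarith, fun x y => ?_⟩
    have px := jb_pos x
    have py := jb_pos y
    rw [← Real.mul_rpow px.le py.le, show (1 - (1 + 4 * k)) / 2 = -(2 * k) by ring]
    gcongr
    · exact one_le_jb _
    · linarith

/-! ### The characters and the Duhamel kernel -/

/-- The character `e^{2πix}`. -/
def ee (x : ℝ) : ℂ := Complex.exp (((2 * Real.pi * x : ℝ) : ℂ) * Complex.I)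

theorem ee_add (x y : ℝ) : ee (x + y) = ee x * ee y := by
  unfold ee; rw [← Complex.exp_add]; congr 1; push_cast; ring

@[simp] theorem ee_zero : ee 0 = 1 := by simp [ee]

theorem ee_neg_mul_self (x : ℝ) : ee (-x) * ee x = 1 := by rw [← ee_add]; simp

@[simp] theorem norm_ee (x : ℝ) : ‖ee x‖ = 1 := Complex.norm_exp_ofReal_mul_I _

@[simp] theorem enorm_ee (x : ℝ) : ‖ee x‖ₑ = 1 := by
  rw [← ofReal_norm]; simp

theorem conj_ee (x : ℝ) : (starRingEnd ℂ) (ee x) = ee (-x) := by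
  unfold ee
  rw [← Complex.exp_conj]
  congr 1
  simp [-Complex.ofReal_ofNat, Complex.conj_ofReal]

@[fun_prop]
theorem continuous_ee : Continuous ee := by unfold ee; fun_prop

@[fun_prop]
theorem measurable_ee : Measurable ee := continuous_ee.measurable

theorem hasDerivAt_ee (x : ℝ) : HasDerivAt ee (2 * Real.pi * Complex.I * ee x) x := by
  unfold ee
  have h : HasDerivAt (fun x : ℝ => ((2 * Real.pi * x : ℝ) : ℂ) * Complex.I)
      (2 * Real.pi * Complex.I) x := by
    have := ((hasDerivAt_id x).const_mul (2 * Real.pi)).ofReal_comp.mul_const Complex.I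
    simpa using this
  rw [mul_comm (2 * Real.pi * Complex.I : ℂ)]
  exact h.cexp

theorem hasDerivAt_ee_mul (ν x : ℝ) :
    HasDerivAt (fun x => ee (x * ν)) (2 * Real.pi * Complex.I * ν * ee (x * ν)) x := by
  have := (hasDerivAt_ee (x * ν)).scomp x ((hasDerivAt_id x).mul_const ν)
  simp only [id_eq, one_mul, Function.comp_def, Complex.real_smul] at this
  rwa [show (ν * (2 * Real.pi * Complex.I * ee (x * ν)) : ℂ) =
    2 * Real.pi * Complex.I * ν * ee (x * ν) by ring] at this

theorem fourier_eq_integral_ee (f : ℝ → ℂ) (w : ℝ) : 𝓕 f w = ∫ t, ee (-(t * w)) * f t := by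
  rw [Real.fourier_real_eq_integral_exp_smul]
  refine integral_congr_ae (Eventually.of_forall fun t => ?_)
  simp only [ee, smul_eq_mul]
  congr 2; push_cast; ring

theorem fourierInv_eq_integral_ee (f : ℝ → ℂ) (w : ℝ) : 𝓕⁻ f w = ∫ t, ee (t * w) * f t := by
  rw [Real.fourierInv_eq']
  refine integral_congr_ae (Eventually.of_forall fun t => ?_)
  simp only [ee, smul_eq_mul, RCLike.inner_apply, conj_trivial]
  congr 2; push_cast; ring

/-- `∫₀ᵗ e^{2πixν} dx`. -/
def duk (t ν : ℝ) : ℂ := ∫ x in (0 : ℝ)..t, ee (x * ν)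

theorem duk_eq {ν : ℝ} (hν : ν ≠ 0) (t : ℝ) :
    duk t ν = (ee (t * ν) - 1) / (2 * Real.pi * Complex.I * ν) := by
  have hne : (2 * Real.pi * Complex.I * ν : ℂ) ≠ 0 := by
    simp [Complex.ofReal_ne_zero.2 hν, Complex.ofReal_ne_zero.2 Real.pi_ne_zero]
  have := intervalIntegral.integral_eq_sub_of_hasDerivAt (a := 0) (b := t)
    (fun x _ => hasDerivAt_ee_mul ν x) (Continuous.intervalIntegrable (by fun_prop) _ _)
  rw [intervalIntegral.integral_const_mul] at this
  simp only [zero_mul, ee_zero] at this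
  rw [eq_div_iff hne, duk, mul_comm]
  exact this

theorem hasDerivAt_duk (t ν : ℝ) : HasDerivAt (fun t => duk t ν) (ee (t * ν)) t :=
  intervalIntegral.integral_hasDerivAt_right (Continuous.intervalIntegrable (by fun_prop) _ _)
    (Continuous.stronglyMeasurableAtFilter (by fun_prop) _ _) (by fun_prop)

@[simp] theorem duk_zero (ν : ℝ) : duk 0 ν = 0 := by simp [duk]

/-- The integral is at most `|t|`, and its closed form gives `2π|ν|‖duk t ν‖ ≤ 2`. Adding the two
bounds yields decay of order `1` in `ν` with a constant linear in `t`. -/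
theorem norm_duk_le (t ν : ℝ) : ‖duk t ν‖ ≤ (|t| + 2) * (jb ν)⁻¹ := by
  have h1 : ‖duk t ν‖ ≤ |t| := by
    have := intervalIntegral.norm_integral_le_of_norm_le_const (a := 0) (b := t) (C := 1)
      (f := fun x => ee (x * ν)) (fun x _ => by simp)
    simpa [duk] using this
  have h2 : 2 * Real.pi * |ν| * ‖duk t ν‖ ≤ 2 := by
    rcases eq_or_ne ν 0 with rfl | hν
    · simp
    rw [duk_eq hν, norm_div]
    have h0 : ‖(2 * Real.pi * Complex.I * ν : ℂ)‖ = 2 * Real.pi * |ν| := by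
      simp [abs_of_pos Real.pi_pos]
    rw [h0, mul_div_cancel₀ _ (by have := abs_pos.2 hν; positivity)]
    refine (norm_sub_le _ _).trans ?_
    simp; norm_num
  rw [← div_eq_mul_inv, le_div_iff₀ (jb_pos ν)]
  have : jb ν = 1 + 2 * Real.pi * |ν| := by
    unfold jb bracket; rw [abs_mul, abs_of_pos Real.two_pi_pos]
  rw [this]; nlinarith

/-- This cocycle identity is what allows the Duhamel formula to be restarted at a later time. -/
theorem duk_add (s t ν : ℝ) : duk (s + t) ν = duk s ν + ee (s * ν) * duk t ν := by
  unfold duk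
  rw [← intervalIntegral.integral_add_adjacent_intervals (b := s)
    (Continuous.intervalIntegrable (by fun_prop) _ _)
    (Continuous.intervalIntegrable (by fun_prop) _ _), ← intervalIntegral.integral_const_mul]
  congr 1
  have := intervalIntegral.integral_comp_add_right (a := 0) (b := t) (fun x => ee (x * ν)) s
  rw [zero_add, add_comm t s] at this
  rw [← this]
  refine intervalIntegral.integral_congr fun x _ => ?_
  simp only [add_mul, ee_add]; ring

theorem continuous_duk : Continuous fun p : ℝ × ℝ => duk p.1 p.2 := by
  unfold duk
  exact intervalIntegral.continuous_parametric_intervalIntegral_of_continuous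
    (f := fun (p : ℝ × ℝ) x => ee (x * p.2)) (μ := volume) (by fun_prop) (by fun_prop)

@[fun_prop]
theorem measurable_duk_comp {α : Type*} [MeasurableSpace α] {f g : α → ℝ} (hf : Measurable f)
    (hg : Measurable g) : Measurable fun x => duk (f x) (g x) :=
  continuous_duk.measurable.comp (hf.prodMk hg)

theorem conj_duk (t ν : ℝ) : (starRingEnd ℂ) (duk t ν) = duk t (-ν) := by
  unfold duk
  simp only [intervalIntegral, map_sub, ← integral_conj, conj_ee, mul_neg]

/-! ### The localized Duhamel kernel -/

theorem integral_cutoff_ee (χ : 𝓢(ℝ, ℂ)) {T : ℝ} (hT : 0 < T) (y : ℝ) :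
    ∫ t, χ (t / T) * ee (-(t * y)) = T * (𝓕 χ : 𝓢(ℝ, ℂ)) (T * y) := by
  have h1 : (𝓕 χ : 𝓢(ℝ, ℂ)) (T * y) = 𝓕 (χ : ℝ → ℂ) (T * y) := by
    rw [← SchwartzMap.fourier_coe]
  rw [h1, fourier_eq_integral_ee]
  have := Measure.integral_comp_div (fun t => χ t * ee (-(T * t * y))) T
  rw [abs_of_pos hT, Complex.real_smul] at this
  convert this using 2
  · funext t; rw [mul_div_cancel₀ _ hT.ne']
  · refine integral_congr_ae (Eventually.of_forall fun t => ?_)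
    simp only; rw [mul_comm]; ring_nf

theorem integrable_cutoff (χ : 𝓢(ℝ, ℂ)) {T : ℝ} (hT : 0 < T) :
    Integrable fun t => χ (t / T) := (χ.integrable).comp_div hT.ne'

theorem integral_cutoff_duk (χ : 𝓢(ℝ, ℂ)) {T : ℝ} (hT : 0 < T) {ν : ℝ} (hν : ν ≠ 0) (y : ℝ) :
    ∫ t, χ (t / T) * (ee (-(t * y)) * duk t ν) =
      T * ((𝓕 χ : 𝓢(ℝ, ℂ)) (T * (y - ν)) - (𝓕 χ : 𝓢(ℝ, ℂ)) (T * y)) /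
        (2 * Real.pi * Complex.I * ν) := by
  have hi : ∀ y : ℝ, Integrable fun t => χ (t / T) * ee (-(t * y)) := fun y =>
    (integrable_cutoff χ hT).mul_bdd (c := 1) (by fun_prop) (Eventually.of_forall fun t => by simp)
  rw [mul_sub, ← integral_cutoff_ee χ hT, ← integral_cutoff_ee χ hT, ← integral_sub (hi _) (hi _),
    ← integral_div]
  refine integral_congr_ae (Eventually.of_forall fun t => ?_)
  simp only
  rw [duk_eq hν, show -(t * (y - ν)) = -(t * y) + t * ν by ring, ee_add]
  ring

theorem exists_schwartz_jb_le (f : 𝓢(ℝ, ℂ)) :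
    ∃ C : ℝ, 0 < C ∧ ∀ x, ‖f x‖ ≤ C * jb x ^ (-2 : ℝ) := by
  obtain ⟨C0, hC0, h0⟩ := f.decay 0 0
  obtain ⟨C2, hC2, h2⟩ := f.decay 2 0
  refine ⟨2 * C0 + 2 * (2 * Real.pi) ^ 2 * C2, by positivity, fun x => ?_⟩
  have h0' : ‖f x‖ ≤ C0 := by simpa using h0 x
  have h2' : |x| ^ 2 * ‖f x‖ ≤ C2 := by simpa using h2 x
  rw [Real.rpow_neg (jb_pos x).le, ← div_eq_mul_inv, le_div_iff₀ (by
    have := jb_pos x; positivity)]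
  have e : jb x = 1 + 2 * Real.pi * |x| := by
    unfold jb bracket; rw [abs_mul, abs_of_pos Real.two_pi_pos]
  have : jb x ^ (2 : ℝ) ≤ 2 + 2 * (2 * Real.pi) ^ 2 * |x| ^ 2 := by
    rw [e, Real.rpow_two]; nlinarith [sq_nonneg (1 - 2 * Real.pi * |x|)]
  calc ‖f x‖ * jb x ^ (2 : ℝ) ≤ ‖f x‖ * (2 + 2 * (2 * Real.pi) ^ 2 * |x| ^ 2) := by gcongr
    _ = 2 * ‖f x‖ + 2 * (2 * Real.pi) ^ 2 * (|x| ^ 2 * ‖f x‖) := by ring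
    _ ≤ _ := by gcongr

/-- The difference quotient of a Schwartz function. -/
theorem exists_schwartz_diffquot_le (f : 𝓢(ℝ, ℂ)) :
    ∃ C : ℝ, 0 < C ∧ ∀ x ν : ℝ, ν ≠ 0 → ‖(f (x - ν) - f x) / (2 * Real.pi * Complex.I * ν)‖ ≤
      C * ((jb (x - ν) ^ (-2 : ℝ) + jb x ^ (-2 : ℝ)) * (jb ν)⁻¹) := by
  obtain ⟨C0, hC0, h0⟩ := exists_schwartz_jb_le f
  obtain ⟨C1, hC1, h1⟩ := exists_schwartz_jb_le (SchwartzMap.derivCLM ℂ ℂ f)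
  have hpi := Real.pi_gt_three
  set D : ℝ := 1 + 2 * Real.pi
  have hD : 0 < D := by positivity
  refine ⟨C0 * 2 + C1 * D ^ 3, by positivity, fun x ν hν => ?_⟩
  have pa := jb_rpow_pos (x - ν) (-2)
  have pb := jb_rpow_pos x (-2)
  have pj := jb_pos ν
  have hn : ‖(2 * Real.pi * Complex.I * ν : ℂ)‖ = 2 * Real.pi * |ν| := by
    simp [abs_of_pos Real.pi_pos]
  have habs := abs_pos.2 hν
  have e : jb ν = 1 + 2 * Real.pi * |ν| := by
    unfold jb bracket; rw [abs_mul, abs_of_pos Real.two_pi_pos]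
  rw [norm_div, hn, div_le_iff₀ (by positivity)]
  set S := jb (x - ν) ^ (-2 : ℝ) + jb x ^ (-2 : ℝ) with hS
  have hSp : 0 < S := by positivity
  have hj : (jb ν)⁻¹ * jb ν = 1 := inv_mul_cancel₀ pj.ne'
  -- For large `ν` the triangle inequality suffices, since `jb ν` is comparable to `|ν|`. For small
  -- `ν` the mean value inequality is used on a segment along which `jb` changes by at most the
  -- factor `D`.
  rcases le_or_gt 1 |ν| with hc | hc
  · have h2 : jb ν ≤ 2 * (2 * Real.pi * |ν|) := by rw [e]; nlinarith
    have h3 : 1 ≤ 2 * ((jb ν)⁻¹ * (2 * Real.pi * |ν|)) := by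
      rw [← hj, ← mul_assoc, mul_comm 2, mul_assoc]; gcongr
    calc ‖f (x - ν) - f x‖ ≤ ‖f (x - ν)‖ + ‖f x‖ := norm_sub_le _ _
      _ ≤ C0 * jb (x - ν) ^ (-2 : ℝ) + C0 * jb x ^ (-2 : ℝ) := add_le_add (h0 _) (h0 _)
      _ = C0 * S * 1 := by rw [hS]; ring
      _ ≤ C0 * S * (2 * ((jb ν)⁻¹ * (2 * Real.pi * |ν|))) := by gcongr
      _ = C0 * 2 * (S * (jb ν)⁻¹) * (2 * Real.pi * |ν|) := by ring
      _ ≤ _ := by gcongr; linarith [show 0 < C1 * D ^ 3 by positivity]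
  · have hjD : jb ν ≤ D := by rw [e]; nlinarith
    have hder : ∀ y ∈ segment ℝ (x - ν) x, ‖deriv f y‖ ≤ C1 * (D ^ 2 * jb x ^ (-2 : ℝ)) := by
      intro y hy
      have hy' : |x - y| ≤ |ν| := by
        have := norm_sub_le_of_mem_segment hy
        simp only [Real.norm_eq_abs, sub_sub_cancel] at this
        rw [segment_eq_uIcc] at hy
        have h := abs_sub_right_of_mem_uIcc hy
        simpa using h
      have hjx : jb x ≤ D * jb y := by
        have h3 := jb_add_le_mul (x - y) y
        rw [sub_add_cancel] at h3
        refine h3.trans ?_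
        have := jb_pos y
        gcongr
        unfold jb bracket; rw [abs_mul, abs_of_pos Real.two_pi_pos]; nlinarith
      have h4 := rpow_neg_le_of_le_mul (jb_pos x) hD (jb_pos y) hjx (by norm_num : (0 : ℝ) ≤ 2)
      have h5 := h1 y
      simp only [SchwartzMap.derivCLM_apply] at h5
      refine h5.trans ?_
      gcongr
      simpa using h4
    have hmv := (convex_segment (𝕜 := ℝ) (x - ν) x).norm_image_sub_le_of_norm_deriv_le
      (fun y _ => f.differentiableAt) hder (right_mem_segment ℝ _ _) (left_mem_segment ℝ _ _)
    rw [show x - ν - x = -ν by ring, norm_neg, Real.norm_eq_abs] at hmv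
    refine hmv.trans ?_
    have h6 : 1 ≤ D * (jb ν)⁻¹ := by rw [← div_eq_mul_inv, le_div_iff₀ pj]; linarith
    have h7 : jb x ^ (-2 : ℝ) ≤ S := by rw [hS]; linarith
    calc C1 * (D ^ 2 * jb x ^ (-2 : ℝ)) * |ν|
        ≤ C1 * (D ^ 2 * S) * |ν| * (D * (jb ν)⁻¹) := by
          calc _ ≤ C1 * (D ^ 2 * S) * |ν| * 1 := by rw [mul_one]; gcongr
            _ ≤ _ := by gcongr
      _ = C1 * D ^ 3 * (S * (jb ν)⁻¹) * |ν| := by ring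
      _ ≤ (C0 * 2 + C1 * D ^ 3) * (S * (jb ν)⁻¹) * (2 * Real.pi * |ν|) := by
          gcongr
          · linarith
          · nlinarith

theorem l2_comp_mul_left {T : ℝ} (hT : 0 < T) (f : ℝ → ℝ≥0∞) :
    l2 (fun x => f (T * x)) = ENNReal.ofReal (T ^ (-(1 / 2) : ℝ)) * l2 f := by
  unfold l2
  rw [lintegral_comp_mul_left hT fun x => f x ^ 2, ENNReal.mul_rpow_of_nonneg _ _ (by norm_num),
    ENNReal.ofReal_rpow_of_nonneg (by positivity) (by norm_num)]
  congr 2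
  rw [Real.inv_rpow hT.le, Real.rpow_neg hT.le]

theorem l2_jb_lt_top {r : ℝ} (hr : 1 / 2 < r) :
    l2 (fun x => ENNReal.ofReal (jb x ^ (-r))) < ⊤ := by
  unfold l2
  refine ENNReal.rpow_lt_top_of_nonneg (by norm_num) (ne_of_lt ?_)
  refine lt_of_eq_of_lt (lintegral_congr fun x => ?_) (lintegral_jb_lt_top
    (show 1 < 2 * r by linarith))
  rw [← ENNReal.ofReal_pow (jb_rpow_pos _ _).le, sq_rpow_bracket]; ring_nf

theorem jb_le_inv_mul_jb {T : ℝ} (hT : 0 < T) (hT1 : T ≤ 1) (x : ℝ) :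
    jb x ≤ T⁻¹ * jb (T * x) := by
  have e : ∀ x, jb x = 1 + 2 * Real.pi * |x| := fun x => by
    unfold jb bracket; rw [abs_mul, abs_of_pos Real.two_pi_pos]
  rw [e, e, abs_mul, abs_of_pos hT, mul_add, mul_one]
  have : 1 ≤ T⁻¹ := (one_le_inv₀ hT).2 hT1
  have h2 : T⁻¹ * (2 * Real.pi * (T * |x|)) = 2 * Real.pi * |x| := by field_simp
  linarith

theorem jb_rpow_le_mul {T : ℝ} (hT : 0 < T) (hT1 : T ≤ 1) {r : ℝ} (hr : 0 ≤ r) (x : ℝ) :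
    jb x ^ r ≤ T ^ (-r) * jb (T * x) ^ r := by
  calc jb x ^ r ≤ (T⁻¹ * jb (T * x)) ^ r :=
        Real.rpow_le_rpow (jb_pos x).le (jb_le_inv_mul_jb hT hT1 x) hr
    _ = _ := by
        rw [Real.mul_rpow (by positivity) (jb_pos _).le, Real.inv_rpow hT.le,
          Real.rpow_neg hT.le]

/-- The modulus of the Fourier transform of the localized Duhamel kernel. -/
def dukHat (χ : 𝓢(ℝ, ℂ)) (T x ν : ℝ) : ℝ≥0∞ := ‖∫ t, χ (t / T) * (ee (-(t * x)) * duk t ν)‖ₑ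

/-- By scaling, the transform of the localized kernel is `T²` times the difference quotient of `𝓕 χ`
at `T * x` with step `T * ν`. The point `ν = 0` is excluded because of the division, and it is a
null set. -/
theorem exists_dukHat_le (χ : 𝓢(ℝ, ℂ)) : ∃ C : ℝ, 0 < C ∧ ∀ T : ℝ, 0 < T → ∀ x ν : ℝ, ν ≠ 0 →
    dukHat χ T x ν ≤ ENNReal.ofReal (C * (T ^ 2 *
      ((jb (T * (x - ν)) ^ (-2 : ℝ) + jb (T * x) ^ (-2 : ℝ)) * (jb (T * ν))⁻¹))) := by
  obtain ⟨C, hC, h⟩ := exists_schwartz_diffquot_le (𝓕 χ)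
  refine ⟨C, hC, fun T hT x ν hν => ?_⟩
  unfold dukHat
  rw [integral_cutoff_duk χ hT hν, ← ofReal_norm]
  refine ENNReal.ofReal_le_ofReal ?_
  have h1 := h (T * x) (T * ν) (mul_ne_zero hT.ne' hν)
  have e : (T * ((𝓕 χ : 𝓢(ℝ, ℂ)) (T * (x - ν)) - (𝓕 χ : 𝓢(ℝ, ℂ)) (T * x)) /
      (2 * Real.pi * Complex.I * ν) : ℂ) = (T ^ 2 : ℝ) *
      (((𝓕 χ : 𝓢(ℝ, ℂ)) (T * x - T * ν) - (𝓕 χ : 𝓢(ℝ, ℂ)) (T * x)) /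
      (2 * Real.pi * Complex.I * (T * ν : ℝ))) := by
    have h2 : (ν : ℂ) ≠ 0 := Complex.ofReal_ne_zero.2 hν
    have h3 : (T : ℂ) ≠ 0 := Complex.ofReal_ne_zero.2 hT.ne'
    have h4 : (Real.pi : ℂ) ≠ 0 := Complex.ofReal_ne_zero.2 Real.pi_ne_zero
    rw [mul_sub T x ν]
    push_cast
    field_simp
  rw [e, norm_mul, Complex.norm_real, Real.norm_of_nonneg (by positivity)]
  rw [mul_sub T x ν]
  calc _ ≤ T ^ 2 * _ := mul_le_mul_of_nonneg_left h1 (by positivity)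
    _ = _ := by ring

/-- The one-dimensional Duhamel estimate, with the gain of a power of `T`. -/
theorem exists_dukHat_operator_le (χ : 𝓢(ℝ, ℂ)) {a b : ℝ} (ha : 0 ≤ a) (ha2 : a < 1 / 2)
    (hb : 0 ≤ b) (hb1 : b < 1) (hab : a + b ≤ 1) :
    ∃ C : ℝ≥0∞, C ≠ ⊤ ∧ ∀ T : ℝ, 0 < T → T ≤ 1 → ∀ g : ℝ → ℝ≥0∞, Measurable g →
      l2 (fun x => ENNReal.ofReal (jb x ^ b) * ∫⁻ ν, dukHat χ T x ν * g ν) ≤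
        C * (ENNReal.ofReal (T ^ (1 - a - b)) *
          l2 fun ν => ENNReal.ofReal (jb ν ^ (-a)) * g ν) := by
  obtain ⟨C, hC, hK⟩ := exists_dukHat_le χ
  set I := ∫⁻ x, ENNReal.ofReal (jb x ^ (-(2 - b))) with hI
  have hIt : I ≠ ⊤ := (lintegral_jb_lt_top (by linarith)).ne
  set M := l2 (fun x => ENNReal.ofReal (jb x ^ (-(2 - b)))) with hM
  have hMt : M ≠ ⊤ := (l2_jb_lt_top (by linarith)).ne
  set N := l2 (fun x => ENNReal.ofReal (jb x ^ (-(1 - a)))) with hN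
  have hNt : N ≠ ⊤ := (l2_jb_lt_top (by linarith)).ne
  refine ⟨ENNReal.ofReal C * (I + M * N), by finiteness, fun T hT hT1 g hg => ?_⟩
  set g0 : ℝ → ℝ≥0∞ := fun ν => ENNReal.ofReal (jb ν ^ (-a)) * g ν with hg0
  have mg0 : Measurable g0 := by fun_prop
  have hgg : ∀ ν, g ν = ENNReal.ofReal (jb ν ^ a) * g0 ν := fun ν => by
    rw [hg0, ← mul_assoc, ← ENNReal.ofReal_mul (jb_rpow_pos _ _).le,
      ← Real.rpow_add (jb_pos ν)]
    simp
  have pT : 0 < T ^ (2 - a - b) := Real.rpow_pos_of_pos hT _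
  have hpt : ∀ x ν : ℝ, jb x ^ b * (C * (T ^ 2 * ((jb (T * (x - ν)) ^ (-2 : ℝ) +
      jb (T * x) ^ (-2 : ℝ)) * (jb (T * ν))⁻¹))) * jb ν ^ a ≤
      C * T ^ (2 - a - b) * (jb (T * (x - ν)) ^ (-(2 - b)) +
        jb (T * x) ^ (-(2 - b)) * jb (T * ν) ^ (-(1 - a))) := by
    intro x ν
    have h1 := jb_rpow_le_mul hT hT1 hb x
    have h2 := jb_rpow_le_mul hT hT1 ha ν
    have e2 : (T : ℝ) ^ 2 * (T ^ (-b) * T ^ (-a)) = T ^ (2 - a - b) := by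
      rw [← Real.rpow_two, ← Real.rpow_add hT, ← Real.rpow_add hT]; ring_nf
    set X := jb (T * x) with hX
    set V := jb (T * ν) with hV
    set D := jb (T * (x - ν)) with hD
    have pX : 0 < X := jb_pos _
    have pV : 0 < V := jb_pos _
    have pD : 0 < D := jb_pos _
    have hXDV : X ≤ D * V := by
      have := jb_add_le_mul (T * (x - ν)) (T * ν)
      rwa [← mul_add, sub_add_cancel] at this
    have e3 : V⁻¹ * V ^ a = V ^ (-(1 - a)) := by
      rw [← Real.rpow_neg_one, ← Real.rpow_add pV]; ring_nf
    have e4 : X ^ b * X ^ (-2 : ℝ) = X ^ (-(2 - b)) := by rw [← Real.rpow_add pX]; ring_nf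
    -- The weight `X ^ b` is distributed by `X ≤ D * V`. The power `V ^ (a + b - 1)` produced in
    -- this way is at most `1` because `a + b ≤ 1`.
    have h5 : X ^ b * D ^ (-2 : ℝ) * V ^ (-(1 - a)) ≤ D ^ (-(2 - b)) := by
      calc X ^ b * D ^ (-2 : ℝ) * V ^ (-(1 - a))
          ≤ (D * V) ^ b * D ^ (-2 : ℝ) * V ^ (-(1 - a)) := by gcongr
        _ = D ^ (-(2 - b)) * V ^ (a + b - 1) := by
            rw [Real.mul_rpow pD.le pV.le]
            have q1 : D ^ (-(2 - b)) = D ^ b * D ^ (-2 : ℝ) := by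
              rw [← Real.rpow_add pD]; ring_nf
            have q2 : V ^ (a + b - 1) = V ^ b * V ^ (-(1 - a)) := by
              rw [← Real.rpow_add pV]; ring_nf
            rw [q1, q2]; ring
        _ ≤ D ^ (-(2 - b)) * 1 := by
            gcongr
            exact Real.rpow_le_one_of_one_le_of_nonpos (one_le_jb _) (by linarith)
        _ = _ := mul_one _
    have pTb : 0 < T ^ (-b) := Real.rpow_pos_of_pos hT _
    have pTa : 0 < T ^ (-a) := Real.rpow_pos_of_pos hT _
    have pja := jb_rpow_pos ν a
    calc jb x ^ b * (C * (T ^ 2 * ((D ^ (-2 : ℝ) + X ^ (-2 : ℝ)) * V⁻¹))) * jb ν ^ a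
        ≤ (T ^ (-b) * X ^ b) * (C * (T ^ 2 * ((D ^ (-2 : ℝ) + X ^ (-2 : ℝ)) * V⁻¹))) *
          (T ^ (-a) * V ^ a) := by
          gcongr
      _ = C * (T ^ 2 * (T ^ (-b) * T ^ (-a))) * (X ^ b * D ^ (-2 : ℝ) * (V⁻¹ * V ^ a) +
          (X ^ b * X ^ (-2 : ℝ)) * (V⁻¹ * V ^ a)) := by ring
      _ ≤ _ := by rw [e2, e3, e4]; gcongr
  set c : ℝ≥0∞ := ENNReal.ofReal (C * T ^ (2 - a - b)) with hc
  -- The kernel is dominated by a convolution kernel, treated with Young's inequality, plus a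
  -- product kernel, treated with Cauchy–Schwarz. Rescaling costs `T⁻¹` in each, which turns `T ^ (2
  -- - a - b)` into `T ^ (1 - a - b)`.
  have hmain : ∀ x, ENNReal.ofReal (jb x ^ b) * ∫⁻ ν, dukHat χ T x ν * g ν ≤
      c * ((∫⁻ ν, ENNReal.ofReal (jb (T * (x - ν)) ^ (-(2 - b))) * g0 ν) +
        (∫⁻ ν, ENNReal.ofReal (jb (T * ν) ^ (-(1 - a))) * g0 ν) *
        ENNReal.ofReal (jb (T * x) ^ (-(2 - b)))) := by
    intro x
    rw [← lintegral_mul_const _ (by fun_prop), ← lintegral_add_left (by fun_prop),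
      ← lintegral_const_mul c (by fun_prop),
      ← lintegral_const_mul' (ENNReal.ofReal (jb x ^ b)) _ ENNReal.ofReal_ne_top]
    refine lintegral_mono_ae ?_
    have hne : ∀ᵐ ν : ℝ, ν ≠ 0 := by
      simp [ae_iff, measure_singleton]
    filter_upwards [hne] with ν hν
    rw [hgg ν]
    calc _ ≤ ENNReal.ofReal (jb x ^ b) * (ENNReal.ofReal (C * (T ^ 2 *
          ((jb (T * (x - ν)) ^ (-2 : ℝ) + jb (T * x) ^ (-2 : ℝ)) * (jb (T * ν))⁻¹))) *
          (ENNReal.ofReal (jb ν ^ a) * g0 ν)) := by gcongr; exact hK T hT x ν hν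
      _ = ENNReal.ofReal (jb x ^ b * (C * (T ^ 2 *
          ((jb (T * (x - ν)) ^ (-2 : ℝ) + jb (T * x) ^ (-2 : ℝ)) * (jb (T * ν))⁻¹))) *
            jb ν ^ a) * g0 ν := by
          have q1 := jb_rpow_pos x b
          have q2 := jb_rpow_pos (T * (x - ν)) (-2)
          have q3 := jb_rpow_pos (T * x) (-2)
          have q4 := jb_pos (T * ν)
          rw [ENNReal.ofReal_mul (q := jb ν ^ a) (by positivity), ENNReal.ofReal_mul q1.le]; ring
      _ ≤ ENNReal.ofReal (C * T ^ (2 - a - b) * (jb (T * (x - ν)) ^ (-(2 - b)) +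
          jb (T * x) ^ (-(2 - b)) * jb (T * ν) ^ (-(1 - a)))) * g0 ν := by
          exact mul_le_mul_left (ENNReal.ofReal_le_ofReal (hpt x ν)) _
      _ = _ := by
          have q2 := jb_rpow_pos (T * (x - ν)) (-(2 - b))
          have q3 := jb_rpow_pos (T * x) (-(2 - b))
          have q4 := jb_rpow_pos (T * ν) (-(1 - a))
          rw [ENNReal.ofReal_mul (by positivity), ENNReal.ofReal_add q2.le (by positivity),
            ENNReal.ofReal_mul q3.le]
          ring
  have hconv : l2 (fun x => ∫⁻ ν, ENNReal.ofReal (jb (T * (x - ν)) ^ (-(2 - b))) * g0 ν) ≤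
      ENNReal.ofReal T⁻¹ * I * l2 g0 := by
    have := l2_conv_le (h := fun x => ENNReal.ofReal (jb (T * x) ^ (-(2 - b)))) (by fun_prop) mg0
    rwa [lintegral_comp_mul_left hT fun x => ENNReal.ofReal (jb x ^ (-(2 - b)))] at this
  have hsep : ∫⁻ ν, ENNReal.ofReal (jb (T * ν) ^ (-(1 - a))) * g0 ν ≤
      ENNReal.ofReal (T ^ (-(1 / 2) : ℝ)) * N * l2 g0 := by
    have := lintegral_mul_le_l2 (f := fun ν => ENNReal.ofReal (jb (T * ν) ^ (-(1 - a))))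
      (by fun_prop) mg0
    rwa [l2_comp_mul_left hT fun x => ENNReal.ofReal (jb x ^ (-(1 - a)))] at this
  have hm1 : Measurable fun x : ℝ =>
      ∫⁻ ν, ENNReal.ofReal (jb (T * (x - ν)) ^ (-(2 - b))) * g0 ν := by
    have h : Measurable fun p : ℝ × ℝ =>
      ENNReal.ofReal (jb (T * (p.1 - p.2)) ^ (-(2 - b))) * g0 p.2 := by fun_prop
    exact Measurable.lintegral_prod_right' h
  -- If the norm on the right is infinite, the claim still requires the constant to be nonzero,
  -- since `0 * ⊤ = 0`; it is nonzero because `I > 0`.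
  by_cases htop : l2 g0 = ⊤
  · rw [htop]
    have hT' : ENNReal.ofReal (T ^ (1 - a - b)) ≠ 0 := by
      simp only [ne_eq, ENNReal.ofReal_eq_zero, not_le]; exact Real.rpow_pos_of_pos hT _
    by_cases hz : ENNReal.ofReal C * (I + M * N) = 0
    · exfalso
      have hI0 : I ≠ 0 := by
        rw [hI]
        intro h0
        rw [lintegral_eq_zero_iff (by fun_prop)] at h0
        obtain ⟨x, hx⟩ := h0.exists
        simp only [Pi.zero_apply, ENNReal.ofReal_eq_zero] at hx
        linarith [jb_rpow_pos x (-(2 - b))]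
      simp [hI0] at hz
      linarith
    · rw [ENNReal.mul_top hT', ENNReal.mul_top hz]; exact le_top
  calc _ ≤ l2 (fun x => c * ((∫⁻ ν, ENNReal.ofReal (jb (T * (x - ν)) ^ (-(2 - b))) * g0 ν) +
        (∫⁻ ν, ENNReal.ofReal (jb (T * ν) ^ (-(1 - a))) * g0 ν) *
        ENNReal.ofReal (jb (T * x) ^ (-(2 - b))))) := l2_mono hmain
    _ ≤ c * (ENNReal.ofReal T⁻¹ * I * l2 g0 +
        (ENNReal.ofReal (T ^ (-(1 / 2) : ℝ)) * N * l2 g0) *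
          (ENNReal.ofReal (T ^ (-(1 / 2) : ℝ)) * M)) := by
        rw [l2_const_mul ENNReal.ofReal_ne_top]
        gcongr
        refine (l2_add_le hm1 (by fun_prop)).trans ?_
        gcongr
        rw [l2_const_mul (ne_top_of_le_ne_top (by finiteness) hsep),
          l2_comp_mul_left hT fun x => ENNReal.ofReal (jb x ^ (-(2 - b)))]
        gcongr
    _ = _ := by
        have e1 : ENNReal.ofReal (T ^ (-(1 / 2) : ℝ)) * ENNReal.ofReal (T ^ (-(1 / 2) : ℝ)) =
            ENNReal.ofReal T⁻¹ := by
          rw [← ENNReal.ofReal_mul (by positivity), ← Real.rpow_add hT, ← Real.rpow_neg_one]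
          norm_num
        have e2 : c * ENNReal.ofReal T⁻¹ = ENNReal.ofReal C * ENNReal.ofReal (T ^ (1 - a - b)) := by
          rw [hc, ← ENNReal.ofReal_mul (by positivity), ← ENNReal.ofReal_mul hC.le,
            ← Real.rpow_neg_one, mul_assoc, ← Real.rpow_add hT]
          ring_nf
        calc _ = c * (ENNReal.ofReal T⁻¹ * (I * l2 g0) + (ENNReal.ofReal (T ^ (-(1 / 2) : ℝ)) *
              ENNReal.ofReal (T ^ (-(1 / 2) : ℝ))) * (N * l2 g0 * M)) := by ring
          _ = (c * ENNReal.ofReal T⁻¹) * ((I + M * N) * l2 g0) := by rw [e1]; ring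
          _ = _ := by rw [e2]; ring

/-- The localized free evolution. -/
theorem exists_cutoffHat_le (χ : 𝓢(ℝ, ℂ)) {b : ℝ} (hb : 0 ≤ b) (hb1 : b < 1) :
    ∃ C : ℝ≥0∞, C ≠ ⊤ ∧ ∀ T : ℝ, 0 < T → T ≤ 1 →
      l2 (fun x => ENNReal.ofReal (jb x ^ b) * ‖T * (𝓕 χ : 𝓢(ℝ, ℂ)) (T * x)‖ₑ) ≤
        C * ENNReal.ofReal (T ^ (1 / 2 - b)) := by
  obtain ⟨C, hC, h⟩ := exists_schwartz_jb_le (𝓕 χ)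
  set M := l2 (fun x => ENNReal.ofReal (jb x ^ (-(2 - b)))) with hM
  have hMt : M ≠ ⊤ := (l2_jb_lt_top (by linarith)).ne
  refine ⟨ENNReal.ofReal C * M, by finiteness, fun T hT hT1 => ?_⟩
  calc _ ≤ l2 (fun x => ENNReal.ofReal (C * T ^ (1 - b)) *
        ENNReal.ofReal (jb (T * x) ^ (-(2 - b)))) := by
        refine l2_mono fun x => ?_
        rw [← ofReal_norm, ← ENNReal.ofReal_mul (jb_rpow_pos _ _).le,
          ← ENNReal.ofReal_mul (by positivity)]
        refine ENNReal.ofReal_le_ofReal ?_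
        rw [norm_mul, Complex.norm_real, Real.norm_of_nonneg hT.le]
        have pX := jb_pos (T * x)
        calc _ ≤ (T ^ (-b) * jb (T * x) ^ b) * (T * (C * jb (T * x) ^ (-2 : ℝ))) := by
              gcongr
              · exact jb_rpow_le_mul hT hT1 hb x
              · exact h _
          _ = C * (T ^ (-b) * T) * (jb (T * x) ^ b * jb (T * x) ^ (-2 : ℝ)) := by ring
          _ = _ := by
              nth_rw 2 [← Real.rpow_one T]
              rw [← Real.rpow_add hT, ← Real.rpow_add pX]
              ring_nf
    _ = ENNReal.ofReal (C * T ^ (1 - b)) * (ENNReal.ofReal (T ^ (-(1 / 2) : ℝ)) * M) := by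
        rw [l2_const_mul ENNReal.ofReal_ne_top,
          l2_comp_mul_left hT fun x => ENNReal.ofReal (jb x ^ (-(2 - b)))]
    _ ≤ _ := by
        rw [← mul_assoc, ← ENNReal.ofReal_mul (by positivity), mul_assoc C, ← Real.rpow_add hT,
          ENNReal.ofReal_mul hC.le]
        apply le_of_eq; ring_nf

/-! ### The Duhamel formula in the frequency variable -/

/-- The dispersion relation `κπξ²`. -/
def disp (κ ξ : ℝ) : ℝ := κ * Real.pi * ξ ^ 2

@[fun_prop]
theorem continuous_disp (κ : ℝ) : Continuous (disp κ) := by unfold disp; fun_prop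

@[fun_prop]
theorem measurable_disp (κ : ℝ) : Measurable (disp κ) := (continuous_disp κ).measurable

theorem wt_mk (κ k b ξ τ : ℝ) : wt κ k b (ξ, τ) = jb ξ ^ k * jb (τ + disp κ ξ) ^ b := rfl

/-- The solution at time `t` and frequency `ξ` of `∂ₜ y + 2πi·disp κ ξ·y = q` with datum `f`. -/
def duh (κ : ℝ) (f : ℝ → ℂ) (q : ℝ × ℝ → ℂ) (ξ t : ℝ) : ℂ :=
  ee (-(disp κ ξ * t)) * (f ξ + ∫ τ, q (ξ, τ) * duk t (τ + disp κ ξ))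

/-- The space-time Fourier transform of the localized Duhamel formula. -/
def duhF (χ : 𝓢(ℝ, ℂ)) (T κ : ℝ) (f : ℝ → ℂ) (q : ℝ × ℝ → ℂ) (z : ℝ × ℝ) : ℂ :=
  ∫ t, χ (t / T) * (ee (-(t * z.2)) * duh κ f q z.1 t)

/-- The size of the source at frequency `ξ`. -/
def srcSize (κ : ℝ) (q : ℝ × ℝ → ℂ) (ξ : ℝ) : ℝ≥0∞ :=
  ∫⁻ τ, ‖q (ξ, τ)‖ₑ * ENNReal.ofReal (jb (τ + disp κ ξ) ^ (-1 : ℝ))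

/-- The inverse Fourier transform in the time variable. -/
def tr (F : ℝ × ℝ → ℂ) (ξ t : ℝ) : ℂ := ∫ τ, ee (t * τ) * F (ξ, τ)

/-- The weighted `L²` norm in the space frequency. -/
def snorm (k : ℝ) (f : ℝ → ℂ) : ℝ≥0∞ := l2 fun ξ => ENNReal.ofReal (jb ξ ^ k) * ‖f ξ‖ₑ

/-- The weighted `L²` norm of a complex function. -/
def cnorm (κ k b : ℝ) (F : ℝ × ℝ → ℂ) : ℝ≥0∞ := wnorm κ k b fun z => ‖F z‖ₑ

section Measurability

variable {f : ℝ → ℂ} {q F : ℝ × ℝ → ℂ}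

theorem measurable_duh_comp (κ : ℝ) (hf : Measurable f) (hq : Measurable q) {α : Type*}
    [MeasurableSpace α] {x y : α → ℝ} (hx : Measurable x) (hy : Measurable y) :
    Measurable fun p => duh κ f q (x p) (y p) := by
  have h : StronglyMeasurable fun p : α × ℝ =>
      q (x p.1, p.2) * duk (y p.1) (p.2 + disp κ (x p.1)) := by
    refine Measurable.stronglyMeasurable ?_
    fun_prop
  have h2 : Measurable fun p : α => ∫ τ, q (x p, τ) * duk (y p) (τ + disp κ (x p)) :=
    h.integral_prod_right'.measurable
  unfold duh
  fun_prop

theorem measurable_duh (κ : ℝ) (hf : Measurable f) (hq : Measurable q) :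
    Measurable fun p : ℝ × ℝ => duh κ f q p.1 p.2 :=
  measurable_duh_comp κ hf hq measurable_fst measurable_snd

theorem measurable_duhF (χ : 𝓢(ℝ, ℂ)) (T κ : ℝ) (hf : Measurable f) (hq : Measurable q) :
    Measurable (duhF χ T κ f q) := by
  have h2 : Measurable χ := χ.continuous.measurable
  have h1 : Measurable fun p : (ℝ × ℝ) × ℝ => duh κ f q p.1.1 p.2 :=
    measurable_duh_comp κ hf hq (by fun_prop) (by fun_prop)
  have h3 : Measurable fun p : (ℝ × ℝ) × ℝ => χ (p.2 / T) * ee (-(p.2 * p.1.2)) := by fun_prop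
  have h : Measurable fun p : (ℝ × ℝ) × ℝ =>
      χ (p.2 / T) * (ee (-(p.2 * p.1.2)) * duh κ f q p.1.1 p.2) := by
    simp only [← mul_assoc]
    exact h3.mul h1
  exact h.stronglyMeasurable.integral_prod_right'.measurable

theorem measurable_srcSize (κ : ℝ) (hq : Measurable q) : Measurable (srcSize κ q) := by
  have h : Measurable fun p : ℝ × ℝ =>
      ‖q (p.1, p.2)‖ₑ * ENNReal.ofReal (jb (p.2 + disp κ p.1) ^ (-1 : ℝ)) := by fun_prop
  exact Measurable.lintegral_prod_right' h

theorem measurable_tr (hF : Measurable F) : Measurable fun p : ℝ × ℝ => tr F p.1 p.2 := by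
  have h : StronglyMeasurable fun p : (ℝ × ℝ) × ℝ => ee (p.1.2 * p.2) * F (p.1.1, p.2) := by
    refine Measurable.stronglyMeasurable ?_
    fun_prop
  exact h.integral_prod_right'.measurable

end Measurability

/-! ### Slice bounds -/

theorem wnorm_eq_l2_l2 (κ k b : ℝ) {F : ℝ × ℝ → ℝ≥0∞} (hF : Measurable F) :
    wnorm κ k b F = l2 fun ξ => ENNReal.ofReal (jb ξ ^ k) *
      l2 fun τ => ENNReal.ofReal (jb (τ + disp κ ξ) ^ b) * F (ξ, τ) := by
  unfold wnorm
  rw [l2_prod (by fun_prop)]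
  congr 1
  funext ξ
  rw [← l2_const_mul ENNReal.ofReal_ne_top]
  congr 1
  funext τ
  rw [wt_mk, ENNReal.ofReal_mul (jb_rpow_pos _ _).le, mul_assoc]

/-- Cauchy–Schwarz in `τ`: the power `-(p + β)` of `jb` is square integrable, and by translation
invariance its norm does not depend on the dispersion. The case `p = 1`, `β = -a` controls the
Duhamel integral; the case `p = 0`, `β = b` is the embedding behind continuity in time. -/
theorem exists_l2_slice_le {p β : ℝ} (h : 1 / 2 < p + β) :
    ∃ C : ℝ≥0∞, C ≠ ⊤ ∧ ∀ (κ k : ℝ) (F : ℝ × ℝ → ℝ≥0∞), Measurable F →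
      l2 (fun ξ => ENNReal.ofReal (jb ξ ^ k) *
        ∫⁻ τ, F (ξ, τ) * ENNReal.ofReal (jb (τ + disp κ ξ) ^ (-p))) ≤ C * wnorm κ k β F := by
  set N := l2 (fun x => ENNReal.ofReal (jb x ^ (-(p + β)))) with hN
  have hNt : N ≠ ⊤ := (l2_jb_lt_top h).ne
  refine ⟨N, hNt, fun κ k F hF => ?_⟩
  rw [wnorm_eq_l2_l2 κ k β hF, ← l2_const_mul hNt]
  refine l2_mono fun ξ => ?_
  rw [← mul_assoc, mul_comm N, mul_assoc]
  gcongr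
  have hsh : l2 (fun τ => ENNReal.ofReal (jb (τ + disp κ ξ) ^ (-(p + β)))) = N := by
    unfold l2 at hN ⊢
    rw [lintegral_add_right_eq_self (fun x => ENNReal.ofReal (jb x ^ (-(p + β))) ^ 2), hN]
  rw [← hsh]
  refine le_trans (le_of_eq ?_) (lintegral_mul_le_l2 (by fun_prop) (by fun_prop))
  refine lintegral_congr fun τ => ?_
  rw [← mul_assoc, ← ENNReal.ofReal_mul (jb_rpow_pos _ _).le, ← Real.rpow_add (jb_pos _), mul_comm]
  ring_nf

theorem ae_lt_top_of_l2 {g : ℝ → ℝ≥0∞} (hg : Measurable g) {k : ℝ}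
    (h : l2 (fun ξ => ENNReal.ofReal (jb ξ ^ k) * g ξ) ≠ ⊤) : ∀ᵐ ξ, g ξ < ⊤ := by
  have h1 : ∫⁻ ξ, (ENNReal.ofReal (jb ξ ^ k) * g ξ) ^ 2 ≠ ⊤ := by
    rw [← l2_sq]; exact ENNReal.pow_ne_top h
  filter_upwards [ae_lt_top (by fun_prop) h1] with ξ hξ
  by_contra hc
  rw [not_lt, top_le_iff] at hc
  rw [hc, ENNReal.mul_top (by simp [jb_rpow_pos])] at hξ
  simp at hξ

theorem exists_l2_srcSize_le {a : ℝ} (ha : a < 1 / 2) : ∃ C : ℝ≥0∞, C ≠ ⊤ ∧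
    ∀ (κ k : ℝ) (q : ℝ × ℝ → ℂ), Measurable q →
      l2 (fun ξ => ENNReal.ofReal (jb ξ ^ k) * srcSize κ q ξ) ≤ C * cnorm κ k (-a) q := by
  obtain ⟨C, hC, h⟩ := exists_l2_slice_le (p := 1) (β := -a) (by linarith)
  exact ⟨C, hC, fun κ k q hq => h κ k (fun z => ‖q z‖ₑ) (by fun_prop)⟩

theorem ae_srcSize_lt_top {a : ℝ} (ha : a < 1 / 2) {κ k : ℝ} {q : ℝ × ℝ → ℂ} (hq : Measurable q)
    (h : cnorm κ k (-a) q ≠ ⊤) : ∀ᵐ ξ, srcSize κ q ξ < ⊤ := by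
  obtain ⟨C, hC, hb⟩ := exists_l2_srcSize_le ha
  refine ae_lt_top_of_l2 (k := k) (measurable_srcSize κ hq) (ne_top_of_le_ne_top ?_ (hb κ k q hq))
  finiteness

theorem exists_l2_lintegral_le {b : ℝ} (hb : 1 / 2 < b) : ∃ C : ℝ≥0∞, C ≠ ⊤ ∧
    ∀ (κ k : ℝ) (F : ℝ × ℝ → ℂ), Measurable F →
      l2 (fun ξ => ENNReal.ofReal (jb ξ ^ k) * ∫⁻ τ, ‖F (ξ, τ)‖ₑ) ≤ C * cnorm κ k b F := by
  obtain ⟨C, hC, h⟩ := exists_l2_slice_le (p := 0) (β := b) (by linarith)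
  refine ⟨C, hC, fun κ k F hF => ?_⟩
  have := h κ k (fun z => ‖F z‖ₑ) (by fun_prop)
  simpa [cnorm] using this

theorem measurable_lintegral_slice {F : ℝ × ℝ → ℂ} (hF : Measurable F) :
    Measurable fun ξ => ∫⁻ τ, ‖F (ξ, τ)‖ₑ := by
  have h : Measurable fun p : ℝ × ℝ => ‖F (p.1, p.2)‖ₑ := by fun_prop
  exact Measurable.lintegral_prod_right' h

theorem ae_integrable_slice {b : ℝ} (hb : 1 / 2 < b) {κ k : ℝ} {F : ℝ × ℝ → ℂ} (hF : Measurable F)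
    (h : cnorm κ k b F ≠ ⊤) : ∀ᵐ ξ, Integrable fun τ => F (ξ, τ) := by
  obtain ⟨C, hC, hb'⟩ := exists_l2_lintegral_le hb
  filter_upwards [ae_lt_top_of_l2 (k := k) (measurable_lintegral_slice hF)
    (ne_top_of_le_ne_top (by finiteness) (hb' κ k F hF))] with ξ hξ
  exact ⟨(by fun_prop : Measurable fun τ => F (ξ, τ)).aestronglyMeasurable, hξ⟩

theorem enorm_tr_le (F : ℝ × ℝ → ℂ) (ξ t : ℝ) : ‖tr F ξ t‖ₑ ≤ ∫⁻ τ, ‖F (ξ, τ)‖ₑ := by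
  refine (enorm_integral_le_lintegral_enorm _).trans (le_of_eq ?_)
  simp [enorm_mul]

theorem continuous_tr {F : ℝ × ℝ → ℂ} {ξ : ℝ} (h : Integrable fun τ => F (ξ, τ)) :
    Continuous fun t => tr F ξ t := by
  unfold tr
  refine continuous_of_dominated (bound := fun τ => ‖F (ξ, τ)‖) (fun t => ?_) (fun t => ?_) h.norm
    (Eventually.of_forall fun τ => by fun_prop)
  · exact (Continuous.aestronglyMeasurable (by fun_prop)).mul h.aestronglyMeasurable
  · exact Eventually.of_forall fun τ => by simp

section Slice

variable {κ : ℝ} {f : ℝ → ℂ} {q : ℝ × ℝ → ℂ} {ξ : ℝ}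

theorem integrable_src (hq : Measurable q) (h : srcSize κ q ξ < ⊤) :
    Integrable fun τ => ‖q (ξ, τ)‖ * (jb (τ + disp κ ξ))⁻¹ := by
  refine ⟨(by fun_prop : Measurable fun τ => ‖q (ξ, τ)‖ *
    (jb (τ + disp κ ξ))⁻¹).aestronglyMeasurable, ?_⟩
  refine lt_of_eq_of_lt (lintegral_congr fun τ => ?_) h
  have := jb_pos (τ + disp κ ξ)
  rw [enorm_mul, enorm_norm, Real.rpow_neg_one, ← ofReal_norm, ← ofReal_norm,
    Real.norm_of_nonneg (by positivity)]

theorem norm_mul_duk_le (τ t : ℝ) : ‖q (ξ, τ) * duk t (τ + disp κ ξ)‖ ≤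
    (|t| + 2) * (‖q (ξ, τ)‖ * (jb (τ + disp κ ξ))⁻¹) := by
  rw [norm_mul]
  calc _ ≤ ‖q (ξ, τ)‖ * ((|t| + 2) * (jb (τ + disp κ ξ))⁻¹) := by
        gcongr; exact norm_duk_le _ _
    _ = _ := by ring

theorem integrable_mul_duk (hq : Measurable q) (h : srcSize κ q ξ < ⊤) (t : ℝ) :
    Integrable fun τ => q (ξ, τ) * duk t (τ + disp κ ξ) :=
  ((integrable_src hq h).const_mul (|t| + 2)).mono'
    (by fun_prop : Measurable fun τ => q (ξ, τ) * duk t (τ + disp κ ξ)).aestronglyMeasurable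
    (Eventually.of_forall fun τ => norm_mul_duk_le τ t)

theorem norm_integral_mul_duk_le (hq : Measurable q) (h : srcSize κ q ξ < ⊤) (t : ℝ) :
    ‖∫ τ, q (ξ, τ) * duk t (τ + disp κ ξ)‖ ≤ (|t| + 2) * (srcSize κ q ξ).toReal := by
  have e : (srcSize κ q ξ).toReal = ∫ τ, ‖q (ξ, τ)‖ * (jb (τ + disp κ ξ))⁻¹ := by
    rw [integral_eq_lintegral_of_nonneg_ae (Eventually.of_forall fun τ => by
      have := jb_pos (τ + disp κ ξ); positivity) (integrable_src hq h).aestronglyMeasurable]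
    unfold srcSize
    congr 1
    refine lintegral_congr fun τ => ?_
    rw [ENNReal.ofReal_mul (norm_nonneg _), ofReal_norm, Real.rpow_neg_one]
  rw [e, ← integral_const_mul]
  exact norm_integral_le_of_norm_le ((integrable_src hq h).const_mul _)
    (Eventually.of_forall fun τ => norm_mul_duk_le τ t)

theorem norm_duh_le (hq : Measurable q) (h : srcSize κ q ξ < ⊤) (t : ℝ) :
    ‖duh κ f q ξ t‖ ≤ ‖f ξ‖ + (|t| + 2) * (srcSize κ q ξ).toReal := by
  unfold duh
  rw [norm_mul, norm_ee, one_mul]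
  exact (norm_add_le _ _).trans (by gcongr; exact norm_integral_mul_duk_le hq h t)

theorem continuous_integral_mul_duk (hq : Measurable q) (h : srcSize κ q ξ < ⊤) :
    Continuous fun t => ∫ τ, q (ξ, τ) * duk t (τ + disp κ ξ) := by
  rw [continuous_iff_continuousAt]
  intro t₀
  refine continuousAt_of_dominated
    (bound := fun τ => (|t₀| + 1 + 2) * (‖q (ξ, τ)‖ * (jb (τ + disp κ ξ))⁻¹)) ?_ ?_ ?_ ?_
  · exact Eventually.of_forall fun t => (integrable_mul_duk hq h t).aestronglyMeasurable
  · have : ∀ᶠ t in 𝓝 t₀, |t| < |t₀| + 1 :=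
      continuous_abs.continuousAt.eventually_lt continuousAt_const (by linarith)
    filter_upwards [this] with t ht
    refine Eventually.of_forall fun τ => (norm_mul_duk_le τ t).trans ?_
    have := jb_pos (τ + disp κ ξ)
    gcongr
  · exact (integrable_src hq h).const_mul _
  · refine Eventually.of_forall fun τ => ?_
    exact (continuous_const.mul (continuous_duk.comp (by fun_prop :
      Continuous fun t : ℝ => (t, τ + disp κ ξ)))).continuousAt

theorem continuous_duh (hq : Measurable q) (h : srcSize κ q ξ < ⊤) :
    Continuous fun t => duh κ f q ξ t := by
  have := continuous_integral_mul_duk hq h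
  unfold duh
  fun_prop

theorem integrable_cutoff_mul_linear (χ : 𝓢(ℝ, ℂ)) {T : ℝ} (hT : 0 < T) :
    Integrable fun t => ‖χ (t / T)‖ * (|t| + 2) := by
  have h1 : Integrable fun t : ℝ => ‖t‖ ^ 1 * ‖χ t‖ := χ.integrable_pow_mul volume 1
  have h2 := (h1.comp_div hT.ne').const_mul T
  refine (h2.add ((integrable_cutoff χ hT).norm.const_mul 2)).congr
    (Eventually.of_forall fun t => ?_)
  simp only [pow_one, norm_div, Real.norm_eq_abs, abs_of_pos hT, Pi.add_apply]
  field_simp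

theorem integrable_cutoff_duh (χ : 𝓢(ℝ, ℂ)) {T : ℝ} (hT : 0 < T) (hq : Measurable q)
    (h : srcSize κ q ξ < ⊤) : Integrable fun t => χ (t / T) * duh κ f q ξ t := by
  refine ((integrable_cutoff_mul_linear χ hT).mul_const
    (‖f ξ‖ + (srcSize κ q ξ).toReal)).mono' ?_ (Eventually.of_forall fun t => ?_)
  · exact ((χ.continuous.comp (by fun_prop)).mul (continuous_duh hq h)).aestronglyMeasurable
  · rw [norm_mul, mul_assoc]
    gcongr
    refine (norm_duh_le hq h t).trans ?_
    have : 0 ≤ (srcSize κ q ξ).toReal := ENNReal.toReal_nonneg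
    nlinarith [abs_nonneg t, norm_nonneg (f ξ)]

theorem duhF_eq_fourier (χ : 𝓢(ℝ, ℂ)) (T : ℝ) (τ : ℝ) :
    duhF χ T κ f q (ξ, τ) = 𝓕 (fun t => χ (t / T) * duh κ f q ξ t) τ := by
  rw [fourier_eq_integral_ee]
  unfold duhF
  refine integral_congr_ae (Eventually.of_forall fun t => ?_)
  simp only; ring

/-- The trace of the localized Duhamel formula. -/
theorem tr_duhF (χ : 𝓢(ℝ, ℂ)) {T : ℝ} (hT : 0 < T) (hq : Measurable q) (h : srcSize κ q ξ < ⊤)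
    (hi : Integrable fun τ => duhF χ T κ f q (ξ, τ)) (t : ℝ) :
    tr (duhF χ T κ f q) ξ t = χ (t / T) * duh κ f q ξ t := by
  have hc : Continuous fun t => χ (t / T) * duh κ f q ξ t :=
    (χ.continuous.comp (by fun_prop)).mul (continuous_duh hq h)
  have h1 : 𝓕 (fun t => χ (t / T) * duh κ f q ξ t) = fun τ => duhF χ T κ f q (ξ, τ) := by
    funext τ; rw [duhF_eq_fourier]
  have h2 := congrFun (hc.fourierInv_fourier_eq (integrable_cutoff_duh χ hT hq h)
    (by rw [h1]; exact hi)) t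
  rw [h1, fourierInv_eq_integral_ee] at h2
  rw [← h2]
  unfold tr
  simp_rw [mul_comm t]

/-- Fubini. In the shifted variable `τ + disp κ ξ` the dispersion disappears, so the same
one-dimensional operator acts at every frequency and for every `κ`. -/
theorem duhF_expand (χ : 𝓢(ℝ, ℂ)) {T : ℝ} (hT : 0 < T) (hq : Measurable q)
    (h : srcSize κ q ξ < ⊤) (τ : ℝ) : duhF χ T κ f q (ξ, τ) =
      f ξ * (T * (𝓕 χ : 𝓢(ℝ, ℂ)) (T * (τ + disp κ ξ))) +
      ∫ τ', q (ξ, τ') * ∫ t, χ (t / T) *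
        (ee (-(t * (τ + disp κ ξ))) * duk t (τ' + disp κ ξ)) := by
  have hi : Integrable (Function.uncurry fun t τ' : ℝ => χ (t / T) *
      (ee (-(t * (τ + disp κ ξ))) * (q (ξ, τ') * duk t (τ' + disp κ ξ)))) := by
    have hmeas : Measurable (Function.uncurry fun t τ' : ℝ => χ (t / T) *
        (ee (-(t * (τ + disp κ ξ))) * (q (ξ, τ') * duk t (τ' + disp κ ξ)))) := by
      have h2 : Measurable χ := χ.continuous.measurable
      unfold Function.uncurry
      fun_prop
    refine ((integrable_cutoff_mul_linear χ hT).mul_prod (integrable_src hq h)).mono'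
      hmeas.aestronglyMeasurable (Eventually.of_forall fun p => ?_)
    simp only [Function.uncurry, norm_mul, norm_ee, one_mul]
    have := norm_mul_duk_le (κ := κ) (q := q) (ξ := ξ) p.2 p.1
    rw [norm_mul] at this
    calc _ ≤ ‖χ (p.1 / T)‖ * ((|p.1| + 2) * (‖q (ξ, p.2)‖ * (jb (p.2 + disp κ ξ))⁻¹)) := by
          gcongr
      _ = _ := by ring
  have e1 : ∀ t, χ (t / T) * (ee (-(t * τ)) * duh κ f q ξ t) =
      f ξ * (χ (t / T) * ee (-(t * (τ + disp κ ξ)))) +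
      ∫ τ', χ (t / T) * (ee (-(t * (τ + disp κ ξ))) * (q (ξ, τ') * duk t (τ' + disp κ ξ))) := by
    intro t
    rw [integral_const_mul, integral_const_mul,
      show -(t * (τ + disp κ ξ)) = -(t * τ) + -(disp κ ξ * t) by ring, ee_add]
    unfold duh
    ring
  unfold duhF
  simp only [e1]
  rw [integral_add, integral_const_mul, integral_cutoff_ee χ hT, integral_integral_swap hi]
  · congr 1
    refine integral_congr_ae (Eventually.of_forall fun τ' => ?_)
    simp only
    rw [← integral_const_mul]
    refine integral_congr_ae (Eventually.of_forall fun t => ?_)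
    simp only; ring
  · exact ((integrable_cutoff χ hT).mul_bdd (c := 1) (by fun_prop)
      (Eventually.of_forall fun t => by simp)).const_mul _
  · exact hi.integral_prod_left

end Slice

/-- The linear estimate. -/
theorem exists_cnorm_duhF_le (χ : 𝓢(ℝ, ℂ)) {a b : ℝ} (ha : 0 ≤ a) (ha2 : a < 1 / 2)
    (hb : 0 ≤ b) (hb1 : b < 1) (hab : a + b ≤ 1) : ∃ C : ℝ≥0∞, C ≠ ⊤ ∧
    ∀ (κ k T : ℝ) (f : ℝ → ℂ) (q : ℝ × ℝ → ℂ), 0 < T → T ≤ 1 → Measurable f → Measurable q →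
      cnorm κ k (-a) q ≠ ⊤ → cnorm κ k b (duhF χ T κ f q) ≤
        C * (ENNReal.ofReal (T ^ (1 / 2 - b)) * snorm k f +
          ENNReal.ofReal (T ^ (1 - a - b)) * cnorm κ k (-a) q) := by
  obtain ⟨C₀, hC₀, h₀⟩ := exists_cutoffHat_le χ hb hb1
  obtain ⟨C₁, hC₁, h₁⟩ := exists_dukHat_operator_le χ ha ha2 hb hb1 hab
  refine ⟨C₀ + C₁, by finiteness, fun κ k T f q hT hT1 hf hq hfin => ?_⟩
  have hgood := ae_srcSize_lt_top ha2 hq hfin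
  have hslice : ∀ᵐ ξ, ENNReal.ofReal (jb ξ ^ k) *
      l2 (fun τ => ENNReal.ofReal (jb (τ + disp κ ξ) ^ b) * ‖duhF χ T κ f q (ξ, τ)‖ₑ) ≤
      C₀ * ENNReal.ofReal (T ^ (1 / 2 - b)) * (ENNReal.ofReal (jb ξ ^ k) * ‖f ξ‖ₑ) +
      C₁ * ENNReal.ofReal (T ^ (1 - a - b)) * (ENNReal.ofReal (jb ξ ^ k) *
        l2 (fun τ => ENNReal.ofReal (jb (τ + disp κ ξ) ^ (-a)) * ‖q (ξ, τ)‖ₑ)) := by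
    filter_upwards [hgood] with ξ hξ
    set A : ℝ → ℝ≥0∞ := fun x => ENNReal.ofReal (jb x ^ b) * ‖T * (𝓕 χ : 𝓢(ℝ, ℂ)) (T * x)‖ₑ
    set g : ℝ → ℝ≥0∞ := fun ν => ‖q (ξ, ν - disp κ ξ)‖ₑ with hg
    set B : ℝ → ℝ≥0∞ := fun x => ENNReal.ofReal (jb x ^ b) * ∫⁻ ν, dukHat χ T x ν * g ν
    have mA : Measurable A := by
      have h2 : Measurable (𝓕 χ : 𝓢(ℝ, ℂ)) := (𝓕 χ : 𝓢(ℝ, ℂ)).continuous.measurable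
      fun_prop
    have mB : Measurable B := by
      have h2 : Measurable χ := χ.continuous.measurable
      have h3 : StronglyMeasurable fun p : (ℝ × ℝ) × ℝ =>
          χ (p.2 / T) * (ee (-(p.2 * p.1.1)) * duk p.2 p.1.2) := by
        refine Measurable.stronglyMeasurable ?_
        fun_prop
      have h4 : Measurable fun p : ℝ × ℝ => dukHat χ T p.1 p.2 * g p.2 := by
        have h6 : Measurable fun p : ℝ × ℝ => ∫ t, χ (t / T) * (ee (-(t * p.1)) * duk t p.2) :=
          h3.integral_prod_right'.measurable
        exact h6.enorm.mul (by fun_prop)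
      have h5 : Measurable fun x => ∫⁻ ν, dukHat χ T x ν * g ν :=
        Measurable.lintegral_prod_right' h4
      exact Measurable.mul (by fun_prop) h5
    have hpt : ∀ τ, ENNReal.ofReal (jb (τ + disp κ ξ) ^ b) * ‖duhF χ T κ f q (ξ, τ)‖ₑ ≤
        ‖f ξ‖ₑ * A (τ + disp κ ξ) + B (τ + disp κ ξ) := by
      intro τ
      rw [duhF_expand χ hT hq hξ]
      calc _ ≤ ENNReal.ofReal (jb (τ + disp κ ξ) ^ b) *
            (‖f ξ‖ₑ * ‖T * (𝓕 χ : 𝓢(ℝ, ℂ)) (T * (τ + disp κ ξ))‖ₑ +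
            ∫⁻ ν, dukHat χ T (τ + disp κ ξ) ν * g ν) := by
            gcongr
            refine (enorm_add_le _ _).trans ?_
            rw [enorm_mul]
            gcongr
            refine (enorm_integral_le_lintegral_enorm _).trans (le_of_eq ?_)
            rw [← lintegral_sub_right_eq_self _ (disp κ ξ)]
            refine lintegral_congr fun ν => ?_
            rw [enorm_mul, sub_add_cancel, mul_comm, hg]
            rfl
        _ = _ := by simp only [A, B]; ring
    have hl2 : l2 (fun τ => ENNReal.ofReal (jb (τ + disp κ ξ) ^ b) *
        ‖duhF χ T κ f q (ξ, τ)‖ₑ) ≤ ‖f ξ‖ₑ * l2 A + l2 B := by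
      calc _ ≤ l2 (fun τ => ‖f ξ‖ₑ * A (τ + disp κ ξ) + B (τ + disp κ ξ)) := l2_mono hpt
        _ = l2 (fun x => ‖f ξ‖ₑ * A x + B x) := by
            unfold l2
            rw [lintegral_add_right_eq_self (fun x => (‖f ξ‖ₑ * A x + B x) ^ 2)]
        _ ≤ _ := by
            refine (l2_add_le (by fun_prop) mB).trans ?_
            rw [l2_const_mul enorm_ne_top]
    have hB := h₁ T hT hT1 g (by fun_prop)
    have hgn : l2 (fun ν => ENNReal.ofReal (jb ν ^ (-a)) * g ν) =
        l2 (fun τ => ENNReal.ofReal (jb (τ + disp κ ξ) ^ (-a)) * ‖q (ξ, τ)‖ₑ) := by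
      unfold l2
      rw [← lintegral_add_right_eq_self _ (disp κ ξ)]
      simp [hg]
    rw [hgn] at hB
    calc _ ≤ ENNReal.ofReal (jb ξ ^ k) * (‖f ξ‖ₑ * (C₀ * ENNReal.ofReal (T ^ (1 / 2 - b))) +
          C₁ * (ENNReal.ofReal (T ^ (1 - a - b)) *
            l2 (fun τ => ENNReal.ofReal (jb (τ + disp κ ξ) ^ (-a)) * ‖q (ξ, τ)‖ₑ))) := by
          gcongr
          refine hl2.trans ?_
          gcongr
          exact h₀ T hT hT1
      _ = _ := by ring
  unfold cnorm
  rw [wnorm_eq_l2_l2 κ k b (measurable_duhF χ T κ hf hq).enorm]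
  refine (l2_mono_ae hslice).trans ?_
  have mq : Measurable fun ξ => l2 (fun τ => ENNReal.ofReal (jb (τ + disp κ ξ) ^ (-a)) *
      ‖q (ξ, τ)‖ₑ) := measurable_l2_right (by unfold Function.uncurry; fun_prop)
  refine (l2_add_le (by fun_prop) (by fun_prop)).trans ?_
  rw [l2_const_mul (by finiteness), l2_const_mul (by finiteness),
    wnorm_eq_l2_l2 κ k (-a) hq.enorm]
  unfold snorm
  set P := l2 fun ξ => ENNReal.ofReal (jb ξ ^ k) * ‖f ξ‖ₑ
  set Q := l2 fun ξ => ENNReal.ofReal (jb ξ ^ k) *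
    l2 (fun τ => ENNReal.ofReal (jb (τ + disp κ ξ) ^ (-a)) * ‖q (ξ, τ)‖ₑ)
  calc _ = C₀ * (ENNReal.ofReal (T ^ (1 / 2 - b)) * P) +
        C₁ * (ENNReal.ofReal (T ^ (1 - a - b)) * Q) := by ring
    _ ≤ (C₀ + C₁) * (ENNReal.ofReal (T ^ (1 / 2 - b)) * P) +
        (C₀ + C₁) * (ENNReal.ofReal (T ^ (1 - a - b)) * Q) := by
        gcongr
        · exact le_self_add
        · exact le_add_self
    _ = _ := by ring

/-! ### Convolutions and the source terms of the system -/

/-- The convolution of complex functions on the frequency plane. -/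
def cv (F G : ℝ × ℝ → ℂ) (z : ℝ × ℝ) : ℂ := ∫ w, F w * G (z - w)

/-- The Fourier transform of the complex conjugate. -/
def cj (F : ℝ × ℝ → ℂ) (z : ℝ × ℝ) : ℂ := (starRingEnd ℂ) (F (-z))

theorem measurable_cv {F G : ℝ × ℝ → ℂ} (hF : Measurable F) (hG : Measurable G) :
    Measurable (cv F G) := by
  have h : Measurable fun p : (ℝ × ℝ) × (ℝ × ℝ) => F p.2 * G (p.1 - p.2) := by fun_prop
  exact h.stronglyMeasurable.integral_prod_right'.measurable

theorem measurable_cj {F : ℝ × ℝ → ℂ} (hF : Measurable F) : Measurable (cj F) :=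
  Complex.continuous_conj.measurable.comp (hF.comp measurable_neg)

theorem enorm_cj (F : ℝ × ℝ → ℂ) (z : ℝ × ℝ) : ‖cj F z‖ₑ = ‖F (-z)‖ₑ := by
  unfold cj
  rw [← ofReal_norm, RCLike.norm_conj, ofReal_norm]

theorem enorm_cv_le (F G : ℝ × ℝ → ℂ) (z : ℝ × ℝ) :
    ‖cv F G z‖ₑ ≤ lconv (fun w => ‖F w‖ₑ) (fun w => ‖G w‖ₑ) z := by
  refine (enorm_integral_le_lintegral_enorm _).trans (le_of_eq ?_)
  simp [enorm_mul, lconv]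

section Norms

variable {κ k b : ℝ} {F G : ℝ × ℝ → ℂ}

theorem wnorm_mono {F G : ℝ × ℝ → ℝ≥0∞} (h : ∀ᵐ z, F z ≤ G z) : wnorm κ k b F ≤ wnorm κ k b G :=
  l2_mono_ae (h.mono fun z hz => by gcongr)

theorem wnorm_mono_exponent {c : ℝ} (h : b ≤ c) (F : ℝ × ℝ → ℝ≥0∞) :
    wnorm κ k b F ≤ wnorm κ k c F := by
  refine l2_mono fun z => ?_
  gcongr
  unfold wt
  have := jb_rpow_pos z.1 k
  gcongr
  exact one_le_jb _

theorem cnorm_mono_exponent {c : ℝ} (h : b ≤ c) (F : ℝ × ℝ → ℂ) :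
    cnorm κ k b F ≤ cnorm κ k c F := wnorm_mono_exponent h _

theorem cnorm_congr (h : F =ᵐ[volume] G) : cnorm κ k b F = cnorm κ k b G :=
  l2_congr_ae (h.mono fun z hz => by simp only [hz])

theorem cnorm_add_le (hF : Measurable F) (hG : Measurable G) :
    cnorm κ k b (fun z => F z + G z) ≤ cnorm κ k b F + cnorm κ k b G := by
  refine le_trans (l2_mono fun z => ?_)
    (l2_add_le ((measurable_wt κ k b).ennreal_ofReal.mul hF.enorm)
      ((measurable_wt κ k b).ennreal_ofReal.mul hG.enorm))
  rw [← mul_add]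
  gcongr
  exact enorm_add_le _ _

theorem cnorm_const_mul (c : ℂ) (F : ℝ × ℝ → ℂ) :
    cnorm κ k b (fun z => c * F z) = ‖c‖ₑ * cnorm κ k b F := by
  unfold cnorm wnorm
  rw [← l2_const_mul enorm_ne_top]
  congr 1
  funext z
  simp only [enorm_mul]; ring

theorem cnorm_zero : cnorm κ k b (fun _ => 0) = 0 := by
  have := cnorm_const_mul (κ := κ) (k := k) (b := b) 0 (fun _ => 0)
  simpa using this

theorem cnorm_sub_le (hF : Measurable F) (hG : Measurable G) :
    cnorm κ k b (fun z => F z - G z) ≤ cnorm κ k b F + cnorm κ k b G := by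
  have h := cnorm_add_le (κ := κ) (k := k) (b := b) hF (hG.const_mul (-1))
  rw [cnorm_const_mul] at h
  simpa [sub_eq_add_neg] using h

theorem ae_lt_top_of_wnorm {F : ℝ × ℝ → ℝ≥0∞} (hF : Measurable F) (h : wnorm κ k b F ≠ ⊤) :
    ∀ᵐ z, F z < ⊤ := by
  have h1 : ∫⁻ z, (ENNReal.ofReal (wt κ k b z) * F z) ^ 2 ≠ ⊤ := by
    rw [← l2_sq]; exact ENNReal.pow_ne_top h
  have hw := measurable_wt κ k b
  filter_upwards [ae_lt_top (by fun_prop) h1] with z hz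
  by_contra hc
  rw [not_lt, top_le_iff] at hc
  rw [hc, ENNReal.mul_top (by simp [wt_pos])] at hz
  simp at hz

theorem ae_integrable_cv (hF : Measurable F) (hG : Measurable G)
    (h : wnorm κ k b (lconv (fun w => ‖F w‖ₑ) (fun w => ‖G w‖ₑ)) ≠ ⊤) :
    ∀ᵐ z, Integrable fun w => F w * G (z - w) := by
  filter_upwards [ae_lt_top_of_wnorm (measurable_lconv hF.enorm hG.enorm) h] with z hz
  refine ⟨(by fun_prop : Measurable fun w => F w * G (z - w)).aestronglyMeasurable, ?_⟩
  refine lt_of_eq_of_lt (lintegral_congr fun w => ?_) hz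
  rw [enorm_mul]

end Norms

/-- The bilinear estimates of the system at the regularity `(k, s)`. -/
structure BilinearBounds (k s a b : ℝ) (C : ℝ≥0∞) : Prop where
  ne_top : C ≠ ⊤
  product : ∀ F G : ℝ × ℝ → ℝ≥0∞, Measurable F → Measurable G →
      wnorm 1 k (-a) (lconv F G) ≤ C * (wnorm 1 k b F * wnorm 0 s b G)
  modulus : ∀ F G : ℝ × ℝ → ℝ≥0∞, Measurable F → Measurable G →
      wnorm 0 s (-a) (lconv F fun w => G (-w)) ≤ C * (wnorm 1 k b F * wnorm 1 k b G)

/-- The exponent `c = 2a` is placed between `max (1 - γ/2) γ` and `1`, which is possible because `0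
< γ < 1`; then `c > 1/2` gives `a ≥ 1/4`. It is fixed before `b`, so that `b` can afterwards be
taken close to `1/2`, depending on `a`. -/
theorem exists_bilinearBounds {k s : ℝ} (hks : |k| - 1 / 2 ≤ s)
    (hs : s < min (k + 1 / 2) (2 * k + 1 / 2)) (hk : -(1 / 4) < k) :
    ∃ a : ℝ, 1 / 4 ≤ a ∧ a < 1 / 2 ∧ ∀ b : ℝ, 1 / 2 < b → ∃ C, BilinearBounds k s a b C := by
  obtain ⟨γ, h0, h1, hw⟩ := exists_interpolation_exponent hs hk
  obtain ⟨c, hc1, hc2⟩ := exists_between (max_lt (by linarith) h1 : max (1 - γ / 2) γ < 1)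
  obtain ⟨hc3, hc4⟩ := max_lt_iff.1 hc1
  refine ⟨c / 2, by linarith, by linarith, fun b hb => ?_⟩
  obtain ⟨C, hC, h⟩ := exists_product_le (a := c / 2) hks (by linarith) hb
  obtain ⟨C', hC', h'⟩ := exists_modulus_le (a := c / 2) (b := b) h0 h1 hw (by linarith)
    (by linarith) (by linarith) hb
  refine ⟨C + C', by finiteness, fun F G hF hG => (h F G hF hG).trans ?_,
    fun F G hF hG => (h' F G hF hG).trans ?_⟩
  · gcongr; exact le_self_add
  · gcongr; exact le_add_self

/-- The source term `-i u v`. -/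
def srcU (F G : ℝ × ℝ → ℂ) (z : ℝ × ℝ) : ℂ := -Complex.I * cv F G z

/-- The source term `(ε u w̄ - v) / σ`. -/
def srcV (σ ε : ℝ) (F H G : ℝ × ℝ → ℂ) (z : ℝ × ℝ) : ℂ :=
  (σ : ℂ)⁻¹ * (ε * cv F (cj H) z - G z)

theorem measurable_srcU {F G : ℝ × ℝ → ℂ} (hF : Measurable F) (hG : Measurable G) :
    Measurable (srcU F G) := (measurable_cv hF hG).const_mul _

theorem measurable_srcV (σ ε : ℝ) {F H G : ℝ × ℝ → ℂ} (hF : Measurable F) (hH : Measurable H)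
    (hG : Measurable G) : Measurable (srcV σ ε F H G) :=
  (((measurable_cv hF (measurable_cj hH)).const_mul _).sub hG).const_mul _

section Source

variable {σ ε k s a b : ℝ} {C : ℝ≥0∞} {F F' G G' H H' : ℝ × ℝ → ℂ}

namespace BilinearBounds

theorem wnorm_product_ne_top (h : BilinearBounds k s a b C) (hF : Measurable F)
    (hG : Measurable G) (nF : cnorm 1 k b F ≠ ⊤) (nG : cnorm 0 s b G ≠ ⊤) :
    wnorm 1 k (-a) (lconv (fun w => ‖F w‖ₑ) (fun w => ‖G w‖ₑ)) ≠ ⊤ := by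
  refine ne_top_of_le_ne_top ?_ (h.product _ _ hF.enorm hG.enorm)
  exact ENNReal.mul_ne_top h.ne_top (ENNReal.mul_ne_top nF nG)

theorem wnorm_modulus_ne_top (h : BilinearBounds k s a b C) (hF : Measurable F)
    (hG : Measurable G) (nF : cnorm 1 k b F ≠ ⊤) (nG : cnorm 1 k b G ≠ ⊤) :
    wnorm 0 s (-a) (lconv (fun w => ‖F w‖ₑ) (fun w => ‖cj G w‖ₑ)) ≠ ⊤ := by
  simp only [enorm_cj]
  refine ne_top_of_le_ne_top ?_ (h.modulus _ _ hF.enorm hG.enorm)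
  exact ENNReal.mul_ne_top h.ne_top (ENNReal.mul_ne_top nF nG)

theorem cnorm_srcU_le (h : BilinearBounds k s a b C) (hF : Measurable F) (hG : Measurable G) :
    cnorm 1 k (-a) (srcU F G) ≤ C * (cnorm 1 k b F * cnorm 0 s b G) := by
  unfold srcU
  have e : ‖-Complex.I‖ₑ = 1 := by rw [← ofReal_norm]; simp
  rw [cnorm_const_mul, e, one_mul]
  exact (wnorm_mono (Eventually.of_forall fun z => enorm_cv_le F G z)).trans
    (h.product _ _ hF.enorm hG.enorm)

theorem cnorm_srcV_le (h : BilinearBounds k s a b C) (ha : 0 ≤ a) (hb : 0 ≤ b)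
    (hF : Measurable F) (hH : Measurable H) (hG : Measurable G) :
    cnorm 0 s (-a) (srcV σ ε F H G) ≤ ENNReal.ofReal |σ|⁻¹ * (ENNReal.ofReal |ε| * C + 1) *
      (cnorm 1 k b F * cnorm 1 k b H + cnorm 0 s b G) := by
  have hm := measurable_cv hF (measurable_cj hH)
  have e1 : ‖((σ : ℂ))⁻¹‖ₑ = ENNReal.ofReal |σ|⁻¹ := by
    rw [← ofReal_norm, norm_inv, Complex.norm_real, Real.norm_eq_abs]
  have e2 : ‖(ε : ℂ)‖ₑ = ENNReal.ofReal |ε| := by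
    rw [← ofReal_norm, Complex.norm_real, Real.norm_eq_abs]
  unfold srcV
  rw [cnorm_const_mul, e1, mul_assoc]
  gcongr
  have h1 : cnorm 0 s (-a) (cv F (cj H)) ≤ C * (cnorm 1 k b F * cnorm 1 k b H) := by
    refine (wnorm_mono (Eventually.of_forall fun z => enorm_cv_le F (cj H) z)).trans ?_
    simp only [enorm_cj]
    exact h.modulus _ _ hF.enorm hH.enorm
  have h2 : cnorm 0 s (-a) G ≤ cnorm 0 s b G := cnorm_mono_exponent (by linarith) G
  refine (cnorm_sub_le (hm.const_mul _) hG).trans ?_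
  rw [cnorm_const_mul, e2]
  calc _ ≤ ENNReal.ofReal |ε| * (C * (cnorm 1 k b F * cnorm 1 k b H)) + cnorm 0 s b G := by gcongr
    _ ≤ (ENNReal.ofReal |ε| * C + 1) * (cnorm 1 k b F * cnorm 1 k b H) +
        (ENNReal.ofReal |ε| * C + 1) * cnorm 0 s b G := by
        rw [← mul_assoc]
        gcongr
        · exact le_self_add
        · exact le_mul_of_one_le_left zero_le le_add_self
    _ = _ := by ring

/-- The identity is bilinearity of the convolution. It holds only almost everywhere because absolute
convergence, supplied by the bilinear estimate, is known only there. -/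
theorem srcU_sub_ae (h : BilinearBounds k s a b C) (hF : Measurable F) (hF' : Measurable F')
    (hG : Measurable G) (hG' : Measurable G') (nF : cnorm 1 k b F ≠ ⊤) (nF' : cnorm 1 k b F' ≠ ⊤)
    (nG : cnorm 0 s b G ≠ ⊤) (nG' : cnorm 0 s b G' ≠ ⊤) : ∀ᵐ z, srcU F G z - srcU F' G' z =
      srcU (fun w => F w - F' w) G z + srcU F' (fun w => G w - G' w) z := by
  filter_upwards [ae_integrable_cv hF hG (h.wnorm_product_ne_top hF hG nF nG),
    ae_integrable_cv hF' hG (h.wnorm_product_ne_top hF' hG nF' nG),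
    ae_integrable_cv hF' hG' (h.wnorm_product_ne_top hF' hG' nF' nG')] with z h1 h2 h3
  simp only [srcU, cv, sub_mul, mul_sub]
  rw [integral_sub h1 h2, integral_sub h2 h3]
  ring

theorem srcV_sub_ae (h : BilinearBounds k s a b C) (hF : Measurable F) (hF' : Measurable F')
    (nF : cnorm 1 k b F ≠ ⊤) (nF' : cnorm 1 k b F' ≠ ⊤) (G G' : ℝ × ℝ → ℂ) :
    ∀ᵐ z, srcV σ ε F F G z - srcV σ ε F' F' G' z =
      srcV σ ε (fun w => F w - F' w) F (fun w => G w - G' w) z +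
      srcV σ ε F' (fun w => F w - F' w) (fun _ => 0) z := by
  filter_upwards [ae_integrable_cv hF (measurable_cj hF) (h.wnorm_modulus_ne_top hF hF nF nF),
    ae_integrable_cv hF' (measurable_cj hF) (h.wnorm_modulus_ne_top hF' hF nF' nF),
    ae_integrable_cv hF' (measurable_cj hF') (h.wnorm_modulus_ne_top hF' hF' nF' nF')]
    with z h1 h2 h3
  have e : cj (fun w => F w - F' w) = fun w => cj F w - cj F' w := by
    funext w; simp [cj]
  simp only [srcV, cv, e, sub_mul, mul_sub]
  rw [integral_sub h1 h2, integral_sub h2 h3]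
  ring

end BilinearBounds

end Source

/-! ### Linearity of the Duhamel formula -/

section Linear

variable {κ : ℝ} {f f' : ℝ → ℂ} {q q' : ℝ × ℝ → ℂ} {ξ : ℝ}

theorem ae_slice_eq (h : q =ᵐ[volume] q') : ∀ᵐ ξ : ℝ, ∀ᵐ τ : ℝ, q (ξ, τ) = q' (ξ, τ) :=
  Measure.ae_ae_of_ae_prod h

theorem duh_sub (hq : Measurable q) (hq' : Measurable q') (h : srcSize κ q ξ < ⊤)
    (h' : srcSize κ q' ξ < ⊤) (t : ℝ) : duh κ f q ξ t - duh κ f' q' ξ t =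
      duh κ (fun x => f x - f' x) (fun z => q z - q' z) ξ t := by
  unfold duh
  simp only [sub_mul]
  rw [integral_sub (integrable_mul_duk hq h t) (integrable_mul_duk hq' h' t)]
  ring

theorem duhF_sub_ae (χ : 𝓢(ℝ, ℂ)) {T a k : ℝ} (hT : 0 < T) (ha : a < 1 / 2) (hq : Measurable q)
    (hq' : Measurable q') (h : cnorm κ k (-a) q ≠ ⊤) (h' : cnorm κ k (-a) q' ≠ ⊤) :
    ∀ᵐ z, duhF χ T κ f q z - duhF χ T κ f' q' z =
      duhF χ T κ (fun x => f x - f' x) (fun z => q z - q' z) z := by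
  have h1 : ∀ᵐ z : ℝ × ℝ, srcSize κ q z.1 < ⊤ ∧ srcSize κ q' z.1 < ⊤ :=
    Measure.quasiMeasurePreserving_fst.ae
      ((ae_srcSize_lt_top ha hq h).and (ae_srcSize_lt_top ha hq' h'))
  filter_upwards [h1] with z hz
  unfold duhF
  have hi : ∀ {f : ℝ → ℂ} {q : ℝ × ℝ → ℂ}, Measurable q → srcSize κ q z.1 < ⊤ →
      Integrable fun t => χ (t / T) * (ee (-(t * z.2)) * duh κ f q z.1 t) := by
    intro f q hq hs
    have := (integrable_cutoff_duh (f := f) χ hT hq hs).bdd_mul (c := 1)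
      (f := fun t => ee (-(t * z.2))) (by fun_prop) (Eventually.of_forall fun t => by simp)
    refine this.congr (Eventually.of_forall fun t => ?_)
    simp only; ring
  rw [← integral_sub (hi hq hz.1) (hi hq' hz.2)]
  refine integral_congr_ae (Eventually.of_forall fun t => ?_)
  simp only
  rw [← duh_sub hq hq' hz.1 hz.2]
  ring

end Linear

/-! ### The weighted `L²` spaces -/

/-- The measure whose `L²` space has the norm `cnorm κ k b`. -/
def wmeasure (κ k b : ℝ) : Measure (ℝ × ℝ) :=
  volume.withDensity fun z => ENNReal.ofReal (wt κ k b z) ^ 2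

/-- The density is positive everywhere, so the null sets are those of Lebesgue measure. Functions of
the two weighted spaces may therefore be combined almost everywhere. -/
theorem ae_wmeasure_iff {κ k b : ℝ} {p : ℝ × ℝ → Prop} :
    (∀ᵐ z ∂wmeasure κ k b, p z) ↔ ∀ᵐ z, p z := by
  have hw := measurable_wt κ k b
  have h1 : wmeasure κ k b ≪ volume := withDensity_absolutelyContinuous _ _
  have h2 : (volume : Measure (ℝ × ℝ)) ≪ wmeasure κ k b :=
    withDensity_absolutelyContinuous' (by fun_prop)
      (Eventually.of_forall fun z => by simp [wt_pos])
  exact ⟨fun h => h2.ae_le h, fun h => h1.ae_le h⟩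

theorem eLpNorm_wmeasure (κ k b : ℝ) {F : ℝ × ℝ → ℂ} (hF : Measurable F) :
    eLpNorm F 2 (wmeasure κ k b) = cnorm κ k b F := by
  have hw := measurable_wt κ k b
  rw [eLpNorm_eq_lintegral_rpow_enorm_toReal (by norm_num) (by norm_num)]
  unfold wmeasure cnorm wnorm l2
  rw [lintegral_withDensity_eq_lintegral_mul _ (by fun_prop) (by fun_prop)]
  simp [mul_pow]

theorem edist_lp_eq {κ k b : ℝ} (x y : Lp ℂ 2 (wmeasure κ k b)) :
    edist x y = cnorm κ k b fun z => x z - y z := by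
  rw [Lp.edist_def]
  exact eLpNorm_wmeasure κ k b ((Lp.stronglyMeasurable x).measurable.sub
    (Lp.stronglyMeasurable y).measurable)

theorem memLp_wmeasure {κ k b : ℝ} {F : ℝ × ℝ → ℂ} (hF : Measurable F) (h : cnorm κ k b F ≠ ⊤) :
    MemLp F 2 (wmeasure κ k b) :=
  ⟨hF.aestronglyMeasurable, by rw [eLpNorm_wmeasure κ k b hF]; exact h.lt_top⟩

/-! ### The Picard iteration -/

/-- The constants of the linear and the bilinear estimates. -/
structure PicardBounds (σ ε : ℝ) (χ : 𝓢(ℝ, ℂ)) (k s a b : ℝ) (K : ℝ≥0∞) : Prop where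
  a_nonneg : 0 ≤ a
  a_lt : a < 1 / 2
  lt_b : 1 / 2 < b
  bilinear : BilinearBounds k s a b K
  srcV_le : ∀ F H G : ℝ × ℝ → ℂ, Measurable F → Measurable H → Measurable G →
    cnorm 0 s (-a) (srcV σ ε F H G) ≤ K * (cnorm 1 k b F * cnorm 1 k b H + cnorm 0 s b G)
  linear : ∀ (κ k T : ℝ) (f : ℝ → ℂ) (q : ℝ × ℝ → ℂ), 0 < T → T ≤ 1 → Measurable f →
    Measurable q → cnorm κ k (-a) q ≠ ⊤ → cnorm κ k b (duhF χ T κ f q) ≤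
      K * (ENNReal.ofReal (T ^ (1 / 2 - b)) * snorm k f +
        ENNReal.ofReal (T ^ (1 - a - b)) * cnorm κ k (-a) q)
  trace : ∀ (κ k : ℝ) (F : ℝ × ℝ → ℂ), Measurable F →
      l2 (fun ξ => ENNReal.ofReal (jb ξ ^ k) * ∫⁻ τ, ‖F (ξ, τ)‖ₑ) ≤ K * cnorm κ k b F

theorem BilinearBounds.exists_picardBounds {k s a b : ℝ} {C : ℝ≥0∞}
    (h : BilinearBounds k s a b C) (σ ε : ℝ) (χ : 𝓢(ℝ, ℂ)) (ha : 0 ≤ a) (ha2 : a < 1 / 2)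
    (hb : 1 / 2 < b) (hab : a + b ≤ 1) (hb1 : b < 1) : ∃ K, PicardBounds σ ε χ k s a b K := by
  obtain ⟨A, hA, h₁⟩ := exists_cnorm_duhF_le χ ha ha2 (by linarith : 0 ≤ b) hb1 hab
  obtain ⟨B, hB, h₂⟩ := exists_l2_lintegral_le hb
  set D := ENNReal.ofReal |σ|⁻¹ * (ENNReal.ofReal |ε| * C + 1)
  have hC := h.ne_top
  have hD : D ≠ ⊤ := by finiteness
  have e1 : C ≤ C + D + A + B := by rw [add_assoc, add_assoc]; exact le_self_add
  have e2 : D ≤ C + D + A + B := by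
    rw [add_assoc, add_assoc, add_left_comm]; exact le_self_add
  have e3 : A ≤ C + D + A + B := by rw [add_right_comm]; exact le_add_self
  have e4 : B ≤ C + D + A + B := le_add_self
  refine ⟨C + D + A + B, ha, ha2, hb, ⟨by finiteness, fun F G hF hG => ?_, fun F G hF hG => ?_⟩,
    fun F H G hF hH hG => ?_, fun κ k T f q h0 h1 hf hq hn => ?_, fun κ k F hF => ?_⟩
  · exact (h.product F G hF hG).trans (by gcongr)
  · exact (h.modulus F G hF hG).trans (by gcongr)
  · exact (h.cnorm_srcV_le ha (by linarith) hF hH hG).trans (by gcongr)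
  · exact (h₁ κ k T f q h0 h1 hf hq hn).trans (by gcongr)
  · exact (h₂ κ k F hF).trans (by gcongr)

namespace PicardBounds

variable {σ ε k s a b T : ℝ} {χ : 𝓢(ℝ, ℂ)} {K R D : ℝ≥0∞} {f f' g g' : ℝ → ℂ}
  {F F' G G' : ℝ × ℝ → ℂ}

theorem srcU_ne_top (h : PicardBounds σ ε χ k s a b K) (hF : Measurable F) (hG : Measurable G)
    (nF : cnorm 1 k b F ≠ ⊤) (nG : cnorm 0 s b G ≠ ⊤) : cnorm 1 k (-a) (srcU F G) ≠ ⊤ :=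
  ne_top_of_le_ne_top (ENNReal.mul_ne_top h.bilinear.ne_top (ENNReal.mul_ne_top nF nG))
    (h.bilinear.cnorm_srcU_le hF hG)

theorem srcV_ne_top (h : PicardBounds σ ε χ k s a b K) {H : ℝ × ℝ → ℂ} (hF : Measurable F)
    (hH : Measurable H) (hG : Measurable G) (nF : cnorm 1 k b F ≠ ⊤) (nH : cnorm 1 k b H ≠ ⊤)
    (nG : cnorm 0 s b G ≠ ⊤) : cnorm 0 s (-a) (srcV σ ε F H G) ≠ ⊤ :=
  ne_top_of_le_ne_top (ENNReal.mul_ne_top h.bilinear.ne_top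
    (ENNReal.add_ne_top.2 ⟨ENNReal.mul_ne_top nF nH, nG⟩)) (h.srcV_le F H G hF hH hG)

/-- The bilinear difference needs only `2 * R`. The summand `1` is included so that the bound has
the same form as that of `sub_srcV_le`, where it comes from the linear damping term. -/
theorem sub_srcU_le (h : PicardBounds σ ε χ k s a b K) (hR : R ≠ ⊤) (hF : Measurable F)
    (hF' : Measurable F') (hG : Measurable G) (hG' : Measurable G') (nF : cnorm 1 k b F ≤ R)
    (nF' : cnorm 1 k b F' ≤ R) (nG : cnorm 0 s b G ≤ R) (nG' : cnorm 0 s b G' ≤ R)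
    (hA : cnorm 1 k b (fun z => F z - F' z) ≤ D) (hB : cnorm 0 s b (fun z => G z - G' z) ≤ D) :
    cnorm 1 k (-a) (fun z => srcU F G z - srcU F' G' z) ≤ K * ((2 * R + 1) * D) := by
  have fin : ∀ {x : ℝ≥0∞}, x ≤ R → x ≠ ⊤ := fun h => ne_top_of_le_ne_top hR h
  rw [cnorm_congr (h.bilinear.srcU_sub_ae hF hF' hG hG' (fin nF) (fin nF') (fin nG) (fin nG'))]
  refine (cnorm_add_le (measurable_srcU (hF.sub hF') hG) (measurable_srcU hF' (hG.sub hG'))).trans ?_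
  calc _ ≤ K * (D * R) + K * (R * D) := by
        gcongr
        · exact (h.bilinear.cnorm_srcU_le (hF.sub hF') hG).trans (by gcongr; exact hA)
        · exact (h.bilinear.cnorm_srcU_le hF' (hG.sub hG')).trans (by gcongr; exact hB)
    _ = K * ((2 * R) * D) := by ring
    _ ≤ _ := by gcongr; exact le_self_add

theorem sub_srcV_le (h : PicardBounds σ ε χ k s a b K) (hR : R ≠ ⊤) (hF : Measurable F)
    (hF' : Measurable F') (hG : Measurable G) (hG' : Measurable G') (nF : cnorm 1 k b F ≤ R)
    (nF' : cnorm 1 k b F' ≤ R)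
    (hA : cnorm 1 k b (fun z => F z - F' z) ≤ D) (hB : cnorm 0 s b (fun z => G z - G' z) ≤ D) :
    cnorm 0 s (-a) (fun z => srcV σ ε F F G z - srcV σ ε F' F' G' z) ≤
      K * ((2 * R + 1) * D) := by
  have fin : ∀ {x : ℝ≥0∞}, x ≤ R → x ≠ ⊤ := fun h => ne_top_of_le_ne_top hR h
  rw [cnorm_congr (h.bilinear.srcV_sub_ae hF hF' (fin nF) (fin nF') G G')]
  refine (cnorm_add_le (measurable_srcV σ ε (hF.sub hF') hF (hG.sub hG'))
    (measurable_srcV σ ε hF' (hF.sub hF') measurable_const)).trans ?_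
  calc _ ≤ K * (D * R + D) + K * (R * D + 0) := by
        gcongr
        · exact (h.srcV_le _ _ _ (hF.sub hF') hF (hG.sub hG')).trans
            (by gcongr; exacts [hA, hB])
        · exact (h.srcV_le _ _ _ hF' (hF.sub hF') measurable_const).trans
            (by rw [cnorm_zero]; gcongr; exact hA)
    _ = _ := by ring

theorem sub_duhF_srcU_le (h : PicardBounds σ ε χ k s a b K) (hT : 0 < T) (hT1 : T ≤ 1)
    (hR : R ≠ ⊤) (hD : D ≠ ⊤) (hf : Measurable f) (hf' : Measurable f') (hF : Measurable F)
    (hF' : Measurable F') (hG : Measurable G) (hG' : Measurable G') (nF : cnorm 1 k b F ≤ R)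
    (nF' : cnorm 1 k b F' ≤ R) (nG : cnorm 0 s b G ≤ R) (nG' : cnorm 0 s b G' ≤ R)
    (hA : cnorm 1 k b (fun z => F z - F' z) ≤ D) (hB : cnorm 0 s b (fun z => G z - G' z) ≤ D) :
    cnorm 1 k b (fun z => duhF χ T 1 f (srcU F G) z - duhF χ T 1 f' (srcU F' G') z) ≤
      K * (ENNReal.ofReal (T ^ (1 / 2 - b)) * snorm k (fun x => f x - f' x) +
        ENNReal.ofReal (T ^ (1 - a - b)) * (K * ((2 * R + 1) * D))) := by
  have fin : ∀ {x : ℝ≥0∞}, x ≤ R → x ≠ ⊤ := fun h => ne_top_of_le_ne_top hR h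
  have h1 := h.sub_srcU_le hR hF hF' hG hG' nF nF' nG nG' hA hB
  have hK := h.bilinear.ne_top
  rw [cnorm_congr (duhF_sub_ae χ hT h.a_lt (measurable_srcU hF hG) (measurable_srcU hF' hG')
    (h.srcU_ne_top hF hG (fin nF) (fin nG)) (h.srcU_ne_top hF' hG' (fin nF') (fin nG')))]
  refine (h.linear _ _ _ _ _ hT hT1 (hf.sub hf')
    ((measurable_srcU hF hG).sub (measurable_srcU hF' hG'))
    (ne_top_of_le_ne_top (by finiteness) h1)).trans ?_
  gcongr
  exacts [le_rfl, h1]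

theorem sub_duhF_srcV_le (h : PicardBounds σ ε χ k s a b K) (hT : 0 < T) (hT1 : T ≤ 1)
    (hR : R ≠ ⊤) (hD : D ≠ ⊤) (hg : Measurable g) (hg' : Measurable g') (hF : Measurable F)
    (hF' : Measurable F') (hG : Measurable G) (hG' : Measurable G') (nF : cnorm 1 k b F ≤ R)
    (nF' : cnorm 1 k b F' ≤ R) (nG : cnorm 0 s b G ≤ R) (nG' : cnorm 0 s b G' ≤ R)
    (hA : cnorm 1 k b (fun z => F z - F' z) ≤ D) (hB : cnorm 0 s b (fun z => G z - G' z) ≤ D) :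
    cnorm 0 s b (fun z => duhF χ T 0 g (srcV σ ε F F G) z -
      duhF χ T 0 g' (srcV σ ε F' F' G') z) ≤
      K * (ENNReal.ofReal (T ^ (1 / 2 - b)) * snorm s (fun x => g x - g' x) +
        ENNReal.ofReal (T ^ (1 - a - b)) * (K * ((2 * R + 1) * D))) := by
  have fin : ∀ {x : ℝ≥0∞}, x ≤ R → x ≠ ⊤ := fun h => ne_top_of_le_ne_top hR h
  have h1 := h.sub_srcV_le hR hF hF' hG hG' nF nF' hA hB
  have hK := h.bilinear.ne_top
  rw [cnorm_congr (duhF_sub_ae χ hT h.a_lt (measurable_srcV σ ε hF hF hG)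
    (measurable_srcV σ ε hF' hF' hG')
    (h.srcV_ne_top hF hF hG (fin nF) (fin nF) (fin nG))
    (h.srcV_ne_top hF' hF' hG' (fin nF') (fin nF') (fin nG')))]
  refine (h.linear _ _ _ _ _ hT hT1 (hg.sub hg')
    ((measurable_srcV σ ε hF hF hG).sub (measurable_srcV σ ε hF' hF' hG'))
    (ne_top_of_le_ne_top (by finiteness) h1)).trans ?_
  gcongr
  exacts [le_rfl, h1]

/-- The conditions on the time `T` and the radius `R` for data of size at most `m`. -/
structure Admissible (a b T : ℝ) (K R m : ℝ≥0∞) : Prop where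
  pos : 0 < T
  two_mul_le : 2 * T ≤ 1
  ne_top : R ≠ ⊤
  data : K * (ENNReal.ofReal (T ^ (1 / 2 - b)) * m) ≤ R / 2
  contract : K * (ENNReal.ofReal (T ^ (1 - a - b)) * (K * (2 * R + 1))) ≤ 1 / 2

theorem Admissible.le_one (hT : Admissible a b T K R D) : T ≤ 1 := by
  linarith [hT.pos, hT.two_mul_le]

theorem Admissible.contract_le (hT : Admissible a b T K R D) (x : ℝ≥0∞) :
    K * (ENNReal.ofReal (T ^ (1 - a - b)) * (K * ((2 * R + 1) * x))) ≤ x / 2 := by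
  calc _ = K * (ENNReal.ofReal (T ^ (1 - a - b)) * (K * (2 * R + 1))) * x := by ring
    _ ≤ 1 / 2 * x := by gcongr; exact hT.contract
    _ = _ := by rw [one_div, mul_comm, ENNReal.div_eq_inv_mul, mul_comm]

theorem mapsTo_ball (h : PicardBounds σ ε χ k s a b K) {m : ℝ≥0∞} (hT : Admissible a b T K R m)
    (hf : Measurable f) (hg : Measurable g) (nf : snorm k f ≤ m) (ng : snorm s g ≤ m)
    (hF : Measurable F) (hG : Measurable G) (nF : cnorm 1 k b F ≤ R) (nG : cnorm 0 s b G ≤ R) :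
    cnorm 1 k b (duhF χ T 1 f (srcU F G)) ≤ R ∧
      cnorm 0 s b (duhF χ T 0 g (srcV σ ε F F G)) ≤ R := by
  have fin : ∀ {x : ℝ≥0∞}, x ≤ R → x ≠ ⊤ := fun h => ne_top_of_le_ne_top hT.ne_top h
  have key : ∀ x y : ℝ≥0∞, x ≤ m → y ≤ K * ((2 * R + 1) * R) →
      K * (ENNReal.ofReal (T ^ (1 / 2 - b)) * x + ENNReal.ofReal (T ^ (1 - a - b)) * y) ≤ R := by
    intro x y hx hy
    rw [mul_add, ← ENNReal.add_halves R]
    refine add_le_add (le_trans (by gcongr) hT.data) (le_trans ?_ (hT.contract_le R))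
    gcongr
  constructor
  · refine (h.linear _ _ _ _ _ hT.pos hT.le_one hf (measurable_srcU hF hG)
      (h.srcU_ne_top hF hG (fin nF) (fin nG))).trans (key _ _ nf ?_)
    refine (h.bilinear.cnorm_srcU_le hF hG).trans ?_
    gcongr
    refine nF.trans ?_
    calc R = 1 * R := (one_mul R).symm
      _ ≤ (1 + 1) * R := by gcongr; exact le_self_add
      _ ≤ 2 * R + 1 := by rw [one_add_one_eq_two]; exact le_self_add
  · refine (h.linear _ _ _ _ _ hT.pos hT.le_one hg (measurable_srcV σ ε hF hF hG)
      (h.srcV_ne_top hF hF hG (fin nF) (fin nF) (fin nG))).trans (key _ _ ng ?_)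
    refine (h.srcV_le _ _ _ hF hF hG).trans ?_
    gcongr
    calc _ ≤ R * R + R := by gcongr
      _ = (R + 1) * R := by ring
      _ ≤ _ := by
        gcongr
        calc R = 1 * R := (one_mul R).symm
          _ ≤ 2 * R := by gcongr; exact one_le_two

theorem le_of_le_half_add {x y : ℝ≥0∞} (hx : x ≠ ⊤) (h : x ≤ y + x / 2) : x ≤ 2 * y := by
  have h1 : x / 2 + x / 2 ≤ y + x / 2 := by rw [ENNReal.add_halves]; exact h
  have h2 := (ENNReal.add_le_add_iff_right (ENNReal.div_ne_top hx (by norm_num))).1 h1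
  calc x = x / 2 + x / 2 := (ENNReal.add_halves x).symm
    _ ≤ y + y := by gcongr
    _ = 2 * y := by ring

/-- Fixed points of the Picard map depend in a Lipschitz way on the data. -/
theorem fixedPoint_sub_le (h : PicardBounds σ ε χ k s a b K) {m : ℝ≥0∞}
    (hT : Admissible a b T K R m) (hf : Measurable f) (hg : Measurable g) (hf' : Measurable f')
    (hg' : Measurable g') (hF : Measurable F) (hF' : Measurable F') (hG : Measurable G)
    (hG' : Measurable G') (nF : cnorm 1 k b F ≤ R) (nF' : cnorm 1 k b F' ≤ R)
    (nG : cnorm 0 s b G ≤ R) (nG' : cnorm 0 s b G' ≤ R)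
    (eF : ∀ᵐ z, F z = duhF χ T 1 f (srcU F G) z)
    (eG : ∀ᵐ z, G z = duhF χ T 0 g (srcV σ ε F F G) z)
    (eF' : ∀ᵐ z, F' z = duhF χ T 1 f' (srcU F' G') z)
    (eG' : ∀ᵐ z, G' z = duhF χ T 0 g' (srcV σ ε F' F' G') z) :
    max (cnorm 1 k b fun z => F z - F' z) (cnorm 0 s b fun z => G z - G' z) ≤
      2 * (K * (ENNReal.ofReal (T ^ (1 / 2 - b)) *
        (snorm k (fun x => f x - f' x) + snorm s (fun x => g x - g' x)))) := by
  set D := max (cnorm 1 k b fun z => F z - F' z) (cnorm 0 s b fun z => G z - G' z)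
  have fin : ∀ {x : ℝ≥0∞}, x ≤ R → x ≠ ⊤ := fun h => ne_top_of_le_ne_top hT.ne_top h
  have hD : D ≠ ⊤ := (max_lt
    ((cnorm_sub_le hF hF').trans_lt (ENNReal.add_lt_top.2 ⟨(fin nF).lt_top, (fin nF').lt_top⟩))
    ((cnorm_sub_le hG hG').trans_lt
      (ENNReal.add_lt_top.2 ⟨(fin nG).lt_top, (fin nG').lt_top⟩))).ne
  refine le_of_le_half_add hD (max_le ?_ ?_)
  · have := h.sub_duhF_srcU_le hT.pos hT.le_one hT.ne_top hD hf hf' hF hF' hG hG' nF nF' nG nG'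
      (le_max_left _ _) (le_max_right _ _)
    rw [mul_add, ← cnorm_congr (eF.mp (eF'.mono fun z h1 h2 => by rw [h1, h2]) :
      ∀ᵐ z, F z - F' z = _)] at this
    refine this.trans (add_le_add ?_ (hT.contract_le D))
    gcongr
    exact le_self_add
  · have := h.sub_duhF_srcV_le hT.pos hT.le_one hT.ne_top hD hg hg' hF hF' hG hG' nF nF' nG nG'
      (le_max_left _ _) (le_max_right _ _)
    rw [mul_add, ← cnorm_congr (eG.mp (eG'.mono fun z h1 h2 => by rw [h1, h2]) :
      ∀ᵐ z, G z - G' z = _)] at this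
    refine this.trans (add_le_add ?_ (hT.contract_le D))
    gcongr
    exact le_add_self

/-- Banach's theorem on a product of closed balls in the two weighted `L²` spaces, with the maximum
metric. Completeness is that of `Lp`, and the contraction factor is `1/2`. -/
theorem exists_fixedPoint (h : PicardBounds σ ε χ k s a b K) {m : ℝ≥0∞}
    (hT : Admissible a b T K R m) (hf : Measurable f) (hg : Measurable g) (nf : snorm k f ≤ m)
    (ng : snorm s g ≤ m) : ∃ F G : ℝ × ℝ → ℂ, Measurable F ∧ Measurable G ∧
      cnorm 1 k b F ≤ R ∧ cnorm 0 s b G ≤ R ∧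
      (∀ᵐ z, F z = duhF χ T 1 f (srcU F G) z) ∧
      ∀ᵐ z, G z = duhF χ T 0 g (srcV σ ε F F G) z := by
  classical
  let X := Lp ℂ 2 (wmeasure 1 k b) × Lp ℂ 2 (wmeasure 0 s b)
  let S : Set X := {x | cnorm 1 k b x.1 ≤ R ∧ cnorm 0 s b x.2 ≤ R}
  have mX : ∀ x : X, Measurable (x.1 : ℝ × ℝ → ℂ) ∧ Measurable (x.2 : ℝ × ℝ → ℂ) := fun x =>
    ⟨(Lp.stronglyMeasurable x.1).measurable, (Lp.stronglyMeasurable x.2).measurable⟩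
  have hSe : S = {x : X | eLpNorm x.1 2 (wmeasure 1 k b) ≤ R} ∩
      {x : X | eLpNorm x.2 2 (wmeasure 0 s b) ≤ R} := by
    ext x
    simp only [S, mem_ofPred_eq, mem_inter_iff, eLpNorm_wmeasure _ _ _ (mX x).1,
      eLpNorm_wmeasure _ _ _ (mX x).2]
  have hSc : IsClosed S := by
    rw [hSe]
    refine IsClosed.inter ?_ ?_
    · have hc : Continuous fun x : X => ‖x.1‖ₑ := by fun_prop
      simpa [Lp.enorm_def] using isClosed_le hc continuous_const
    · have hc : Continuous fun x : X => ‖x.2‖ₑ := by fun_prop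
      simpa [Lp.enorm_def] using isClosed_le hc continuous_const
  have fin : ∀ {x : ℝ≥0∞}, x ≤ R → x ≠ ⊤ := fun h => ne_top_of_le_ne_top hT.ne_top h
  let Φ : X → ℝ × ℝ → ℂ := fun x => duhF χ T 1 f (srcU x.1 x.2)
  let Ψ : X → ℝ × ℝ → ℂ := fun x => duhF χ T 0 g (srcV σ ε x.1 x.1 x.2)
  have mΦ : ∀ x, Measurable (Φ x) := fun x =>
    measurable_duhF χ T 1 hf (measurable_srcU (mX x).1 (mX x).2)
  have mΨ : ∀ x, Measurable (Ψ x) := fun x =>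
    measurable_duhF χ T 0 hg (measurable_srcV σ ε (mX x).1 (mX x).1 (mX x).2)
  have ball : ∀ x ∈ S, cnorm 1 k b (Φ x) ≤ R ∧ cnorm 0 s b (Ψ x) ≤ R := fun x hx =>
    h.mapsTo_ball hT hf hg nf ng (mX x).1 (mX x).2 hx.1 hx.2
  -- Only on the ball is the image known to lie in the weighted spaces; outside it the map is given
  -- the dummy value `x`.
  let P : X → X := fun x => if hx : x ∈ S then
    ((memLp_wmeasure (mΦ x) (fin (ball x hx).1)).toLp (Φ x),
      (memLp_wmeasure (mΨ x) (fin (ball x hx).2)).toLp (Ψ x)) else x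
  have P1 : ∀ x ∈ S, ∀ᵐ z, (P x).1 z = Φ x z := fun x hx => by
    simp only [P, dif_pos hx]
    exact ae_wmeasure_iff.1 (MemLp.coeFn_toLp _)
  have P2 : ∀ x ∈ S, ∀ᵐ z, (P x).2 z = Ψ x z := fun x hx => by
    simp only [P, dif_pos hx]
    exact ae_wmeasure_iff.1 (MemLp.coeFn_toLp _)
  have hmaps : MapsTo P S S := fun x hx => by
    refine ⟨?_, ?_⟩
    · rw [cnorm_congr (P1 x hx)]; exact (ball x hx).1
    · rw [cnorm_congr (P2 x hx)]; exact (ball x hx).2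
  have hlip : ∀ x ∈ S, ∀ y ∈ S, edist (P x) (P y) ≤ (1 / 2 : ℝ≥0) * edist x y := by
    intro x hx y hy
    have ec : ((1 / 2 : ℝ≥0) : ℝ≥0∞) * edist x y = edist x y / 2 := by
      rw [ENNReal.div_eq_inv_mul]; simp
    have hA : cnorm 1 k b (fun z => x.1 z - y.1 z) ≤ edist x y := by
      rw [← edist_lp_eq, Prod.edist_eq]; exact le_max_left _ _
    have hB : cnorm 0 s b (fun z => x.2 z - y.2 z) ≤ edist x y := by
      rw [← edist_lp_eq, Prod.edist_eq]; exact le_max_right _ _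
    have z1 : ∀ (r : ℝ) (w : ℝ → ℂ), snorm r (fun x => w x - w x) = 0 := by
      intro r w; simp [snorm, l2]
    rw [ec, Prod.edist_eq, edist_lp_eq, edist_lp_eq]
    refine max_le ?_ ?_
    · have e : cnorm 1 k b (fun z => (P x).1 z - (P y).1 z) =
          cnorm 1 k b (fun z => Φ x z - Φ y z) := cnorm_congr (by
        filter_upwards [P1 x hx, P1 y hy] with z h1 h2
        rw [h1, h2])
      rw [e]
      refine (h.sub_duhF_srcU_le hT.pos hT.le_one hT.ne_top (edist_ne_top x y) hf hf (mX x).1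
        (mX y).1 (mX x).2 (mX y).2 hx.1 hy.1 hx.2 hy.2 hA hB).trans ?_
      rw [z1, mul_zero, zero_add]
      exact hT.contract_le _
    · have e : cnorm 0 s b (fun z => (P x).2 z - (P y).2 z) =
          cnorm 0 s b (fun z => Ψ x z - Ψ y z) := cnorm_congr (by
        filter_upwards [P2 x hx, P2 y hy] with z h1 h2
        rw [h1, h2])
      rw [e]
      refine (h.sub_duhF_srcV_le hT.pos hT.le_one hT.ne_top (edist_ne_top x y) hg hg (mX x).1
        (mX y).1 (mX x).2 (mX y).2 hx.1 hy.1 hx.2 hy.2 hA hB).trans ?_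
      rw [z1, mul_zero, zero_add]
      exact hT.contract_le _
  have h0 : (0 : X) ∈ S := by
    rw [hSe]
    have e1 : eLpNorm (0 : X).1 2 (wmeasure 1 k b) = 0 := by rw [← Lp.enorm_def]; simp
    have e2 : eLpNorm (0 : X).2 2 (wmeasure 0 s b) = 0 := by rw [← Lp.enorm_def]; simp
    exact ⟨by rw [mem_ofPred_eq, e1]; exact zero_le, by rw [mem_ofPred_eq, e2]; exact zero_le⟩
  have hcon : ContractingWith (1 / 2) (hmaps.restrict P S S) :=
    ⟨by rw [← NNReal.coe_lt_coe]; norm_num, fun x y => hlip x x.2 y y.2⟩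
  obtain ⟨x, hxS, hfix, -⟩ := hcon.exists_fixedPoint' hSc.isComplete hmaps h0 (edist_ne_top _ _)
  have e1 : ∀ᵐ z, x.1 z = Φ x z := by
    have := P1 x hxS; rwa [hfix] at this
  have e2 : ∀ᵐ z, x.2 z = Ψ x z := by
    have := P2 x hxS; rwa [hfix] at this
  exact ⟨x.1, x.2, (mX x).1, (mX x).2, hxS.1, hxS.2, e1, e2⟩

end PicardBounds

/-! ### Locality in time of the Duhamel formula -/

section Locality

theorem integral_mul_intervalIntegral_ee {H m : ℝ → ℂ} (hH : Integrable H) (hm : Continuous m)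
    (t : ℝ) : ∫ τ, H τ * (∫ x in (0 : ℝ)..t, ee (x * τ) * m x) =
      ∫ x in (0 : ℝ)..t, m x * ∫ τ, ee (x * τ) * H τ := by
  have key : ∀ u v : ℝ, ∫ τ, H τ * (∫ x in Ioc u v, ee (x * τ) * m x) =
      ∫ x in Ioc u v, m x * ∫ τ, ee (x * τ) * H τ := by
    intro u v
    simp only [← integral_const_mul]
    have hI : Integrable (fun p : ℝ × ℝ => H p.1 * (ee (p.2 * p.1) * m p.2))
        (volume.prod (volume.restrict (Ioc u v))) := by
      have h1 : Integrable m (volume.restrict (Ioc u v)) :=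
        (hm.integrableOn_Icc).mono_set Ioc_subset_Icc_self
      have h2 := (hH.mul_prod h1).bdd_mul (c := 1) (f := fun p : ℝ × ℝ => ee (p.2 * p.1))
        (by fun_prop) (Eventually.of_forall fun p => by simp)
      refine h2.congr (Eventually.of_forall fun p => ?_)
      simp only; ring
    rw [integral_integral_swap (f := fun τ x => H τ * (ee (x * τ) * m x)) hI]
    refine integral_congr_ae (Eventually.of_forall fun x => ?_)
    refine integral_congr_ae (Eventually.of_forall fun τ => ?_)
    simp only; ring
  rcases le_total 0 t with h | h
  · simp only [intervalIntegral.integral_of_le h, key]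
  · simp only [intervalIntegral.integral_of_ge h, mul_neg, integral_neg, key]

theorem integral_mul_duk_eq {H : ℝ → ℂ} (hH : Integrable H) (c t : ℝ) :
    ∫ τ, H τ * duk t (τ + c) = ∫ x in (0 : ℝ)..t, ee (x * c) * ∫ τ, ee (x * τ) * H τ := by
  rw [← integral_mul_intervalIntegral_ee hH (by fun_prop)]
  simp only [duk, mul_add, ee_add]

/-- Convolution in `τ` becomes multiplication in time, and integration against `duk t` becomes
integration over the times between `0` and `t`. -/
theorem integral_conv_duk_eq {X Y : ℝ → ℂ} (hX : Integrable X) (hY : Integrable Y) (c t : ℝ) :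
    ∫ τ', X τ' * ∫ τ, Y (τ - τ') * duk t (τ + c) = ∫ x in (0 : ℝ)..t, ee (x * c) *
      ((∫ τ, ee (x * τ) * X τ) * ∫ τ, ee (x * τ) * Y τ) := by
  have hcH : Continuous fun x => ∫ τ, ee (x * τ) * Y τ := by
    refine continuous_of_dominated (bound := fun τ => ‖Y τ‖) (fun t => ?_) (fun t => ?_) hY.norm
      (Eventually.of_forall fun τ => by fun_prop)
    · exact (Continuous.aestronglyMeasurable (by fun_prop)).mul hY.aestronglyMeasurable
    · exact Eventually.of_forall fun τ => by simp
  have h1 : ∀ τ', ∫ τ, Y (τ - τ') * duk t (τ + c) =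
      ∫ x in (0 : ℝ)..t, ee (x * τ') * (ee (x * c) * ∫ τ, ee (x * τ) * Y τ) := by
    intro τ'
    rw [← integral_add_right_eq_self _ τ']
    simp only [add_sub_cancel_right]
    have := integral_mul_duk_eq hY (τ' + c) t
    simp only [← add_assoc] at this
    rw [this]
    refine intervalIntegral.integral_congr fun x _ => ?_
    simp only [mul_add, ee_add]; ring
  simp only [h1]
  rw [integral_mul_intervalIntegral_ee hX (by fun_prop)]
  refine intervalIntegral.integral_congr fun x _ => ?_
  ring

variable {κ : ℝ} {X Y X' Y' : ℝ × ℝ → ℂ}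

/-- The source of locality: the right side involves the traces of the factors only at times between
`0` and `t`. The hypothesis on the modulus of the convolution, combined with the decay of `duk`,
justifies every interchange of integrals. -/
theorem integral_cv_duk_eq (hX : Measurable X) (hY : Measurable Y)
    (iX : ∀ᵐ ξ, Integrable fun τ => X (ξ, τ)) (iY : ∀ᵐ ξ, Integrable fun τ => Y (ξ, τ)) {ξ : ℝ}
    (h : ∫⁻ τ, lconv (fun w => ‖X w‖ₑ) (fun w => ‖Y w‖ₑ) (ξ, τ) *
      ENNReal.ofReal (jb (τ + disp κ ξ) ^ (-1 : ℝ)) < ⊤) (t : ℝ) :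
    ∫ τ, cv X Y (ξ, τ) * duk t (τ + disp κ ξ) = ∫ η, ∫ x in (0 : ℝ)..t,
      ee (x * disp κ ξ) * (tr X η x * tr Y (ξ - η) x) := by
  set c := disp κ ξ
  let H : ℝ → ℝ × ℝ → ℂ := fun τ w => X w * Y ((ξ, τ) - w) * duk t (τ + c)
  have mH : Measurable (Function.uncurry H) := by
    simp only [H, Function.uncurry_def]
    fun_prop
  have iH : Integrable (Function.uncurry H) := by
    refine ⟨mH.aestronglyMeasurable, ?_⟩
    change ∫⁻ p : ℝ × (ℝ × ℝ), _ < ⊤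
    rw [Measure.volume_eq_prod, lintegral_prod _ mH.enorm.aemeasurable]
    calc _ ≤ ∫⁻ τ, ENNReal.ofReal (|t| + 2) *
          (lconv (fun w => ‖X w‖ₑ) (fun w => ‖Y w‖ₑ) (ξ, τ) *
          ENNReal.ofReal (jb (τ + c) ^ (-1 : ℝ))) := by
          refine lintegral_mono fun τ => ?_
          have e : ∀ w, ‖Function.uncurry H (τ, w)‖ₑ =
              ‖X w‖ₑ * ‖Y ((ξ, τ) - w)‖ₑ * ‖duk t (τ + c)‖ₑ := fun w => by
            simp [H, enorm_mul]
          simp only [e]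
          rw [lintegral_mul_const _ (by fun_prop), mul_left_comm]
          unfold lconv
          gcongr
          rw [← ENNReal.ofReal_mul (by positivity), ← ofReal_norm, Real.rpow_neg_one]
          exact ENNReal.ofReal_le_ofReal (norm_duk_le _ _)
      _ < ⊤ := by
          rw [lintegral_const_mul' _ _ ENNReal.ofReal_ne_top]
          exact ENNReal.mul_lt_top ENNReal.ofReal_lt_top h
  have e1 : ∀ τ, cv X Y (ξ, τ) * duk t (τ + c) = ∫ w, H τ w := fun τ => by
    simp only [cv, H, integral_mul_const]
  simp only [e1]
  rw [integral_integral_swap iH]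
  have iH2 : Integrable (fun w => ∫ τ, H τ w) ((volume : Measure ℝ).prod volume) :=
    iH.integral_prod_right
  rw [Measure.volume_eq_prod, integral_prod _ iH2]
  have iY' : ∀ᵐ η : ℝ, Integrable fun τ => Y (ξ - η, τ) :=
    (Measure.measurePreserving_sub_left volume ξ).quasiMeasurePreserving.ae iY
  refine integral_congr_ae ?_
  filter_upwards [iX, iY'] with η h1 h2
  have := integral_conv_duk_eq h1 h2 c t
  unfold tr
  rw [← this]
  refine integral_congr_ae (Eventually.of_forall fun τ' => ?_)
  simp only [H, Prod.mk_sub_mk]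
  rw [← integral_const_mul]
  refine integral_congr_ae (Eventually.of_forall fun τ => ?_)
  simp only; ring

theorem ae_lintegral_lconv_lt_top {a k : ℝ} (ha : a < 1 / 2) (hX : Measurable X)
    (hY : Measurable Y)
    (h : wnorm κ k (-a) (lconv (fun w => ‖X w‖ₑ) (fun w => ‖Y w‖ₑ)) ≠ ⊤) :
    ∀ᵐ ξ, ∫⁻ τ, lconv (fun w => ‖X w‖ₑ) (fun w => ‖Y w‖ₑ) (ξ, τ) *
      ENNReal.ofReal (jb (τ + disp κ ξ) ^ (-1 : ℝ)) < ⊤ := by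
  have hm := measurable_lconv hX.enorm hY.enorm
  obtain ⟨C, hC, hb⟩ := exists_l2_slice_le (p := 1) (β := -a) (by linarith)
  refine ae_lt_top_of_l2 (k := k) ?_ (ne_top_of_le_ne_top ?_ (hb κ k _ hm))
  · have : Measurable fun p : ℝ × ℝ => lconv (fun w => ‖X w‖ₑ) (fun w => ‖Y w‖ₑ) (p.1, p.2) *
      ENNReal.ofReal (jb (p.2 + disp κ p.1) ^ (-1 : ℝ)) := by fun_prop
    exact Measurable.lintegral_prod_right' this
  · finiteness

theorem ae_integral_cv_duk_congr {a k δ : ℝ} (ha : a < 1 / 2) (hX : Measurable X)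
    (hY : Measurable Y) (hX' : Measurable X') (hY' : Measurable Y')
    (h : wnorm κ k (-a) (lconv (fun w => ‖X w‖ₑ) (fun w => ‖Y w‖ₑ)) ≠ ⊤)
    (h' : wnorm κ k (-a) (lconv (fun w => ‖X' w‖ₑ) (fun w => ‖Y' w‖ₑ)) ≠ ⊤)
    (iX : ∀ᵐ ξ, Integrable fun τ => X (ξ, τ)) (iY : ∀ᵐ ξ, Integrable fun τ => Y (ξ, τ))
    (iX' : ∀ᵐ ξ, Integrable fun τ => X' (ξ, τ)) (iY' : ∀ᵐ ξ, Integrable fun τ => Y' (ξ, τ))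
    (eX : ∀ᵐ ξ, ∀ t ∈ Icc 0 δ, tr X ξ t = tr X' ξ t)
    (eY : ∀ᵐ ξ, ∀ t ∈ Icc 0 δ, tr Y ξ t = tr Y' ξ t) :
    ∀ᵐ ξ, ∀ t ∈ Icc 0 δ, ∫ τ, cv X Y (ξ, τ) * duk t (τ + disp κ ξ) =
      ∫ τ, cv X' Y' (ξ, τ) * duk t (τ + disp κ ξ) := by
  filter_upwards [ae_lintegral_lconv_lt_top ha hX hY h, ae_lintegral_lconv_lt_top ha hX' hY' h']
    with ξ h1 h2 t ht
  rw [integral_cv_duk_eq hX hY iX iY h1, integral_cv_duk_eq hX' hY' iX' iY' h2]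
  refine integral_congr_ae ?_
  have eY2 : ∀ᵐ η : ℝ, ∀ t ∈ Icc 0 δ, tr Y (ξ - η) t = tr Y' (ξ - η) t :=
    (Measure.measurePreserving_sub_left volume ξ).quasiMeasurePreserving.ae eY
  filter_upwards [eX, eY2] with η h3 h4
  refine intervalIntegral.integral_congr fun x hx => ?_
  rw [uIcc_of_le ht.1] at hx
  simp only [h3 x ⟨hx.1, hx.2.trans ht.2⟩, h4 x ⟨hx.1, hx.2.trans ht.2⟩]

theorem tr_cj (F : ℝ × ℝ → ℂ) (ξ t : ℝ) : tr (cj F) ξ t = (starRingEnd ℂ) (tr F (-ξ) t) := by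
  unfold tr cj
  rw [← integral_conj, ← integral_neg_eq_self]
  refine integral_congr_ae (Eventually.of_forall fun τ => ?_)
  simp [conj_ee]

theorem integrable_cj {F : ℝ × ℝ → ℂ} (h : ∀ᵐ ξ, Integrable fun τ => F (ξ, τ)) :
    ∀ᵐ ξ, Integrable fun τ => cj F (ξ, τ) := by
  filter_upwards [(Measure.measurePreserving_neg
    (volume : Measure ℝ)).quasiMeasurePreserving.ae h] with ξ hξ
  have := hξ.comp_neg
  exact (Complex.conjCLE.toContinuousLinearMap.integrable_comp this)

end Locality

/-! ### Locality for the two source terms of the system -/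

section DuhLocality

variable {σ ε k s a b : ℝ} {χ : 𝓢(ℝ, ℂ)} {K : ℝ≥0∞} {F F' G G' : ℝ × ℝ → ℂ} {δ : ℝ}

theorem PicardBounds.ae_duh_srcU_congr (h : PicardBounds σ ε χ k s a b K) (f : ℝ → ℂ)
    (hF : Measurable F)
    (hF' : Measurable F') (hG : Measurable G) (hG' : Measurable G') (nF : cnorm 1 k b F ≠ ⊤)
    (nF' : cnorm 1 k b F' ≠ ⊤) (nG : cnorm 0 s b G ≠ ⊤) (nG' : cnorm 0 s b G' ≠ ⊤)
    (eF : ∀ᵐ ξ, ∀ t ∈ Icc 0 δ, tr F ξ t = tr F' ξ t)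
    (eG : ∀ᵐ ξ, ∀ t ∈ Icc 0 δ, tr G ξ t = tr G' ξ t) :
    ∀ᵐ ξ, ∀ t ∈ Icc 0 δ, duh 1 f (srcU F G) ξ t = duh 1 f (srcU F' G') ξ t := by
  filter_upwards [ae_integral_cv_duk_congr h.a_lt hF hG hF' hG'
    (h.bilinear.wnorm_product_ne_top hF hG nF nG) (h.bilinear.wnorm_product_ne_top hF' hG' nF' nG')
    (ae_integrable_slice h.lt_b hF nF) (ae_integrable_slice h.lt_b hG nG)
    (ae_integrable_slice h.lt_b hF' nF') (ae_integrable_slice h.lt_b hG' nG') eF eG] with ξ hξ t ht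
  unfold duh srcU
  simp only [mul_assoc, integral_const_mul]
  rw [hξ t ht]

theorem PicardBounds.ae_duh_srcV_congr (h : PicardBounds σ ε χ k s a b K) (g : ℝ → ℂ)
    (hF : Measurable F)
    (hF' : Measurable F') (hG : Measurable G) (hG' : Measurable G') (nF : cnorm 1 k b F ≠ ⊤)
    (nF' : cnorm 1 k b F' ≠ ⊤) (nG : cnorm 0 s b G ≠ ⊤) (nG' : cnorm 0 s b G' ≠ ⊤)
    (eF : ∀ᵐ ξ, ∀ t ∈ Icc 0 δ, tr F ξ t = tr F' ξ t)
    (eG : ∀ᵐ ξ, ∀ t ∈ Icc 0 δ, tr G ξ t = tr G' ξ t) :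
    ∀ᵐ ξ, ∀ t ∈ Icc 0 δ, duh 0 g (srcV σ ε F F G) ξ t = duh 0 g (srcV σ ε F' F' G') ξ t := by
  have iF := ae_integrable_slice h.lt_b hF nF
  have iF' := ae_integrable_slice h.lt_b hF' nF'
  have eJ : ∀ᵐ ξ, ∀ t ∈ Icc 0 δ, tr (cj F) ξ t = tr (cj F') ξ t := by
    filter_upwards [(Measure.measurePreserving_neg
      (volume : Measure ℝ)).quasiMeasurePreserving.ae eF] with ξ hξ t ht
    rw [tr_cj, tr_cj, hξ t ht]
  have n1 := h.bilinear.wnorm_modulus_ne_top hF hF nF nF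
  have n2 := h.bilinear.wnorm_modulus_ne_top hF' hF' nF' nF'
  filter_upwards [ae_integral_cv_duk_congr h.a_lt hF (measurable_cj hF) hF' (measurable_cj hF')
    n1 n2 iF (integrable_cj iF) iF' (integrable_cj iF') eF eJ,
    ae_integrable_slice h.lt_b hG nG, ae_integrable_slice h.lt_b hG' nG', eG,
    ae_srcSize_lt_top (κ := 0) (k := s) h.a_lt (measurable_cv hF (measurable_cj hF))
      (ne_top_of_le_ne_top n1 (wnorm_mono (Eventually.of_forall fun z => enorm_cv_le _ _ z))),
    ae_srcSize_lt_top (κ := 0) (k := s) h.a_lt (measurable_cv hF' (measurable_cj hF'))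
      (ne_top_of_le_ne_top n2 (wnorm_mono (Eventually.of_forall fun z => enorm_cv_le _ _ z)))]
    with ξ h1 h2 h3 h4 h5 h6 t ht
  have expand : ∀ {F G : ℝ × ℝ → ℂ}, Measurable F →
      srcSize 0 (cv F (cj F)) ξ < ⊤ → (Integrable fun τ => G (ξ, τ)) →
      ∫ τ, srcV σ ε F F G (ξ, τ) * duk t (τ + disp 0 ξ) =
        (σ : ℂ)⁻¹ * (ε * (∫ τ, cv F (cj F) (ξ, τ) * duk t (τ + disp 0 ξ)) -
          ∫ x in (0 : ℝ)..t, ee (x * disp 0 ξ) * tr G ξ x) := by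
    intro F G hF hs hG
    have i1 := integrable_mul_duk (measurable_cv hF (measurable_cj hF)) hs t
    have i2 : Integrable fun τ => G (ξ, τ) * duk t (τ + disp 0 ξ) := by
      refine hG.mul_bdd (c := |t| + 2) ?_ (Eventually.of_forall fun τ => ?_)
      · exact (by fun_prop : Measurable fun τ => duk t (τ + disp 0 ξ)).aestronglyMeasurable
      · refine (norm_duk_le _ _).trans ?_
        have := inv_le_one_of_one_le₀ (one_le_jb (τ + disp 0 ξ))
        nlinarith [abs_nonneg t]
    have := integral_mul_duk_eq hG (disp 0 ξ) t
    unfold tr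
    rw [← this, ← integral_const_mul, ← integral_sub (i1.const_mul _) i2, ← integral_const_mul]
    refine integral_congr_ae (Eventually.of_forall fun τ => ?_)
    simp only [srcV]; ring
  have e5 : ∫ x in (0 : ℝ)..t, ee (x * disp 0 ξ) * tr G ξ x =
      ∫ x in (0 : ℝ)..t, ee (x * disp 0 ξ) * tr G' ξ x := by
    refine intervalIntegral.integral_congr fun x hx => ?_
    rw [uIcc_of_le ht.1] at hx
    simp only [h4 x ⟨hx.1, hx.2.trans ht.2⟩]
  unfold duh
  rw [expand hF h5 h2, expand hF' h6 h3, h1 t ht, e5]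

end DuhLocality

/-! ### Translation in time -/

/-- Translation in time by `t₀` on the Fourier side. -/
def md (t₀ : ℝ) (F : ℝ × ℝ → ℂ) (z : ℝ × ℝ) : ℂ := ee (t₀ * z.2) * F z

section Modulation

variable {κ k b : ℝ} {F G q : ℝ × ℝ → ℂ}

theorem measurable_md (t₀ : ℝ) (hF : Measurable F) : Measurable (md t₀ F) := by
  unfold md; fun_prop

theorem cnorm_md (t₀ : ℝ) : cnorm κ k b (md t₀ F) = cnorm κ k b F := by
  unfold cnorm md
  simp [enorm_mul]

theorem tr_md (t₀ ξ t : ℝ) : tr (md t₀ F) ξ t = tr F ξ (t₀ + t) := by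
  unfold tr md
  refine integral_congr_ae (Eventually.of_forall fun τ => ?_)
  simp only [add_mul, ee_add]; ring

/-- The character is multiplicative over `z = w + (z - w)`, so translation in time commutes with
products. -/
theorem cv_md (t₀ : ℝ) : cv (md t₀ F) (md t₀ G) = md t₀ (cv F G) := by
  funext z
  unfold cv md
  rw [← integral_const_mul]
  refine integral_congr_ae (Eventually.of_forall fun w => ?_)
  have : t₀ * z.2 = t₀ * w.2 + t₀ * (z - w).2 := by simp only [Prod.snd_sub]; ring
  simp only
  rw [this, ee_add]; ring

theorem cj_md (t₀ : ℝ) : cj (md t₀ F) = md t₀ (cj F) := by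
  funext z
  simp [cj, md, conj_ee]

theorem srcU_md (t₀ : ℝ) : srcU (md t₀ F) (md t₀ G) = md t₀ (srcU F G) := by
  funext z
  simp only [srcU, cv_md, md]; ring

theorem srcV_md (σ ε t₀ : ℝ) :
    srcV σ ε (md t₀ F) (md t₀ F) (md t₀ G) = md t₀ (srcV σ ε F F G) := by
  funext z
  simp only [srcV, cj_md, cv_md, md]; ring

theorem srcSize_md (t₀ ξ : ℝ) : srcSize κ (md t₀ q) ξ = srcSize κ q ξ := by
  unfold srcSize md
  simp [enorm_mul]

/-- The semigroup property, from `duk_add`: the value at `t₀` serves as new datum and the source is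
translated in time. -/
theorem duh_add {f : ℝ → ℂ} {ξ : ℝ} (hq : Measurable q) (h : srcSize κ q ξ < ⊤) (t₀ t : ℝ) :
    duh κ f q ξ (t₀ + t) = duh κ (fun ξ => duh κ f q ξ t₀) (md t₀ q) ξ t := by
  have i2 := integrable_mul_duk (measurable_md t₀ hq)
    (by rwa [srcSize_md] : srcSize κ (md t₀ q) ξ < ⊤) t
  have e : ∀ τ, q (ξ, τ) * duk (t₀ + t) (τ + disp κ ξ) = q (ξ, τ) * duk t₀ (τ + disp κ ξ) +
      ee (disp κ ξ * t₀) * (md t₀ q (ξ, τ) * duk t (τ + disp κ ξ)) := by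
    intro τ
    rw [duk_add, md, show t₀ * (τ + disp κ ξ) = disp κ ξ * t₀ + t₀ * τ by ring, ee_add]
    ring
  unfold duh
  simp only [e]
  rw [integral_add (integrable_mul_duk hq h t₀) (i2.const_mul _), integral_const_mul,
    show -(disp κ ξ * (t₀ + t)) = -(disp κ ξ * t₀) + -(disp κ ξ * t) by ring, ee_add]
  linear_combination (ee (-(disp κ ξ * t)) *
    ∫ τ, md t₀ q (ξ, τ) * duk t (τ + disp κ ξ)) * ee_neg_mul_self (disp κ ξ * t₀)

end Modulation

/-! ### Uniqueness for the frequency formulation -/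

/-- The traces of `(F, G)` solve the integral equations on `[0, T]`. -/
def TraceSol (σ ε T : ℝ) (f g : ℝ → ℂ) (F G : ℝ × ℝ → ℂ) : Prop :=
  ∀ᵐ ξ, ∀ t ∈ Icc 0 T, tr F ξ t = duh 1 f (srcU F G) ξ t ∧
    tr G ξ t = duh 0 g (srcV σ ε F F G) ξ t

theorem duh_congr_data {κ : ℝ} {f f' : ℝ → ℂ} {q : ℝ × ℝ → ℂ} {ξ : ℝ} (h : f ξ = f' ξ) (t : ℝ) :
    duh κ f q ξ t = duh κ f' q ξ t := by
  unfold duh; rw [h]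

theorem measurable_tr_left {F : ℝ × ℝ → ℂ} (hF : Measurable F) (t : ℝ) :
    Measurable fun ξ => tr F ξ t := by
  have h : StronglyMeasurable fun p : ℝ × ℝ => ee (t * p.2) * F (p.1, p.2) := by
    refine Measurable.stronglyMeasurable ?_
    fun_prop
  exact h.integral_prod_right'.measurable

/-! ### Choice of the time and of the radius for the contraction -/

section Admissible

variable {a b : ℝ} {K m R₀ : ℝ≥0∞}

/-- The data condition forces a radius of order `p = T^(1/2-b)`, which grows as `T` tends to `0`.
The contraction factor is of order `T^(1-a-b)` times this radius, that is `T^μ` with `μ = 3/2 - a -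
2b > 0`. The lower bound `R₀` makes the ball contain given functions, as needed for uniqueness. -/
theorem PicardBounds.exists_admissible (hab : a + 2 * b < 3 / 2) (hb : 1 / 2 < b) (hK : K ≠ ⊤)
    (hm : m ≠ ⊤) (hR : R₀ ≠ ⊤) :
    ∃ T R, R₀ ≤ R ∧ PicardBounds.Admissible a b T K R m := by
  set μ := 3 / 2 - a - 2 * b with hμ
  have hμ0 : 0 < μ := by linarith
  -- For `R = 2 * (K * (p * m)) + R₀` and `p ≥ 1`, the number `2R + 1` is at most `p` times the
  -- inner bracket. The contraction condition thus follows from `T ^ μ * A ≤ 1/2`.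
  set A : ℝ≥0∞ := K * (K * (4 * (K * m) + 2 * R₀ + 1)) with hA
  have hA1 : A ≠ ⊤ := by finiteness
  obtain ⟨T, hT0, hT2, hT⟩ : ∃ T : ℝ, 0 < T ∧ 2 * T ≤ 1 ∧ T ^ μ * A.toReal ≤ 1 / 2 := by
    have h1 : Tendsto (fun T : ℝ => T ^ μ * A.toReal) (𝓝[>] 0) (𝓝 (0 ^ μ * A.toReal)) :=
      ((Real.continuousAt_rpow_const 0 μ (Or.inr hμ0.le)).tendsto.mono_left
        nhdsWithin_le_nhds).mul_const _
    rw [Real.zero_rpow hμ0.ne', zero_mul] at h1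
    have h2 : ∀ᶠ T : ℝ in 𝓝[>] 0, T ∈ Ioo (0 : ℝ) (1 / 2) :=
      Ioo_mem_nhdsGT (by norm_num)
    obtain ⟨T, h3, h4⟩ := ((h1.eventually_le_const (by norm_num : (0 : ℝ) < 1 / 2)).and h2).exists
    exact ⟨T, h4.1, by linarith [h4.2], h3⟩
  have hT1 : T ≤ 1 := by linarith
  have hT' : ENNReal.ofReal (T ^ μ) * A ≤ 1 / 2 := by
    rw [← ENNReal.ofReal_toReal hA1, ← ENNReal.ofReal_mul (by positivity)]
    refine (ENNReal.ofReal_le_ofReal hT).trans (le_of_eq ?_)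
    rw [ENNReal.ofReal_div_of_pos (by norm_num)]; simp
  set p := ENNReal.ofReal (T ^ (1 / 2 - b)) with hp
  set r := ENNReal.ofReal (T ^ (1 - a - b)) with hr
  have hp1 : 1 ≤ p := by
    rw [hp, ← ENNReal.ofReal_one]
    exact ENNReal.ofReal_le_ofReal (Real.one_le_rpow_of_pos_of_le_one_of_nonpos hT0 hT1
      (by linarith))
  have hpr : p * r = ENNReal.ofReal (T ^ μ) := by
    rw [hp, hr, ← ENNReal.ofReal_mul (by positivity), ← Real.rpow_add hT0, hμ]
    ring_nf
  refine ⟨T, 2 * (K * (p * m)) + R₀, le_add_self, hT0, hT2, by finiteness, ?_, ?_⟩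
  · rw [ENNReal.le_div_iff_mul_le (by simp) (by simp), mul_comm]
    exact le_self_add
  · calc K * (r * (K * (2 * (2 * (K * (p * m)) + R₀) + 1))) =
          K * (r * (K * (p * (4 * (K * m)) + (2 * R₀ + 1)))) := by ring
      _ ≤ K * (r * (K * (p * (4 * (K * m)) + p * (2 * R₀ + 1)))) := by
          gcongr
          exact le_mul_of_one_le_left zero_le hp1
      _ = (p * r) * A := by rw [hA]; ring
      _ ≤ 1 / 2 := by rw [hpr]; exact hT'

end Admissible

/-! ### Uniqueness on a short interval and its continuation -/

namespace PicardBounds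

variable {σ ε k s a b T δ : ℝ} {χ : 𝓢(ℝ, ℂ)} {K R m : ℝ≥0∞} {f f' g g' : ℝ → ℂ}
  {F F' G G' : ℝ × ℝ → ℂ}

theorem snorm_tr_le (h : PicardBounds σ ε χ k s a b K) (κ r : ℝ) (hF : Measurable F) (t : ℝ) :
    snorm r (fun ξ => tr F ξ t) ≤ K * cnorm κ r b F :=
  le_trans (l2_mono fun ξ => by gcongr; exact enorm_tr_le F ξ t) (h.trace κ r F hF)

theorem ae_tr_duhF (h : PicardBounds σ ε χ k s a b K) (hχ : ∀ t, |t| ≤ 1 → χ t = 1)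
    {κ r : ℝ} {q : ℝ × ℝ → ℂ} (hT : 0 < T) (hf : Measurable f)
    (hq : Measurable q) (nq : cnorm κ r (-a) q ≠ ⊤) (nF : cnorm κ r b (duhF χ T κ f q) ≠ ⊤) :
    ∀ᵐ ξ, ∀ t ∈ Icc 0 T, tr (duhF χ T κ f q) ξ t = duh κ f q ξ t := by
  filter_upwards [ae_srcSize_lt_top h.a_lt hq nq,
    ae_integrable_slice h.lt_b (measurable_duhF χ T κ hf hq) nF] with ξ h1 h2 t ht
  rw [tr_duhF χ hT hq h1 h2, hχ, one_mul]
  rw [abs_of_nonneg (div_nonneg ht.1 hT.le)]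
  exact div_le_one_of_le₀ ht.2 hT.le

/-- A trace is bounded at all times simultaneously by the integral of `‖A n (ξ, τ)‖` in `τ`. The
infimum of these integrals over `n` has zero weighted norm, hence vanishes outside one null set of
frequencies that does not depend on `t`. -/
theorem ae_tr_eq_of_approx (h : PicardBounds σ ε χ k s a b K) {κ r : ℝ} {D : ℝ≥0∞} (hD : D ≠ ⊤)
    {A : ℕ → ℝ × ℝ → ℂ} (hA : ∀ n, Measurable (A n)) (nA : ∀ n, cnorm κ r b (A n) ≤ D / 2 ^ n)
    {y : ℝ → ℝ → ℂ} (hy : ∀ n, ∀ᵐ ξ, ∀ t ∈ Icc 0 δ, y ξ t = tr (A n) ξ t) :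
    ∀ᵐ ξ, ∀ t ∈ Icc 0 δ, y ξ t = 0 := by
  let M : ℝ → ℝ≥0∞ := fun ξ => ⨅ n, ∫⁻ τ, ‖A n (ξ, τ)‖ₑ
  have mM : Measurable M := Measurable.iInf fun n => measurable_lintegral_slice (hA n)
  have hK := h.bilinear.ne_top
  have h0 : l2 (fun ξ => ENNReal.ofReal (jb ξ ^ r) * M ξ) = 0 := by
    have h1 : ∀ n : ℕ, l2 (fun ξ => ENNReal.ofReal (jb ξ ^ r) * M ξ) ≤ K * D * (2⁻¹) ^ n := by
      intro n
      refine le_trans (l2_mono fun ξ => ?_) ((h.trace κ r (A n) (hA n)).trans ?_)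
      · gcongr; exact iInf_le _ n
      · rw [mul_assoc]
        gcongr
        rw [← ENNReal.inv_pow, ← div_eq_mul_inv]
        exact nA n
    have h2 : Tendsto (fun n : ℕ => K * D * (2⁻¹ : ℝ≥0∞) ^ n) atTop (𝓝 (K * D * 0)) :=
      ENNReal.Tendsto.const_mul (ENNReal.tendsto_pow_atTop_nhds_zero_of_lt_one
        (by simp)) (Or.inr (by finiteness))
    rw [mul_zero] at h2
    exact le_antisymm (ge_of_tendsto' h2 h1) zero_le
  have h1 := (l2_eq_zero_iff (by fun_prop)).1 h0
  filter_upwards [h1, ae_all_iff.2 hy] with ξ h2 h3 t ht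
  have h4 : M ξ = 0 := by simpa [(jb_rpow_pos ξ r).not_ge] using h2
  have h5 : ‖y ξ t‖ₑ ≤ M ξ := le_iInf fun n => by
    rw [h3 n t ht]; exact enorm_tr_le _ _ _
  rw [h4] at h5
  simpa using h5

/-- The two pairs are not fixed points, only their traces on `[0, δ]` satisfy the integral
equations. By locality, applying the Picard map does not change these traces, since the cutoff
equals `1` there. Each application halves the distance between the two iterates, so the traces have
to coincide. -/
theorem traceSol_unique_short (h : PicardBounds σ ε χ k s a b K)
    (hχ : ∀ t, |t| ≤ 1 → χ t = 1) (hT : Admissible a b T K R m) (hδ : δ ≤ T)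
    (hf : Measurable f) (hg : Measurable g) (nf : snorm k f ≤ m) (ng : snorm s g ≤ m)
    (hF : Measurable F) (hF' : Measurable F') (hG : Measurable G) (hG' : Measurable G')
    (nF : cnorm 1 k b F ≤ R) (nF' : cnorm 1 k b F' ≤ R)
    (nG : cnorm 0 s b G ≤ R) (nG' : cnorm 0 s b G' ≤ R)
    (hs : TraceSol σ ε δ f g F G) (hs' : TraceSol σ ε δ f g F' G') :
    ∀ᵐ ξ, ∀ t ∈ Icc 0 δ, tr F ξ t = tr F' ξ t ∧ tr G ξ t = tr G' ξ t := by
  have fin : ∀ {x : ℝ≥0∞}, x ≤ R → x ≠ ⊤ := fun h => ne_top_of_le_ne_top hT.ne_top h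
  let Good : (ℝ × ℝ → ℂ) → (ℝ × ℝ → ℂ) → (ℝ × ℝ → ℂ) → (ℝ × ℝ → ℂ) → Prop := fun F G A B =>
    Measurable A ∧ Measurable B ∧ cnorm 1 k b A ≤ R ∧ cnorm 0 s b B ≤ R ∧
      (∀ᵐ ξ, ∀ t ∈ Icc 0 δ, tr A ξ t = tr F ξ t) ∧ (∀ᵐ ξ, ∀ t ∈ Icc 0 δ, tr B ξ t = tr G ξ t)
  have step : ∀ {F G A B : ℝ × ℝ → ℂ}, Measurable F → Measurable G → cnorm 1 k b F ≤ R →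
      cnorm 0 s b G ≤ R → TraceSol σ ε δ f g F G → Good F G A B →
      Good F G (duhF χ T 1 f (srcU A B)) (duhF χ T 0 g (srcV σ ε A A B)) := by
    intro F G A B hF hG nF nG hs ⟨hA, hB, nA, nB, eA, eB⟩
    obtain ⟨n1, n2⟩ := h.mapsTo_ball hT hf hg nf ng hA hB nA nB
    have mU := measurable_srcU hA hB
    have mV := measurable_srcV σ ε hA hA hB
    refine ⟨measurable_duhF χ T 1 hf mU, measurable_duhF χ T 0 hg mV, n1, n2, ?_, ?_⟩
    · filter_upwards [h.ae_tr_duhF hχ hT.pos hf mU (h.srcU_ne_top hA hB (fin nA) (fin nB)) (fin n1),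
        h.ae_duh_srcU_congr f hA hF hB hG (fin nA) (fin nF) (fin nB) (fin nG) eA eB, hs]
        with ξ h1 h2 h3 t ht
      rw [h1 t ⟨ht.1, ht.2.trans hδ⟩, h2 t ht, (h3 t ht).1]
    · filter_upwards [h.ae_tr_duhF hχ hT.pos hg mV
        (h.srcV_ne_top hA hA hB (fin nA) (fin nA) (fin nB)) (fin n2),
        h.ae_duh_srcV_congr g hA hF hB hG (fin nA) (fin nF) (fin nB) (fin nG) eA eB, hs]
        with ξ h1 h2 h3 t ht
      rw [h1 t ⟨ht.1, ht.2.trans hδ⟩, h2 t ht, (h3 t ht).2]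
  have hR := hT.ne_top
  have iter : ∀ n : ℕ, ∃ A B A' B' : ℝ × ℝ → ℂ, Good F G A B ∧ Good F' G' A' B' ∧
      cnorm 1 k b (fun z => A z - A' z) ≤ (R + R) / 2 ^ n ∧
      cnorm 0 s b (fun z => B z - B' z) ≤ (R + R) / 2 ^ n := by
    intro n
    induction n with
    | zero =>
      refine ⟨F, G, F', G', ⟨hF, hG, nF, nG, ?_, ?_⟩, ⟨hF', hG', nF', nG', ?_, ?_⟩, ?_, ?_⟩
      · exact Eventually.of_forall fun ξ t _ => rfl
      · exact Eventually.of_forall fun ξ t _ => rfl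
      · exact Eventually.of_forall fun ξ t _ => rfl
      · exact Eventually.of_forall fun ξ t _ => rfl
      · rw [pow_zero, div_one]
        exact (cnorm_sub_le hF hF').trans (add_le_add nF nF')
      · rw [pow_zero, div_one]
        exact (cnorm_sub_le hG hG').trans (add_le_add nG nG')
    | succ n ih =>
      obtain ⟨A, B, A', B', g1, g2, d1, d2⟩ := ih
      have z1 : ∀ (r : ℝ) (w : ℝ → ℂ), snorm r (fun x => w x - w x) = 0 := by
        intro r w; simp [snorm, l2]
      have hD : (R + R) / 2 ^ n ≠ ⊤ := ENNReal.div_ne_top (by finiteness) (by simp)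
      have e : (R + R) / 2 ^ (n + 1) = (R + R) / 2 ^ n / 2 := by
        rw [pow_succ, div_eq_mul_inv, div_eq_mul_inv, div_eq_mul_inv,
          ENNReal.mul_inv (by simp) (by simp), mul_assoc]
      refine ⟨_, _, _, _, step hF hG nF nG hs g1, step hF' hG' nF' nG' hs' g2, ?_, ?_⟩
      · refine (h.sub_duhF_srcU_le hT.pos hT.le_one hR hD hf hf g1.1 g2.1 g1.2.1 g2.2.1 g1.2.2.1
          g2.2.2.1 g1.2.2.2.1 g2.2.2.2.1 d1 d2).trans ?_
        rw [z1, mul_zero, zero_add, e]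
        exact hT.contract_le _
      · refine (h.sub_duhF_srcV_le hT.pos hT.le_one hR hD hg hg g1.1 g2.1 g1.2.1 g2.2.1 g1.2.2.1
          g2.2.2.1 g1.2.2.2.1 g2.2.2.2.1 d1 d2).trans ?_
        rw [z1, mul_zero, zero_add, e]
        exact hT.contract_le _
  choose A B A' B' g1 g2 d1 d2 using iter
  have tsub : ∀ {X Y : ℝ × ℝ → ℂ} {ξ t : ℝ}, Integrable (fun τ => X (ξ, τ)) →
      Integrable (fun τ => Y (ξ, τ)) →
      tr (fun z => X z - Y z) ξ t = tr X ξ t - tr Y ξ t := by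
    intro X Y ξ t hX hY
    have hb : ∀ {X : ℝ × ℝ → ℂ}, Integrable (fun τ => X (ξ, τ)) →
        Integrable fun τ => ee (t * τ) * X (ξ, τ) := fun hX =>
      hX.bdd_mul (c := 1) (by fun_prop) (Eventually.of_forall fun τ => by simp)
    unfold tr
    simp only [mul_sub]
    exact integral_sub (hb hX) (hb hY)
  have u1 := h.ae_tr_eq_of_approx (δ := δ) (κ := 1) (r := k) (D := R + R) (by finiteness)
    (fun n => (g1 n).1.sub (g2 n).1) d1 (y := fun ξ t => tr F ξ t - tr F' ξ t) (fun n => by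
      filter_upwards [(g1 n).2.2.2.2.1, (g2 n).2.2.2.2.1,
        ae_integrable_slice h.lt_b (g1 n).1 (fin (g1 n).2.2.1),
        ae_integrable_slice h.lt_b (g2 n).1 (fin (g2 n).2.2.1)] with ξ h1 h2 h3 h4 t ht
      rw [← h1 t ht, ← h2 t ht]
      exact (tsub h3 h4).symm)
  have u2 := h.ae_tr_eq_of_approx (δ := δ) (κ := 0) (r := s) (D := R + R) (by finiteness)
    (fun n => (g1 n).2.1.sub (g2 n).2.1) d2 (y := fun ξ t => tr G ξ t - tr G' ξ t) (fun n => by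
      filter_upwards [(g1 n).2.2.2.2.2, (g2 n).2.2.2.2.2,
        ae_integrable_slice h.lt_b (g1 n).2.1 (fin (g1 n).2.2.2.1),
        ae_integrable_slice h.lt_b (g2 n).2.1 (fin (g2 n).2.2.2.1)] with ξ h1 h2 h3 h4 t ht
      rw [← h1 t ht, ← h2 t ht]
      exact (tsub h3 h4).symm)
  filter_upwards [u1, u2] with ξ h1 h2 t ht
  exact ⟨sub_eq_zero.1 (h1 t ht), sub_eq_zero.1 (h2 t ht)⟩

theorem traceSol_restart (h : PicardBounds σ ε χ k s a b K) {t₀ : ℝ} (ht₀ : 0 ≤ t₀) (ht₁ : t₀ ≤ T)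
    (hF : Measurable F) (hG : Measurable G) (nF : cnorm 1 k b F ≠ ⊤) (nG : cnorm 0 s b G ≠ ⊤)
    (hs : TraceSol σ ε T f g F G) : TraceSol σ ε (T - t₀) (fun ξ => tr F ξ t₀)
      (fun ξ => tr G ξ t₀) (md t₀ F) (md t₀ G) := by
  have mU := measurable_srcU hF hG
  have mV := measurable_srcV σ ε hF hF hG
  unfold TraceSol at hs ⊢
  filter_upwards [hs, ae_srcSize_lt_top h.a_lt mU (h.srcU_ne_top hF hG nF nG),
    ae_srcSize_lt_top h.a_lt mV (h.srcV_ne_top hF hF hG nF nF nG)] with ξ h1 h2 h3 t ht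
  have a1 := h1 t₀ ⟨ht₀, ht₁⟩
  have a2 := h1 (t₀ + t) ⟨by linarith [ht.1], by linarith [ht.2]⟩
  rw [tr_md, tr_md, srcU_md, srcV_md, a2.1, a2.2, duh_add mU h2, duh_add mV h3]
  exact ⟨duh_congr_data (by rw [a1.1]) t, duh_congr_data (by rw [a1.2]) t⟩

/-- The four space-time norms are invariant under translation in time and control the data at every
restart through the trace estimate. One step length `δ` therefore serves for all restarts, and
induction on the number of steps reaches `T`. -/
theorem traceSol_unique (h : PicardBounds σ ε χ k s a b K) (hab : a + 2 * b < 3 / 2)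
    (hχ : ∀ t, |t| ≤ 1 → χ t = 1) (hf : f =ᵐ[volume] f') (hg : g =ᵐ[volume] g')
    (hF : Measurable F) (hF' : Measurable F') (hG : Measurable G) (hG' : Measurable G')
    (nF : cnorm 1 k b F ≠ ⊤) (nF' : cnorm 1 k b F' ≠ ⊤)
    (nG : cnorm 0 s b G ≠ ⊤) (nG' : cnorm 0 s b G' ≠ ⊤)
    (hs : TraceSol σ ε T f g F G) (hs' : TraceSol σ ε T f' g' F' G') :
    ∀ᵐ ξ, ∀ t ∈ Icc 0 T, tr F ξ t = tr F' ξ t ∧ tr G ξ t = tr G' ξ t := by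
  set M := cnorm 1 k b F + cnorm 1 k b F' + cnorm 0 s b G + cnorm 0 s b G' with hM
  have hK := h.bilinear.ne_top
  have l1 : cnorm 1 k b F ≤ M := by
    rw [hM, add_assoc, add_assoc]; exact le_self_add
  have l2 : cnorm 1 k b F' ≤ M := by
    rw [hM, add_assoc, add_assoc, add_left_comm]; exact le_self_add
  have l3 : cnorm 0 s b G ≤ M := by rw [hM, add_right_comm]; exact le_add_self
  have l4 : cnorm 0 s b G' ≤ M := le_add_self
  have hMt : M ≠ ⊤ := by finiteness
  obtain ⟨δ, R, hMR, hδ⟩ := exists_admissible (m := K * M) (R₀ := M) hab h.lt_b hK (by finiteness)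
    hMt
  have agree0 : 0 ≤ T → ∀ᵐ ξ, tr F ξ 0 = tr F' ξ 0 ∧ tr G ξ 0 = tr G' ξ 0 := by
    intro hT
    filter_upwards [hs, hs', hf, hg] with ξ h1 h2 h3 h4
    have a1 := h1 0 ⟨le_rfl, hT⟩
    have a2 := h2 0 ⟨le_rfl, hT⟩
    rw [a1.1, a1.2, a2.1, a2.2]
    simp [duh, h3, h4]
  have main : ∀ n : ℕ, ∀ᵐ ξ, ∀ t ∈ Icc 0 T, t ≤ n * δ →
      tr F ξ t = tr F' ξ t ∧ tr G ξ t = tr G' ξ t := by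
    intro n
    induction n with
    | zero =>
      rcases le_or_gt 0 T with hT | hT
      · filter_upwards [agree0 hT] with ξ hξ t ht ht0
        have : t = 0 := le_antisymm (by simpa using ht0) ht.1
        rw [this]; exact hξ
      · exact Eventually.of_forall fun ξ t ht => absurd (ht.1.trans ht.2) (not_le.2 hT)
    | succ n ih =>
      set t₀ : ℝ := n * δ with ht₀
      have h0 : 0 ≤ t₀ := by have := hδ.pos; positivity
      rcases le_or_gt t₀ T with hT | hT
      · have r1 := h.traceSol_restart h0 hT hF hG nF nG hs
        have r2 := h.traceSol_restart h0 hT hF' hG' nF' nG' hs'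
        have at0 : ∀ᵐ ξ, tr F ξ t₀ = tr F' ξ t₀ ∧ tr G ξ t₀ = tr G' ξ t₀ :=
          ih.mono fun ξ hξ => hξ t₀ ⟨h0, hT⟩ le_rfl
        -- The last step is shortened so as not to pass the time `T`.
        set ρ := min δ (T - t₀) with hρ
        have r1' : TraceSol σ ε ρ (fun ξ => tr F ξ t₀) (fun ξ => tr G ξ t₀) (md t₀ F)
            (md t₀ G) := r1.mono fun ξ hξ t ht => hξ t ⟨ht.1, ht.2.trans (min_le_right _ _)⟩
        have r2' : TraceSol σ ε ρ (fun ξ => tr F ξ t₀) (fun ξ => tr G ξ t₀) (md t₀ F')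
            (md t₀ G') := by
          filter_upwards [r2, at0] with ξ hξ h2 t ht
          have := hξ t ⟨ht.1, ht.2.trans (min_le_right _ _)⟩
          rw [this.1, this.2]
          exact ⟨duh_congr_data (by rw [h2.1]) t, duh_congr_data (by rw [h2.2]) t⟩
        have u := h.traceSol_unique_short hχ hδ (min_le_left _ _) (measurable_tr_left hF t₀)
          (measurable_tr_left hG t₀)
          ((h.snorm_tr_le 1 k hF t₀).trans (by gcongr))
          ((h.snorm_tr_le 0 s hG t₀).trans (by gcongr)) (measurable_md t₀ hF)
          (measurable_md t₀ hF') (measurable_md t₀ hG) (measurable_md t₀ hG')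
          (by rw [cnorm_md]; exact l1.trans hMR) (by rw [cnorm_md]; exact l2.trans hMR)
          (by rw [cnorm_md]; exact l3.trans hMR) (by rw [cnorm_md]; exact l4.trans hMR) r1' r2'
        filter_upwards [ih, u] with ξ h1 h2 t ht htn
        rcases le_or_gt t t₀ with hle | hlt
        · exact h1 t ht hle
        · have h3 := h2 (t - t₀) ⟨by linarith, le_min (by push_cast at htn; linarith)
            (by linarith [ht.2])⟩
          simpa only [tr_md, add_sub_cancel] using h3
      · filter_upwards [ih] with ξ hξ t ht _
        exact hξ t ht (ht.2.trans hT.le)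
  obtain ⟨n, hn⟩ := exists_nat_ge (T / δ)
  filter_upwards [main n] with ξ hξ t ht
  exact hξ t ht (ht.2.trans ((div_le_iff₀ hδ.pos).1 hn))

end PicardBounds

/-! ### Tempered distributions whose Fourier transform is a function -/

section HasFourierFun

variable {E : Type*} [NormedAddCommGroup E] [InnerProductSpace ℝ E] [FiniteDimensional ℝ E]
  [MeasurableSpace E] [BorelSpace E] {f f' : 𝓢'(E, ℂ)} {g g' : E → ℂ}

namespace HasFourierFun

theorem apply_eq (h : HasFourierFun f g) (φ : 𝓢(E, ℂ)) :
    f φ = ∫ ζ, (𝓕⁻ φ : 𝓢(E, ℂ)) ζ * g ζ := by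
  rw [← (h _).2, TemperedDistribution.fourier_apply, FourierTransform.fourier_fourierInv_eq]

theorem congr (h : HasFourierFun f g) (hg : g =ᵐ[volume] g') : HasFourierFun f g' := fun φ => by
  have e : (fun ζ => φ ζ * g ζ) =ᵐ[volume] fun ζ => φ ζ * g' ζ := by
    filter_upwards [hg] with ζ hζ
    rw [hζ]
  exact ⟨(h φ).1.congr e, (h φ).2.trans (integral_congr_ae e)⟩

theorem ext (h : HasFourierFun f g) (h' : HasFourierFun f' g) : f = f' := by
  ext φ
  rw [h.apply_eq, h'.apply_eq]

theorem add (h : HasFourierFun f g) (h' : HasFourierFun f' g') :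
    HasFourierFun (f + f') (fun ζ => g ζ + g' ζ) := fun φ => by
  simp only [mul_add]
  refine ⟨(h φ).1.add (h' φ).1, ?_⟩
  rw [integral_add (h φ).1 (h' φ).1, ← (h φ).2, ← (h' φ).2]
  simp [TemperedDistribution.fourier_apply]

theorem smul (c : ℂ) (h : HasFourierFun f g) : HasFourierFun (c • f) (fun ζ => c * g ζ) :=
  fun φ => by
  simp only [mul_left_comm _ c]
  refine ⟨(h φ).1.const_mul c, ?_⟩
  rw [integral_const_mul, ← (h φ).2]
  simp [TemperedDistribution.fourier_apply]

theorem sub (h : HasFourierFun f g) (h' : HasFourierFun f' g') :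
    HasFourierFun (f - f') (fun ζ => g ζ - g' ζ) := fun φ => by
  simp only [mul_sub]
  refine ⟨(h φ).1.sub (h' φ).1, ?_⟩
  rw [integral_sub (h φ).1 (h' φ).1, ← (h φ).2, ← (h' φ).2]
  simp [TemperedDistribution.fourier_apply]

/-- A bump function equal to `1` near the point converts integrability against Schwartz functions
into integrability on a ball. -/
theorem locallyIntegrable (h : HasFourierFun f g) : LocallyIntegrable g := by
  intro x
  let B : ContDiffBump x := ⟨1, 2, one_pos, one_lt_two⟩
  have hs : HasCompactSupport fun y => ((B y : ℝ) : ℂ) :=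
    B.hasCompactSupport.comp_left (g := fun r : ℝ => (r : ℂ)) (by simp)
  have hd : ContDiff ℝ ∞ fun y => ((B y : ℝ) : ℂ) := Complex.ofRealCLM.contDiff.comp B.contDiff
  refine ⟨Metric.closedBall x 1, Metric.closedBall_mem_nhds x one_pos, ?_⟩
  refine ((h (hs.toSchwartzMap hd)).1.integrableOn (s := Metric.closedBall x 1)).congr_fun
    (fun y hy => ?_) Metric.isClosed_closedBall.measurableSet
  simp [B.one_of_mem_closedBall hy]

/-- Compactly supported smooth functions are Schwartz functions and determine a locally integrable
density. Consequently the infimum in `fourierNorm` is over a single value. -/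
theorem ae_eq (h : HasFourierFun f g) (h' : HasFourierFun f g') : g =ᵐ[volume] g' := by
  refine ae_eq_of_integral_contDiff_smul_eq h.locallyIntegrable h'.locallyIntegrable
    fun φ hφ hc => ?_
  have hs : HasCompactSupport fun y => ((φ y : ℝ) : ℂ) :=
    hc.comp_left (g := fun r : ℝ => (r : ℂ)) (by simp)
  have hd : ContDiff ℝ ∞ fun y => ((φ y : ℝ) : ℂ) := Complex.ofRealCLM.contDiff.comp hφ
  have := (h (hs.toSchwartzMap hd)).2.symm.trans (h' (hs.toSchwartzMap hd)).2
  simpa using this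

theorem exists_measurable (h : HasFourierFun f g) :
    ∃ g' : E → ℂ, Measurable g' ∧ g =ᵐ[volume] g' ∧ HasFourierFun f g' := by
  have hm := h.locallyIntegrable.aestronglyMeasurable.aemeasurable
  exact ⟨hm.mk g, hm.measurable_mk, hm.ae_eq_mk, h.congr hm.ae_eq_mk⟩

theorem fourierNorm_eq (h : HasFourierFun f g) (w : E → ℝ) :
    fourierNorm w f = eLpNorm (fun ζ => (w ζ : ℂ) * g ζ) 2 volume := by
  refine le_antisymm (iInf₂_le g h) (le_iInf₂ fun g' h' => le_of_eq ?_)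
  refine eLpNorm_congr_ae ?_
  filter_upwards [h.ae_eq h'] with ζ hζ
  rw [hζ]

theorem conj (h : HasFourierFun f g) :
    HasFourierFun (conjDist f) (fun ζ => (starRingEnd ℂ) (g (-ζ))) := fun φ => by
  -- Conjugation of a distribution is conjugation with reflection in frequency; `φ'` transfers both
  -- operations to the test function.
  let φ' : 𝓢(E, ℂ) := conjSchwartz (SchwartzMap.compCLMOfContinuousLinearEquiv ℂ
    (ContinuousLinearEquiv.neg ℝ) φ)
  have e0 : ∀ ζ, φ' ζ = (starRingEnd ℂ) (φ (-ζ)) := fun ζ => rfl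
  have e1 : (fun ζ => φ ζ * (starRingEnd ℂ) (g (-ζ))) =
      fun ζ => (fun ζ => (starRingEnd ℂ) (φ' ζ * g ζ)) (-ζ) := by
    funext ζ; simp [e0]
  have hi : Integrable fun ζ => (starRingEnd ℂ) (φ' ζ * g ζ) :=
    Complex.conjCLE.toContinuousLinearMap.integrable_comp (h φ').1
  refine ⟨by rw [e1]; exact hi.comp_neg, ?_⟩
  rw [e1, integral_neg_eq_self (fun ζ => (starRingEnd ℂ) (φ' ζ * g ζ)), integral_conj,
    ← (h φ').2, TemperedDistribution.fourier_apply, TemperedDistribution.fourier_apply,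
    conjDist_apply]
  congr 2
  ext x
  change (starRingEnd ℂ) ((𝓕 φ : 𝓢(E, ℂ)) x) = (𝓕 φ' : 𝓢(E, ℂ)) x
  rw [SchwartzMap.fourier_coe, SchwartzMap.fourier_coe, Real.fourier_eq, Real.fourier_eq,
    ← integral_conj, ← integral_neg_eq_self]
  refine integral_congr_ae (Eventually.of_forall fun y => ?_)
  simp only [e0, Circle.smul_def, smul_eq_mul, map_mul, inner_neg_left, neg_neg]
  rw [← Circle.coe_inv_eq_conj, ← AddChar.map_neg_eq_inv]

end HasFourierFun

/-- A function of polynomial growth in the `L¹` sense is the Fourier transform of a tempered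
distribution. -/
theorem exists_hasFourierFun (hg : Measurable g) (N : ℕ)
    (h : ∫⁻ ζ, ‖g ζ‖ₑ * ENNReal.ofReal (((1 + ‖ζ‖) ^ N)⁻¹) ≠ ⊤) :
    ∃ f : 𝓢'(E, ℂ), HasFourierFun f g := by
  set I : ℝ := (∫⁻ ζ, ‖g ζ‖ₑ * ENNReal.ofReal (((1 + ‖ζ‖) ^ N)⁻¹)).toReal with hI
  have hbd : ∀ φ : 𝓢(E, ℂ), ∫⁻ ζ, ‖φ ζ * g ζ‖ₑ ≤ ENNReal.ofReal (2 ^ N *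
      (Finset.Iic (N, 0)).sup (fun m => SchwartzMap.seminorm ℂ m.1 m.2) φ * I) := by
    intro φ
    set S := 2 ^ N * (Finset.Iic (N, 0)).sup (fun m => SchwartzMap.seminorm ℂ m.1 m.2) φ
    have hS : 0 ≤ S := by positivity
    rw [ENNReal.ofReal_mul hS, hI, ENNReal.ofReal_toReal h,
      ← lintegral_const_mul' _ _ ENNReal.ofReal_ne_top]
    refine lintegral_mono fun ζ => ?_
    have h1 := SchwartzMap.one_add_le_sup_seminorm_apply (𝕜 := ℂ) (m := (N, 0)) (k := N) (n := 0)
      le_rfl le_rfl φ ζ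
    rw [norm_iteratedFDeriv_zero] at h1
    have hp : 0 < (1 + ‖ζ‖) ^ N := by positivity
    have h2 : ‖φ ζ‖ ≤ S * ((1 + ‖ζ‖) ^ N)⁻¹ := by
      rw [← div_eq_mul_inv, le_div_iff₀ hp, mul_comm]; exact h1
    rw [enorm_mul, mul_left_comm, mul_comm]
    gcongr
    rw [← ENNReal.ofReal_mul hS, ← ofReal_norm]
    exact ENNReal.ofReal_le_ofReal h2
  have hint : ∀ φ : 𝓢(E, ℂ), Integrable fun ζ => φ ζ * g ζ := fun φ =>
    ⟨(φ.continuous.measurable.mul hg).aestronglyMeasurable,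
      (hbd φ).trans_lt ENNReal.ofReal_lt_top⟩
  let D : 𝓢(E, ℂ) →L[ℂ] ℂ := SchwartzMap.mkCLMtoNormedSpace (fun φ => ∫ ζ, φ ζ * g ζ)
    (fun φ χ => by
      simp only [add_apply, add_mul]
      exact integral_add (hint φ) (hint χ))
    (fun c φ => by
      simp only [smul_apply, smul_eq_mul, mul_assoc, integral_const_mul]
      rfl)
    ⟨Finset.Iic (N, 0), 2 ^ N * I, by positivity, fun φ => by
      have h1 := (enorm_integral_le_lintegral_enorm (fun ζ => φ ζ * g ζ)).trans (hbd φ)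
      rw [← ofReal_norm, ENNReal.ofReal_le_ofReal_iff (by positivity)] at h1
      refine h1.trans (le_of_eq ?_)
      rw [mul_right_comm]
      rfl⟩
  let D' : 𝓢'(E, ℂ) := ContinuousLinearMap.toPointwiseConvergenceCLM ℂ _ _ _ D
  refine ⟨𝓕⁻ D', fun φ => ⟨hint φ, ?_⟩⟩
  rw [FourierTransform.fourier_fourierInv_eq]
  rfl

end HasFourierFun

/-! ### Sobolev norms and Fourier transforms on the line -/

section Line

variable {k : ℝ} {f f' : 𝓢'(ℝ, ℂ)} {g g' : ℝ → ℂ}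

theorem eLpNorm_eq_l2 {α : Type*} [MeasureSpace α] {w : α → ℝ} (hw : ∀ x, 0 ≤ w x) (g : α → ℂ) :
    eLpNorm (fun x => (w x : ℂ) * g x) 2 volume =
      l2 fun x => ENNReal.ofReal (w x) * ‖g x‖ₑ := by
  rw [eLpNorm_eq_lintegral_rpow_enorm_toReal (by norm_num) (by norm_num)]
  unfold l2
  have e : ∀ x, ‖(w x : ℂ) * g x‖ₑ = ENNReal.ofReal (w x) * ‖g x‖ₑ := fun x => by
    rw [enorm_mul, ← ofReal_norm, Complex.norm_real, Real.norm_of_nonneg (hw x)]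
  simp [e]

theorem HasFourierFun.sobolevNorm_eq (h : HasFourierFun f g) : sobolevNorm k f = snorm k g := by
  unfold sobolevNorm
  rw [h.fourierNorm_eq]
  exact eLpNorm_eq_l2 (w := fun ξ => jb ξ ^ k) (fun ξ => (jb_rpow_pos ξ k).le) g

theorem MemH.exists_hasFourierFun (h : MemH k f) :
    ∃ g, Measurable g ∧ HasFourierFun f g ∧ snorm k g = sobolevNorm k f := by
  have h1 : ∃ g, HasFourierFun f g := by
    by_contra! hc
    unfold MemH sobolevNorm fourierNorm at h
    simp [hc] at h
  obtain ⟨g, hg⟩ := h1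
  obtain ⟨g', hm, -, hg'⟩ := hg.exists_measurable
  exact ⟨g', hm, hg', hg'.sobolevNorm_eq.symm⟩

theorem snorm_add_le (hg : Measurable g) (hg' : Measurable g') :
    snorm k (fun ξ => g ξ + g' ξ) ≤ snorm k g + snorm k g' := by
  refine le_trans (l2_mono fun ξ => ?_) (l2_add_le (f := fun ξ => ENNReal.ofReal (jb ξ ^ k) * ‖g ξ‖ₑ)
    (g := fun ξ => ENNReal.ofReal (jb ξ ^ k) * ‖g' ξ‖ₑ) (by fun_prop) (by fun_prop))
  rw [← mul_add]
  gcongr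
  exact enorm_add_le _ _

theorem sobolevNorm_add_le (h : MemH k f) (h' : MemH k f') :
    sobolevNorm k (f + f') ≤ sobolevNorm k f + sobolevNorm k f' := by
  obtain ⟨g, hg, hf, e⟩ := h.exists_hasFourierFun
  obtain ⟨g', hg', hf', e'⟩ := h'.exists_hasFourierFun
  rw [← e, ← e', (hf.add hf').sobolevNorm_eq]
  exact snorm_add_le hg hg'

theorem jb_le_mul_one_add_norm (ξ : ℝ) : jb ξ ≤ 2 * Real.pi * (1 + ‖ξ‖) := by
  have := one_le_two_pi
  unfold jb bracket
  rw [abs_mul, abs_of_pos (by positivity), Real.norm_eq_abs]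
  nlinarith [abs_nonneg ξ]

theorem inv_one_add_norm_pow_le (ξ : ℝ) (N : ℕ) :
    ((1 + ‖ξ‖) ^ N)⁻¹ ≤ (2 * Real.pi) ^ N * (jb ξ ^ N)⁻¹ := by
  have h1 := jb_le_mul_one_add_norm ξ
  have h2 := jb_pos ξ
  have h3 : jb ξ ^ N ≤ (2 * Real.pi) ^ N * (1 + ‖ξ‖) ^ N := by
    rw [← mul_pow]; gcongr
  rw [← div_eq_mul_inv, le_div_iff₀ (by positivity), inv_mul_le_iff₀ (by positivity), mul_comm]
  exact h3

/-- Pairing with a rapidly decaying weight. -/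
theorem exists_lintegral_jb_le (k : ℝ) : ∃ (N : ℕ) (C : ℝ≥0∞), C ≠ ⊤ ∧ ∀ h : ℝ → ℝ≥0∞,
    Measurable h → ∫⁻ ξ, h ξ * ENNReal.ofReal ((jb ξ ^ N)⁻¹) ≤
      C * l2 fun ξ => ENNReal.ofReal (jb ξ ^ k) * h ξ := by
  obtain ⟨N, hN⟩ := exists_nat_gt (1 / 2 - k)
  refine ⟨N, l2 (fun ξ => ENNReal.ofReal (jb ξ ^ (-(k + N)))), (l2_jb_lt_top (by linarith)).ne,
    fun h hh => ?_⟩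
  refine le_trans (le_of_eq ?_) (lintegral_mul_le_l2 (by fun_prop) (by fun_prop))
  refine lintegral_congr fun ξ => ?_
  rw [← mul_assoc, ← ENNReal.ofReal_mul (jb_rpow_pos _ _).le, ← Real.rpow_add (jb_pos _),
    show -(k + N) + k = -(N : ℝ) by ring, Real.rpow_neg (jb_pos _).le, Real.rpow_natCast, mul_comm]

theorem exists_hasFourierFun_of_snorm (hg : Measurable g) (h : snorm k g ≠ ⊤) :
    ∃ f : 𝓢'(ℝ, ℂ), HasFourierFun f g := by
  obtain ⟨N, C, hC, hb⟩ := exists_lintegral_jb_le k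
  refine exists_hasFourierFun hg N (ne_top_of_le_ne_top ?_ (b := ENNReal.ofReal
    ((2 * Real.pi) ^ N) * (C * snorm k g)) ?_)
  · finiteness
  · refine le_trans ?_ (mul_le_mul_right (hb (fun ξ => ‖g ξ‖ₑ) (by fun_prop)) _)
    rw [← lintegral_const_mul' _ _ ENNReal.ofReal_ne_top]
    refine lintegral_mono fun ξ => ?_
    rw [mul_left_comm, ← ENNReal.ofReal_mul (by positivity)]
    gcongr
    exact inv_one_add_norm_pow_le ξ N

theorem exists_schwartz_jb_pow_le (β : 𝓢(ℝ, ℂ)) (N : ℕ) :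
    ∃ C : ℝ, 0 ≤ C ∧ ∀ ξ, ‖β ξ‖ ≤ C * (jb ξ ^ N)⁻¹ := by
  set S := 2 ^ N * (Finset.Iic (N, 0)).sup (fun m => SchwartzMap.seminorm ℂ m.1 m.2) β
  have hS : 0 ≤ S := by positivity
  refine ⟨S * (2 * Real.pi) ^ N, by positivity, fun ξ => ?_⟩
  have h1 := SchwartzMap.one_add_le_sup_seminorm_apply (𝕜 := ℂ) (m := (N, 0)) (k := N) (n := 0)
    le_rfl le_rfl β ξ
  rw [norm_iteratedFDeriv_zero] at h1
  have hp : 0 < (1 + ‖ξ‖) ^ N := by positivity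
  have h2 : ‖β ξ‖ ≤ S * ((1 + ‖ξ‖) ^ N)⁻¹ := by
    rw [← div_eq_mul_inv, le_div_iff₀ hp, mul_comm]; exact h1
  calc _ ≤ S * ((1 + ‖ξ‖) ^ N)⁻¹ := h2
    _ ≤ S * ((2 * Real.pi) ^ N * (jb ξ ^ N)⁻¹) :=
      mul_le_mul_of_nonneg_left (inv_one_add_norm_pow_le ξ N) hS
    _ = _ := by ring

/-- Evaluation at a Schwartz function is continuous on `H^k`, whatever the sign of `k`; norm
continuity of a curve then gives continuity of its pairings. -/
theorem exists_norm_apply_le (k : ℝ) (φ : 𝓢(ℝ, ℂ)) : ∃ C : ℝ≥0∞, C ≠ ⊤ ∧ ∀ f : 𝓢'(ℝ, ℂ),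
    MemH k f → ‖f φ‖ₑ ≤ C * sobolevNorm k f := by
  obtain ⟨N, C, hC, hb⟩ := exists_lintegral_jb_le k
  obtain ⟨D, hD, hφ⟩ := exists_schwartz_jb_pow_le (𝓕⁻ φ) N
  refine ⟨ENNReal.ofReal D * C, by finiteness, fun f hf => ?_⟩
  obtain ⟨g, hg, hfg, e⟩ := hf.exists_hasFourierFun
  rw [hfg.apply_eq, ← e, mul_assoc]
  refine (enorm_integral_le_lintegral_enorm _).trans ?_
  refine le_trans ?_ (mul_le_mul_right (hb (fun ξ => ‖g ξ‖ₑ) (by fun_prop)) _)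
  rw [← lintegral_const_mul' _ _ ENNReal.ofReal_ne_top]
  refine lintegral_mono fun ξ => ?_
  rw [enorm_mul, mul_left_comm, mul_comm, ← ENNReal.ofReal_mul hD]
  gcongr
  rw [← ofReal_norm]
  exact ENNReal.ofReal_le_ofReal (hφ ξ)

end Line

/-! ### Plane coordinates -/

/-- The coordinates of a point of the plane. -/
def pr (ζ : Plane) : ℝ × ℝ := (ζ 0, ζ 1)

/-- The point of the plane with given coordinates. -/
def pl (z : ℝ × ℝ) : Plane := WithLp.toLp 2 ![z.1, z.2]

@[simp] theorem pr_pl (z : ℝ × ℝ) : pr (pl z) = z := by simp [pr, pl]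

@[simp] theorem pl_pr (ζ : Plane) : pl (pr ζ) = ζ := by
  ext i; fin_cases i <;> simp [pr, pl]

theorem pl_sub (z w : ℝ × ℝ) : pl (z - w) = pl z - pl w := by
  ext i; fin_cases i <;> simp [pl]

theorem pr_neg (ζ : Plane) : pr (-ζ) = -pr ζ := by simp [pr]

theorem pl_zero_apply (z : ℝ × ℝ) : pl z 0 = z.1 := by simp [pl]

theorem pl_one_apply (z : ℝ × ℝ) : pl z 1 = z.2 := by simp [pl]

theorem lineAt_eq_pl (t x : ℝ) : lineAt t x = pl (x, t) := by
  ext i; fin_cases i <;> simp [lineAt, pl, ex, et]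

theorem inner_pl (z w : ℝ × ℝ) : inner ℝ (pl z) (pl w) = z.1 * w.1 + z.2 * w.2 := by
  simp [pl, PiLp.inner_apply, Fin.sum_univ_two, mul_comm]

/-- Plane coordinates as a measurable equivalence. -/
def prEquiv : Plane ≃ᵐ ℝ × ℝ :=
  (MeasurableEquiv.toLp 2 (Fin 2 → ℝ)).symm.trans MeasurableEquiv.finTwoArrow

theorem prEquiv_apply (ζ : Plane) : prEquiv ζ = pr ζ := rfl

theorem prEquiv_symm_apply (z : ℝ × ℝ) : prEquiv.symm z = pl z := by
  rw [MeasurableEquiv.symm_apply_eq, prEquiv_apply, pr_pl]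

theorem measurePreserving_pr : MeasurePreserving pr volume volume :=
  (EuclideanSpace.volume_preserving_symm_measurableEquiv_toLp (Fin 2)).trans
    (volume_preserving_finTwoArrow ℝ)

theorem measurable_pr : Measurable pr := measurePreserving_pr.measurable

@[fun_prop]
theorem continuous_pl : Continuous pl := by unfold pl; fun_prop

theorem measurable_pl : Measurable pl := continuous_pl.measurable

theorem measurePreserving_pl : MeasurePreserving pl volume volume := by
  have : (prEquiv.symm : ℝ × ℝ → Plane) = pl := funext prEquiv_symm_apply
  rw [← this]
  exact MeasurePreserving.symm prEquiv measurePreserving_pr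

theorem integral_plane (Φ : Plane → ℂ) : ∫ ζ, Φ ζ = ∫ z, Φ (pl z) := by
  have := measurePreserving_pr.integral_comp prEquiv.measurableEmbedding (fun z => Φ (pl z))
  simpa using this

theorem integrable_plane_iff (Φ : Plane → ℂ) : Integrable Φ ↔ Integrable fun z => Φ (pl z) := by
  have := measurePreserving_pr.integrable_comp_emb prEquiv.measurableEmbedding
    (g := fun z => Φ (pl z))
  rw [← this]
  simp [Function.comp_def]

theorem lintegral_plane (Φ : Plane → ℝ≥0∞) : ∫⁻ ζ, Φ ζ = ∫⁻ z, Φ (pl z) := by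
  have := measurePreserving_pr.lintegral_comp_emb prEquiv.measurableEmbedding
    (fun z => Φ (pl z))
  simpa using this

theorem ae_plane_iff (p : Plane → Prop) : (∀ᵐ ζ, p ζ) ↔ ∀ᵐ z, p (pl z) := by
  constructor
  · exact fun h => measurePreserving_pl.quasiMeasurePreserving.ae h
  · intro h
    have := measurePreserving_pr.quasiMeasurePreserving.ae h
    simpa using this

/-- The space-time Fourier transform of `U` is the function `F` of the frequencies `(ξ, τ)`. -/
def HasFF (U : 𝓢'(Plane, ℂ)) (F : ℝ × ℝ → ℂ) : Prop := HasFourierFun U fun ζ => F (pr ζ)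

section PlaneNorms

variable {U V : 𝓢'(Plane, ℂ)} {F G : ℝ × ℝ → ℂ} {k b : ℝ}

theorem l2_plane (Φ : Plane → ℝ≥0∞) : l2 Φ = l2 fun z => Φ (pl z) := by
  unfold l2; rw [lintegral_plane]

theorem HasFF.bourgainNorm_eq (h : HasFF U F) : bourgainNorm k b U = cnorm 1 k b F := by
  unfold bourgainNorm
  rw [HasFourierFun.fourierNorm_eq h]
  have e : ∀ ζ : Plane, bracket (2 * Real.pi * ζ 0) ^ k *
      bracket (2 * Real.pi * ζ 1 + (2 * Real.pi * ζ 0) ^ 2 / 2) ^ b = wt 1 k b (pr ζ) := by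
    intro ζ
    unfold wt jb pr
    congr 3
    ring
  simp only [e]
  rw [eLpNorm_eq_l2 (fun ζ => (wt_pos 1 k b (pr ζ)).le), l2_plane]
  simp only [pr_pl]
  rfl

theorem HasFF.mixedNorm_eq (h : HasFF U F) : mixedNorm k b U = cnorm 0 k b F := by
  unfold mixedNorm
  rw [HasFourierFun.fourierNorm_eq h]
  have e : ∀ ζ : Plane, bracket (2 * Real.pi * ζ 0) ^ k *
      bracket (2 * Real.pi * ζ 1) ^ b = wt 0 k b (pr ζ) := by
    intro ζ
    unfold wt jb pr
    congr 3
    ring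
  simp only [e]
  rw [eLpNorm_eq_l2 (fun ζ => (wt_pos 0 k b (pr ζ)).le), l2_plane]
  simp only [pr_pl]
  rfl

theorem exists_hasFF_of_fourierNorm {w : Plane → ℝ} (h : fourierNorm w U < ⊤) :
    ∃ F, Measurable F ∧ HasFF U F := by
  have h1 : ∃ g, HasFourierFun U g := by
    by_contra! hc
    unfold fourierNorm at h
    simp [hc] at h
  obtain ⟨g, hg⟩ := h1
  obtain ⟨g', hm, -, hg'⟩ := hg.exists_measurable
  refine ⟨fun z => g' (pl z), hm.comp measurable_pl, ?_⟩
  unfold HasFF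
  simpa using hg'

theorem HasFF.congr (h : HasFF U F) (e : ∀ᵐ z, F z = G z) : HasFF U G :=
  HasFourierFun.congr h (measurePreserving_pr.quasiMeasurePreserving.ae e)

theorem HasFF.conj (h : HasFF U F) : HasFF (conjDist U) (cj F) := by
  have := HasFourierFun.conj h
  simpa only [HasFF, cj, pr_neg] using this

theorem convolution_eq_cv (F G : Plane → ℂ) (ζ : Plane) :
    (F ⋆[ContinuousLinearMap.mul ℂ ℂ, volume] G) ζ =
      cv (fun z => F (pl z)) (fun z => G (pl z)) (pr ζ) := by
  unfold MeasureTheory.convolution cv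
  rw [integral_plane]
  simp [pl_sub]

theorem convolutionExistsAt_iff (F G : Plane → ℂ) (ζ : Plane) :
    ConvolutionExistsAt F G ζ (ContinuousLinearMap.mul ℂ ℂ) volume ↔
      Integrable fun w => F (pl w) * G (pl (pr ζ - w)) := by
  unfold ConvolutionExistsAt
  rw [integrable_plane_iff]
  simp [pl_sub]

theorem cv_congr {F F' G G' : ℝ × ℝ → ℂ} (hF : ∀ᵐ z, F z = F' z) (hG : ∀ᵐ z, G z = G' z) :
    cv F G = cv F' G' := by
  funext z
  refine integral_congr_ae ?_
  have h2 : ∀ᵐ w, G (z - w) = G' (z - w) :=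
    (Measure.measurePreserving_sub_left volume z).quasiMeasurePreserving.ae hG
  filter_upwards [hF, h2] with w h3 h4
  rw [h3, h4]

/-- The Fourier transform of a product is the convolution of the Fourier transforms. -/
theorem IsFourierProduct.hasFF {P : 𝓢'(Plane, ℂ)} (h : IsFourierProduct U V P) (hU : HasFF U F)
    (hV : HasFF V G) : HasFF P (cv F G) := by
  obtain ⟨F', G', h1, h2, -, h3⟩ := h
  have a1 := (ae_plane_iff _).1 (HasFourierFun.ae_eq h1 hU)
  have a2 := (ae_plane_iff _).1 (HasFourierFun.ae_eq h2 hV)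
  simp only [pr_pl] at a1 a2
  unfold HasFF
  rw [← cv_congr a1 a2]
  have e : (F' ⋆[ContinuousLinearMap.mul ℂ ℂ, volume] G') =
      fun ζ => cv (fun z => F' (pl z)) (fun z => G' (pl z)) (pr ζ) :=
    funext fun ζ => convolution_eq_cv F' G' ζ
  rwa [e] at h3

theorem isFourierProduct_of_hasFF {P : 𝓢'(Plane, ℂ)} (hU : HasFF U F) (hV : HasFF V G)
    (hi : ∀ᵐ z, Integrable fun w => F w * G (z - w)) (hP : HasFF P (cv F G)) :
    IsFourierProduct U V P := by
  refine ⟨_, _, hU, hV, ?_, ?_⟩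
  · rw [ae_plane_iff]
    filter_upwards [hi] with z hz
    rw [convolutionExistsAt_iff]
    simpa using hz
  · have e : ((fun ζ => F (pr ζ)) ⋆[ContinuousLinearMap.mul ℂ ℂ, volume] fun ζ => G (pr ζ)) =
        fun ζ => cv F G (pr ζ) := by
      funext ζ
      rw [convolution_eq_cv]
      simp
    rw [e]
    exact hP

theorem norm_le_norm_plane (ζ : Plane) : |ζ 0| ≤ ‖ζ‖ ∧ |ζ 1| ≤ ‖ζ‖ :=
  ⟨by simpa using PiLp.norm_apply_le ζ 0, by simpa using PiLp.norm_apply_le ζ 1⟩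

/-- Weighted square integrable functions are Fourier transforms of tempered distributions. -/
theorem exists_hasFF_of_cnorm {κ a : ℝ} (hκ : |κ| ≤ 1) (ha : a < 1 / 2) (hF : Measurable F)
    (h : cnorm κ k (-a) F ≠ ⊤) : ∃ U, HasFF U F := by
  obtain ⟨N, C, hC, hb⟩ := exists_lintegral_jb_le k
  obtain ⟨A, hA, hs⟩ := exists_l2_srcSize_le ha
  have fin : ∫⁻ ξ, srcSize κ F ξ * ENNReal.ofReal ((jb ξ ^ N)⁻¹) ≠ ⊤ := by
    refine ne_top_of_le_ne_top ?_ (hb _ (measurable_srcSize κ hF))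
    refine ENNReal.mul_ne_top hC (ne_top_of_le_ne_top ?_ (hs κ k F hF))
    finiteness
  refine exists_hasFourierFun (hF.comp measurable_pr) (N + 2)
    (ne_top_of_le_ne_top (b := ENNReal.ofReal ((2 * Real.pi) ^ N * (2 * Real.pi * Real.pi)) *
      ∫⁻ ξ, srcSize κ F ξ * ENNReal.ofReal ((jb ξ ^ N)⁻¹)) (by finiteness) ?_)
  rw [lintegral_plane, Measure.volume_eq_prod, lintegral_prod _ (by
    have : Measurable fun z : ℝ × ℝ => ‖pl z‖ := (continuous_pl.norm).measurable
    simp only [pr_pl]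
    fun_prop), ← lintegral_const_mul' _ _ ENNReal.ofReal_ne_top]
  refine lintegral_mono fun ξ => ?_
  unfold srcSize
  rw [mul_comm (lintegral _ _), ← mul_assoc, ← ENNReal.ofReal_mul (by positivity),
    ← lintegral_const_mul' _ _ ENNReal.ofReal_ne_top]
  refine lintegral_mono fun τ => ?_
  simp only [pr_pl]
  rw [mul_left_comm, ← ENNReal.ofReal_mul (by have := jb_pos ξ; positivity)]
  gcongr
  set n := ‖pl (ξ, τ)‖ with hn
  have n0 : 0 ≤ n := norm_nonneg _
  obtain ⟨h1, h2⟩ := norm_le_norm_plane (pl (ξ, τ))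
  rw [pl_zero_apply] at h1
  rw [pl_one_apply] at h2
  simp only [← hn] at h1 h2
  have hp3 := Real.pi_gt_three
  have j1 : jb ξ ≤ 2 * Real.pi * (1 + n) :=
    (jb_le_mul_one_add_norm ξ).trans (by rw [Real.norm_eq_abs]; gcongr)
  -- The modulation grows at most quadratically, by `|κ| ≤ 1`, which accounts for the two additional
  -- powers in `N + 2`.
  have j2 : jb (τ + disp κ ξ) ≤ 2 * Real.pi * Real.pi * (1 + n) ^ 2 := by
    have e1 : |τ + disp κ ξ| ≤ n + Real.pi * n ^ 2 := by
      refine (abs_add_le _ _).trans ?_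
      gcongr
      unfold disp
      rw [abs_mul, abs_mul, abs_of_pos Real.pi_pos, abs_pow]
      calc _ ≤ 1 * Real.pi * n ^ 2 := by gcongr
        _ = _ := by ring
    have e2 : jb (τ + disp κ ξ) = 1 + 2 * Real.pi * |τ + disp κ ξ| := by
      unfold jb bracket
      rw [abs_mul, abs_of_pos (by positivity)]
    rw [e2]
    calc 1 + 2 * Real.pi * |τ + disp κ ξ| ≤ 1 + 2 * Real.pi * (n + Real.pi * n ^ 2) := by gcongr
      _ ≤ _ := by
          nlinarith [mul_nonneg (mul_nonneg Real.pi_pos.le (by linarith : 0 ≤ Real.pi - 1)) n0,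
            Real.pi_pos, mul_pos Real.pi_pos Real.pi_pos]
  have j3 := jb_pos ξ
  have j4 := jb_pos (τ + disp κ ξ)
  rw [Real.rpow_neg_one]
  have key : jb ξ ^ N * jb (τ + disp κ ξ) ≤
      ((2 * Real.pi) ^ N * (2 * Real.pi * Real.pi)) * (1 + n) ^ (N + 2) := by
    calc _ ≤ (2 * Real.pi * (1 + n)) ^ N * (2 * Real.pi * Real.pi * (1 + n) ^ 2) := by gcongr
      _ = _ := by rw [mul_pow]; ring
  set A₀ := (2 * Real.pi) ^ N * (2 * Real.pi * Real.pi)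
  have e : A₀ * (jb ξ ^ N)⁻¹ * (jb (τ + disp κ ξ))⁻¹ * (1 + n) ^ (N + 2) =
      A₀ * (1 + n) ^ (N + 2) / (jb ξ ^ N * jb (τ + disp κ ξ)) := by field_simp
  rw [inv_le_iff_one_le_mul₀ (by positivity), e, le_div_iff₀ (by positivity), one_mul]
  exact key

end PlaneNorms

/-! ### The partial Fourier transform of a test function -/

/-- The inverse Fourier transform of a test function, in the coordinates `(ξ, τ)`. -/
def hatS (φ : 𝓢(Plane, ℂ)) (z : ℝ × ℝ) : ℂ := (𝓕⁻ φ : 𝓢(Plane, ℂ)) (pl z)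

/-- The inverse Fourier transform in space of a test function. -/
def gph (φ : 𝓢(Plane, ℂ)) (ξ t : ℝ) : ℂ := (𝓕⁻ (slice t φ) : 𝓢(ℝ, ℂ)) ξ

section TestFunctions

theorem exists_schwartz_plane_le (φ : 𝓢(Plane, ℂ)) (N : ℕ) :
    ∃ C : ℝ, 0 ≤ C ∧ ∀ z : ℝ × ℝ, ‖φ (pl z)‖ ≤ C * ((jb z.1 ^ N)⁻¹ * (jb z.2 ^ N)⁻¹) := by
  set S := 2 ^ (N + N) *
    (Finset.Iic (N + N, 0)).sup (fun m => SchwartzMap.seminorm ℂ m.1 m.2) φ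
  have hS : 0 ≤ S := by positivity
  refine ⟨S * ((2 * Real.pi) ^ N * (2 * Real.pi) ^ N), by positivity, fun z => ?_⟩
  have h1 := SchwartzMap.one_add_le_sup_seminorm_apply (𝕜 := ℂ) (m := (N + N, 0)) (k := N + N)
    (n := 0) le_rfl le_rfl φ (pl z)
  rw [norm_iteratedFDeriv_zero] at h1
  obtain ⟨h2, h3⟩ := norm_le_norm_plane (pl z)
  rw [pl_zero_apply] at h2
  rw [pl_one_apply] at h3
  have h4 : (1 + ‖z.1‖) ^ N * (1 + ‖z.2‖) ^ N * ‖φ (pl z)‖ ≤ S := by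
    refine le_trans ?_ h1
    rw [pow_add]
    gcongr <;> simpa
  have p1 : 0 < (1 + ‖z.1‖) ^ N := by positivity
  have p2 : 0 < (1 + ‖z.2‖) ^ N := by positivity
  have h5 : ‖φ (pl z)‖ ≤ S * (((1 + ‖z.1‖) ^ N)⁻¹ * ((1 + ‖z.2‖) ^ N)⁻¹) := by
    rw [← mul_inv, ← div_eq_mul_inv, le_div_iff₀ (by positivity), mul_comm]
    exact h4
  have q1 := jb_pos z.1
  have q2 := jb_pos z.2
  calc _ ≤ S * (((1 + ‖z.1‖) ^ N)⁻¹ * ((1 + ‖z.2‖) ^ N)⁻¹) := h5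
    _ ≤ S * (((2 * Real.pi) ^ N * (jb z.1 ^ N)⁻¹) * ((2 * Real.pi) ^ N * (jb z.2 ^ N)⁻¹)) :=
      mul_le_mul_of_nonneg_left (mul_le_mul (inv_one_add_norm_pow_le _ N)
        (inv_one_add_norm_pow_le _ N) (by positivity) (by positivity)) hS
    _ = _ := by ring

theorem integrable_inv_jb_pow {N : ℕ} (hN : 2 ≤ N) : Integrable fun x => (jb x ^ N)⁻¹ := by
  have hm : Measurable fun x => (jb x ^ N)⁻¹ := by fun_prop
  refine ⟨hm.aestronglyMeasurable, ?_⟩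
  have h := lintegral_jb_lt_top (r := (N : ℝ)) (by
    have : (2 : ℝ) ≤ N := by exact_mod_cast hN
    linarith)
  refine lt_of_eq_of_lt (lintegral_congr fun x => ?_) h
  have := jb_pos x
  rw [← ofReal_norm, Real.norm_of_nonneg (by positivity), Real.rpow_neg this.le, Real.rpow_natCast]

variable (φ : 𝓢(Plane, ℂ))

theorem exists_hatS_le (N : ℕ) : ∃ C : ℝ, 0 ≤ C ∧ ∀ ξ τ : ℝ,
    ‖hatS φ (ξ, τ)‖ ≤ C * ((jb ξ ^ N)⁻¹ * (jb τ ^ N)⁻¹) := by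
  obtain ⟨C, hC, h⟩ := exists_schwartz_plane_le (𝓕⁻ φ) N
  exact ⟨C, hC, fun ξ τ => h (ξ, τ)⟩

theorem continuous_hatS : Continuous (hatS φ) := (𝓕⁻ φ : 𝓢(Plane, ℂ)).continuous.comp continuous_pl

theorem measurable_hatS : Measurable (hatS φ) := (continuous_hatS φ).measurable

theorem gph_eq_integral (ξ t : ℝ) : gph φ ξ t = ∫ x, ee (x * ξ) * φ (pl (x, t)) := by
  unfold gph
  rw [SchwartzMap.fourierInv_coe, fourierInv_eq_integral_ee]
  simp only [slice_apply, lineAt_eq_pl]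

theorem integrable_test (ξ : ℝ) : Integrable fun z : ℝ × ℝ => ee (z.1 * ξ) * φ (pl z) := by
  have h := (integrable_plane_iff φ).1 φ.integrable
  exact h.bdd_mul (c := 1) (Continuous.aestronglyMeasurable (by fun_prop))
    (Eventually.of_forall fun z => by simp)

theorem integrable_gph (ξ : ℝ) : Integrable fun t => gph φ ξ t := by
  simp only [gph_eq_integral]
  exact (integrable_test φ ξ).integral_prod_right

theorem continuous_gph (ξ : ℝ) : Continuous fun t => gph φ ξ t := by
  obtain ⟨C, hC, h⟩ := exists_schwartz_plane_le φ 2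
  simp only [gph_eq_integral]
  refine continuous_of_dominated (bound := fun x => C * (jb x ^ 2)⁻¹) (fun t => ?_) (fun t => ?_)
    ((integrable_inv_jb_pow le_rfl).const_mul C) (Eventually.of_forall fun x => ?_)
  · have : Continuous fun x : ℝ => φ (pl (x, t)) :=
      φ.continuous.comp (continuous_pl.comp (by fun_prop))
    exact Continuous.aestronglyMeasurable (by fun_prop)
  · refine Eventually.of_forall fun x => ?_
    rw [norm_mul, norm_ee, one_mul]
    refine (h (x, t)).trans ?_
    have h1 : (jb t ^ 2)⁻¹ ≤ 1 := inv_le_one_of_one_le₀ (one_le_pow₀ (one_le_jb t))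
    have := jb_pos x
    gcongr
    exact mul_le_of_le_one_right (by positivity) h1
  · have : Continuous fun t : ℝ => φ (pl (x, t)) :=
      φ.continuous.comp (continuous_pl.comp (by fun_prop))
    fun_prop

theorem hatS_eq_integral (ξ τ : ℝ) : hatS φ (ξ, τ) = ∫ t, ee (t * τ) * gph φ ξ t := by
  have h1 : hatS φ (ξ, τ) = ∫ z : ℝ × ℝ, ee (z.2 * τ) * (ee (z.1 * ξ) * φ (pl z)) := by
    unfold hatS
    rw [SchwartzMap.fourierInv_coe, Real.fourierInv_eq', integral_plane]
    refine integral_congr_ae (Eventually.of_forall fun z => ?_)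
    simp only [inner_pl, smul_eq_mul]
    rw [← mul_assoc, ← ee_add, ee]
    congr 3
    push_cast
    ring
  have h2 := (integrable_test φ ξ).bdd_mul (c := 1) (f := fun z : ℝ × ℝ => ee (z.2 * τ))
    (by fun_prop) (Eventually.of_forall fun z => by simp)
  rw [h1, Measure.volume_eq_prod, integral_prod_symm _ h2]
  refine integral_congr_ae (Eventually.of_forall fun t => ?_)
  simp only [gph_eq_integral]
  rw [← integral_const_mul]

theorem integrable_hatS_pow (ξ : ℝ) (N : ℕ) : Integrable fun τ => τ ^ N * hatS φ (ξ, τ) := by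
  obtain ⟨C, hC, h⟩ := exists_hatS_le φ (N + 2)
  refine ((integrable_inv_jb_pow le_rfl).const_mul (C * (jb ξ ^ (N + 2))⁻¹)).mono' ?_
    (Eventually.of_forall fun τ => ?_)
  · have := continuous_hatS φ
    exact Continuous.aestronglyMeasurable (by fun_prop)
  · have h1 : |τ| ≤ jb τ := by
      unfold jb bracket
      rw [abs_mul, abs_of_pos (by positivity : 0 < 2 * Real.pi)]
      nlinarith [one_le_two_pi, abs_nonneg τ]
    have := jb_pos τ
    have := jb_pos ξ
    rw [norm_mul, norm_pow, Complex.norm_real, Real.norm_eq_abs]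
    calc _ ≤ jb τ ^ N * (C * ((jb ξ ^ (N + 2))⁻¹ * (jb τ ^ (N + 2))⁻¹)) := by
          gcongr
          exact h ξ τ
      _ = _ := by rw [pow_add (jb τ)]; field_simp

theorem integrable_hatS (ξ : ℝ) : Integrable fun τ => hatS φ (ξ, τ) := by
  simpa using integrable_hatS_pow φ ξ 0

/-- Fourier inversion in time alone. It expresses `gph` through the rapidly decaying `hatS`, from
which decay in `ξ` uniform in `t` and differentiability in `t` can be read off. -/
theorem fourier_hatS (ξ : ℝ) : 𝓕 (fun τ => hatS φ (ξ, τ)) = fun t => gph φ ξ t := by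
  have h1 : 𝓕⁻ (fun t => gph φ ξ t) = fun τ => hatS φ (ξ, τ) := by
    funext τ
    rw [fourierInv_eq_integral_ee, hatS_eq_integral]
  have := (continuous_gph φ ξ).fourier_fourierInv_eq (integrable_gph φ ξ)
    (by
      have h2 : Integrable (𝓕⁻ (fun t => gph φ ξ t)) := by rw [h1]; exact integrable_hatS φ ξ
      have h3 := h2.comp_neg
      refine h3.congr (Eventually.of_forall fun t => ?_)
      simp only
      rw [Real.fourierInv_eq_fourier_neg, neg_neg])
  rwa [h1] at this

theorem gph_eq_integral_hatS (ξ t : ℝ) : gph φ ξ t = ∫ τ, ee (-(τ * t)) * hatS φ (ξ, τ) := by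
  have := congrFun (fourier_hatS φ ξ) t
  rw [fourier_eq_integral_ee] at this
  exact this.symm

theorem exists_gph_le (N : ℕ) : ∃ C : ℝ, 0 ≤ C ∧ ∀ ξ t : ℝ, ‖gph φ ξ t‖ ≤ C * (jb ξ ^ N)⁻¹ := by
  obtain ⟨C, hC, h⟩ := exists_hatS_le φ (N + 2)
  set I := ∫ τ, (jb τ ^ (N + 2))⁻¹ with hI
  have hI0 : 0 ≤ I := integral_nonneg fun τ => by have := jb_pos τ; positivity
  refine ⟨C * I, by positivity, fun ξ t => ?_⟩
  rw [gph_eq_integral_hatS]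
  have hj := jb_pos ξ
  have hj1 := one_le_jb ξ
  calc _ ≤ ∫ τ, C * (jb ξ ^ N)⁻¹ * (jb τ ^ (N + 2))⁻¹ := by
        refine norm_integral_le_of_norm_le ((integrable_inv_jb_pow (by omega)).const_mul _)
          (Eventually.of_forall fun τ => ?_)
        rw [norm_mul, norm_ee, one_mul, mul_assoc]
        refine (h ξ τ).trans ?_
        have := jb_pos τ
        gcongr
        omega
    _ = _ := by rw [integral_const_mul, ← hI]; ring

theorem measurable_gph : Measurable fun p : ℝ × ℝ => gph φ p.1 p.2 := by
  have hm := measurable_hatS φ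
  have h : StronglyMeasurable fun p : (ℝ × ℝ) × ℝ => ee (-(p.2 * p.1.2)) * hatS φ (p.1.1, p.2) := by
    refine Measurable.stronglyMeasurable ?_
    fun_prop
  simp only [gph_eq_integral_hatS]
  exact h.integral_prod_right'.measurable

theorem inner_pl_et (z : ℝ × ℝ) : inner ℝ (pl z) et = z.2 := by
  have : et = pl (0, 1) := by ext i; fin_cases i <;> simp [et, pl]
  rw [this, inner_pl]; simp

theorem inner_pl_ex (z : ℝ × ℝ) : inner ℝ (pl z) ex = z.1 := by
  have : ex = pl (1, 0) := by ext i; fin_cases i <;> simp [ex, pl]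
  rw [this, inner_pl]; simp

theorem hatS_lineDeriv_et (z : ℝ × ℝ) :
    hatS (∂_{et} φ) z = -(2 * Real.pi * Complex.I) * (z.2 * hatS φ z) := by
  unfold hatS
  rw [SchwartzMap.fourierInv_lineDerivOp_eq]
  have : (inner ℝ · et : Plane → ℝ).HasTemperateGrowth := by fun_prop
  rw [smul_apply, SchwartzMap.smulLeftCLM_apply_apply this, inner_pl_et]
  simp

theorem hatS_lineDeriv_ex (z : ℝ × ℝ) :
    hatS (∂_{ex} φ) z = -(2 * Real.pi * Complex.I) * (z.1 * hatS φ z) := by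
  unfold hatS
  rw [SchwartzMap.fourierInv_lineDerivOp_eq]
  have : (inner ℝ · ex : Plane → ℝ).HasTemperateGrowth := by fun_prop
  rw [smul_apply, SchwartzMap.smulLeftCLM_apply_apply this, inner_pl_ex]
  simp

theorem gph_lineDeriv_ex (ξ t : ℝ) :
    gph (∂_{ex} φ) ξ t = -(2 * Real.pi * Complex.I) * (ξ * gph φ ξ t) := by
  simp only [gph_eq_integral_hatS, hatS_lineDeriv_ex]
  rw [← integral_const_mul, ← integral_const_mul]
  refine integral_congr_ae (Eventually.of_forall fun τ => ?_)
  simp only; ring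

theorem gph_lineDeriv_ex_ex (ξ t : ℝ) :
    gph (∂_{ex} (∂_{ex} φ)) ξ t = -(4 * Real.pi ^ 2 * ξ ^ 2) * gph φ ξ t := by
  rw [gph_lineDeriv_ex, gph_lineDeriv_ex]
  linear_combination (4 * Real.pi ^ 2 * ξ ^ 2 * gph φ ξ t : ℂ) * Complex.I_sq

theorem hasDerivAt_gph (ξ t : ℝ) : HasDerivAt (fun t => gph φ ξ t) (gph (∂_{et} φ) ξ t) t := by
  have h1 := Real.hasDerivAt_fourier (integrable_hatS φ ξ)
    (by
      have := integrable_hatS_pow φ ξ 1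
      refine this.congr (Eventually.of_forall fun τ => ?_)
      simp) t
  rw [fourier_hatS] at h1
  have e : gph (∂_{et} φ) ξ t =
      𝓕 (fun x : ℝ => (-2 * Real.pi * Complex.I * x) • hatS φ (ξ, x)) t := by
    rw [fourier_eq_integral_ee, gph_eq_integral_hatS]
    refine integral_congr_ae (Eventually.of_forall fun τ => ?_)
    simp only [hatS_lineDeriv_et, smul_eq_mul]
    ring
  rw [e]
  exact h1

theorem gph_eq_zero {T : ℝ} (h : tsupport φ ⊆ strip T) (ξ : ℝ) {t : ℝ} (ht : t ∉ Ioo 0 T) :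
    gph φ ξ t = 0 := by
  rw [gph_eq_integral]
  refine integral_eq_zero_of_ae (Eventually.of_forall fun x => ?_)
  have : pl (x, t) ∉ tsupport φ := fun hx => ht (by
    have := h hx
    simpa [strip, pl_one_apply] using this)
  simp [image_eq_zero_of_notMem_tsupport this]

theorem localize_apply (ψ : ℝ → ℝ) (T : ℝ) (U : 𝓢'(Plane, ℂ)) : localize ψ T U φ =
    U (SchwartzMap.smulLeftCLM ℂ (fun z : Plane => ((ψ (z 1 / T) : ℝ) : ℂ)) φ) := rfl

theorem gph_cutoff {ψ : ℝ → ℝ} (hψ : IsCutoff ψ) (T ξ t : ℝ) :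
    gph (SchwartzMap.smulLeftCLM ℂ (fun z : Plane => ((ψ (z 1 / T) : ℝ) : ℂ)) φ) ξ t =
      ψ (t / T) * gph φ ξ t := by
  simp only [gph_eq_integral]
  rw [← integral_const_mul]
  refine integral_congr_ae (Eventually.of_forall fun x => ?_)
  simp only [SchwartzMap.smulLeftCLM_apply_apply (hψ.hasTemperateGrowth T), pl_one_apply,
    smul_eq_mul]
  ring

theorem cutoff_smul_eq {ψ : ℝ → ℝ} (hψ : IsCutoff ψ) {T : ℝ} (hT : 0 < T)
    (h : tsupport φ ⊆ strip T) :
    SchwartzMap.smulLeftCLM ℂ (fun z : Plane => ((ψ (z 1 / T) : ℝ) : ℂ)) φ = φ := by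
  ext ζ
  rw [SchwartzMap.smulLeftCLM_apply_apply (hψ.hasTemperateGrowth T)]
  by_cases hζ : ζ ∈ tsupport φ
  · have h1 : ζ 1 ∈ Ioo 0 T := h hζ
    rw [hψ.eq_one, Complex.ofReal_one, one_smul]
    rw [abs_of_nonneg (div_nonneg h1.1.le hT.le)]
    exact div_le_one_of_le₀ h1.2.le hT.le
  · rw [image_eq_zero_of_notMem_tsupport hζ, smul_zero]

end TestFunctions

/-! ### The action on test functions -/

section Action

variable {U : 𝓢'(Plane, ℂ)} {F : ℝ × ℝ → ℂ}

theorem HasFF.apply_eq (h : HasFF U F) (φ : 𝓢(Plane, ℂ)) :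
    (Integrable fun z => hatS φ z * F z) ∧ U φ = ∫ ξ, ∫ τ, hatS φ (ξ, τ) * F (ξ, τ) := by
  have h1 := (h (𝓕⁻ φ)).1
  rw [integrable_plane_iff] at h1
  simp only [pr_pl] at h1
  refine ⟨h1, ?_⟩
  rw [HasFourierFun.apply_eq h, integral_plane]
  simp only [pr_pl]
  exact integral_prod _ h1

/-- Parseval's formula in time at a fixed space frequency: the pairing over `τ` is a pairing over
`t` with the trace. -/
theorem integral_hatS_mul (φ : 𝓢(Plane, ℂ)) {ξ : ℝ} (hF : Integrable fun τ => F (ξ, τ)) :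
    ∫ τ, hatS φ (ξ, τ) * F (ξ, τ) = ∫ t, gph φ ξ t * tr F ξ t := by
  have hi : Integrable (Function.uncurry fun t τ : ℝ =>
      ee (t * τ) * (gph φ ξ t * F (ξ, τ))) :=
    ((integrable_gph φ ξ).mul_prod hF).bdd_mul (c := 1)
      (f := fun p : ℝ × ℝ => ee (p.1 * p.2)) (by fun_prop)
      (Eventually.of_forall fun p => by simp)
  have e1 : ∀ τ, hatS φ (ξ, τ) * F (ξ, τ) = ∫ t, ee (t * τ) * (gph φ ξ t * F (ξ, τ)) := by
    intro τ
    rw [hatS_eq_integral, ← integral_mul_const]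
    refine integral_congr_ae (Eventually.of_forall fun t => ?_)
    simp only; ring
  simp only [e1]
  rw [← integral_integral_swap hi]
  refine integral_congr_ae (Eventually.of_forall fun t => ?_)
  simp only [tr]
  rw [← integral_const_mul]
  refine integral_congr_ae (Eventually.of_forall fun τ => ?_)
  simp only; ring

theorem HasFF.apply_eq_tr (h : HasFF U F) (hF : ∀ᵐ ξ, Integrable fun τ => F (ξ, τ))
    (φ : 𝓢(Plane, ℂ)) : U φ = ∫ ξ, ∫ t, gph φ ξ t * tr F ξ t := by
  rw [(h.apply_eq φ).2]
  exact integral_congr_ae (hF.mono fun _ hξ => integral_hatS_mul φ hξ)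

theorem HasFF.integrable_tr (h : HasFF U F) (hF : ∀ᵐ ξ, Integrable fun τ => F (ξ, τ))
    (φ : 𝓢(Plane, ℂ)) : Integrable fun ξ => ∫ t, gph φ ξ t * tr F ξ t :=
  (h.apply_eq φ).1.integral_prod_left.congr (hF.mono fun _ hξ => integral_hatS_mul φ hξ)

end Action

/-! ### The linear equation in the sense of distributions -/

section WeakLinear

/-- `U` solves `∂ₜ U - κ (i/2) ∂ₓ² U = P` on the strip. -/
def WeakEq (κ T : ℝ) (U P : 𝓢'(Plane, ℂ)) : Prop := ∀ φ : 𝓢(Plane, ℂ), tsupport φ ⊆ strip T →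
  (∂_{et} U) φ - (κ * (Complex.I / 2)) * (∂_{ex} (∂_{ex} U)) φ = P φ

variable {κ r a b T ξ : ℝ} {f : ℝ → ℂ} {q : ℝ × ℝ → ℂ}

/-- The weak form of the scalar ODE. With the integrating factor, `g = e^{-2πict} h`, the
combination `h' - 2πic h` paired with the Duhamel formula becomes `g'` paired with the datum plus
the source integral. The datum drops out because `∫ g' = 0`, and the source integral is integrated
by parts for each `τ` separately. -/
theorem integral_deriv_mul_duh {h h' : ℝ → ℂ} (hd : ∀ t, HasDerivAt h (h' t) t)
    (hc : Continuous h') (hs : ∀ t, t ∉ Ioo 0 T → h t = 0) (hs' : ∀ t, t ∉ Ioo 0 T → h' t = 0)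
    (hq : Measurable q) (hsrc : srcSize κ q ξ < ⊤) :
    ∫ t, h' t * duh κ f q ξ t = 2 * Real.pi * Complex.I * disp κ ξ * (∫ t, h t * duh κ f q ξ t) -
      ∫ τ, (∫ t, ee (t * τ) * h t) * q (ξ, τ) := by
  set c := disp κ ξ
  have hcont : Continuous h := continuous_iff_continuousAt.2 fun t => (hd t).continuousAt
  have cs : ∀ {w : ℝ → ℂ}, Continuous w → (∀ t, t ∉ Ioo 0 T → w t = 0) → Integrable w := by
    intro w hw h0
    refine hw.integrable_of_hasCompactSupport (HasCompactSupport.intro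
      (isCompact_Icc (a := 0) (b := T)) fun t ht => h0 t fun h1 => ht (Ioo_subset_Icc_self h1))
  let g : ℝ → ℂ := fun t => ee (t * (-c)) * h t
  let g' : ℝ → ℂ := fun t => ee (t * (-c)) * (h' t - 2 * Real.pi * Complex.I * c * h t)
  have dg : ∀ t, HasDerivAt g (g' t) t := fun t => by
    have := (hasDerivAt_ee_mul (-c) t).mul (hd t)
    refine this.congr_deriv ?_
    simp only [g']
    push_cast
    ring
  have cg : Continuous g := by fun_prop
  have cg' : Continuous g' := by fun_prop
  have zg : ∀ t, t ∉ Ioo 0 T → g t = 0 := fun t ht => by simp [g, hs t ht]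
  have zg' : ∀ t, t ∉ Ioo 0 T → g' t = 0 := fun t ht => by simp [g', hs t ht, hs' t ht]
  have ig := cs cg zg
  have ig' := cs cg' zg'
  have cd := continuous_duh (f := f) hq hsrc
  have i1 : Integrable fun t => h' t * duh κ f q ξ t :=
    cs (by fun_prop) fun t ht => by simp [hs' t ht]
  have i2 : Integrable fun t => h t * duh κ f q ξ t :=
    cs (by fun_prop) fun t ht => by simp [hs t ht]
  have cQ := continuous_integral_mul_duk hq hsrc
  have e1 : (∫ t, h' t * duh κ f q ξ t) -
      2 * Real.pi * Complex.I * c * (∫ t, h t * duh κ f q ξ t) =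
      ∫ t, g' t * ∫ τ, q (ξ, τ) * duk t (τ + c) := by
    have z : ∫ t, g' t = 0 := integral_eq_zero_of_hasDerivAt_of_integrable dg ig' ig
    have z2 : ∫ t, g' t * f ξ = 0 := by rw [integral_mul_const, z, zero_mul]
    have i3 : Integrable fun t => h' t * duh κ f q ξ t -
        2 * Real.pi * Complex.I * c * (h t * duh κ f q ξ t) := i1.sub (i2.const_mul _)
    rw [← integral_const_mul, ← integral_sub i1 (i2.const_mul _), ← sub_zero (integral _ _), ← z2,
      ← integral_sub i3 (ig'.mul_const _)]
    refine integral_congr_ae (Eventually.of_forall fun t => ?_)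
    simp only [duh, g']
    rw [show -(c * t) = t * (-c) by ring]
    ring
  have hi : Integrable (Function.uncurry fun t τ : ℝ => g' t * (q (ξ, τ) * duk t (τ + c))) := by
    have hm : Measurable (Function.uncurry fun t τ : ℝ => g' t * (q (ξ, τ) * duk t (τ + c))) := by
      have := cg'.measurable
      unfold Function.uncurry
      fun_prop
    have ib : Integrable fun t => ‖g' t‖ * (|t| + 2) := by
      have := cs (w := fun t => g' t * ((|t| + 2 : ℝ) : ℂ)) (by fun_prop)
        (fun t ht => by simp [zg' t ht])
      refine this.norm.congr (Eventually.of_forall fun t => ?_)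
      simp only
      rw [norm_mul, Complex.norm_real, Real.norm_of_nonneg (by positivity)]
    refine (ib.mul_prod (integrable_src hq hsrc)).mono' hm.aestronglyMeasurable
      (Eventually.of_forall fun p => ?_)
    simp only [Function.uncurry]
    rw [norm_mul]
    calc _ ≤ ‖g' p.1‖ * ((|p.1| + 2) * (‖q (ξ, p.2)‖ * (jb (p.2 + c))⁻¹)) := by
          gcongr
          exact norm_mul_duk_le p.2 p.1
      _ = _ := by ring
  have e2 : ∫ t, g' t * ∫ τ, q (ξ, τ) * duk t (τ + c) =
      -∫ τ, (∫ t, ee (t * τ) * h t) * q (ξ, τ) := by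
    simp only [← integral_const_mul]
    rw [integral_integral_swap hi, ← integral_neg]
    refine integral_congr_ae (Eventually.of_forall fun τ => ?_)
    simp only
    have cduk : Continuous fun t => duk t (τ + c) :=
      continuous_duk.comp (by fun_prop : Continuous fun t : ℝ => (t, τ + c))
    have ibp := integral_mul_deriv_eq_deriv_mul_of_integrable
      (u := fun t => duk t (τ + c)) (v := g) (fun t _ => hasDerivAt_duk t (τ + c)) (fun t _ => dg t)
      (cs (cduk.mul cg') fun t ht => by simp [zg' t ht])
      (cs (w := fun t => ee (t * (τ + c)) * g t) (by fun_prop) fun t ht => by simp [zg t ht])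
      (cs (cduk.mul cg) fun t ht => by simp [zg t ht])
    have e3 : ∀ t, g' t * (q (ξ, τ) * duk t (τ + c)) = q (ξ, τ) * (duk t (τ + c) * g' t) :=
      fun t => by ring
    simp only [e3]
    rw [integral_const_mul, ibp, mul_neg, mul_comm]
    congr 2
    refine integral_congr_ae (Eventually.of_forall fun t => ?_)
    simp only [g]
    rw [← mul_assoc, ← ee_add]
    ring_nf
  linear_combination e1.trans e2

theorem lineDeriv_et_apply (U : 𝓢'(Plane, ℂ)) (φ : 𝓢(Plane, ℂ)) :
    (∂_{et} U) φ = -U (∂_{et} φ) := by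
  rw [TemperedDistribution.lineDerivOp_apply_apply, map_neg]

theorem lineDeriv_ex_ex_apply (U : 𝓢'(Plane, ℂ)) (φ : 𝓢(Plane, ℂ)) :
    (∂_{ex} (∂_{ex} U)) φ = U (∂_{ex} (∂_{ex} φ)) := by
  simp only [TemperedDistribution.lineDerivOp_apply_apply, map_neg, neg_neg]

/-- The weak form of the equation, frequency by frequency. -/
theorem HasFF.weak_sub_eq {U P : 𝓢'(Plane, ℂ)} {F : ℝ × ℝ → ℂ} (hU : HasFF U F) (hP : HasFF P q)
    (hF : ∀ᵐ ξ, Integrable fun τ => F (ξ, τ)) (κ : ℝ) (φ : 𝓢(Plane, ℂ)) :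
    (∂_{et} U) φ - (κ * (Complex.I / 2)) * (∂_{ex} (∂_{ex} U)) φ - P φ =
      ∫ ξ, (-(∫ t, gph (∂_{et} φ) ξ t * tr F ξ t) +
        2 * Real.pi * Complex.I * disp κ ξ * (∫ t, gph φ ξ t * tr F ξ t) -
        ∫ τ, hatS φ (ξ, τ) * q (ξ, τ)) := by
  have i1 : Integrable fun ξ => -∫ t, gph (∂_{et} φ) ξ t * tr F ξ t :=
    (hU.integrable_tr hF _).neg
  have i2 : Integrable fun ξ => κ * (Complex.I / 2) *
      ∫ t, gph (∂_{ex} (∂_{ex} φ)) ξ t * tr F ξ t := (hU.integrable_tr hF _).const_mul _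
  have i3 : Integrable fun ξ => (-∫ t, gph (∂_{et} φ) ξ t * tr F ξ t) - κ * (Complex.I / 2) *
      ∫ t, gph (∂_{ex} (∂_{ex} φ)) ξ t * tr F ξ t := i1.sub i2
  rw [lineDeriv_et_apply, lineDeriv_ex_ex_apply, hU.apply_eq_tr hF, hU.apply_eq_tr hF,
    (hP.apply_eq φ).2, ← integral_neg, ← integral_const_mul, ← integral_sub i1 i2,
    ← integral_sub i3 (hP.apply_eq φ).1.integral_prod_left]
  refine integral_congr_ae (Eventually.of_forall fun ξ => ?_)
  simp only [gph_lineDeriv_ex_ex, mul_assoc, integral_const_mul, disp]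
  push_cast
  ring

theorem tsupport_lineDeriv_subset {φ : 𝓢(Plane, ℂ)} (h : tsupport φ ⊆ strip T) (m : Plane) :
    tsupport (∂_{m} φ : 𝓢(Plane, ℂ)) ⊆ strip T :=
  (SchwartzMap.tsupport_lineDerivOp_subset m φ).trans h

theorem integral_gph_mul_congr {φ : 𝓢(Plane, ℂ)} (h : tsupport φ ⊆ strip T) {y y' : ℝ → ℂ}
    (e : ∀ t ∈ Icc 0 T, y t = y' t) (ξ : ℝ) : ∫ t, gph φ ξ t * y t = ∫ t, gph φ ξ t * y' t := by
  refine integral_congr_ae (Eventually.of_forall fun t => ?_)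
  by_cases ht : t ∈ Ioo 0 T
  · simp only [e t (Ioo_subset_Icc_self ht)]
  · simp only [gph_eq_zero φ h ξ ht, zero_mul]

/-- A distribution whose trace is given by the Duhamel formula solves the equation. -/
theorem HasFF.weakEq {U P : 𝓢'(Plane, ℂ)} {F : ℝ × ℝ → ℂ} (hU : HasFF U F) (hP : HasFF P q)
    (hF : ∀ᵐ ξ, Integrable fun τ => F (ξ, τ)) (hq : Measurable q)
    (hsrc : ∀ᵐ ξ, srcSize κ q ξ < ⊤)
    (htr : ∀ᵐ ξ, ∀ t ∈ Icc 0 T, tr F ξ t = duh κ f q ξ t) : WeakEq κ T U P := by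
  intro φ hφ
  rw [← sub_eq_zero, hU.weak_sub_eq hP hF]
  refine integral_eq_zero_of_ae ?_
  filter_upwards [hsrc, htr] with ξ h1 h2
  have hφ' := tsupport_lineDeriv_subset hφ et
  have := integral_deriv_mul_duh (f := f) (h := fun t => gph φ ξ t)
    (fun t => hasDerivAt_gph φ ξ t)
    (continuous_gph _ ξ) (fun t ht => gph_eq_zero φ hφ ξ ht) (fun t ht => gph_eq_zero _ hφ' ξ ht)
    hq h1
  rw [integral_gph_mul_congr hφ h2, integral_gph_mul_congr hφ' h2, this]
  simp only [← hatS_eq_integral, Pi.zero_apply]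
  ring

end WeakLinear

/-! ### The solution of the linear equation as a curve of distributions -/

section LinearCurve

variable {κ r a b T : ℝ} {f : ℝ → ℂ} {q : ℝ × ℝ → ℂ}

theorem measurable_duh_left (κ : ℝ) (hf : Measurable f) (hq : Measurable q) (t : ℝ) :
    Measurable fun ξ => duh κ f q ξ t :=
  measurable_duh_comp κ hf hq measurable_id measurable_const

theorem enorm_duh_le {ξ : ℝ} (hq : Measurable q) (h : srcSize κ q ξ < ⊤) {t : ℝ} (ht : |t| ≤ 1) :
    ‖duh κ f q ξ t‖ₑ ≤ ‖f ξ‖ₑ + 3 * srcSize κ q ξ := by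
  have h1 := norm_duh_le (f := f) hq h t
  have h2 : ‖duh κ f q ξ t‖ ≤ ‖f ξ‖ + 3 * (srcSize κ q ξ).toReal :=
    h1.trans (by gcongr; linarith)
  rw [← ofReal_norm]
  refine (ENNReal.ofReal_le_ofReal h2).trans (le_of_eq ?_)
  rw [ENNReal.ofReal_add (norm_nonneg _) (by positivity), ENNReal.ofReal_mul (by norm_num),
    ENNReal.ofReal_toReal h.ne, ofReal_norm]
  norm_num

theorem l2_data_src_ne_top (ha : a < 1 / 2) (hf : Measurable f) (hq : Measurable q)
    (nf : snorm r f ≠ ⊤) (nq : cnorm κ r (-a) q ≠ ⊤) :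
    l2 (fun ξ => ENNReal.ofReal (jb ξ ^ r) * (‖f ξ‖ₑ + 3 * srcSize κ q ξ)) ≠ ⊤ := by
  obtain ⟨C, hC, hs⟩ := exists_l2_srcSize_le ha
  have hm := measurable_srcSize κ hq
  have h1 : l2 (fun ξ => ENNReal.ofReal (jb ξ ^ r) * srcSize κ q ξ) ≠ ⊤ :=
    ne_top_of_le_ne_top (by finiteness) (hs κ r q hq)
  have e : ∀ ξ, ENNReal.ofReal (jb ξ ^ r) * (‖f ξ‖ₑ + 3 * srcSize κ q ξ) =
      ENNReal.ofReal (jb ξ ^ r) * ‖f ξ‖ₑ + 3 * (ENNReal.ofReal (jb ξ ^ r) * srcSize κ q ξ) :=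
    fun ξ => by ring
  simp only [e]
  refine ne_top_of_le_ne_top ?_ (l2_add_le (by fun_prop) (by fun_prop))
  rw [l2_const_mul (by norm_num)]
  unfold snorm at nf
  finiteness

theorem snorm_duh_ne_top (ha : a < 1 / 2) (hf : Measurable f) (hq : Measurable q)
    (nf : snorm r f ≠ ⊤) (nq : cnorm κ r (-a) q ≠ ⊤) {t : ℝ} (ht : |t| ≤ 1) :
    snorm r (fun ξ => duh κ f q ξ t) ≠ ⊤ := by
  refine ne_top_of_le_ne_top (l2_data_src_ne_top ha hf hq nf nq) (l2_mono_ae ?_)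
  filter_upwards [ae_srcSize_lt_top ha hq nq] with ξ hξ
  gcongr
  exact enorm_duh_le hq hξ ht

/-- Dominated convergence: at almost every frequency the Duhamel formula is continuous in time, and
for `|t| ≤ 1` it is bounded by the datum plus three times the source size. -/
theorem tendsto_snorm_duh (ha : a < 1 / 2) (hf : Measurable f) (hq : Measurable q)
    (nf : snorm r f ≠ ⊤) (nq : cnorm κ r (-a) q ≠ ⊤) (hT : T ≤ 1) {t : ℝ} (ht : t ∈ Icc 0 T) :
    Tendsto (fun t' => snorm r fun ξ => duh κ f q ξ t' - duh κ f q ξ t) (𝓝[Icc 0 T] t) (𝓝 0) := by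
  set B : ℝ → ℝ≥0∞ := fun ξ => 2 * (ENNReal.ofReal (jb ξ ^ r) * (‖f ξ‖ₑ + 3 * srcSize κ q ξ))
  have hm := measurable_srcSize κ hq
  have hB : ∫⁻ ξ, B ξ ^ 2 ≠ ⊤ := by
    rw [← l2_sq, l2_const_mul (by norm_num)]
    have := l2_data_src_ne_top (κ := κ) ha hf hq nf nq
    finiteness
  have habs : ∀ t' ∈ Icc 0 T, |t'| ≤ 1 := fun t' h => by
    rw [abs_of_nonneg h.1]; exact h.2.trans hT
  have key : Tendsto (fun t' => ∫⁻ ξ, (ENNReal.ofReal (jb ξ ^ r) *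
      ‖duh κ f q ξ t' - duh κ f q ξ t‖ₑ) ^ 2) (𝓝[Icc 0 T] t) (𝓝 (∫⁻ _ : ℝ, 0)) := by
    refine tendsto_lintegral_filter_of_dominated_convergence (fun ξ => B ξ ^ 2) ?_ ?_ hB ?_
    · refine Eventually.of_forall fun t' => ?_
      have m1 := measurable_duh_left κ hf hq t'
      have m2 := measurable_duh_left κ hf hq t
      fun_prop
    · filter_upwards [self_mem_nhdsWithin] with t' ht'
      filter_upwards [ae_srcSize_lt_top ha hq nq] with ξ hξ
      have h1 := enorm_duh_le (f := f) hq hξ (habs t' ht')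
      have h2 := enorm_duh_le (f := f) hq hξ (habs t ht)
      have h3 : ‖duh κ f q ξ t' - duh κ f q ξ t‖ₑ ≤ 2 * (‖f ξ‖ₑ + 3 * srcSize κ q ξ) := by
        rw [two_mul]
        exact enorm_sub_le.trans (add_le_add h1 h2)
      simp only [B]
      rw [mul_left_comm]
      gcongr
    · filter_upwards [ae_srcSize_lt_top ha hq nq] with ξ hξ
      have hc : Continuous fun t' => (ENNReal.ofReal (jb ξ ^ r) *
          ‖duh κ f q ξ t' - duh κ f q ξ t‖ₑ) ^ 2 := by
        have := continuous_duh (f := f) hq hξ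
        have h2 : Continuous fun t' => ‖duh κ f q ξ t' - duh κ f q ξ t‖ₑ := by fun_prop
        have h3 : Continuous fun t' => ENNReal.ofReal (jb ξ ^ r) *
          ‖duh κ f q ξ t' - duh κ f q ξ t‖ₑ :=
          ENNReal.continuous_const_mul ENNReal.ofReal_ne_top |>.comp h2
        exact (ENNReal.continuous_pow 2).comp h3
      have := (hc.tendsto t).mono_left (nhdsWithin_le_nhds (s := Icc 0 T))
      simpa using this
  rw [lintegral_zero] at key
  have h2 := (ENNReal.continuous_rpow_const (y := 1 / 2)).tendsto 0 |>.comp key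
  rw [ENNReal.zero_rpow_of_pos (by norm_num)] at h2
  exact h2

end LinearCurve

/-! ### The extension in time and its localization -/

section LinearExistence

variable {κ r a b T : ℝ} {f : ℝ → ℂ} {q : ℝ × ℝ → ℂ} {ψ : ℝ → ℝ} {χ : 𝓢(ℝ, ℂ)}

/-- The extension uses the cutoff at scale `2T`, which equals `1` on the support of `ψ_T`.
Localizing it therefore gives back the Duhamel formula with the cutoff at scale `T` exactly, and not
with the square of that cutoff. -/
theorem hasFF_localize {U : 𝓢'(Plane, ℂ)} (hψ : IsCutoff ψ) (hχ : ∀ t, χ t = ψ t)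
    (hκ : |κ| ≤ 1) (ha : a < 1 / 2) (hb : 1 / 2 < b) (hT : 0 < T) (hf : Measurable f)
    (hq : Measurable q) (nq : cnorm κ r (-a) q ≠ ⊤) (n1 : cnorm κ r b (duhF χ T κ f q) ≠ ⊤)
    (n2 : cnorm κ r b (duhF χ (2 * T) κ f q) ≠ ⊤) (hU : HasFF U (duhF χ (2 * T) κ f q)) :
    HasFF (localize ψ T U) (duhF χ T κ f q) := by
  have m1 := measurable_duhF χ T κ hf hq
  have m2 := measurable_duhF χ (2 * T) κ hf hq
  obtain ⟨W, hW⟩ := exists_hasFF_of_cnorm (a := 1 / 4) hκ (by norm_num) m1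
    (ne_top_of_le_ne_top n1 (cnorm_mono_exponent (by linarith) _))
  suffices localize ψ T U = W by rw [this]; exact hW
  ext φ
  have i1 := ae_integrable_slice hb m1 n1
  have i2 := ae_integrable_slice hb m2 n2
  rw [localize_apply, hU.apply_eq_tr i2, hW.apply_eq_tr i1]
  refine integral_congr_ae ?_
  filter_upwards [i1, i2, ae_srcSize_lt_top ha hq nq] with ξ h1 h2 h3
  refine integral_congr_ae (Eventually.of_forall fun t => ?_)
  simp only [gph_cutoff φ hψ, tr_duhF χ hT hq h3 h1, tr_duhF χ (by linarith : 0 < 2 * T) hq h3 h2,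
    hχ]
  rcases le_or_gt 2 |t / T| with h | h
  · simp [hψ.eq_zero _ h]
  · have : |t / (2 * T)| ≤ 1 := by
      rw [mul_comm, ← div_div, abs_div, abs_two]; linarith
    rw [hψ.eq_one _ this]
    push_cast
    ring

/-- Both sides are iterated integrals of `gph * duh` over frequency and time. The content is
absolute integrability, which comes from the decay of `gph` in `ξ` and the bound on `duh` uniform in
time. -/
theorem extends_of_hasFF {U : 𝓢'(Plane, ℂ)} {u : ℝ → 𝓢'(ℝ, ℂ)} {F : ℝ × ℝ → ℂ} (ha : a < 1 / 2)
    (hT1 : T ≤ 1) (hf : Measurable f) (hq : Measurable q) (nf : snorm r f ≠ ⊤)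
    (nq : cnorm κ r (-a) q ≠ ⊤) (hU : HasFF U F) (hF : ∀ᵐ ξ, Integrable fun τ => F (ξ, τ))
    (htr : ∀ᵐ ξ, ∀ t ∈ Icc 0 T, tr F ξ t = duh κ f q ξ t)
    (hu : ∀ t ∈ Icc 0 T, HasFourierFun (u t) fun ξ => duh κ f q ξ t) : Extends T u U := by
  intro φ hφ
  have e1 : ∫ t in Ioo 0 T, u t (slice t φ) =
      ∫ t in Ioo 0 T, ∫ ξ, gph φ ξ t * duh κ f q ξ t :=
    setIntegral_congr_fun measurableSet_Ioo fun t ht => (hu t (Ioo_subset_Icc_self ht)).apply_eq _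
  have e2 : U φ = ∫ ξ, ∫ t in Ioo 0 T, gph φ ξ t * duh κ f q ξ t := by
    rw [hU.apply_eq_tr hF]
    refine integral_congr_ae ?_
    filter_upwards [htr] with ξ h1
    rw [integral_gph_mul_congr hφ h1, setIntegral_eq_integral_of_forall_compl_eq_zero]
    intro t ht
    rw [gph_eq_zero φ hφ ξ ht, zero_mul]
  rw [e1, e2]
  obtain ⟨N, C, hC, hb⟩ := exists_lintegral_jb_le r
  obtain ⟨A, hA, hg⟩ := exists_gph_le φ N
  have hm := measurable_srcSize κ hq
  have md := measurable_duh κ hf hq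
  have mg := measurable_gph φ
  refine integral_integral_swap (f := fun ξ t => gph φ ξ t * duh κ f q ξ t) ⟨?_, ?_⟩
  · exact (mg.mul md).aestronglyMeasurable
  · have mm : Measurable fun p : ℝ × ℝ => ‖gph φ p.1 p.2 * duh κ f q p.1 p.2‖ₑ := (mg.mul md).enorm
    refine (lintegral_prod _ mm.aemeasurable).trans_lt ?_
    calc _ ≤ ∫⁻ ξ, ENNReal.ofReal A * ((‖f ξ‖ₑ + 3 * srcSize κ q ξ) *
          ENNReal.ofReal ((jb ξ ^ N)⁻¹)) := by
          refine lintegral_mono_ae ?_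
          filter_upwards [ae_srcSize_lt_top ha hq nq] with ξ hξ
          have hb2 : ∀ t ∈ Ioo 0 T, ‖gph φ ξ t * duh κ f q ξ t‖ₑ ≤
              ENNReal.ofReal A * ((‖f ξ‖ₑ + 3 * srcSize κ q ξ) *
              ENNReal.ofReal ((jb ξ ^ N)⁻¹)) := by
            intro t ht
            rw [enorm_mul, mul_left_comm, mul_comm, ← ENNReal.ofReal_mul hA]
            gcongr
            · exact enorm_duh_le hq hξ (by rw [abs_of_pos ht.1]; exact ht.2.le.trans hT1)
            · rw [← ofReal_norm]; exact ENNReal.ofReal_le_ofReal (hg ξ t)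
          refine (setLIntegral_mono measurable_const hb2).trans ?_
          rw [setLIntegral_const, Real.volume_Ioo]
          refine mul_le_of_le_one_right zero_le ?_
          rw [sub_zero, ← ENNReal.ofReal_one]
          exact ENNReal.ofReal_le_ofReal hT1
      _ < ⊤ := by
          rw [lintegral_const_mul' _ _ ENNReal.ofReal_ne_top]
          refine ENNReal.mul_lt_top ENNReal.ofReal_lt_top ?_
          refine (hb _ (by fun_prop)).trans_lt ?_
          have := l2_data_src_ne_top (κ := κ) ha hf hq nf nq
          exact ENNReal.mul_lt_top hC.lt_top this.lt_top

end LinearExistence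

/-! ### Gronwall's lemma for a homogeneous integral equation -/

section Gronwall

theorem eq_zero_of_eq_const_mul_integral {y : ℝ → ℂ} (hy : Continuous y) {c : ℂ} {T : ℝ}
    (h : ∀ t ∈ Icc 0 T, y t = c * ∫ x in (0 : ℝ)..t, y x) : ∀ t ∈ Icc 0 T, y t = 0 := by
  intro t ht
  have hd : ∀ t, HasDerivAt (fun t => ∫ x in (0 : ℝ)..t, y x) (y t) t := fun t =>
    intervalIntegral.integral_hasDerivAt_right (hy.intervalIntegrable _ _)
      (hy.stronglyMeasurableAtFilter _ _) hy.continuousAt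
  have hY : Continuous fun t => ∫ x in (0 : ℝ)..t, y x :=
    continuous_iff_continuousAt.2 fun t => (hd t).continuousAt
  have := norm_le_gronwallBound_of_norm_deriv_right_le (f := fun t => ∫ x in (0 : ℝ)..t, y x)
    (f' := y) (δ := 0) (K := ‖c‖) (ε := 0) (a := 0) (b := T) hY.continuousOn
    (fun x _ => (hd x).hasDerivWithinAt) (by simp)
    (fun x hx => by rw [h x (Ico_subset_Icc_self hx), norm_mul, add_zero]) t ht
  rw [gronwallBound_ε0_δ0] at this
  rw [h t ht, norm_le_zero_iff.1 this, mul_zero]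

end Gronwall

/-! ### Reality of the Debye component -/

section Reality

variable {κ : ℝ} {f : ℝ → ℂ} {q F G : ℝ × ℝ → ℂ}

/-- The Fourier-side expression of the fact that `u ū` is real. -/
theorem cj_cv_cj (F : ℝ × ℝ → ℂ) : cj (cv F (cj F)) = cv F (cj F) := by
  funext z
  simp only [cj, cv, ← integral_conj, map_mul, Complex.conj_conj]
  rw [← integral_sub_right_eq_self _ z]
  refine integral_congr_ae (Eventually.of_forall fun w => ?_)
  simp only [mul_comm]
  congr 2
  · abel
  · congr 1; abel

theorem srcV_sub_cj (σ ε : ℝ) (F G : ℝ × ℝ → ℂ) (z : ℝ × ℝ) :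
    srcV σ ε F F G z - cj (srcV σ ε F F G) z = -(σ : ℂ)⁻¹ * (G z - cj G z) := by
  have h : (starRingEnd ℂ) (cv F (cj F) (-z)) = cv F (cj F) z := congrFun (cj_cv_cj F) z
  simp only [srcV, cj, map_mul, map_sub, map_inv₀, Complex.conj_ofReal] at h ⊢
  rw [h]
  ring

theorem duh_zero_eq (f : ℝ → ℂ) (q : ℝ × ℝ → ℂ) (ξ t : ℝ) :
    duh 0 f q ξ t = f ξ + ∫ τ, q (ξ, τ) * duk t τ := by
  simp [duh, disp, ee_zero]

theorem conj_duh_zero (f : ℝ → ℂ) (q : ℝ × ℝ → ℂ) (ξ t : ℝ) :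
    (starRingEnd ℂ) (duh 0 f q (-ξ) t) =
      duh 0 (fun ξ => (starRingEnd ℂ) (f (-ξ))) (cj q) ξ t := by
  rw [duh_zero_eq, duh_zero_eq, map_add, ← integral_conj, ← integral_neg_eq_self]
  congr 2
  funext τ
  simp [cj, conj_duk]

theorem srcSize_cj_lt_top (h : srcSize 0 q (-ξ) < ⊤) : srcSize 0 (cj q) ξ < ⊤ := by
  refine lt_of_eq_of_lt ?_ h
  unfold srcSize
  rw [← lintegral_neg_eq_self]
  refine lintegral_congr fun τ => ?_
  simp only [disp, enorm_cj, zero_mul, add_zero, jb_neg, Prod.neg_mk, neg_neg]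

/-- A solution of the relaxation equation with real data is real. -/
theorem ae_tr_eq_conj {σ ε T : ℝ} {g : ℝ → ℂ} (hF : Measurable F) (hG : Measurable G)
    (iG : ∀ᵐ ξ, Integrable fun τ => G (ξ, τ))
    (hsrc : ∀ᵐ ξ, srcSize 0 (srcV σ ε F F G) ξ < ⊤)
    (hg : ∀ᵐ ξ, g ξ = (starRingEnd ℂ) (g (-ξ)))
    (h : ∀ᵐ ξ, ∀ t ∈ Icc 0 T, tr G ξ t = duh 0 g (srcV σ ε F F G) ξ t) :
    ∀ᵐ ξ, ∀ t ∈ Icc 0 T, tr G ξ t = (starRingEnd ℂ) (tr G (-ξ) t) := by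
  have hq := measurable_srcV σ ε hF hF hG
  have neg : ∀ {p : ℝ → Prop}, (∀ᵐ ξ, p ξ) → ∀ᵐ ξ, p (-ξ) := fun hp =>
    (Measure.measurePreserving_neg (volume : Measure ℝ)).quasiMeasurePreserving.ae hp
  filter_upwards [iG, integrable_cj iG, hsrc, neg hsrc, hg, h, neg h] with ξ i1 i2 s1 s2 g1 h1 h2
  have i3 : Integrable fun τ => G (ξ, τ) - cj G (ξ, τ) := i1.sub i2
  set D : ℝ × ℝ → ℂ := fun z => G z - cj G z with hD
  have e1 : ∀ t, tr D ξ t = tr G ξ t - (starRingEnd ℂ) (tr G (-ξ) t) := fun t => by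
    rw [← tr_cj]
    simp only [tr, hD, mul_sub]
    have cb : ∀ {H : ℝ → ℂ}, Integrable H → Integrable fun τ => ee (t * τ) * H τ := fun hH =>
      hH.bdd_mul (c := 1) (by unfold ee; fun_prop)
        (Eventually.of_forall fun τ => (norm_ee _).le)
    exact integral_sub (cb i1) (cb i2)
  -- The quadratic parts and the data cancel, so the trace of `G - cj G` equals `-σ⁻¹` times its own
  -- integral from `0`.
  have key := eq_zero_of_eq_const_mul_integral (continuous_tr (F := D) i3) (c := -(σ : ℂ)⁻¹) (T := T)
    fun t ht => by
      rw [e1, h1 t ht, h2 t ht, conj_duh_zero, duh_sub hq (measurable_cj hq) s1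
        (srcSize_cj_lt_top s2), duh_zero_eq, ← g1, sub_self, zero_add]
      simp only [srcV_sub_cj, mul_assoc, integral_const_mul]
      congr 1
      have := integral_mul_duk_eq i3 0 t
      simp only [add_zero, mul_zero, ee_zero, one_mul] at this
      exact this
  intro t ht
  exact sub_eq_zero.1 ((e1 t).symm.trans (key t ht))

end Reality

/-! ### From fixed points in frequency to solutions of the system -/

section Existence

variable {σ ε κ r k s a b T : ℝ} {f g : ℝ → ℂ} {q F G : ℝ × ℝ → ℂ} {ψ : ℝ → ℝ} {χ : 𝓢(ℝ, ℂ)}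
  {K R m : ℝ≥0∞}

theorem duh_at_zero (κ : ℝ) (f : ℝ → ℂ) (q : ℝ × ℝ → ℂ) (ξ : ℝ) : duh κ f q ξ 0 = f ξ := by
  simp [duh, duk_zero, ee_zero]

/-- The distributions attached to a solution of the cut-off Duhamel equation. -/
theorem PicardBounds.exists_curve (h : PicardBounds σ ε χ k s a b K) (hψ : IsCutoff ψ)
    (hχ : ∀ t, χ t = ψ t) (hκ : |κ| ≤ 1) (hT : 0 < T) (hT1 : 2 * T ≤ 1) (hf : Measurable f)
    (hq : Measurable q) (nf : snorm r f ≠ ⊤) (nq : cnorm κ r (-a) q ≠ ⊤)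
    (nF : cnorm κ r b F ≠ ⊤) (eF : ∀ᵐ z, F z = duhF χ T κ f q z)
    {u₀ : 𝓢'(ℝ, ℂ)} (hu₀ : HasFourierFun u₀ f) :
    ∃ (u : ℝ → 𝓢'(ℝ, ℂ)) (U : 𝓢'(Plane, ℂ)), u 0 = u₀ ∧ ContinuousInH r T u ∧ Extends T u U ∧
      HasFF (localize ψ T U) F ∧ (∀ P, HasFF P q → WeakEq κ T U P) ∧
      (∀ᵐ ξ, ∀ t ∈ Icc 0 T, tr F ξ t = duh κ f q ξ t) ∧
      ∀ t ∈ Icc 0 T, HasFourierFun (u t) fun ξ => tr F ξ t := by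
  have hT' : T ≤ 1 := by linarith
  have hχ1 : ∀ t, |t| ≤ 1 → χ t = 1 := fun t ht => by rw [hχ, hψ.eq_one t ht, Complex.ofReal_one]
  have n1 : cnorm κ r b (duhF χ T κ f q) ≠ ⊤ := by rwa [← cnorm_congr eF]
  have hK := h.bilinear.ne_top
  -- The linear estimate is applied at time `2T`, which is why an admissible time satisfies `2T ≤
  -- 1`.
  have n2 : cnorm κ r b (duhF χ (2 * T) κ f q) ≠ ⊤ :=
    ne_top_of_le_ne_top (by finiteness) (h.linear κ r (2 * T) f q (by linarith) hT1 hf hq nq)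
  have m2 := measurable_duhF χ (2 * T) κ hf hq
  have lt : ∀ {X : ℝ × ℝ → ℂ}, X =ᵐ[volume] duhF χ T κ f q → ∀ᵐ ξ, ∀ t, tr X ξ t =
      tr (duhF χ T κ f q) ξ t := fun e => by
    filter_upwards [ae_slice_eq e] with ξ h1 t
    refine integral_congr_ae ?_
    filter_upwards [h1] with τ h2
    rw [h2]
  have ht1 : ∀ᵐ ξ, ∀ t ∈ Icc 0 T, tr F ξ t = duh κ f q ξ t := by
    filter_upwards [lt eF, h.ae_tr_duhF hχ1 hT hf hq nq n1] with ξ h1 h2 t ht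
    rw [h1, h2 t ht]
  have ht2 : ∀ᵐ ξ, ∀ t ∈ Icc 0 T, tr (duhF χ (2 * T) κ f q) ξ t = duh κ f q ξ t := by
    filter_upwards [h.ae_tr_duhF hχ1 (by linarith) hf hq nq n2] with ξ h2 t ht
    exact h2 t ⟨ht.1, by linarith [ht.2]⟩
  obtain ⟨U, hU⟩ := exists_hasFF_of_cnorm (a := 1 / 4) hκ (by norm_num) m2
    (ne_top_of_le_ne_top n2 (cnorm_mono_exponent (by linarith [h.lt_b]) _))
  have habs : ∀ t ∈ Icc 0 T, |t| ≤ 1 := fun t h => by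
    rw [abs_of_nonneg h.1]; exact h.2.trans hT'
  have hex : ∀ t : Icc 0 T, ∃ v : 𝓢'(ℝ, ℂ), HasFourierFun v fun ξ => duh κ f q ξ t := fun t =>
    exists_hasFourierFun_of_snorm (measurable_duh_left κ hf hq t)
      (snorm_duh_ne_top h.a_lt hf hq nf nq (habs t t.2))
  choose w hw using hex
  let u : ℝ → 𝓢'(ℝ, ℂ) := fun t => if ht : t ∈ Icc 0 T then w ⟨t, ht⟩ else 0
  have hu : ∀ t ∈ Icc 0 T, HasFourierFun (u t) fun ξ => duh κ f q ξ t := fun t ht => by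
    simp only [u, dif_pos ht]; exact hw ⟨t, ht⟩
  have i2 := ae_integrable_slice h.lt_b m2 n2
  refine ⟨u, U, ?_, ?_, extends_of_hasFF h.a_lt hT' hf hq nf nq hU i2 ht2 hu, ?_, ?_, ht1, ?_⟩
  · refine (hu 0 ⟨le_rfl, hT.le⟩).ext ?_
    simpa only [duh_at_zero] using hu₀
  · refine fun t ht => ⟨?_, ?_⟩
    · rw [MemH, (hu t ht).sobolevNorm_eq]
      exact (snorm_duh_ne_top h.a_lt hf hq nf nq (habs t ht)).lt_top
    · refine (tendsto_snorm_duh h.a_lt hf hq nf nq hT' ht).congr' ?_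
      filter_upwards [self_mem_nhdsWithin] with t' ht'
      exact ((hu t' ht').sub (hu t ht)).sobolevNorm_eq.symm
  · exact (hasFF_localize hψ hχ hκ h.a_lt h.lt_b hT hf hq nq n1 n2 hU).congr
      (eF.mono fun z hz => hz.symm)
  · exact fun P hP => hU.weakEq hP i2 hq (ae_srcSize_lt_top h.a_lt hq nq) ht2
  · intro t ht
    refine (hu t ht).congr ?_
    filter_upwards [ht1] with ξ h1 using (h1 t ht).symm

/-- A fixed point of the Picard map yields a solution of the system. -/
theorem PicardBounds.exists_isSolution (h : PicardBounds σ ε χ k s a b K) (hσ : σ ≠ 0)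
    (hψ : IsCutoff ψ) (hχ : ∀ t, χ t = ψ t) (hT : 0 < T) (hT1 : 2 * T ≤ 1)
    (hf : Measurable f) (hg : Measurable g) (nf : snorm k f ≠ ⊤) (ng : snorm s g ≠ ⊤)
    (hF : Measurable F) (hG : Measurable G) (nF : cnorm 1 k b F ≠ ⊤) (nG : cnorm 0 s b G ≠ ⊤)
    (eF : ∀ᵐ z, F z = duhF χ T 1 f (srcU F G) z)
    (eG : ∀ᵐ z, G z = duhF χ T 0 g (srcV σ ε F F G) z)
    {u₀ v₀ : 𝓢'(ℝ, ℂ)} (hu₀ : HasFourierFun u₀ f) (hv₀ : HasFourierFun v₀ g)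
    (hr : IsRealDist v₀) : ∃ u v : ℝ → 𝓢'(ℝ, ℂ),
      (∀ b' ≤ b, IsSolution σ ε ψ k s b' T u₀ v₀ u v) ∧ TraceSol σ ε T f g F G ∧
      ∀ t ∈ Icc 0 T, HasFourierFun (u t) (fun ξ => tr F ξ t) ∧
        HasFourierFun (v t) fun ξ => tr G ξ t := by
  have hqU := measurable_srcU hF hG
  have hqV := measurable_srcV σ ε hF hF hG
  have nqU := h.srcU_ne_top hF hG nF nG
  have nqV := h.srcV_ne_top hF hF hG nF nF nG
  obtain ⟨u, U, u0, cu, xu, lu, wu, tu, su⟩ := h.exists_curve hψ hχ (κ := 1) (by norm_num) hT hT1 hf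
    hqU nf nqU nF eF hu₀
  obtain ⟨v, V, v0, cv', xv, lv, wv, tv, sv⟩ := h.exists_curve hψ hχ (κ := 0) (by norm_num) hT hT1
    hg hqV ng nqV nG eG hv₀
  have w1 := h.bilinear.wnorm_product_ne_top hF hG nF nG
  have w2 := h.bilinear.wnorm_modulus_ne_top hF hF nF nF
  obtain ⟨uv, huv⟩ := exists_hasFF_of_cnorm (κ := 1) (k := k) (a := a) (by norm_num) h.a_lt
    (measurable_cv hF hG) (ne_top_of_le_ne_top w1 (wnorm_mono
      (Eventually.of_forall fun z => enorm_cv_le F G z)))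
  obtain ⟨uu, huu⟩ := exists_hasFF_of_cnorm (κ := 0) (k := s) (a := a) (by norm_num) h.a_lt
    (measurable_cv hF (measurable_cj hF)) (ne_top_of_le_ne_top w2 (wnorm_mono
      (Eventually.of_forall fun z => enorm_cv_le F (cj F) z)))
  refine ⟨u, v, fun b' hb' => ⟨u0, v0, ?_, cu, cv', U, V, uv, uu, xu, xv, ?_, ?_, ?_, ?_, ?_, ?_⟩,
    ?_, fun t ht => ⟨su t ht, sv t ht⟩⟩
  · intro t ht
    have hg' : ∀ᵐ ξ, g ξ = (starRingEnd ℂ) (g (-ξ)) := by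
      have := hv₀.conj
      rw [show conjDist v₀ = v₀ from hr] at this
      exact hv₀.ae_eq this
    have hc := ae_tr_eq_conj hF hG (ae_integrable_slice h.lt_b hG nG)
      (ae_srcSize_lt_top h.a_lt hqV nqV) hg' tv
    refine (sv t ht).conj.ext ((sv t ht).congr ?_)
    filter_upwards [hc] with ξ h1 using h1 t ht
  · rw [lu.bourgainNorm_eq]
    exact (cnorm_mono_exponent hb' F).trans_lt nF.lt_top
  · rw [lv.mixedNorm_eq]
    exact (cnorm_mono_exponent hb' G).trans_lt nG.lt_top
  · exact isFourierProduct_of_hasFF lu lv (ae_integrable_cv hF hG w1) huv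
  · exact isFourierProduct_of_hasFF lu lu.conj (ae_integrable_cv hF (measurable_cj hF) w2) huu
  · intro φ hφ
    have := wu _ (huv.smul (-Complex.I)) φ hφ
    simp only [Complex.ofReal_one, one_mul] at this
    have e : ∀ A B C : ℂ, A - Complex.I / 2 * B = -Complex.I * C →
        Complex.I * A + 1 / 2 * B - C = 0 := fun A B C hh => by
      linear_combination Complex.I * hh + (1 / 2 * B - C) * Complex.I_mul_I
    exact e _ _ _ this
  · intro φ hφ
    have := wv _ (((huu.smul (ε : ℂ)).sub lv).smul (σ : ℂ)⁻¹) φ hφ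
    -- The fixed point equation contains the localized `V` in the damping term, while the system
    -- contains `V` itself. On test functions supported in the strip they agree.
    have hl : localize ψ T V φ = V φ := by rw [localize_apply, cutoff_smul_eq φ hψ hT hφ]
    simp only [Complex.ofReal_zero, zero_mul, sub_zero] at this
    have e : ∀ A B C : ℂ, A = (σ : ℂ)⁻¹ * (ε * B - C) → σ * A + C - ε * B = 0 := fun A B C hh => by
      rw [hh, mul_inv_cancel_left₀ (by exact_mod_cast hσ)]; ring
    refine e ((∂_{et} V) φ) (uu φ) (V φ) (this.trans ?_)
    rw [← hl]
    rfl
  · filter_upwards [tu, tv] with ξ h1 h2 t ht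
    exact ⟨h1 t ht, h2 t ht⟩

end Existence

/-! ### Product test functions -/

section Tensor

theorem norm_iteratedFDeriv_comp_proj_le (β : 𝓢(ℝ, ℂ)) (i : Fin 2) (n : ℕ) (z : Plane) :
    ‖iteratedFDeriv ℝ n (fun z : Plane => β (z i)) z‖ ≤ ‖iteratedFDeriv ℝ n β (z i)‖ := by
  have h := (EuclideanSpace.proj i : Plane →L[ℝ] ℝ).iteratedFDeriv_comp_right
    (β.smooth n) z le_rfl
  change ‖iteratedFDeriv ℝ n (β ∘ (EuclideanSpace.proj i : Plane →L[ℝ] ℝ)) z‖ ≤ _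
  rw [h]
  refine (ContinuousMultilinearMap.norm_compContinuousLinearMap_le _ _).trans ?_
  have hp : ‖(EuclideanSpace.proj i : Plane →L[ℝ] ℝ)‖ ≤ 1 :=
    ContinuousLinearMap.opNorm_le_bound _ zero_le_one fun z => by
      simpa using PiLp.norm_apply_le z i
  rw [Finset.prod_const]
  exact mul_le_of_le_one_right (norm_nonneg _) (pow_le_one₀ (norm_nonneg _) hp)

/-- The product `β(x) α(t)`. -/
def tensor (β α : 𝓢(ℝ, ℂ)) : 𝓢(Plane, ℂ) where
  toFun z := β (z 0) * α (z 1)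
  smooth' := by
    have h0 : ContDiff ℝ ∞ fun z : Plane => β (z 0) :=
      (β.smooth ⊤).comp (EuclideanSpace.proj (0 : Fin 2) : Plane →L[ℝ] ℝ).contDiff
    have h1 : ContDiff ℝ ∞ fun z : Plane => α (z 1) :=
      (α.smooth ⊤).comp (EuclideanSpace.proj (1 : Fin 2) : Plane →L[ℝ] ℝ).contDiff
    exact h0.mul h1
  decay' k n := by
    have h0 : ContDiff ℝ ∞ fun z : Plane => β (z 0) :=
      (β.smooth ⊤).comp (EuclideanSpace.proj (0 : Fin 2) : Plane →L[ℝ] ℝ).contDiff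
    have h1 : ContDiff ℝ ∞ fun z : Plane => α (z 1) :=
      (α.smooth ⊤).comp (EuclideanSpace.proj (1 : Fin 2) : Plane →L[ℝ] ℝ).contDiff
    let S : 𝓢(ℝ, ℂ) → ℝ := fun γ =>
      2 ^ k * (Finset.Iic (k, n)).sup (fun m => SchwartzMap.seminorm ℂ m.1 m.2) γ
    have hS : ∀ (γ : 𝓢(ℝ, ℂ)) (i : ℕ), i ≤ n → ∀ x, (1 + ‖x‖) ^ k * ‖iteratedFDeriv ℝ i γ x‖ ≤ S γ :=
      fun γ i hi x => SchwartzMap.one_add_le_sup_seminorm_apply (𝕜 := ℂ) (m := (k, n)) le_rfl hi γ x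
    refine ⟨∑ i ∈ Finset.range (n + 1), (n.choose i : ℝ) * (S β * S α), fun z => ?_⟩
    have hz : ‖z‖ ≤ (1 + ‖z 0‖) * (1 + ‖z 1‖) := by
      have h2 : ‖z‖ ^ 2 ≤ (‖z 0‖ + ‖z 1‖) ^ 2 := by
        rw [EuclideanSpace.norm_sq_eq, Fin.sum_univ_two]
        nlinarith [norm_nonneg (z 0), norm_nonneg (z 1)]
      have h3 := abs_le_of_sq_le_sq h2 (by positivity)
      nlinarith [norm_nonneg (z 0), norm_nonneg (z 1), le_abs_self ‖z‖]
    calc _ ≤ ((1 + ‖z 0‖) * (1 + ‖z 1‖)) ^ k * ∑ i ∈ Finset.range (n + 1), (n.choose i : ℝ) *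
          ‖iteratedFDeriv ℝ i (fun z : Plane => β (z 0)) z‖ *
          ‖iteratedFDeriv ℝ (n - i) (fun z : Plane => α (z 1)) z‖ := by
          gcongr
          exact norm_iteratedFDeriv_mul_le h0 h1 z (by exact_mod_cast le_top)
      _ ≤ _ := by
          rw [Finset.mul_sum]
          refine Finset.sum_le_sum fun i hi => ?_
          have hi' : i ≤ n := Nat.lt_succ_iff.1 (Finset.mem_range.1 hi)
          have a1 := norm_iteratedFDeriv_comp_proj_le β 0 i z
          have a2 := norm_iteratedFDeriv_comp_proj_le α 1 (n - i) z
          have a3 := hS β i hi' (z 0)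
          have a4 := hS α (n - i) (Nat.sub_le _ _) (z 1)
          calc _ = (n.choose i : ℝ) * (((1 + ‖z 0‖) ^ k *
                ‖iteratedFDeriv ℝ i (fun z : Plane => β (z 0)) z‖) * ((1 + ‖z 1‖) ^ k *
                ‖iteratedFDeriv ℝ (n - i) (fun z : Plane => α (z 1)) z‖)) := by
                rw [mul_pow]; ring
            _ ≤ (n.choose i : ℝ) * (((1 + ‖z 0‖) ^ k * ‖iteratedFDeriv ℝ i β (z 0)‖) *
                ((1 + ‖z 1‖) ^ k * ‖iteratedFDeriv ℝ (n - i) α (z 1)‖)) := by gcongr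
            _ ≤ _ := by gcongr

theorem tensor_apply (β α : 𝓢(ℝ, ℂ)) (z : Plane) : tensor β α z = β (z 0) * α (z 1) := rfl

theorem slice_tensor (β α : 𝓢(ℝ, ℂ)) (t : ℝ) : slice t (tensor β α) = α t • β := by
  ext x
  rw [slice_apply, tensor_apply, lineAt_eq_pl, pl_zero_apply, pl_one_apply, mul_comm]
  rfl

theorem gph_tensor (β α : 𝓢(ℝ, ℂ)) (ξ t : ℝ) :
    gph (tensor β α) ξ t = (𝓕⁻ β : 𝓢(ℝ, ℂ)) ξ * α t := by
  have : gph (tensor β α) ξ t = (𝓕⁻ (α t • β) : 𝓢(ℝ, ℂ)) ξ := by rw [gph, slice_tensor]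
  rw [this, FourierTransform.fourierInv_smul, mul_comm]
  rfl

theorem gph_lineDeriv_et_tensor (β α : 𝓢(ℝ, ℂ)) (ξ t : ℝ) :
    gph (∂_{et} (tensor β α)) ξ t = (𝓕⁻ β : 𝓢(ℝ, ℂ)) ξ * deriv α t := by
  have h := hasDerivAt_gph (tensor β α) ξ t
  simp only [gph_tensor] at h
  exact h.unique ((α.differentiableAt.hasDerivAt).const_mul _)

theorem hatS_tensor (β α : 𝓢(ℝ, ℂ)) (ξ τ : ℝ) :
    hatS (tensor β α) (ξ, τ) = (𝓕⁻ β : 𝓢(ℝ, ℂ)) ξ * ∫ t, ee (t * τ) * α t := by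
  rw [hatS_eq_integral, ← integral_const_mul]
  refine integral_congr_ae (Eventually.of_forall fun t => ?_)
  simp only [gph_tensor]; ring

theorem tsupport_tensor_subset {T : ℝ} (β : 𝓢(ℝ, ℂ)) {α : 𝓢(ℝ, ℂ)} {c d : ℝ} (hc : 0 < c)
    (hd : d < T) (h : ∀ t, t ∉ Icc c d → α t = 0) : tsupport (tensor β α) ⊆ strip T := by
  have h1 : IsClosed {z : Plane | z 1 ∈ Icc c d} :=
    isClosed_Icc.preimage (EuclideanSpace.proj (1 : Fin 2) : Plane →L[ℝ] ℝ).continuous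
  refine (closure_minimal (fun z hz => ?_) h1).trans fun z hz =>
    ⟨hc.trans_le hz.1, hz.2.trans_lt hd⟩
  by_contra hz'
  exact hz (by rw [tensor_apply, h _ hz', mul_zero])

end Tensor

/-! ### Mollifiers and weak derivatives in one variable -/

section Mollifier

theorem integrable_mul_of_eq_zero {h w : ℝ → ℂ} {c d : ℝ} (hh : Continuous h) (hw : Continuous w)
    (h0 : ∀ x, x ∉ Icc c d → h x = 0) : Integrable fun x => h x * w x :=
  Continuous.integrable_of_hasCompactSupport (f := fun x => h x * w x) (hh.mul hw)
    (HasCompactSupport.intro (isCompact_Icc (a := c) (b := d)) fun x hx => by rw [h0 x hx, zero_mul])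

/-- A bump function supported in `[-1/(n+1), 1/(n+1)]`. -/
def molBump (n : ℕ) : ContDiffBump (0 : ℝ) where
  rIn := 1 / (2 * (n + 1))
  rOut := 1 / (n + 1)
  rIn_pos := by positivity
  rIn_lt_rOut := by
    refine one_div_lt_one_div_of_lt (by positivity) ?_
    linarith [Nat.cast_nonneg (α := ℝ) n]

/-- A sequence of mollifiers. -/
def mol (n : ℕ) (x : ℝ) : ℝ := (molBump n).normed volume x

theorem contDiff_mol (n : ℕ) : ContDiff ℝ ∞ (mol n) := (molBump n).contDiff_normed

theorem continuous_mol (n : ℕ) : Continuous (mol n) := (contDiff_mol n).continuous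

theorem mol_nonneg (n : ℕ) (x : ℝ) : 0 ≤ mol n x := (molBump n).nonneg_normed x

theorem mol_eq_zero {n : ℕ} {x : ℝ} (h : 1 / ((n : ℝ) + 1) ≤ |x|) : mol n x = 0 := by
  have : x ∉ Function.support ((molBump n).normed volume) := by
    rw [ContDiffBump.support_normed_eq, Metric.mem_ball, dist_zero_right, Real.norm_eq_abs, not_lt]
    exact h
  exact Function.notMem_support.1 this

theorem integrable_mol (n : ℕ) : Integrable (mol n) := (molBump n).integrable_normed

theorem integral_mol (n : ℕ) : ∫ x, mol n x = 1 := (molBump n).integral_normed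

theorem tendsto_integral_mol_mul {y : ℝ → ℂ} (hy : Continuous y) (s : ℝ) :
    Tendsto (fun n => ∫ x, (mol n (x - s) : ℂ) * y x) atTop (𝓝 (y s)) := by
  have h := ContDiffBump.convolution_tendsto_right_of_continuous (φ := molBump) (l := atTop)
    (μ := volume) (g := y) (tendsto_one_div_add_atTop_nhds_zero_nat) hy s
  refine h.congr fun n => ?_
  rw [convolution_eq_swap]
  refine integral_congr_ae (Eventually.of_forall fun x => ?_)
  simp only [ContinuousLinearMap.lsmul_apply, Complex.real_smul]
  congr 2
  rw [mol, ← (molBump n).normed_neg, neg_sub]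

theorem norm_integral_mol_mul_le (n : ℕ) (s : ℝ) {y : ℝ → ℂ} {C : ℝ} (h : ∀ x, ‖y x‖ ≤ C) :
    ‖∫ x, (mol n (x - s) : ℂ) * y x‖ ≤ C := by
  have h1 : ∫ x, mol n (x - s) * C = C := by
    rw [integral_mul_const, integral_sub_right_eq_self (mol n) s, integral_mol, one_mul]
  rw [← h1]
  refine norm_integral_le_of_norm_le (((integrable_mol n).comp_sub_right s).mul_const C)
    (Eventually.of_forall fun x => ?_)
  rw [norm_mul, Complex.norm_real, Real.norm_of_nonneg (mol_nonneg _ _)]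
  exact mul_le_mul_of_nonneg_left (h x) (mol_nonneg _ _)

/-- A smooth function which is `0` far from `[s, t]`, with derivative the difference of the
mollifiers at `s` and at `t`. -/
def ramp (n : ℕ) (s t x : ℝ) : ℂ := ∫ y in (x - t)..(x - s), (mol n y : ℂ)

theorem hasDerivAt_ramp (n : ℕ) (s t x : ℝ) :
    HasDerivAt (ramp n s t) ((mol n (x - s) : ℂ) - mol n (x - t)) x := by
  have hc : Continuous fun y => (mol n y : ℂ) := Complex.continuous_ofReal.comp (continuous_mol n)
  have hd : ∀ r, HasDerivAt (fun x => ∫ y in (0 : ℝ)..(x - r), (mol n y : ℂ)) (mol n (x - r)) x :=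
    fun r => (intervalIntegral.integral_hasDerivAt_right (hc.intervalIntegrable _ _)
      (hc.stronglyMeasurableAtFilter _ _) hc.continuousAt).comp_sub_const x r
  have e : ramp n s t = fun x => (∫ y in (0 : ℝ)..(x - s), (mol n y : ℂ)) -
      ∫ y in (0 : ℝ)..(x - t), (mol n y : ℂ) := by
    funext x
    rw [ramp, intervalIntegral.integral_interval_sub_left (hc.intervalIntegrable _ _)
      (hc.intervalIntegrable _ _)]
  rw [e]
  exact (hd s).sub (hd t)

theorem contDiff_ofReal_mol (n : ℕ) (s : ℝ) : ContDiff ℝ ∞ fun x => (mol n (x - s) : ℂ) :=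
  Complex.ofRealCLM.contDiff.comp ((contDiff_mol n).comp (contDiff_id.sub contDiff_const))

theorem contDiff_ramp (n : ℕ) (s t : ℝ) : ContDiff ℝ ∞ (ramp n s t) := by
  refine contDiff_infty_iff_deriv.2 ⟨fun x => (hasDerivAt_ramp n s t x).differentiableAt, ?_⟩
  rw [show deriv (ramp n s t) = _ from funext fun x => (hasDerivAt_ramp n s t x).deriv]
  exact (contDiff_ofReal_mol n s).sub (contDiff_ofReal_mol n t)

theorem mol_sub_eq_zero {n : ℕ} {s x : ℝ}
    (hx : x ∉ Icc (s - 1 / ((n : ℝ) + 1)) (s + 1 / ((n : ℝ) + 1))) : (mol n (x - s) : ℂ) = 0 := by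
  rw [mol_eq_zero, Complex.ofReal_zero]
  by_contra h
  rw [not_le, abs_lt] at h
  exact hx ⟨by linarith [h.1], by linarith [h.2]⟩

theorem ramp_eq_zero {n : ℕ} {s t x : ℝ} (hst : s ≤ t)
    (hx : x ∉ Icc (s - 1 / ((n : ℝ) + 1)) (t + 1 / ((n : ℝ) + 1))) : ramp n s t x = 0 := by
  rw [ramp, intervalIntegral.integral_congr (g := fun _ => (0 : ℂ)),
    intervalIntegral.integral_zero]
  intro y hy
  rw [uIcc_of_le (by linarith)] at hy
  have : 1 / ((n : ℝ) + 1) ≤ |y| := by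
    rw [mem_Icc, not_and_or, not_le, not_le] at hx
    rcases hx with hx | hx
    · exact le_abs.2 (Or.inr (by linarith [hy.2]))
    · exact le_abs.2 (Or.inl (by linarith [hy.1]))
  simp only [mol_eq_zero this, Complex.ofReal_zero]

/-- The mollifier at `s` as a Schwartz function. -/
def molS (n : ℕ) (s : ℝ) : 𝓢(ℝ, ℂ) :=
  (HasCompactSupport.intro isCompact_Icc fun _ hx => mol_sub_eq_zero hx :
    HasCompactSupport fun x => (mol n (x - s) : ℂ)).toSchwartzMap (contDiff_ofReal_mol n s)

theorem molS_apply (n : ℕ) (s x : ℝ) : molS n s x = mol n (x - s) := rfl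

/-- The function `ramp` as a Schwartz function. -/
def rampS (n : ℕ) {s t : ℝ} (hst : s ≤ t) : 𝓢(ℝ, ℂ) :=
  (HasCompactSupport.intro isCompact_Icc fun _ hx => ramp_eq_zero hst hx :
    HasCompactSupport (ramp n s t)).toSchwartzMap (contDiff_ramp n s t)

theorem rampS_apply (n : ℕ) {s t : ℝ} (hst : s ≤ t) (x : ℝ) : rampS n hst x = ramp n s t x := rfl

/-- A continuous function which satisfies `y' + c y = 0` weakly on `(0, T)` and vanishes at `0` is
zero. -/
theorem eq_zero_of_weak_deriv {y : ℝ → ℂ} (hy : Continuous y) (h0 : y 0 = 0) {c : ℂ} {T : ℝ}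
    (h : ∀ (n : ℕ) (s t : ℚ), s ≤ t → 0 < s - 1 / ((n : ℝ) + 1) → t + 1 / ((n : ℝ) + 1) < T →
      ∫ x, ((mol n (x - s) : ℂ) - mol n (x - t)) * y x = c * ∫ x, ramp n s t x * y x) :
    ∀ x ∈ Icc 0 T, y x = 0 := by
  rcases le_or_gt T 0 with hT | hT
  · intro x hx
    rw [show x = 0 by linarith [hx.1, hx.2], h0]
  set Y : ℝ → ℂ := fun t => ∫ x in (0 : ℝ)..t, y x
  have hd : ∀ t, HasDerivAt Y (y t) t := fun t =>
    intervalIntegral.integral_hasDerivAt_right (hy.intervalIntegrable _ _)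
      (hy.stronglyMeasurableAtFilter _ _) hy.continuousAt
  have hY : Continuous Y := continuous_iff_continuousAt.2 fun t => (hd t).continuousAt
  -- The weak equation says that `W` is constant on `(0, T)`. By continuity the constant is `W 0 =
  -- 0`, which is the integral equation needed for Gronwall's lemma.
  set W : ℝ → ℂ := fun t => y t + c * Y t
  have hW : Continuous W := hy.add (hY.const_mul c)
  have im : ∀ (n : ℕ) (s : ℝ) {w : ℝ → ℂ}, Continuous w →
      Integrable fun x => (mol n (x - s) : ℂ) * w x := fun n s w hw =>
    integrable_mul_of_eq_zero (contDiff_ofReal_mol n s).continuous hw fun _ => mol_sub_eq_zero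
  -- Integrating `c * Y` by parts against the ramp cancels the right side of the weak equation, so
  -- the mollified values of `W` at `s` and `t` agree; then `n → ∞`. Rational points suffice by
  -- density.
  have eqW : ∀ s t : ℚ, s ≤ t → (0 : ℝ) < s → (t : ℝ) < T → W s = W t := by
    intro s t hst hs ht
    refine tendsto_nhds_unique ((tendsto_integral_mol_mul hW s).congr' ?_)
      (tendsto_integral_mol_mul hW t)
    have lim := tendsto_one_div_add_atTop_nhds_zero_nat (𝕜 := ℝ)
    filter_upwards [lim.eventually_lt_const hs, lim.eventually_lt_const (sub_pos.2 ht)] with n h1 h2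
    have hst' : (s : ℝ) ≤ t := by exact_mod_cast hst
    have ir : ∀ {w : ℝ → ℂ}, Continuous w → Integrable fun x => ramp n s t x * w x := fun hw =>
      integrable_mul_of_eq_zero (contDiff_ramp n s t).continuous hw fun _ => ramp_eq_zero hst'
    have id : ∀ {w : ℝ → ℂ}, Continuous w →
        Integrable fun x => ((mol n (x - s) : ℂ) - mol n (x - t)) * w x := fun hw => by
      simp only [sub_mul]
      exact (im n s hw).sub (im n t hw)
    have parts := integral_mul_deriv_eq_deriv_mul_of_integrable
      (fun x _ => hasDerivAt_ramp n s t x) (fun x _ => hd x) (ir hy) (id hY) (ir hY)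
    have key : ∫ x, ((mol n (x - s) : ℂ) - mol n (x - t)) * W x = 0 := by
      have e : ∀ x, ((mol n (x - s) : ℂ) - mol n (x - t)) * W x =
          ((mol n (x - s) : ℂ) - mol n (x - t)) * y x +
          c * (((mol n (x - s) : ℂ) - mol n (x - t)) * Y x) := fun x => by simp only [W]; ring
      simp only [e]
      rw [integral_add (id hy) ((id hY).const_mul c), integral_const_mul,
        h n s t hst (by linarith) (by linarith), parts]
      ring
    simp only [sub_mul] at key
    rw [integral_sub (im n s hW) (im n t hW)] at key
    exact sub_eq_zero.1 key
  obtain ⟨r, hr0, hrT⟩ := exists_rat_btwn hT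
  have e1 : EqOn W (fun _ => W r) (Ioo 0 T ∩ range ((↑) : ℚ → ℝ)) := by
    rintro _ ⟨hx, q, rfl⟩
    rcases le_total q r with hq | hq
    · exact eqW q r hq hx.1 hrT
    · exact (eqW r q hq hr0 hx.2).symm
  have e2 : EqOn W (fun _ => W r) (Icc 0 T) := by
    refine e1.of_subset_closure hW.continuousOn continuousOn_const
      (inter_subset_left.trans Ioo_subset_Icc_self) ?_
    rw [← closure_Ioo hT.ne]
    exact closure_minimal (Rat.denseRange_cast.open_subset_closure_inter isOpen_Ioo) isClosed_closure
  have W0 : W 0 = 0 := by simp [W, Y, h0]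
  refine eq_zero_of_eq_const_mul_integral hy (c := -c) fun t ht => ?_
  have := (e2 ht).trans ((e2 ⟨le_rfl, hT.le⟩).symm.trans W0)
  simp only [W, Y] at this
  linear_combination this

end Mollifier

/-! ### Solutions satisfy the Duhamel formula -/

section Trace

variable {κ k b T : ℝ} {F q : ℝ × ℝ → ℂ} {U P : 𝓢'(Plane, ℂ)}

theorem ae_eq_zero_of_integral_schwartz {H : ℝ → ℂ}
    (h : ∀ B : 𝓢(ℝ, ℂ), Integrable (fun ξ => B ξ * H ξ) ∧ ∫ ξ, B ξ * H ξ = 0) :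
    ∀ᵐ ξ, H ξ = 0 := by
  have h1 : HasFourierFun (0 : 𝓢'(ℝ, ℂ)) H := fun φ => ⟨(h φ).1, by
    rw [(h φ).2, TemperedDistribution.fourier_apply]; rfl⟩
  have h2 : HasFourierFun (0 : 𝓢'(ℝ, ℂ)) fun _ => 0 := fun φ => ⟨by simp, by
    rw [TemperedDistribution.fourier_apply]; simp⟩
  exact h1.ae_eq h2

/-- A product test function whose space factor has an arbitrary Schwartz function `B` as inverse
transform separates the frequencies. The exceptional null set depends on the time factor `α`. -/
theorem ae_weak_eq (hU : HasFF U F) (hP : HasFF P q)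
    (hF : ∀ᵐ ξ, Integrable fun τ => F (ξ, τ)) (hw : WeakEq κ T U P) {α : 𝓢(ℝ, ℂ)} {c d : ℝ}
    (hc : 0 < c) (hd : d < T) (h0 : ∀ t, t ∉ Icc c d → α t = 0) :
    ∀ᵐ ξ, -(∫ t, deriv α t * tr F ξ t) + 2 * Real.pi * Complex.I * disp κ ξ *
      (∫ t, α t * tr F ξ t) - ∫ τ, (∫ t, ee (t * τ) * α t) * q (ξ, τ) = 0 := by
  refine ae_eq_zero_of_integral_schwartz fun B => ?_
  set β : 𝓢(ℝ, ℂ) := 𝓕 B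
  have hβ : (𝓕⁻ β : 𝓢(ℝ, ℂ)) = B := FourierTransform.fourierInv_fourier_eq B
  set φ := tensor β α
  have e := hU.weak_sub_eq hP hF κ φ
  rw [hw φ (tsupport_tensor_subset β hc hd h0), sub_self] at e
  have i1 := hU.integrable_tr hF (∂_{et} φ)
  have i2 := hU.integrable_tr hF (∂_{ex} (∂_{ex} φ))
  have i3 := (hP.apply_eq φ).1.integral_prod_left
  have e1 : ∀ ξ, ∫ t, gph (∂_{et} φ) ξ t * tr F ξ t = B ξ * ∫ t, deriv α t * tr F ξ t := fun ξ => by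
    simp only [φ, gph_lineDeriv_et_tensor, hβ, mul_assoc, integral_const_mul]
  have e2 : ∀ ξ, ∫ t, gph φ ξ t * tr F ξ t = B ξ * ∫ t, α t * tr F ξ t := fun ξ => by
    simp only [φ, gph_tensor, hβ, mul_assoc, integral_const_mul]
  have e3 : ∀ ξ, ∫ τ, hatS φ (ξ, τ) * q (ξ, τ) =
      B ξ * ∫ τ, (∫ t, ee (t * τ) * α t) * q (ξ, τ) := fun ξ => by
    simp only [φ, hatS_tensor, hβ, mul_assoc, integral_const_mul]
  have e4 : ∀ ξ, ∫ t, gph (∂_{ex} (∂_{ex} φ)) ξ t * tr F ξ t =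
      -(4 * Real.pi ^ 2 * ξ ^ 2) * (B ξ * ∫ t, α t * tr F ξ t) := fun ξ => by
    rw [← e2]
    simp only [gph_lineDeriv_ex_ex, mul_assoc, integral_const_mul]
  simp only [e4] at i2
  simp only [e1] at i1
  simp only [e3] at i3
  have e5 : ∀ ξ, B ξ * (-(∫ t, deriv α t * tr F ξ t) + 2 * Real.pi * Complex.I * disp κ ξ *
      (∫ t, α t * tr F ξ t) - ∫ τ, (∫ t, ee (t * τ) * α t) * q (ξ, τ)) =
      -(B ξ * ∫ t, deriv α t * tr F ξ t) +
      2 * Real.pi * Complex.I * disp κ ξ * (B ξ * ∫ t, α t * tr F ξ t) -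
      B ξ * ∫ τ, (∫ t, ee (t * τ) * α t) * q (ξ, τ) := fun ξ => by ring
  simp only [e1, e2, e3] at e
  simp only [e5]
  refine ⟨(Integrable.add i1.neg ?_).sub i3, e.symm⟩
  refine (i2.const_mul (-(κ * (Complex.I / 2)))).congr (Eventually.of_forall fun ξ => ?_)
  simp only [disp]
  push_cast
  ring

/-- The trace of a distributional solution of the linear equation is given by the Duhamel
formula. -/
theorem ae_tr_eq_duh (hU : HasFF U F) (hP : HasFF P q) (hF : ∀ᵐ ξ, Integrable fun τ => F (ξ, τ))
    (hq : Measurable q) (hsrc : ∀ᵐ ξ, srcSize κ q ξ < ⊤) (hw : WeakEq κ T U P) :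
    ∀ᵐ ξ, ∀ t ∈ Icc 0 T, tr F ξ t = duh κ (fun ξ => tr F ξ 0) q ξ t := by
  set f : ℝ → ℂ := fun ξ => tr F ξ 0
  -- Restricting to rational `s`, `t` leaves countably many ramps, hence one null set for all of
  -- them.
  have key : ∀ᵐ ξ, ∀ (n : ℕ) (s t : ℚ), s ≤ t → 0 < s - 1 / ((n : ℝ) + 1) →
      t + 1 / ((n : ℝ) + 1) < T →
      -(∫ x, ((mol n (x - s) : ℂ) - mol n (x - t)) * tr F ξ x) +
        2 * Real.pi * Complex.I * disp κ ξ * (∫ x, ramp n s t x * tr F ξ x) -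
        ∫ τ, (∫ x, ee (x * τ) * ramp n s t x) * q (ξ, τ) = 0 := by
    refine ae_all_iff.2 fun n => ae_all_iff.2 fun s => ae_all_iff.2 fun t => ?_
    by_cases hst : s ≤ t
    swap
    · exact Eventually.of_forall fun ξ h => absurd h hst
    by_cases h1 : 0 < s - 1 / ((n : ℝ) + 1)
    swap
    · exact Eventually.of_forall fun ξ _ h => absurd h h1
    by_cases h2 : t + 1 / ((n : ℝ) + 1) < T
    swap
    · exact Eventually.of_forall fun ξ _ _ h => absurd h h2
    have hst' : (s : ℝ) ≤ t := by exact_mod_cast hst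
    filter_upwards [ae_weak_eq hU hP hF hw (α := rampS n hst') h1 h2
      fun x hx => ramp_eq_zero hst' hx] with ξ h3 _ _ _
    have hd : ∀ x, deriv (rampS n hst') x = (mol n (x - s) : ℂ) - mol n (x - t) := fun x =>
      (hasDerivAt_ramp n s t x).deriv
    simpa only [hd, rampS_apply] using h3
  filter_upwards [key, hF, hsrc] with ξ h1 h2 h3
  have c1 := continuous_tr h2
  have c2 := continuous_duh (f := f) hq h3
  have hy : Continuous fun t => tr F ξ t - duh κ f q ξ t := c1.sub c2
  -- The trace and the Duhamel formula satisfy the same weak equation with the same value at time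
  -- `0`, so their difference solves the homogeneous one.
  have hz := eq_zero_of_weak_deriv hy (c := 2 * Real.pi * Complex.I * disp κ ξ) (T := T)
    (by rw [duh_at_zero, sub_self]) fun n s t hst hs ht => by
      have hst' : (s : ℝ) ≤ t := by exact_mod_cast hst
      have r0 : ∀ x, x ∉ Ioo 0 T → ramp n s t x = 0 := fun x hx => ramp_eq_zero hst' fun h =>
        hx ⟨hs.trans_le h.1, h.2.trans_lt ht⟩
      have d0 : ∀ x, x ∉ Ioo 0 T → (mol n (x - s) : ℂ) - mol n (x - t) = 0 := fun x hx => by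
        have hp : (0 : ℝ) < 1 / ((n : ℝ) + 1) := by positivity
        rw [mol_sub_eq_zero, mol_sub_eq_zero, sub_zero]
        · exact fun h => hx ⟨by linarith [h.1], h.2.trans_lt ht⟩
        · exact fun h => hx ⟨hs.trans_le h.1, by linarith [h.2]⟩
      have dc : Continuous fun x => (mol n (x - s) : ℂ) - mol n (x - t) :=
        (contDiff_ofReal_mol n s).continuous.sub (contDiff_ofReal_mol n t).continuous
      have rc := (contDiff_ramp n s t).continuous
      have a1 := integral_deriv_mul_duh (f := f) (fun x => hasDerivAt_ramp n s t x) dc r0 d0 hq h3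
      have a2 := h1 n s t hst hs ht
      have ir : ∀ {w : ℝ → ℂ}, Continuous w → Integrable fun x => ramp n s t x * w x := fun hw =>
        integrable_mul_of_eq_zero rc hw fun _ => ramp_eq_zero hst'
      have id : ∀ {w : ℝ → ℂ}, Continuous w →
          Integrable fun x => ((mol n (x - s) : ℂ) - mol n (x - t)) * w x := fun hw =>
        integrable_mul_of_eq_zero (c := 0) (d := T) dc hw fun x hx =>
          d0 x fun h => hx (Ioo_subset_Icc_self h)
      simp only [mul_sub]
      rw [integral_sub (id c1) (id c2), integral_sub (ir c1) (ir c2), a1]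
      linear_combination -a2
  exact fun t ht => sub_eq_zero.1 (hz t ht)

theorem continuousOn_apply {u : ℝ → 𝓢'(ℝ, ℂ)} (hu : ContinuousInH k T u) (β : 𝓢(ℝ, ℂ)) :
    ContinuousOn (fun t => u t β) (Icc 0 T) := by
  intro t ht
  obtain ⟨C, hC, hb⟩ := exists_norm_apply_le k β
  rw [ContinuousWithinAt, tendsto_iff_edist_tendsto_0]
  have h1 := ENNReal.Tendsto.const_mul (a := C) (hu t ht).2 (Or.inr hC)
  rw [mul_zero] at h1
  refine tendsto_of_tendsto_of_tendsto_of_le_of_le' tendsto_const_nhds h1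
    (Eventually.of_forall fun _ => zero_le) ?_
  have hfin : ∀ᶠ t' in 𝓝[Icc 0 T] t, sobolevNorm k (u t' - u t) < 1 :=
    (hu t ht).2.eventually_lt_const one_pos
  filter_upwards [hfin] with t' h2
  rw [edist_eq_enorm_sub]
  exact hb (u t' - u t) (h2.trans ENNReal.one_lt_top)

/-- A curve in `H^k` which is extended by a distribution is given by the traces of the Fourier
transform. -/
theorem hasFourierFun_tr {u : ℝ → 𝓢'(ℝ, ℂ)} (hb : 1 / 2 < b) (hT : 0 < T)
    (hu : ContinuousInH k T u) (hx : Extends T u U) (hU : HasFF U F) (hFm : Measurable F)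
    (nF : cnorm κ k b F ≠ ⊤) : ∀ t ∈ Icc 0 T, HasFourierFun (u t) fun ξ => tr F ξ t := by
  have hF := ae_integrable_slice hb hFm nF
  obtain ⟨D, hD, htr⟩ := exists_l2_lintegral_le hb
  set A : ℝ → ℝ≥0∞ := fun ξ => ∫⁻ τ, ‖F (ξ, τ)‖ₑ
  have hA : Measurable A := measurable_lintegral_slice hFm
  have nA : l2 (fun ξ => ENNReal.ofReal (jb ξ ^ k) * A ξ) ≠ ⊤ :=
    ne_top_of_le_ne_top (by finiteness) (htr κ k F hFm)
  have fA := ae_lt_top_of_l2 hA nA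
  have trA : ∀ {ξ}, A ξ < ⊤ → ∀ t, ‖tr F ξ t‖ ≤ (A ξ).toReal := fun {ξ} h t => by
    have := ENNReal.toReal_mono h.ne (enorm_tr_le F ξ t)
    simpa using this
  have hw : ∀ t, ∃ w : 𝓢'(ℝ, ℂ), HasFourierFun w fun ξ => tr F ξ t := fun t =>
    exists_hasFourierFun_of_snorm (k := k) (measurable_tr_left hFm t)
      (ne_top_of_le_ne_top nA (l2_mono fun ξ => by gcongr; exact enorm_tr_le F ξ t))
  intro t₀ ht₀
  obtain ⟨w, hw₀⟩ := hw t₀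
  suffices u t₀ = w by rw [this]; exact hw₀
  ext β
  rw [hw₀.apply_eq]
  set B : 𝓢(ℝ, ℂ) := 𝓕⁻ β
  have iB : Integrable fun ξ => ‖B ξ‖ * (A ξ).toReal := by
    obtain ⟨N, C, hC, h1⟩ := exists_lintegral_jb_le k
    obtain ⟨E, hE, h2⟩ := exists_schwartz_jb_pow_le B N
    refine ⟨(B.continuous.norm.measurable.mul hA.ennreal_toReal).aestronglyMeasurable, ?_⟩
    calc ∫⁻ ξ, ‖‖B ξ‖ * (A ξ).toReal‖ₑ
        ≤ ∫⁻ ξ, ENNReal.ofReal E * (A ξ * ENNReal.ofReal ((jb ξ ^ N)⁻¹)) := by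
          refine lintegral_mono fun ξ => ?_
          rw [enorm_mul, enorm_norm, mul_left_comm, mul_comm, ← ENNReal.ofReal_mul hE]
          gcongr
          · rw [Real.enorm_of_nonneg ENNReal.toReal_nonneg]
            exact ENNReal.ofReal_toReal_le
          · rw [← ofReal_norm]
            exact ENNReal.ofReal_le_ofReal (h2 ξ)
      _ < ⊤ := by
          rw [lintegral_const_mul' _ _ ENNReal.ofReal_ne_top]
          refine ENNReal.mul_lt_top ENNReal.ofReal_lt_top ((h1 A hA).trans_lt ?_)
          exact ENNReal.mul_lt_top hC.lt_top nA.lt_top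
  have mB : ∀ t, AEStronglyMeasurable (fun ξ => B ξ * tr F ξ t) := fun t =>
    (B.continuous.measurable.mul (measurable_tr_left hFm t)).aestronglyMeasurable
  have cr : Continuous fun t => ∫ ξ, B ξ * tr F ξ t := by
    refine continuous_of_dominated mB (bound := fun ξ => ‖B ξ‖ * (A ξ).toReal) (fun t => ?_) iB ?_
    · filter_upwards [fA] with ξ h1
      rw [norm_mul]
      exact mul_le_mul_of_nonneg_left (trA h1 t) (norm_nonneg _)
    · filter_upwards [hF] with ξ h1
      exact continuous_const.mul (continuous_tr h1)
  have cu := continuousOn_apply hu β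
  -- The extension property is tested on `β` times a mollifier concentrating at `s`. Both sides
  -- converge to the values at `s`, the frequency side by dominated convergence.
  have key : EqOn (fun t => u t β) (fun t => ∫ ξ, B ξ * tr F ξ t) (Ioo 0 T) := by
    intro s hs
    -- Outside `[0, T]` the curve is unconstrained; its constant continuation is continuous on the
    -- line and may be mollified.
    have ch : Continuous (IccExtend hT.le fun t : Icc 0 T => u t β) :=
      (continuousOn_iff_continuous_domRestrict.1 cu).Icc_extend'
    have l1 := tendsto_integral_mol_mul ch s
    rw [IccExtend_of_mem _ _ (Ioo_subset_Icc_self hs)] at l1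
    refine tendsto_nhds_unique l1 (Tendsto.congr' ?_ (f₁ := fun n : ℕ =>
      ∫ ξ, B ξ * ∫ t, (mol n (t - s) : ℂ) * tr F ξ t) ?_)
    · have lim := tendsto_one_div_add_atTop_nhds_zero_nat (𝕜 := ℝ)
      filter_upwards [lim.eventually_lt_const hs.1, lim.eventually_lt_const (sub_pos.2 hs.2)]
        with n h1 h2
      have h3 := hx (tensor β (molS n s)) (tsupport_tensor_subset β (sub_pos.2 h1)
        (by linarith) fun x hx => mol_sub_eq_zero hx)
      rw [hU.apply_eq_tr hF] at h3
      simp only [gph_tensor, slice_tensor, map_smul, mul_assoc, integral_const_mul, molS_apply,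
        smul_eq_mul] at h3
      rw [h3, setIntegral_congr_fun (g := fun t => (mol n (t - s) : ℂ) *
        IccExtend hT.le (fun t : Icc 0 T => u t β) t) measurableSet_Ioo fun t ht => by
          simp only [IccExtend_of_mem hT.le _ (Ioo_subset_Icc_self ht)],
        setIntegral_eq_integral_of_forall_compl_eq_zero]
      intro t ht
      rw [mol_sub_eq_zero, zero_mul]
      exact fun h => ht ⟨by linarith [h.1], by linarith [h.2]⟩
    · refine tendsto_integral_of_dominated_convergence (fun ξ => ‖B ξ‖ * (A ξ).toReal)
        (fun n => ?_) iB (fun n => ?_) ?_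
      · have hm : Measurable fun p : ℝ × ℝ => (mol n (p.2 - s) : ℂ) * tr F p.1 p.2 :=
          ((contDiff_ofReal_mol n s).continuous.measurable.comp measurable_snd).mul
            (measurable_tr hFm)
        exact (B.continuous.measurable.mul
          hm.stronglyMeasurable.integral_prod_right.measurable).aestronglyMeasurable
      · filter_upwards [fA] with ξ h1
        rw [norm_mul]
        exact mul_le_mul_of_nonneg_left (norm_integral_mol_mul_le n s (trA h1)) (norm_nonneg _)
      · filter_upwards [hF] with ξ h1
        exact (tendsto_integral_mol_mul (continuous_tr h1) s).const_mul _
  -- The extension carries information on the open interval only; the end points, in particular the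
  -- initial time, are reached by continuity.
  exact key.of_subset_closure cu cr.continuousOn Ioo_subset_Icc_self
    (closure_Ioo hT.ne).ge ht₀

end Trace

/-! ### Uniqueness and Lipschitz dependence for distributional solutions -/

section WellPosed

variable {σ ε k s a b T : ℝ} {ψ : ℝ → ℝ} {χ : 𝓢(ℝ, ℂ)} {K R m : ℝ≥0∞} {u₀ v₀ : 𝓢'(ℝ, ℂ)}
  {u v u' v' : ℝ → 𝓢'(ℝ, ℂ)} {U P : 𝓢'(Plane, ℂ)}

theorem localize_apply_of_tsupport_subset (hψ : IsCutoff ψ) (hT : 0 < T) {φ : 𝓢(Plane, ℂ)}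
    (hφ : tsupport φ ⊆ strip T) : localize ψ T U φ = U φ := by
  rw [localize_apply, cutoff_smul_eq φ hψ hT hφ]

theorem Extends.localize (h : Extends T u U) (hψ : IsCutoff ψ) (hT : 0 < T) :
    Extends T u (localize ψ T U) := fun φ hφ => by
  rw [localize_apply_of_tsupport_subset hψ hT hφ, h φ hφ]

theorem WeakEq.localize {κ : ℝ} (h : WeakEq κ T U P) (hψ : IsCutoff ψ) (hT : 0 < T) :
    WeakEq κ T (localize ψ T U) P := fun φ hφ => by
  rw [← h φ hφ, lineDeriv_et_apply, lineDeriv_et_apply, lineDeriv_ex_ex_apply,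
    lineDeriv_ex_ex_apply, localize_apply_of_tsupport_subset hψ hT (tsupport_lineDeriv_subset hφ et),
    localize_apply_of_tsupport_subset hψ hT
      (tsupport_lineDeriv_subset (tsupport_lineDeriv_subset hφ ex) ex)]

/-- The Fourier transform of a solution satisfies the Duhamel equations. -/
theorem IsSolution.exists_traceSol (hs : IsSolution σ ε ψ k s b T u₀ v₀ u v)
    (h : PicardBounds σ ε χ k s a b K) (hσ : σ ≠ 0) (hψ : IsCutoff ψ) (hT : 0 < T) :
    ∃ F G : ℝ × ℝ → ℂ, Measurable F ∧ Measurable G ∧ cnorm 1 k b F ≠ ⊤ ∧ cnorm 0 s b G ≠ ⊤ ∧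
      TraceSol σ ε T (fun ξ => tr F ξ 0) (fun ξ => tr G ξ 0) F G ∧
      ∀ t ∈ Icc 0 T, HasFourierFun (u t) (fun ξ => tr F ξ t) ∧
        HasFourierFun (v t) fun ξ => tr G ξ t := by
  obtain ⟨U, V, uv, uu, xU, xV, nU, nV, huv, huu, hU, hV⟩ := hs.equations
  obtain ⟨F, hF, fF⟩ := exists_hasFF_of_fourierNorm nU
  obtain ⟨G, hG, fG⟩ := exists_hasFF_of_fourierNorm nV
  rw [fF.bourgainNorm_eq] at nU
  rw [fG.mixedNorm_eq] at nV
  have fuv := huv.hasFF fF fG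
  have fuu := huu.hasFF fF fF.conj
  have wU : WeakEq 1 T U (-Complex.I • uv) := fun φ hφ => by
    have e : ∀ A B C : ℂ, Complex.I * A + 1 / 2 * B - C = 0 →
        A - (1 : ℝ) * (Complex.I / 2) * B = -Complex.I * C := fun A B C hh => by
      push_cast
      linear_combination -Complex.I * hh + A * Complex.I_mul_I
    exact e _ _ _ (hU φ hφ)
  have wV : WeakEq 0 T V ((σ : ℂ)⁻¹ • ((ε : ℂ) • uu - localize ψ T V)) := fun φ hφ => by
    have hσ' : (σ : ℂ) ≠ 0 := by exact_mod_cast hσ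
    have e : ∀ A B C D : ℂ, σ * A + C - ε * B = 0 →
        A - (0 : ℝ) * (Complex.I / 2) * D = (σ : ℂ)⁻¹ * (ε * B - C) := fun A B C D hh => by
      rw [eq_inv_mul_iff_mul_eq₀ hσ']
      push_cast
      linear_combination hh
    refine (e ((∂_{et} V) φ) (uu φ) (V φ) _ (hV φ hφ)).trans ?_
    rw [← localize_apply_of_tsupport_subset hψ hT hφ (U := V)]
    rfl
  have tU := ae_tr_eq_duh (q := srcU F G) fF (fuv.smul (-Complex.I)) (ae_integrable_slice h.lt_b hF nU.ne)
    (measurable_srcU hF hG) (ae_srcSize_lt_top h.a_lt (measurable_srcU hF hG)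
      (h.srcU_ne_top hF hG nU.ne nV.ne)) (wU.localize hψ hT)
  have tV := ae_tr_eq_duh (q := srcV σ ε F F G) fG (((fuu.smul (ε : ℂ)).sub fG).smul (σ : ℂ)⁻¹)
    (ae_integrable_slice h.lt_b hG nV.ne)
    (measurable_srcV σ ε hF hF hG) (ae_srcSize_lt_top h.a_lt (measurable_srcV σ ε hF hF hG)
      (h.srcV_ne_top hF hF hG nU.ne nU.ne nV.ne)) (wV.localize hψ hT)
  refine ⟨F, G, hF, hG, nU.ne, nV.ne, ?_, fun t ht => ⟨?_, ?_⟩⟩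
  · filter_upwards [tU, tV] with ξ h1 h2 t ht
    exact ⟨h1 t ht, h2 t ht⟩
  · exact hasFourierFun_tr h.lt_b hT hs.continuous_u (xU.localize hψ hT) fF hF nU.ne t ht
  · exact hasFourierFun_tr h.lt_b hT hs.continuous_v (xV.localize hψ hT) fG hG nV.ne t ht

/-- At time `0` both trace representations are transforms of the same data, so `traceSol_unique`
applies. No smallness of the solutions or of `T` is needed. -/
theorem IsSolution.unique (hs : IsSolution σ ε ψ k s b T u₀ v₀ u v)
    (hs' : IsSolution σ ε ψ k s b T u₀ v₀ u' v') (h : PicardBounds σ ε χ k s a b K)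
    (hab : a + 2 * b < 3 / 2) (hσ : σ ≠ 0) (hψ : IsCutoff ψ) (hχ : ∀ t, χ t = ψ t) (hT : 0 < T) :
    ∀ t ∈ Icc 0 T, u t = u' t ∧ v t = v' t := by
  obtain ⟨F, G, hF, hG, nF, nG, e, hu⟩ := hs.exists_traceSol h hσ hψ hT
  obtain ⟨F', G', hF', hG', nF', nG', e', hu'⟩ := hs'.exists_traceSol h hσ hψ hT
  have h0 : (0 : ℝ) ∈ Icc 0 T := ⟨le_rfl, hT.le⟩
  have a1 := (hu 0 h0).1
  have a2 := (hu 0 h0).2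
  rw [hs.initial_u, ← hs'.initial_u] at a1
  rw [hs.initial_v, ← hs'.initial_v] at a2
  have key := h.traceSol_unique hab
    (fun t ht => by rw [hχ, hψ.eq_one t ht, Complex.ofReal_one]) (a1.ae_eq (hu' 0 h0).1)
    (a2.ae_eq (hu' 0 h0).2) hF hF' hG hG' nF nF' nG nG' e e'
  refine fun t ht => ⟨(hu t ht).1.ext ((hu' t ht).1.congr ?_),
    (hu t ht).2.ext ((hu' t ht).2.congr ?_)⟩
  · filter_upwards [key] with ξ h1 using (h1 t ht).1.symm
  · filter_upwards [key] with ξ h1 using (h1 t ht).2.symm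

/-- The data `(u₀, v₀)` have the solution `(u, v)`, given by a fixed point `(F, G)` of the Picard
map. -/
structure PicardSolution (σ ε : ℝ) (ψ : ℝ → ℝ) (χ : 𝓢(ℝ, ℂ)) (k s b T : ℝ) (R : ℝ≥0∞)
    (u₀ v₀ : 𝓢'(ℝ, ℂ)) (u v : ℝ → 𝓢'(ℝ, ℂ)) (f g : ℝ → ℂ) (F G : ℝ × ℝ → ℂ) : Prop where
  isSolution : ∀ b' ≤ b, IsSolution σ ε ψ k s b' T u₀ v₀ u v
  data_u : HasFourierFun u₀ f
  data_v : HasFourierFun v₀ g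
  measurable_f : Measurable f
  measurable_g : Measurable g
  measurable_F : Measurable F
  measurable_G : Measurable G
  norm_F : cnorm 1 k b F ≤ R
  norm_G : cnorm 0 s b G ≤ R
  eq_F : ∀ᵐ z, F z = duhF χ T 1 f (srcU F G) z
  eq_G : ∀ᵐ z, G z = duhF χ T 0 g (srcV σ ε F F G) z
  curve : ∀ t ∈ Icc 0 T, HasFourierFun (u t) (fun ξ => tr F ξ t) ∧
    HasFourierFun (v t) fun ξ => tr G ξ t

theorem PicardBounds.exists_picardSolution (h : PicardBounds σ ε χ k s a b K) (hσ : σ ≠ 0)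
    (hψ : IsCutoff ψ) (hχ : ∀ t, χ t = ψ t) (hT : Admissible a b T K R m) (hm : m ≠ ⊤)
    (hu : sobolevNorm k u₀ ≤ m) (hv : sobolevNorm s v₀ ≤ m) (hr : IsRealDist v₀) :
    ∃ u v f g F G, PicardSolution σ ε ψ χ k s b T R u₀ v₀ u v f g F G := by
  obtain ⟨f, hf, ff, ef⟩ := MemH.exists_hasFourierFun (hu.trans_lt hm.lt_top)
  obtain ⟨g, hg, fg, eg⟩ := MemH.exists_hasFourierFun (hv.trans_lt hm.lt_top)
  rw [← ef] at hu
  rw [← eg] at hv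
  obtain ⟨F, G, hF, hG, nF, nG, eF, eG⟩ := h.exists_fixedPoint hT hf hg hu hv
  obtain ⟨u, v, hs, -, hc⟩ := h.exists_isSolution hσ hψ hχ hT.pos hT.two_mul_le hf hg
    (ne_top_of_le_ne_top hm hu) (ne_top_of_le_ne_top hm hv) hF hG
    (ne_top_of_le_ne_top hT.ne_top nF) (ne_top_of_le_ne_top hT.ne_top nG) eF eG ff fg hr
  exact ⟨u, v, f, g, F, G, hs, ff, fg, hf, hg, hF, hG, nF, nG, eF, eG, hc⟩

theorem PicardBounds.sobolevNorm_sub_le (h : PicardBounds σ ε χ k s a b K) {κ r : ℝ}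
    {F F' : ℝ × ℝ → ℂ} (hF : Measurable F) (hF' : Measurable F') (nF : cnorm κ r b F ≠ ⊤)
    (nF' : cnorm κ r b F' ≠ ⊤) {w w' : 𝓢'(ℝ, ℂ)} {t : ℝ} (hw : HasFourierFun w fun ξ => tr F ξ t)
    (hw' : HasFourierFun w' fun ξ => tr F' ξ t) :
    sobolevNorm r (w - w') ≤ K * cnorm κ r b fun z => F z - F' z := by
  refine le_trans (le_of_eq ?_) (h.snorm_tr_le κ r (hF.sub hF') t)
  refine (HasFourierFun.congr (hw.sub hw') ?_).sobolevNorm_eq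
  filter_upwards [ae_integrable_slice h.lt_b hF nF, ae_integrable_slice h.lt_b hF' nF']
    with ξ i1 i2
  have cb : ∀ {H : ℝ → ℂ}, Integrable H → Integrable fun τ => ee (t * τ) * H τ := fun hH =>
    hH.bdd_mul (c := 1) (by unfold ee; fun_prop) (Eventually.of_forall fun τ => (norm_ee _).le)
  simp only [tr, mul_sub, Pi.sub_apply]
  exact (integral_sub (cb i1) (cb i2)).symm

/-- The trace estimate turns the Lipschitz bound for fixed points into a bound at each time. Of the
constant `4`, one factor `2` comes from absorbing half of the distance and the other from adding the
two components. -/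
theorem PicardSolution.pairDist_le {u₁ v₁ u₂ v₂ : 𝓢'(ℝ, ℂ)} {f g f' g' : ℝ → ℂ}
    {F G F' G' : ℝ × ℝ → ℂ} (h : PicardBounds σ ε χ k s a b K)
    (hT : PicardBounds.Admissible a b T K R m)
    (p : PicardSolution σ ε ψ χ k s b T R u₁ v₁ u v f g F G)
    (p' : PicardSolution σ ε ψ χ k s b T R u₂ v₂ u' v' f' g' F' G') :
    ∀ t ∈ Icc 0 T, pairDist k s (u t) (v t) (u' t) (v' t) ≤
      4 * K * (K * ENNReal.ofReal (T ^ (1 / 2 - b))) * pairDist k s u₁ v₁ u₂ v₂ := by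
  intro t ht
  have hR := hT.ne_top
  have key := h.fixedPoint_sub_le hT p.measurable_f p.measurable_g p'.measurable_f p'.measurable_g
    p.measurable_F p'.measurable_F p.measurable_G p'.measurable_G p.norm_F p'.norm_F p.norm_G
    p'.norm_G p.eq_F p.eq_G p'.eq_F p'.eq_G
  have d1 := h.sobolevNorm_sub_le p.measurable_F p'.measurable_F
    (ne_top_of_le_ne_top hR p.norm_F) (ne_top_of_le_ne_top hR p'.norm_F) (p.curve t ht).1
    (p'.curve t ht).1
  have d2 := h.sobolevNorm_sub_le p.measurable_G p'.measurable_G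
    (ne_top_of_le_ne_top hR p.norm_G) (ne_top_of_le_ne_top hR p'.norm_G) (p.curve t ht).2
    (p'.curve t ht).2
  rw [pairDist, pairDist, (p.data_u.sub p'.data_u).sobolevNorm_eq,
    (p.data_v.sub p'.data_v).sobolevNorm_eq]
  refine (add_le_add (d1.trans (mul_le_mul_right ((le_max_left _ _).trans key) K))
    (d2.trans (mul_le_mul_right ((le_max_right _ _).trans key) K))).trans (le_of_eq ?_)
  ring

theorem sobolevNorm_le_of_sub_lt {w w₀ : 𝓢'(ℝ, ℂ)} (h₀ : MemH k w₀)
    (h : sobolevNorm k (w - w₀) < 1) : sobolevNorm k w ≤ sobolevNorm k w₀ + 1 := by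
  have := sobolevNorm_add_le (h.trans ENNReal.one_lt_top) h₀
  rw [sub_add_cancel] at this
  exact this.trans (by rw [add_comm]; gcongr)

end WellPosed

end SchrodingerDebye

end

/-! ### Assembly of the well-posedness theorem -/

theorem theorem1p1 (σ ε : ℝ) (hσ : 0 < σ) (hε : ε = 1 ∨ ε = -1)
    (ψ : ℝ → ℝ) (hψ : IsCutoff ψ) (k s : ℝ)
    (hks : |k| - 1 / 2 ≤ s) (hs : s < min (k + 1 / 2) (2 * k + 1 / 2)) (hk : -(1 / 4) < k) :
    ∃ b₀ : ℝ, 1 / 2 < b₀ ∧ ∃ T : ℝ≥0∞ → ℝ≥0∞ → ℝ, (∀ r ρ, 0 < T r ρ) ∧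
      ∀ b ∈ Ioo (1 / 2) b₀, ∀ u₀ v₀ : 𝓢'(ℝ, ℂ), MemH k u₀ → MemH s v₀ → IsRealDist v₀ →
        ∀ T₀ : ℝ, T₀ = T (sobolevNorm k u₀) (sobolevNorm s v₀) →
        -- existence and uniqueness
        (∃ u v : ℝ → 𝓢'(ℝ, ℂ), IsSolution σ ε ψ k s b T₀ u₀ v₀ u v ∧
          ∀ u' v' : ℝ → 𝓢'(ℝ, ℂ), IsSolution σ ε ψ k s b T₀ u₀ v₀ u' v' →
            ∀ t ∈ Icc 0 T₀, u' t = u t ∧ v' t = v t) ∧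
        -- on a neighborhood of the data the solution map into `C([0,T₀]; H^k × H^s)` is
        -- defined and Lipschitz
        (∃ δ : ℝ≥0, 0 < δ ∧ ∃ L : ℝ≥0,
          (∀ u₁ v₁ : 𝓢'(ℝ, ℂ), IsRealDist v₁ → pairDist k s u₁ v₁ u₀ v₀ < δ →
            ∃ u v : ℝ → 𝓢'(ℝ, ℂ), IsSolution σ ε ψ k s b T₀ u₁ v₁ u v) ∧
          (∀ u₁ v₁ u₂ v₂ : 𝓢'(ℝ, ℂ), ∀ u v u' v' : ℝ → 𝓢'(ℝ, ℂ),
            pairDist k s u₁ v₁ u₀ v₀ < δ → pairDist k s u₂ v₂ u₀ v₀ < δ →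
            IsSolution σ ε ψ k s b T₀ u₁ v₁ u v →
            IsSolution σ ε ψ k s b T₀ u₂ v₂ u' v' →
            ∀ t ∈ Icc 0 T₀,
              pairDist k s (u t) (v t) (u' t) (v' t) ≤ L * pairDist k s u₁ v₁ u₂ v₂)) := by
  have hψc : HasCompactSupport ψ := by
    refine HasCompactSupport.intro (isCompact_Icc (a := -2) (b := 2)) fun t ht => hψ.eq_zero t ?_
    rw [mem_Icc, ← abs_le] at ht
    linarith
  let χ : 𝓢(ℝ, ℂ) := (hψc.comp_left Complex.ofReal_zero : HasCompactSupport fun t =>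
    (ψ t : ℂ)).toSchwartzMap (Complex.ofRealCLM.contDiff.comp hψ.smooth)
  have hχ : ∀ t, χ t = ψ t := fun t => rfl
  obtain ⟨a, ha4, ha2, hbil⟩ := exists_bilinearBounds hks hs hk
  -- Any `b` with `1/2 < b ≤ b₁` satisfies both `a + b ≤ 1`, for the linear estimate, and `a + 2b <
  -- 3/2`, for the choice of a contraction time.
  set b₁ : ℝ := 1 / 2 + (1 / 2 - a) / 8 with hb₁
  have hpic : ∀ b, 1 / 2 < b → b ≤ b₁ → ∃ K, PicardBounds σ ε χ k s a b K := fun b hb hb' => by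
    obtain ⟨C, hC⟩ := hbil b hb
    exact hC.exists_picardBounds σ ε χ (by linarith) ha2 hb (by linarith) (by linarith)
  have hb₁' : 1 / 2 < b₁ := by linarith
  obtain ⟨K, hK⟩ := hpic b₁ hb₁' le_rfl
  have hKt := hK.bilinear.ne_top
  -- The summand `1` makes the same time and radius serve for all data at distance less than `1`.
  -- For infinite norms the value of `T` is arbitrary.
  have hadm : ∀ r ρ : ℝ≥0∞, ∃ T : ℝ, 0 < T ∧ (r ≠ ⊤ → ρ ≠ ⊤ →
      ∃ R, PicardBounds.Admissible a b₁ T K R (r + ρ + 1)) := fun r ρ => by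
    by_cases h : r ≠ ⊤ ∧ ρ ≠ ⊤
    · obtain ⟨T, R, -, hT⟩ := PicardBounds.exists_admissible (a := a) (b := b₁) (K := K)
        (m := r + ρ + 1) (R₀ := 0) (by linarith) hb₁' hKt
        (by have := h.1; have := h.2; finiteness) (by simp)
      exact ⟨T, hT.pos, fun _ _ => ⟨R, hT⟩⟩
    · exact ⟨1, one_pos, fun h1 h2 => absurd ⟨h1, h2⟩ h⟩
  choose T hTpos hTadm using hadm
  refine ⟨b₁, hb₁', T, hTpos, fun b hb u₀ v₀ hu₀ hv₀ hr T₀ hT₀ => ?_⟩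
  obtain ⟨R, hR⟩ := hTadm _ _ hu₀.ne hv₀.ne
  rw [← hT₀] at hR
  set m := sobolevNorm k u₀ + sobolevNorm s v₀ + 1
  have hm : m ≠ ⊤ := by have := hu₀.ne; have := hv₀.ne; finiteness
  -- The time, the radius and the constructed solutions belong to `b₁`, which makes `T` independent
  -- of `b`. The estimates at the exponent `b` serve only for uniqueness in the larger class.
  obtain ⟨K', hK'⟩ := hpic b hb.1 hb.2.le
  have uniq : ∀ {u₁ v₁ : 𝓢'(ℝ, ℂ)} {u v u' v' : ℝ → 𝓢'(ℝ, ℂ)},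
      IsSolution σ ε ψ k s b T₀ u₁ v₁ u v → IsSolution σ ε ψ k s b T₀ u₁ v₁ u' v' →
      ∀ t ∈ Icc 0 T₀, u t = u' t ∧ v t = v' t := fun h h' =>
    h.unique h' hK' (by linarith [hb.2]) hσ.ne' hψ hχ hR.pos
  have near : ∀ {u₁ v₁ : 𝓢'(ℝ, ℂ)}, IsRealDist v₁ → pairDist k s u₁ v₁ u₀ v₀ < (1 : ℝ≥0) →
      ∃ u v f g F G, PicardSolution σ ε ψ χ k s b₁ T₀ R u₁ v₁ u v f g F G := fun hr₁ hd => by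
    rw [pairDist, ENNReal.coe_one] at hd
    refine hK.exists_picardSolution hσ.ne' hψ hχ hR hm ?_ ?_ hr₁
    · refine (sobolevNorm_le_of_sub_lt hu₀ (le_self_add.trans_lt hd)).trans ?_
      exact add_le_add_left le_self_add 1
    · refine (sobolevNorm_le_of_sub_lt hv₀ (le_add_self.trans_lt hd)).trans ?_
      exact add_le_add_left le_add_self 1
  refine ⟨?_, 1, one_pos, (4 * K * (K * ENNReal.ofReal (T₀ ^ (1 / 2 - b₁)))).toNNReal, ?_, ?_⟩
  · obtain ⟨u, v, f, g, F, G, p⟩ := hK.exists_picardSolution hσ.ne' hψ hχ hR hm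
      (le_self_add.trans le_self_add) (le_add_self.trans le_self_add) hr
    have p' := p.isSolution b hb.2.le
    exact ⟨u, v, p', fun u' v' h' => uniq h' p'⟩
  · intro u₁ v₁ hr₁ hd
    obtain ⟨u, v, f, g, F, G, p⟩ := near hr₁ hd
    exact ⟨u, v, p.isSolution b hb.2.le⟩
  · intro u₁ v₁ u₂ v₂ u v u' v' hd hd' h h' t ht
    have h0 : (0 : ℝ) ∈ Icc 0 T₀ := ⟨le_rfl, hR.pos.le⟩
    -- The second datum is real because it is the value of a real curve at time `0`. By uniqueness
    -- the given solutions are the Picard solutions, whose distance is already estimated.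
    obtain ⟨w, z, f, g, F, G, p⟩ := near (h.initial_v ▸ h.real_v 0 h0) hd
    obtain ⟨w', z', f', g', F', G', p'⟩ := near (h'.initial_v ▸ h'.real_v 0 h0) hd'
    obtain ⟨e1, e2⟩ := uniq h (p.isSolution b hb.2.le) t ht
    obtain ⟨e3, e4⟩ := uniq h' (p'.isSolution b hb.2.le) t ht
    rw [e1, e2, e3, e4, ENNReal.coe_toNNReal (by finiteness)]
    exact PicardSolution.pairDist_le hK hR p p' t ht
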